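/- Let $l/k$ be a finite separable field extension of degree $d$, let $L/k$ be a finite Galois extension containing $l$, let $G=\mathrm{Gal}(L/k)$, let $H\subseteq G$ be the subgroup of the automorphisms fixing $l$, and let $G/H$ be the set of left cosets. For a complex $V$ of $l$-vector spaces put $V_L=V\otimes_l L$, let ${}^{\sigma}V_L$ be its conjugate by $\sigma\in G$ (the complex $L\otimes_{l,\sigma}V$ of $L$-vector spaces, which depends only on $\sigma H$), and let $G$ act skew-linearly on $\bigotimes_{\sigma\in G/H}{}^{\sigma}V_L$ (tensor product over $L$) by permuting the factors, with Koszul signs, and through its action on $L$. For a dg $l$-algebra $A$, let $\mathcal R^{\mathrm{NC}}_{l/k}(A)=(\bigotimes_{\sigma\in G/H}{}^{\sigma}A_L)^G$, a dg $k$-algebra. For a right dg $A$-module $M$, $(\bigotimes_{\sigma\in G/H}{}^{\sigma}M_L)^G$ is a right dg $\mathcal R^{\mathrm{NC}}_{l/k}(A)$-module. For a dg algebra $B$ let $\mathcal D(B)$ be the derived category (the category of right dg $B$-modules localized at the quasi-isomorphisms), $\mathcal D_c(B)$ its full subcategory of compact objects, and $K_0(B)$ the Grothendieck group of the triangulated category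 $\mathcal D_c(B)$. For a map $f:M\to S$ from an abelian monoid to an abelian group with $f(0)=0$ put $\Delta^0f=f$ and $$\Delta^{n+1}f(m_0,\dots,m_{n+1})=\Delta^{n}f(m_0,\dots,m_{n-1},m_n+m_{n+1})-\Delta^{n}f(m_0,\dots,m_{n-1},m_n)-\Delta^{n}f(m_0,\dots,m_{n-1},m_{n+1}).$$ The map $f$ is called polynomial if $\Delta^Nf=0$ for some $N\ge 0$, and the smallest such $N$ is its degree. Then, for every dg $l$-algebra $A$, the functor $M\mapsto(\bigotimes_{\sigma\in G/H}{}^{\sigma}M_L)^G$ preserves quasi-isomorphisms, and the induced functor $\mathcal D(A)\to\mathcal D(\mathcal R^{\mathrm{NC}}_{l/k}(A))$ preserves compact objects. There is exactly one map $f:K_0(A)\to K_0(\mathcal R^{\mathrm{NC}}_{l/k}(A))$ such that $f([M])=[(\bigotimes_{\sigma\in G/H}{}^{\sigma}M_L)^G]$ for all $M$ in $\mathcal D_c(A)$. This map satisfies $f(0)=0$ and is polynomial of degree at most $d$. Its degree is exactly $d$ whenever $d!\cdot f(x)\neq 0$ for some $x\in K_0(A)$; in particular, the degree is exactly $d$ for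 $A=l$. -/

import Mathlib

universe u

noncomputable section

namespace NCWeil

open CategoryTheory CategoryTheory.Limits
open scoped TensorProduct

/-! ## Cochain complexes of vector spaces -/

/-- A cochain complex of `K`-vector spaces, presented as a `ℤ`-graded vector space
`V = ⨁ₙ Vⁿ` with a differential of degree `1`. -/
structure DGVect (K : Type u) [Field K] where
  carrier : Type u
  [addCommGroup : AddCommGroup carrier]
  [module : Module K carrier]
  /-- the component of degree `n` -/
  deg : ℤ → Submodule K carrier
  isInternal : DirectSum.IsInternal deg
  d : carrier →ₗ[K] carrier
  d_mem : ∀ {i : ℤ} {x : carrier}, x ∈ deg i → d x ∈ deg (i + 1)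
  d_d : ∀ x, d (d x) = 0

namespace DGVect

instance (K : Type u) [Field K] : CoeSort (DGVect K) (Type u) := ⟨DGVect.carrier⟩

attribute [instance] DGVect.addCommGroup DGVect.module

variable {K : Type u} [Field K]

/-- The operator multiplying each homogeneous element of degree `i` by the integer `c i`. -/
def scal (V : DGVect K) (c : ℤ → ℤ) : V →ₗ[K] V :=
  (DirectSum.toModule K ℤ V fun i => c i • (V.deg i).subtype) ∘ₗ
    (LinearEquiv.ofBijective (DirectSum.coeLinearMap V.deg) V.isInternal).symm.toLinearMap

theorem scal_of_mem (V : DGVect K) (c : ℤ → ℤ) {i : ℤ} {x : V} (hx : x ∈ V.deg i) :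
    V.scal c x = c i • x := by
  have h : (LinearEquiv.ofBijective (DirectSum.coeLinearMap V.deg) V.isInternal).symm x =
      DirectSum.lof K ℤ (fun i => V.deg i) i ⟨x, hx⟩ := by
    rw [LinearEquiv.symm_apply_eq]
    exact (DirectSum.coeLinearMap_lof V.deg i ⟨x, hx⟩).symm
  simp only [scal, LinearMap.comp_apply, LinearEquiv.coe_coe, h]
  rw [DirectSum.toModule_lof]
  simp

theorem iSup_deg (V : DGVect K) : ⨆ i, V.deg i = ⊤ := V.isInternal.submodule_iSup_eq_top

theorem hom_induction (V : DGVect K) {motive : V → Prop} (x : V)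
    (mem : ∀ (i : ℤ) (x : V), x ∈ V.deg i → motive x) (zero : motive 0)
    (add : ∀ x y, motive x → motive y → motive (x + y)) : motive x :=
  Submodule.iSup_induction V.deg (motive := motive) (x := x) (by simp [V.iSup_deg]) mem zero add

/-- A criterion for a family of subspaces to be a grading. -/
theorem isInternal_of {V : Type*} [AddCommGroup V] [Module K V] (D : ℤ → Submodule K V)
    (top : ⨆ i, D i = ⊤) {α Y : Type*} [AddCommGroup Y] (t : α → ℤ) (q : α → V →+ Y)
    (hq : ∀ a j, j ≠ t a → ∀ x ∈ D j, q a x = 0) (h0 : ∀ x, (∀ a, q a x = 0) → x = 0) :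
    DirectSum.IsInternal D := by
  refine DirectSum.isInternal_submodule_of_iSupIndep_of_iSup_eq_top ?_ top
  intro i
  rw [Submodule.disjoint_def]
  intro x hx hx'
  refine h0 x fun a => ?_
  by_cases hi : i = t a
  · refine Submodule.iSup_induction _ (motive := fun x => q a x = 0) hx' ?_ (by simp) ?_
    · intro j y hy
      by_cases hj : j = i
      · subst hj
        have : y = 0 := by simpa using hy
        simp [this]
      · refine hq a j (by rwa [← hi]) y ?_
        simpa [hj] using hy
    · intro y z hy hz
      simp [hy, hz]
  · exact hq a i hi x hx

/-- The projection to the component of degree `i`. -/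
def proj (V : DGVect K) (i : ℤ) : V →ₗ[K] V := V.scal (Pi.single i 1)

theorem proj_same (V : DGVect K) {i : ℤ} {x : V} (hx : x ∈ V.deg i) : V.proj i x = x := by
  simp [proj, V.scal_of_mem _ hx]

theorem proj_ne (V : DGVect K) {i j : ℤ} (h : j ≠ i) {x : V} (hx : x ∈ V.deg j) :
    V.proj i x = 0 := by
  simp [proj, V.scal_of_mem _ hx, h]

theorem proj_mem (V : DGVect K) (i : ℤ) (x : V) : V.proj i x ∈ V.deg i := by
  induction x using V.hom_induction with
  | mem j x hx =>
    by_cases h : j = i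
    · subst h; rwa [V.proj_same hx]
    · rw [V.proj_ne h hx]; exact zero_mem _
  | zero => simp
  | add x y hx hy => rw [map_add]; exact add_mem hx hy

theorem exists_sum_proj (V : DGVect K) (x : V) :
    ∃ s : Finset ℤ, ∀ t, s ⊆ t → ∑ i ∈ t, V.proj i x = x := by
  induction x using V.hom_induction with
  | mem j x hx =>
    refine ⟨{j}, fun t ht => ?_⟩
    rw [Finset.sum_eq_single_of_mem j (by simpa using ht), V.proj_same hx]
    intro i _ hi
    exact V.proj_ne hi.symm hx
  | zero => exact ⟨∅, by simp⟩
  | add x y hx hy =>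
    obtain ⟨s, hs⟩ := hx
    obtain ⟨s', hs'⟩ := hy
    refine ⟨s ∪ s', fun t ht => ?_⟩
    simp only [map_add, Finset.sum_add_distrib]
    rw [hs t (Finset.union_subset_left ht), hs' t (Finset.union_subset_right ht)]

theorem eq_zero_of_proj (V : DGVect K) {x : V} (h : ∀ i, V.proj i x = 0) : x = 0 := by
  obtain ⟨s, hs⟩ := V.exists_sum_proj x
  rw [← hs s subset_rfl]
  simp [h]

/-- Additive maps preserving degrees commute with projections. -/
theorem proj_map (V : DGVect K) {K' : Type u} [Field K'] (W : DGVect K') (f : V →+ W)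
    (hf : ∀ i x, x ∈ V.deg i → f x ∈ W.deg i) (i : ℤ) (x : V) :
    f (V.proj i x) = W.proj i (f x) := by
  induction x using V.hom_induction with
  | mem j x hx =>
    by_cases h : j = i
    · subst h; rw [V.proj_same hx, W.proj_same (hf _ _ hx)]
    · rw [V.proj_ne h hx, W.proj_ne h (hf _ _ hx), map_zero]
  | zero => simp
  | add x y hx hy => simp [hx, hy]

end DGVect

/-! ## Signs -/

/-- The sign `(-1)^e ∈ K` for `e ∈ ℤ/2`. -/
def sgn (K : Type u) [Field K] (e : ZMod 2) : K := if e = 0 then 1 else -1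

theorem sgn_add (K : Type u) [Field K] (a b : ZMod 2) : sgn K (a + b) = sgn K a * sgn K b := by
  have h : ∀ x : ZMod 2, x = 0 ∨ x = 1 := by decide
  have h2 : (1 : ZMod 2) + 1 = 0 := by decide
  rcases h a with rfl | rfl <;> rcases h b with rfl | rfl <;> simp [sgn, h2]

theorem map_sgn {K L : Type u} [Field K] [Field L] (f : K →+* L) (a : ZMod 2) :
    f (sgn K a) = sgn L a := by
  unfold sgn; split_ifs <;> simp

theorem negOnePow_eq_sgn (K : Type u) [Field K] (i : ℤ) :
    ((i.negOnePow : ℤ) : K) = sgn K (i : ZMod 2) := by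
  rcases Int.even_or_odd i with h | h
  · rw [Int.negOnePow_even i h, (ZMod.intCast_eq_zero_iff_even).2 h]; simp [sgn]
  · rw [Int.negOnePow_odd i h, (ZMod.intCast_eq_one_iff_odd).2 h]; simp [sgn]

/-! ## The tensor product of a finite family of complexes -/

namespace Tens

variable {K : Type u} [Field K] {I : Type u} [Fintype I] [LinearOrder I]

/-- The underlying vector space of `⨂_c V_c`. -/
abbrev Carrier (V : I → DGVect K) : Type u := ⨂[K] c, (V c : Type u)

variable (V : I → DGVect K)

/-- `v` is a family of homogeneous elements, `v c` of degree `i c`. -/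
def IsHom {V : I → DGVect K} (i : I → ℤ) (v : ∀ c, V c) : Prop := ∀ c, v c ∈ (V c).deg (i c)

theorem IsHom.update {V : I → DGVect K} {i : I → ℤ} {v : ∀ c, V c} (h : IsHom i v) (c : I)
    {j : ℤ} {x : V c} (hx : x ∈ (V c).deg j) :
    IsHom (Function.update i c j) (Function.update v c x) := by
  intro c'
  by_cases hc : c' = c
  · subst hc; simpa using hx
  · simpa [hc] using h c'

theorem induction {motive : Carrier V → Prop} (x : Carrier V)
    (tprod : ∀ i v, IsHom i v → motive (PiTensorProduct.tprod K v))
    (zero : motive 0) (add : ∀ x y, motive x → motive y → motive (x + y))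
    (smul : ∀ (r : K) x, motive x → motive (r • x)) : motive x := by
  have key : ∀ (s : Finset I) (v : ∀ c, V c),
      (∀ c ∉ s, ∃ i, v c ∈ (V c).deg i) → motive (PiTensorProduct.tprod K v) := by
    intro s
    induction s using Finset.induction_on with
    | empty =>
      intro v hv
      choose i hi using fun c => hv c (by simp)
      exact tprod i v hi
    | insert a s ha ih =>
      intro v hv
      have h2 : ∀ y : V a, motive (PiTensorProduct.tprod K (Function.update v a y)) := by
        intro y
        induction y using (V a).hom_induction with
        | mem j y hy =>
          apply ih
          intro c hc
          by_cases hca : c = a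
          · subst hca; exact ⟨j, by simpa using hy⟩
          · simpa [hca] using hv c (by simp [hca, hc])
        | zero => rw [MultilinearMap.map_update_zero]; exact zero
        | add y z hy hz => rw [MultilinearMap.map_update_add]; exact add _ _ hy hz
      simpa using h2 (v a)
  induction x using PiTensorProduct.induction_on with
  | smul_tprod r f => exact smul _ _ (key Finset.univ f (by simp))
  | add x y hx hy => exact add _ _ hx hy

/-! ### Operators -/

/-- The projection of a complex to its part of parity `q`. -/
def parProj (W : DGVect K) (q : ZMod 2) : W →ₗ[K] W :=
  W.scal fun i => if (i : ZMod 2) = q then 1 else 0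

/-- The projection to the part of multi-parity `p`. -/
def parMap (p : I → ZMod 2) : Carrier V →ₗ[K] Carrier V :=
  PiTensorProduct.map fun c => parProj (V c) (p c)

/-- The parities of a multidegree. -/
def par (i : I → ℤ) : I → ZMod 2 := fun c => (i c : ZMod 2)

theorem parMap_tprod {i : I → ℤ} {v : ∀ c, V c} (h : IsHom i v) (p : I → ZMod 2) :
    parMap V p (PiTensorProduct.tprod K v) =
      if par i = p then PiTensorProduct.tprod K v else 0 := by
  rw [parMap, PiTensorProduct.map_tprod]
  have h1 : ∀ c, parProj (V c) (p c) (v c) = if (i c : ZMod 2) = p c then v c else 0 := by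
    intro c
    rw [parProj, (V c).scal_of_mem _ (h c)]
    split_ifs <;> simp
  split_ifs with hp
  · congr 1
    funext c
    rw [h1]; exact if_pos (congrFun hp c)
  · obtain ⟨c, hc⟩ : ∃ c, par i c ≠ p c := by
      by_contra hcon
      push Not at hcon
      exact hp (funext hcon)
    apply MultilinearMap.map_coord_zero _ c
    rw [h1]; exact if_neg hc

/-- The operator multiplying an element of multi-parity `p` by `(-1)^(s p)`. -/
def signOp (s : (I → ZMod 2) → ZMod 2) : Carrier V →ₗ[K] Carrier V :=
  ∑ p : I → ZMod 2, sgn K (s p) • parMap V p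

theorem signOp_tprod (s : (I → ZMod 2) → ZMod 2) {i : I → ℤ} {v : ∀ c, V c} (h : IsHom i v) :
    signOp V s (PiTensorProduct.tprod K v) = sgn K (s (par i)) • PiTensorProduct.tprod K v := by
  rw [signOp, LinearMap.sum_apply, Finset.sum_eq_single (par i)]
  · rw [LinearMap.smul_apply, parMap_tprod V h, if_pos rfl]
  · intro p _ hp
    rw [LinearMap.smul_apply, parMap_tprod V h, if_neg hp.symm, smul_zero]
  · simp

/-! ### Grading -/

/-- The component of degree `n` of `⨂_c V_c`, spanned by the tensors `⨂_c v_c` of homogeneous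
elements with `∑_c |v_c| = n`. -/
def deg (n : ℤ) : Submodule K (Carrier V) :=
  Submodule.span K {x | ∃ (i : I → ℤ) (v : ∀ c, V c), IsHom i v ∧ ∑ c, i c = n ∧
    x = PiTensorProduct.tprod K v}

theorem tprod_mem_deg {i : I → ℤ} {v : ∀ c, V c} (h : IsHom i v) {n : ℤ} (hn : ∑ c, i c = n) :
    PiTensorProduct.tprod K v ∈ deg V n :=
  Submodule.subset_span ⟨i, v, h, hn, rfl⟩

/-- The projection to the part of multidegree `i`. -/
def multiProj (i : I → ℤ) : Carrier V →ₗ[K] Carrier V :=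
  PiTensorProduct.map fun c => (V c).proj (i c)

theorem multiProj_tprod {j : I → ℤ} {v : ∀ c, V c} (h : IsHom j v) (i : I → ℤ) :
    multiProj V i (PiTensorProduct.tprod K v) =
      if j = i then PiTensorProduct.tprod K v else 0 := by
  rw [multiProj, PiTensorProduct.map_tprod]
  split_ifs with hp
  · subst hp
    congr 1
    funext c
    rw [(V c).proj_same (h c)]
  · obtain ⟨c, hc⟩ : ∃ c, j c ≠ i c := by
      by_contra hcon
      push Not at hcon
      exact hp (funext hcon)
    apply MultilinearMap.map_coord_zero _ c
    rw [(V c).proj_ne hc (h c)]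

theorem exists_sum_multiProj (x : Carrier V) :
    ∃ s : Finset (I → ℤ), ∀ t, s ⊆ t → ∑ i ∈ t, multiProj V i x = x := by
  induction x using induction V with
  | tprod j v h =>
    refine ⟨{j}, fun t ht => ?_⟩
    rw [Finset.sum_eq_single_of_mem j (by simpa using ht), multiProj_tprod V h, if_pos rfl]
    intro i _ hi
    rw [multiProj_tprod V h, if_neg hi.symm]
  | zero => exact ⟨∅, by simp⟩
  | add x y hx hy =>
    obtain ⟨s, hs⟩ := hx
    obtain ⟨s', hs'⟩ := hy
    refine ⟨s ∪ s', fun t ht => ?_⟩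
    simp only [map_add, Finset.sum_add_distrib]
    rw [hs t (Finset.union_subset_left ht), hs' t (Finset.union_subset_right ht)]
  | smul r x hx =>
    obtain ⟨s, hs⟩ := hx
    refine ⟨s, fun t ht => ?_⟩
    simp only [map_smul, ← Finset.smul_sum]
    rw [hs t ht]

theorem isInternal_deg : DirectSum.IsInternal (deg V) := by
  refine DGVect.isInternal_of (deg V) ?_ (fun i : I → ℤ => ∑ c, i c)
    (fun i => (multiProj V i).toAddMonoidHom) ?_ ?_
  · rw [eq_top_iff]
    intro x _
    induction x using induction V with
    | tprod j v h => exact Submodule.mem_iSup_of_mem _ (tprod_mem_deg V h rfl)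
    | zero => exact zero_mem _
    | add x y hx hy => exact add_mem (hx trivial) (hy trivial)
    | smul r x hx => exact Submodule.smul_mem _ _ (hx trivial)
  · intro i n hn x hx
    show multiProj V i x = 0
    induction hx using Submodule.span_induction with
    | mem x hx =>
      obtain ⟨j, v, h, hj, rfl⟩ := hx
      rw [multiProj_tprod V h, if_neg]
      rintro rfl
      exact hn hj.symm
    | zero => simp
    | add x y _ _ hx hy => simp [hx, hy]
    | smul r x _ hx => simp [hx]
  · intro x hx
    obtain ⟨s, hs⟩ := exists_sum_multiProj V x
    rw [← hs s subset_rfl]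
    exact Finset.sum_eq_zero fun i _ => hx i

/-! ### Differential -/

/-- The differential of the factor `c`, without sign. -/
def dAt (c : I) : Carrier V →ₗ[K] Carrier V :=
  PiTensorProduct.map (Function.update (fun _ => LinearMap.id) c (V c).d)

theorem dAt_tprod (c : I) (v : ∀ c, V c) :
    dAt V c (PiTensorProduct.tprod K v) =
      PiTensorProduct.tprod K (Function.update v c ((V c).d (v c))) := by
  rw [dAt, PiTensorProduct.map_tprod]
  congr 1
  funext c'
  by_cases h : c' = c
  · subst h; simp
  · simp [h]

/-- The exponent of the sign in front of the differential of the factor `c`: the sum of the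
degrees of the preceding factors. -/
def dExp (c : I) (p : I → ZMod 2) : ZMod 2 := ∑ c', if c' < c then p c' else 0

/-- The differential
`d (⨂ v_c) = ∑_c (-1)^(∑_{c' < c} |v_{c'}|) ⋯ ⊗ d v_c ⊗ ⋯` of `⨂_c V_c`. -/
def d : Carrier V →ₗ[K] Carrier V := ∑ c, dAt V c ∘ₗ signOp V (dExp c)

theorem d_tprod {i : I → ℤ} {v : ∀ c, V c} (h : IsHom i v) :
    d V (PiTensorProduct.tprod K v) = ∑ c, sgn K (dExp c (par i)) •
      PiTensorProduct.tprod K (Function.update v c ((V c).d (v c))) := by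
  simp only [d, LinearMap.sum_apply, LinearMap.comp_apply, signOp_tprod V _ h, map_smul,
    dAt_tprod]

theorem par_update (i : I → ℤ) (c : I) :
    par (Function.update i c (i c + 1)) = par i + Pi.single c 1 := by
  funext c'
  by_cases h : c' = c
  · subst h; simp [par]
  · simp [par, h]

theorem dExp_add (c : I) (p q : I → ZMod 2) : dExp c (p + q) = dExp c p + dExp c q := by
  simp only [dExp, ← Finset.sum_add_distrib]
  exact Finset.sum_congr rfl fun c' _ => by split_ifs <;> simp

theorem dExp_single (c c' : I) : dExp c (Pi.single c' 1) = if c' < c then 1 else 0 := by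
  rw [dExp, Finset.sum_eq_single c']
  · simp
  · intro b _ hb; simp [hb]
  · simp

theorem d_d (x : Carrier V) : d V (d V x) = 0 := by
  induction x using induction V with
  | tprod i v h =>
    rw [d_tprod V h, map_sum]
    have h1 : ∀ c, d V (sgn K (dExp c (par i)) •
        PiTensorProduct.tprod K (Function.update v c ((V c).d (v c)))) =
        ∑ c', (sgn K (dExp c (par i)) * sgn K (dExp c' (par i + Pi.single c 1))) •
          PiTensorProduct.tprod K (Function.update (Function.update v c ((V c).d (v c))) c'
            ((V c').d (Function.update v c ((V c).d (v c)) c'))) := by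
      intro c
      rw [map_smul, d_tprod V (h.update c ((V c).d_mem (h c))), Finset.smul_sum]
      exact Finset.sum_congr rfl fun c' _ => by rw [smul_smul, par_update]
    simp only [h1]
    rw [← Finset.sum_product']
    refine Finset.sum_involution (fun a _ => (a.2, a.1)) ?_ ?_ ?_ ?_
    · rintro ⟨c, c'⟩ -
      by_cases hc : c = c'
      · subst hc
        have : PiTensorProduct.tprod K (Function.update (Function.update v c ((V c).d (v c))) c
            ((V c).d (Function.update v c ((V c).d (v c)) c))) = 0 := by
          apply MultilinearMap.map_coord_zero _ c
          simp [(V c).d_d]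
        simp only [this, smul_zero, add_zero]
      · have hc' : c' ≠ c := fun h => hc h.symm
        simp only [Function.update_of_ne hc, Function.update_of_ne hc']
        rw [Function.update_comm hc', ← add_smul]
        have : sgn K (dExp c (par i)) * sgn K (dExp c' (par i + Pi.single c 1)) +
            sgn K (dExp c' (par i)) * sgn K (dExp c (par i + Pi.single c' 1)) = 0 := by
          simp only [dExp_add, dExp_single, sgn_add]
          rcases lt_or_gt_of_ne hc with hlt | hlt
          · simp only [hlt, hlt.not_gt, if_true, if_false]
            simp [sgn]; split_ifs <;> simp
          · simp only [hlt, hlt.not_gt, if_true, if_false]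
            simp [sgn]; split_ifs <;> simp
        rw [this, zero_smul]
    · rintro ⟨c, c'⟩ - hne heq
      apply hne
      have hc : c' = c := congrArg Prod.fst heq
      subst hc
      have : PiTensorProduct.tprod K (Function.update (Function.update v c' ((V c').d (v c'))) c'
          ((V c').d (Function.update v c' ((V c').d (v c')) c'))) = 0 := by
        apply MultilinearMap.map_coord_zero _ c'
        simp [(V c').d_d]
      simp only [this, smul_zero]
    · simp
    · simp
  | zero => simp
  | add x y hx hy => simp [hx, hy]
  | smul r x hx => simp [hx]

theorem sum_update_succ (i : I → ℤ) (c : I) :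
    ∑ c', Function.update i c (i c + 1) c' = (∑ c', i c') + 1 := by
  have : Function.update i c (i c + 1) = i + Pi.single c 1 := by
    funext c'
    by_cases h : c' = c
    · subst h; simp
    · simp [h]
  rw [this]
  simp [Finset.sum_add_distrib]

theorem d_mem {n : ℤ} {x : Carrier V} (hx : x ∈ deg V n) : d V x ∈ deg V (n + 1) := by
  induction hx using Submodule.span_induction with
  | mem x hx =>
    obtain ⟨i, v, h, hn, rfl⟩ := hx
    rw [d_tprod V h]
    refine sum_mem fun c _ => Submodule.smul_mem _ _ ?_
    refine tprod_mem_deg V (h.update c ((V c).d_mem (h c))) ?_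
    rw [sum_update_succ, hn]
  | zero => simp
  | add x y _ _ hx hy => rw [map_add]; exact add_mem hx hy
  | smul r x _ hx => rw [map_smul]; exact Submodule.smul_mem _ _ hx

end Tens

/-- The tensor product `⨂_c V_c` of a finite family of complexes, with the Koszul sign rule with
respect to a linear order of the index set. (Up to canonical isomorphism, it does not depend on
the order.) -/
def tensor {K : Type u} [Field K] {I : Type u} [Fintype I] [LinearOrder I] (V : I → DGVect K) :
    DGVect K where
  carrier := Tens.Carrier V
  deg := Tens.deg V
  isInternal := Tens.isInternal_deg V
  d := Tens.d V
  d_mem := Tens.d_mem V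
  d_d := Tens.d_d V

/-! ## Pairings of complexes -/

/-- A morphism of complexes `U ⊗ V → W`, presented as a bilinear map. -/
structure Pairing {K : Type u} [Field K] (U V W : DGVect K) where
  toFun : U →ₗ[K] V →ₗ[K] W
  mem : ∀ {i j : ℤ} {x : U} {y : V}, x ∈ U.deg i → y ∈ V.deg j → toFun x y ∈ W.deg (i + j)
  leibniz : ∀ {i : ℤ} {x : U} (y : V), x ∈ U.deg i →
    W.d (toFun x y) = toFun (U.d x) y + ((i.negOnePow : ℤ) : K) • toFun x (V.d y)

namespace Tens

variable {K : Type u} [Field K] {I : Type u} [Fintype I] [LinearOrder I]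
variable {U V W : I → DGVect K} (μ : ∀ c, Pairing (U c) (V c) (W c))

/-- The exponent of the Koszul sign relating `(⨂ u_c) ⊗ (⨂ v_c)` and `⨂ (u_c ⊗ v_c)`. -/
def pExp (p q : I → ZMod 2) : ZMod 2 := ∑ c, ∑ c', if c' < c then p c * q c' else 0

/-- The bilinear map `(⨂ u_c, ⨂ v_c) ↦ (-1)^(∑_{c' < c} |u_c| |v_{c'}|) ⨂ μ_c(u_c, v_c)`. -/
def pair : Carrier U →ₗ[K] Carrier V →ₗ[K] Carrier W :=
  ∑ p : I → ZMod 2, (PiTensorProduct.map₂ fun c => (μ c).toFun).compl₁₂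
    (parMap U p) (signOp V (pExp p))

theorem pair_tprod {i j : I → ℤ} {x : ∀ c, U c} {y : ∀ c, V c} (hx : IsHom i x) (hy : IsHom j y) :
    pair μ (PiTensorProduct.tprod K x) (PiTensorProduct.tprod K y) =
      sgn K (pExp (par i) (par j)) • PiTensorProduct.tprod K fun c => (μ c).toFun (x c) (y c) := by
  rw [pair, LinearMap.sum_apply, LinearMap.sum_apply, Finset.sum_eq_single (par i)]
  · rw [LinearMap.compl₁₂_apply, parMap_tprod U hx, if_pos rfl, signOp_tprod V _ hy, map_smul,
      PiTensorProduct.map₂_tprod_tprod]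
  · intro p _ hp
    rw [LinearMap.compl₁₂_apply, parMap_tprod U hx, if_neg hp.symm]
    simp
  · simp

theorem pExp_add_left (p p' q : I → ZMod 2) : pExp (p + p') q = pExp p q + pExp p' q := by
  simp only [pExp, ← Finset.sum_add_distrib]
  refine Finset.sum_congr rfl fun c _ => Finset.sum_congr rfl fun c' _ => ?_
  split_ifs <;> simp [add_mul]

theorem pExp_add_right (p q q' : I → ZMod 2) : pExp p (q + q') = pExp p q + pExp p q' := by
  simp only [pExp, ← Finset.sum_add_distrib]
  refine Finset.sum_congr rfl fun c _ => Finset.sum_congr rfl fun c' _ => ?_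
  split_ifs <;> simp [mul_add]

theorem pExp_single_left (c : I) (q : I → ZMod 2) : pExp (Pi.single c 1) q = dExp c q := by
  rw [pExp, Finset.sum_eq_single c]
  · simp [dExp]
  · intro b _ hb; simp [hb]
  · simp

theorem pExp_single_right (p : I → ZMod 2) (c : I) :
    pExp p (Pi.single c 1) = dExp c p + p c + ∑ c', p c' := by
  have h1 : pExp p (Pi.single c 1) = ∑ b, if c < b then p b else 0 := by
    rw [pExp]
    refine Finset.sum_congr rfl fun b _ => ?_
    rw [Finset.sum_eq_single c]
    · simp
    · intro a _ ha; simp [ha]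
    · simp
  have h2 : p c = ∑ b, if b = c then p b else 0 := by simp
  rw [h1, dExp]
  conv_rhs => rw [h2]
  rw [← Finset.sum_add_distrib, ← Finset.sum_add_distrib]
  refine Finset.sum_congr rfl fun b _ => ?_
  rcases lt_trichotomy b c with h | h | h
  · simp [h, h.not_gt, h.ne]
    exact (CharTwo.add_self_eq_zero _).symm
  · subst h; simp
    exact (CharTwo.add_self_eq_zero _).symm
  · simp [h, h.not_gt, h.ne']

theorem IsHom.pair {i j : I → ℤ} {x : ∀ c, U c} {y : ∀ c, V c} (hx : IsHom i x) (hy : IsHom j y) :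
    IsHom (i + j) fun c => (μ c).toFun (x c) (y c) := fun c => (μ c).mem (hx c) (hy c)

theorem par_add (i j : I → ℤ) : par (i + j) = par i + par j := by
  funext c; simp [par]

theorem pair_mem {m n : ℤ} {x : Carrier U} {y : Carrier V} (hx : x ∈ deg U m) (hy : y ∈ deg V n) :
    pair μ x y ∈ deg W (m + n) := by
  induction hx using Submodule.span_induction with
  | mem x hx =>
    obtain ⟨i, u, hu, hm, rfl⟩ := hx
    induction hy using Submodule.span_induction with
    | mem y hy =>
      obtain ⟨j, v, hv, hn, rfl⟩ := hy
      rw [pair_tprod μ hu hv]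
      refine Submodule.smul_mem _ _ (tprod_mem_deg W (hu.pair μ hv) ?_)
      simp [Finset.sum_add_distrib, hm, hn]
    | zero => simp
    | add x y _ _ hx hy => rw [map_add]; exact add_mem hx hy
    | smul r x _ hx => rw [map_smul]; exact Submodule.smul_mem _ _ hx
  | zero => simp
  | add x y _ _ hx hy => rw [map_add, LinearMap.add_apply]; exact add_mem hx hy
  | smul r x _ hx => rw [map_smul, LinearMap.smul_apply]; exact Submodule.smul_mem _ _ hx

theorem par_sum (i : I → ℤ) : ((∑ c, i c : ℤ) : ZMod 2) = ∑ c, par i c := by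
  simp [par]

theorem pair_leibniz {n : ℤ} {x : Carrier U} (y : Carrier V) (hx : x ∈ deg U n) :
    d W (pair μ x y) = pair μ (d U x) y + ((n.negOnePow : ℤ) : K) • pair μ x (d V y) := by
  rw [negOnePow_eq_sgn]
  induction hx using Submodule.span_induction with
  | mem x hx =>
    obtain ⟨i, u, hu, hn, rfl⟩ := hx
    induction y using induction V with
    | tprod j v hv =>
      rw [pair_tprod μ hu hv, map_smul, d_tprod W (hu.pair μ hv), d_tprod U hu, d_tprod V hv,
        map_sum, map_sum, LinearMap.sum_apply, Finset.smul_sum, Finset.smul_sum,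
        ← Finset.sum_add_distrib]
      refine Finset.sum_congr rfl fun c _ => ?_
      rw [map_smul, map_smul, LinearMap.smul_apply,
        pair_tprod μ (hu.update c ((U c).d_mem (hu c))) hv,
        pair_tprod μ hu (hv.update c ((V c).d_mem (hv c))),
        (μ c).leibniz _ (hu c), negOnePow_eq_sgn, MultilinearMap.map_update_add,
        MultilinearMap.map_update_smul]
      have e1 : (fun c' => (μ c').toFun (Function.update u c ((U c).d (u c)) c') (v c')) =
          Function.update (fun c' => (μ c').toFun (u c') (v c')) c
            ((μ c).toFun ((U c).d (u c)) (v c)) := by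
        funext c'
        by_cases h : c' = c
        · subst h; simp
        · simp [h]
      have e2 : (fun c' => (μ c').toFun (u c') (Function.update v c ((V c).d (v c)) c')) =
          Function.update (fun c' => (μ c').toFun (u c') (v c')) c
            ((μ c).toFun (u c) ((V c).d (v c))) := by
        funext c'
        by_cases h : c' = c
        · subst h; simp
        · simp [h]
      rw [e1, e2]
      simp only [smul_add, smul_smul, ← sgn_add]
      rw [par_add, par_update, par_update, ← hn, par_sum]
      congr 2
      · congr 1
        rw [dExp_add, pExp_add_left, pExp_single_left]
        ring
      · congr 1
        rw [dExp_add, pExp_add_right, pExp_single_right]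
        change _ + (_ + par i c) = _
        have := CharTwo.add_self_eq_zero (∑ c', par i c')
        linear_combination (-1 : ZMod 2) * this
    | zero => simp
    | add x y hx hy => simp only [map_add, hx, hy, smul_add]; abel
    | smul r x hx => simp only [map_smul, hx, smul_add, smul_comm r]
  | zero => simp
  | add x y _ _ hx hy => simp only [map_add, LinearMap.add_apply, hx, hy, smul_add]; abel
  | smul r x _ hx =>
    simp only [map_smul, LinearMap.smul_apply, hx, smul_add, smul_comm r]

theorem pair_assoc {U V W X Y Z : I → DGVect K} (μ : ∀ c, Pairing (U c) (V c) (X c))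
    (ν : ∀ c, Pairing (X c) (W c) (Z c)) (μ' : ∀ c, Pairing (V c) (W c) (Y c))
    (ν' : ∀ c, Pairing (U c) (Y c) (Z c))
    (h : ∀ c x y z, (ν c).toFun ((μ c).toFun x y) z = (ν' c).toFun x ((μ' c).toFun y z))
    (x : Carrier U) (y : Carrier V) (z : Carrier W) :
    pair ν (pair μ x y) z = pair ν' x (pair μ' y z) := by
  induction x using induction U with
  | tprod i x hx =>
    induction y using induction V with
    | tprod j y hy =>
      induction z using induction W with
      | tprod k z hz =>
        rw [pair_tprod μ hx hy, pair_tprod μ' hy hz, map_smul, map_smul,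
          LinearMap.smul_apply, pair_tprod ν (hx.pair μ hy) hz,
          pair_tprod ν' hx (hy.pair μ' hz), smul_smul, smul_smul, ← sgn_add, ← sgn_add]
        simp only [h, par_add, pExp_add_left, pExp_add_right]
        congr 2
        ring
      | zero => simp
      | add x y hx hy => simp only [map_add, LinearMap.add_apply, hx, hy]
      | smul r x hx => simp only [map_smul, hx]
    | zero => simp
    | add x y hx hy => simp only [map_add, LinearMap.add_apply, hx, hy]
    | smul r x hx => simp only [map_smul, LinearMap.smul_apply, hx]
  | zero => simp
  | add x y hx hy => simp only [map_add, LinearMap.add_apply, hx, hy]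
  | smul r x hx => simp only [map_smul, LinearMap.smul_apply, hx]

end Tens

/-- The pairing of tensor products induced by a family of pairings. -/
def tensorPairing {K : Type u} [Field K] {I : Type u} [Fintype I] [LinearOrder I]
    {U V W : I → DGVect K} (μ : ∀ c, Pairing (U c) (V c) (W c)) :
    Pairing (tensor U) (tensor V) (tensor W) where
  toFun := Tens.pair μ
  mem := Tens.pair_mem μ
  leibniz := Tens.pair_leibniz μ

/-! ## Extension of scalars -/

section Extend

variable {l : Type u} [Field l] (B : Type u) [Field B] [Algebra l B]

/-- The extension of scalars `B ⊗ V` of a complex of `l`-vector spaces. -/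
def extend (V : DGVect l) : DGVect B where
  carrier := B ⊗[l] V
  deg i := (V.deg i).baseChange B
  isInternal := by
    refine DGVect.isInternal_of _ ?_ id
      (fun i => ((V.proj i).baseChange B).toAddMonoidHom) ?_ ?_
    · rw [eq_top_iff]
      intro x hx0
      clear hx0
      induction x with
      | zero => exact zero_mem _
      | add x y hx hy => exact add_mem hx hy
      | tmul b v =>
        induction v using V.hom_induction with
        | mem i v hv =>
          exact Submodule.mem_iSup_of_mem i (Submodule.tmul_mem_baseChange_of_mem b hv)
        | zero => simp
        | add x y hx hy => rw [TensorProduct.tmul_add]; exact add_mem hx hy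
    · intro i j hj x hx
      change (V.proj i).baseChange B x = 0
      have : (V.deg j).baseChange B ≤ LinearMap.ker ((V.proj i).baseChange B) := by
        rw [Submodule.baseChange_eq_span, Submodule.span_le]
        rintro _ ⟨v, hv, rfl⟩
        simp [V.proj_ne (show j ≠ i from hj) hv]
      exact this hx
    · intro x hx
      have hx' : ∀ i, (V.proj i).baseChange B x = 0 := hx
      have : ∃ s : Finset ℤ, ∀ t, s ⊆ t → ∑ i ∈ t, (V.proj i).baseChange B x = x := by
        clear hx hx'
        induction x with
        | zero => exact ⟨∅, by simp⟩
        | tmul b v =>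
          obtain ⟨s, hs⟩ := V.exists_sum_proj v
          refine ⟨s, fun t ht => ?_⟩
          simp only [LinearMap.baseChange_tmul]
          rw [← TensorProduct.tmul_sum, hs t ht]
        | add x y hx hy =>
          obtain ⟨s, hs⟩ := hx
          obtain ⟨s', hs'⟩ := hy
          refine ⟨s ∪ s', fun t ht => ?_⟩
          simp only [map_add, Finset.sum_add_distrib]
          rw [hs t (Finset.union_subset_left ht), hs' t (Finset.union_subset_right ht)]
      obtain ⟨s, hs⟩ := this
      rw [← hs s subset_rfl]
      exact Finset.sum_eq_zero fun i _ => hx' i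
  d := V.d.baseChange B
  d_mem := by
    intro i x hx
    have : (V.deg i).baseChange B ≤
        ((V.deg (i + 1)).baseChange B).comap (V.d.baseChange B) := by
      rw [Submodule.baseChange_eq_span, Submodule.span_le]
      rintro _ ⟨v, hv, rfl⟩
      simpa using Submodule.tmul_mem_baseChange_of_mem (1 : B) (V.d_mem hv)
    exact this hx
  d_d := by
    intro x
    induction x with
    | zero => simp
    | tmul b v => simp [V.d_d]
    | add x y hx hy => simp [hx, hy]

theorem extend_induction {V : DGVect l} {i : ℤ} {motive : B ⊗[l] V → Prop} {x : B ⊗[l] V}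
    (hx : x ∈ (V.deg i).baseChange B)
    (tmul : ∀ (b : B) (v : V), v ∈ V.deg i → motive (b ⊗ₜ v))
    (zero : motive 0) (add : ∀ x y, motive x → motive y → motive (x + y)) : motive x := by
  rw [Submodule.baseChange_eq_span] at hx
  have key : ∀ y ∈ Submodule.span B (((V.deg i).map (TensorProduct.mk l B V 1) :
      Submodule l (B ⊗[l] V)) : Set (B ⊗[l] V)), ∀ b : B, motive (b • y) := by
    intro y hy
    induction hy using Submodule.span_induction with
    | mem y hy =>
      obtain ⟨v, hv, rfl⟩ := hy
      intro b
      simpa [TensorProduct.smul_tmul'] using tmul b v hv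
    | zero => simpa using zero
    | add y z _ _ hy hz => intro b; rw [smul_add]; exact add _ _ (hy b) (hz b)
    | smul r y _ hy => intro b; rw [smul_smul]; exact hy _
  simpa using key x hx 1

/-- Extension of scalars of a bilinear map: `(b ⊗ u, b' ⊗ v) ↦ b b' ⊗ μ(u, v)`. -/
def extPair {U V W : DGVect l} (μ : U →ₗ[l] V →ₗ[l] W) :
    B ⊗[l] U →ₗ[B] B ⊗[l] V →ₗ[B] B ⊗[l] W :=
  LinearMap.liftBaseChange B ((LinearMap.baseChangeHom l B V W) ∘ₗ μ)

theorem extPair_tmul {U V W : DGVect l} (μ : U →ₗ[l] V →ₗ[l] W) (b b' : B) (u : U) (v : V) :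
    extPair B μ (b ⊗ₜ u) (b' ⊗ₜ v) = (b * b') ⊗ₜ μ u v := by
  simp [extPair, TensorProduct.smul_tmul', LinearMap.baseChangeHom]

theorem extPair_mem {U V W : DGVect l} (μ : Pairing U V W) {i j : ℤ} {x : B ⊗[l] U}
    {y : B ⊗[l] V} (hx : x ∈ (U.deg i).baseChange B) (hy : y ∈ (V.deg j).baseChange B) :
    extPair B μ.toFun x y ∈ (W.deg (i + j)).baseChange B := by
  refine extend_induction B (motive := fun x => extPair B μ.toFun x y ∈
    (W.deg (i + j)).baseChange B) hx ?_ ?_ ?_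
  · intro b u hu
    refine extend_induction B (motive := fun y => extPair B μ.toFun (b ⊗ₜ u) y ∈
      (W.deg (i + j)).baseChange B) hy ?_ ?_ ?_
    · intro b' v hv
      rw [extPair_tmul]
      exact Submodule.tmul_mem_baseChange_of_mem _ (μ.mem hu hv)
    · simp
    · intro x y hx hy; rw [map_add]; exact add_mem hx hy
  · simp
  · intro x y hx hy; rw [map_add, LinearMap.add_apply]; exact add_mem hx hy

theorem extPair_leibniz {U V W : DGVect l} (μ : Pairing U V W) {i : ℤ} {x : B ⊗[l] U}
    (y : B ⊗[l] V) (hx : x ∈ (U.deg i).baseChange B) :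
    W.d.baseChange B (extPair B μ.toFun x y) =
      extPair B μ.toFun (U.d.baseChange B x) y +
        ((i.negOnePow : ℤ) : B) • extPair B μ.toFun x (V.d.baseChange B y) := by
  refine extend_induction B (motive := fun x => W.d.baseChange B (extPair B μ.toFun x y) =
    extPair B μ.toFun (U.d.baseChange B x) y +
      ((i.negOnePow : ℤ) : B) • extPair B μ.toFun x (V.d.baseChange B y)) hx ?_ ?_ ?_
  · intro b u hu
    induction y with
    | zero => simp
    | add x y hx hy => simp only [map_add, hx, hy, smul_add]; abel
    | tmul b' v =>
      simp only [LinearMap.baseChange_tmul, extPair_tmul, μ.leibniz v hu,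
        TensorProduct.tmul_add]
      congr 1
      rw [TensorProduct.tmul_smul, ← algebraMap_smul B ((i.negOnePow : ℤ) : l), map_intCast]
  · simp
  · intro x y hx hy; simp only [map_add, LinearMap.add_apply, hx, hy, smul_add]; abel

/-- Extension of scalars of a pairing. -/
def extendPairing {U V W : DGVect l} (μ : Pairing U V W) :
    Pairing (extend B U) (extend B V) (extend B W) where
  toFun := extPair B μ.toFun
  mem := extPair_mem B μ
  leibniz := extPair_leibniz B μ

theorem extPair_assoc {U V W X Y Z : DGVect l} (μ : Pairing U V X) (ν : Pairing X W Z)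
    (μ' : Pairing V W Y) (ν' : Pairing U Y Z)
    (h : ∀ x y z, ν.toFun (μ.toFun x y) z = ν'.toFun x (μ'.toFun y z))
    (x : B ⊗[l] U) (y : B ⊗[l] V) (z : B ⊗[l] W) :
    extPair B ν.toFun (extPair B μ.toFun x y) z =
      extPair B ν'.toFun x (extPair B μ'.toFun y z) := by
  induction x with
  | zero => simp
  | add x x' hx hy => simp only [map_add, LinearMap.add_apply, hx, hy]
  | tmul a x =>
    induction y with
    | zero => simp
    | add x x' hx hy => simp only [map_add, LinearMap.add_apply, hx, hy]
    | tmul b y =>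
      induction z with
      | zero => simp
      | add x x' hx hy => simp only [map_add, hx, hy]
      | tmul c z => simp only [extPair_tmul, h, mul_assoc]

variable {B} {B' : Type u} [Field B'] [Algebra l B']

/-- The map `f ⊗ id : B ⊗ V → B' ⊗ V`, for a morphism `f : B → B'`. -/
def extSemi (f : B →ₐ[l] B') (V : DGVect l) : B ⊗[l] V →ₛₗ[(f : B →+* B')] B' ⊗[l] V where
  toFun := TensorProduct.map f.toLinearMap LinearMap.id
  map_add' := map_add _
  map_smul' r x := by
    induction x with
    | zero => simp
    | add x y hx hy => simp only [smul_add, map_add, hx, hy]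
    | tmul b v => simp [TensorProduct.smul_tmul']

theorem extSemi_tmul (f : B →ₐ[l] B') (V : DGVect l) (b : B) (v : V) :
    extSemi f V (b ⊗ₜ v) = f b ⊗ₜ v := rfl

theorem extSemi_mem (f : B →ₐ[l] B') (V : DGVect l) {i : ℤ} {x : B ⊗[l] V}
    (hx : x ∈ (V.deg i).baseChange B) : extSemi f V x ∈ (V.deg i).baseChange B' := by
  refine extend_induction B (motive := fun x => extSemi f V x ∈ (V.deg i).baseChange B')
    hx ?_ ?_ ?_
  · intro b v hv
    exact Submodule.tmul_mem_baseChange_of_mem _ hv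
  · simp
  · intro x y hx hy; rw [map_add]; exact add_mem hx hy

theorem extSemi_baseChange (f : B →ₐ[l] B') {V W : DGVect l} (g : V →ₗ[l] W) (x : B ⊗[l] V) :
    extSemi f W (g.baseChange B x) = g.baseChange B' (extSemi f V x) := by
  induction x with
  | zero => simp
  | add x y hx hy => simp only [map_add, hx, hy]
  | tmul b v => simp [extSemi_tmul]

theorem extSemi_pair (f : B →ₐ[l] B') {U V W : DGVect l} (μ : U →ₗ[l] V →ₗ[l] W)
    (x : B ⊗[l] U) (y : B ⊗[l] V) :
    extSemi f W (extPair B μ x y) = extPair B' μ (extSemi f U x) (extSemi f V y) := by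
  induction x with
  | zero => simp
  | add x x' hx hy => simp only [map_add, LinearMap.add_apply, hx, hy]
  | tmul a x =>
    induction y with
    | zero => simp
    | add x x' hx hy => simp only [map_add, hx, hy]
    | tmul b y => simp [extSemi_tmul, extPair_tmul]

end Extend

section Conj

variable {l L : Type u} [Field l] [Field L]

/-- The field `L` viewed as an `l`-algebra through `φ : l → L`. -/
def Tw (_φ : l →+* L) : Type u := L

instance (φ : l →+* L) : Field (Tw φ) := inferInstanceAs (Field L)

instance (φ : l →+* L) : Algebra l (Tw φ) := φ.toAlgebra

/-- The complex `L ⊗_{l,φ} V` of `L`-vector spaces. -/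
def baseChange (φ : l →+* L) (V : DGVect l) : DGVect L := extend (Tw φ) V

/-- A ring morphism `ρ : L → L` as a morphism of `l`-algebras. -/
def twHom {φ ψ : l →+* L} (ρ : L →+* L) (h : ψ = ρ.comp φ) : Tw φ →ₐ[l] Tw ψ where
  toRingHom := ρ
  commutes' x := (RingHom.congr_fun h x).symm

/-- The `ρ`-semilinear map `ρ ⊗ id : L ⊗_{l,φ} V → L ⊗_{l,ρφ} V`. -/
def conjMap {φ ψ : l →+* L} (ρ : L →+* L) (h : ψ = ρ.comp φ) (V : DGVect l) :
    baseChange φ V →ₛₗ[ρ] baseChange ψ V := extSemi (twHom ρ h) V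

end Conj

namespace Tens

variable {K : Type u} [Field K] {I : Type u} [Fintype I] [LinearOrder I]

/-! ### Functoriality -/

section Map

variable {U V W : I → DGVect K} (f : ∀ c, V c →ₗ[K] W c)

/-- The map `⨂ f_c : ⨂ V_c → ⨂ W_c`. -/
def map : Carrier V →ₗ[K] Carrier W := PiTensorProduct.map f

theorem map_tprod (v : ∀ c, V c) :
    map f (PiTensorProduct.tprod K v) = PiTensorProduct.tprod K fun c => f c (v c) :=
  PiTensorProduct.map_tprod f v

theorem IsHom.map (hf : ∀ c i x, x ∈ (V c).deg i → f c x ∈ (W c).deg i)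
    {i : I → ℤ} {v : ∀ c, V c} (h : IsHom i v) : IsHom i fun c => f c (v c) :=
  fun c => hf c _ _ (h c)

theorem map_mem (hf : ∀ c i x, x ∈ (V c).deg i → f c x ∈ (W c).deg i)
    {n : ℤ} {x : Carrier V} (hx : x ∈ deg V n) : map f x ∈ deg W n := by
  induction hx using Submodule.span_induction with
  | mem x hx =>
    obtain ⟨i, v, h, hn, rfl⟩ := hx
    rw [map_tprod]
    exact tprod_mem_deg W (h.map f hf) hn
  | zero => simp
  | add x y _ _ hx hy => rw [map_add]; exact add_mem hx hy
  | smul r x _ hx => rw [map_smul]; exact Submodule.smul_mem _ _ hx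

theorem map_d (hf : ∀ c i x, x ∈ (V c).deg i → f c x ∈ (W c).deg i)
    (hd : ∀ c x, f c ((V c).d x) = (W c).d (f c x)) (x : Carrier V) :
    map f (d V x) = d W (map f x) := by
  induction x using induction V with
  | tprod i v h =>
    rw [d_tprod V h, map_tprod, d_tprod W (h.map f hf), map_sum]
    refine Finset.sum_congr rfl fun c _ => ?_
    rw [map_smul, map_tprod]
    congr 2
    funext c'
    by_cases h : c' = c
    · subst h; simp [hd]
    · simp [h]
  | zero => simp
  | add x y hx hy => simp only [map_add, hx, hy]
  | smul r x hx => simp only [map_smul, hx]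

end Map

theorem map_pair {U V W U' V' W' : I → DGVect K} (μ : ∀ c, Pairing (U c) (V c) (W c))
    (μ' : ∀ c, Pairing (U' c) (V' c) (W' c)) (f : ∀ c, U c →ₗ[K] U' c)
    (g : ∀ c, V c →ₗ[K] V' c) (h : ∀ c, W c →ₗ[K] W' c)
    (hf : ∀ c i x, x ∈ (U c).deg i → f c x ∈ (U' c).deg i)
    (hg : ∀ c i x, x ∈ (V c).deg i → g c x ∈ (V' c).deg i)
    (hμ : ∀ c x y, h c ((μ c).toFun x y) = (μ' c).toFun (f c x) (g c y))
    (x : Carrier U) (y : Carrier V) :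
    map h (pair μ x y) = pair μ' (map f x) (map g y) := by
  induction x using induction U with
  | tprod i x hx =>
    induction y using induction V with
    | tprod j y hy =>
      rw [pair_tprod μ hx hy, map_smul, map_tprod, map_tprod, map_tprod,
        pair_tprod μ' (hx.map f hf) (hy.map g hg)]
      simp only [hμ]
    | zero => simp
    | add x y hx hy => simp only [map_add, hx, hy]
    | smul r x hx => simp only [map_smul, hx]
  | zero => simp
  | add x y hx hy => simp only [map_add, LinearMap.add_apply, hx, hy]
  | smul r x hx => simp only [map_smul, LinearMap.smul_apply, hx]

theorem par_eq_zero {i : I → ℤ} (hi : ∀ c, i c = 0) : par i = 0 := by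
  funext c; simp [par, hi]

theorem pExp_zero_left (q : I → ZMod 2) : pExp 0 q = 0 := by simp [pExp]

theorem pExp_zero_right (q : I → ZMod 2) : pExp q 0 = 0 := by simp [pExp]

theorem pair_one_left {U V : I → DGVect K} (μ : ∀ c, Pairing (U c) (V c) (V c))
    (e : ∀ c, U c) (he : ∀ c, e c ∈ (U c).deg 0) (h : ∀ c x, (μ c).toFun (e c) x = x)
    (x : Carrier V) : pair μ (PiTensorProduct.tprod K e) x = x := by
  induction x using induction V with
  | tprod i v hv =>
    rw [pair_tprod μ (i := fun _ => 0) he hv, par_eq_zero fun _ => rfl, pExp_zero_left]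
    simp [sgn, h]
  | zero => simp
  | add x y hx hy => simp only [map_add, hx, hy]
  | smul r x hx => simp only [map_smul, hx]

theorem pair_one_right {U V : I → DGVect K} (μ : ∀ c, Pairing (V c) (U c) (V c))
    (e : ∀ c, U c) (he : ∀ c, e c ∈ (U c).deg 0) (h : ∀ c x, (μ c).toFun x (e c) = x)
    (x : Carrier V) : pair μ x (PiTensorProduct.tprod K e) = x := by
  induction x using induction V with
  | tprod i v hv =>
    rw [pair_tprod μ hv (j := fun _ => 0) he, par_eq_zero fun _ => rfl, pExp_zero_right]
    simp [sgn, h]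
  | zero => simp
  | add x y hx hy => simp only [map_add, LinearMap.add_apply, hx, hy]
  | smul r x hx => simp only [map_smul, LinearMap.smul_apply, hx]

/-! ### Semilinear permutation of the factors -/

/-- A vector space `M` with scalar multiplication twisted by `ρ`. -/
def Twist (_ρ : K →+* K) (M : Type u) : Type u := M

instance (ρ : K →+* K) (M : Type u) [AddCommGroup M] : AddCommGroup (Twist ρ M) :=
  inferInstanceAs (AddCommGroup M)

instance (ρ : K →+* K) (M : Type u) [AddCommGroup M] [Module K M] : Module K (Twist ρ M) :=
  Module.compHom M ρ

theorem twist_smul (ρ : K →+* K) (M : Type u) [AddCommGroup M] [Module K M] (r : K)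
    (x : Twist ρ M) : r • x = (ρ r • (show M from x) : M) := rfl

variable (ρ : K →+* K) {U V W : I → DGVect K}

/-- The `ρ`-semilinear map `⨂ v_c ↦ ⨂ θ_c(v_c)` induced by `ρ`-semilinear maps `θ_c`. -/
def mapSemi (θ : ∀ c, V c →ₛₗ[ρ] W c) : Carrier V →ₛₗ[ρ] Carrier W :=
  let m : MultilinearMap K (fun c => (V c : Type u)) (Twist ρ (Carrier W)) :=
    { toFun := fun v => PiTensorProduct.tprod K fun c => θ c (v c)
      map_update_add' := by
        intro _ v c x y
        have h : ∀ z : V c, (fun c' => θ c' (Function.update v c z c')) =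
            Function.update (fun c' => θ c' (v c')) c (θ c z) := by
          intro z
          funext c'
          by_cases h : c' = c
          · subst h; simp
          · simp [h]
        have := (PiTensorProduct.tprod K).map_update_add (fun c' => θ c' (v c')) c (θ c x) (θ c y)
        rw [← map_add, ← h, ← h, ← h] at this
        exact this
      map_update_smul' := by
        intro _ v c r x
        have h : ∀ z : V c, (fun c' => θ c' (Function.update v c z c')) =
            Function.update (fun c' => θ c' (v c')) c (θ c z) := by
          intro z
          funext c'
          by_cases h : c' = c
          · subst h; simp
          · simp [h]
        have := (PiTensorProduct.tprod K).map_update_smul (fun c' => θ c' (v c')) c (ρ r) (θ c x)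
        rw [← LinearMap.map_smulₛₗ, ← h, ← h] at this
        exact this }
  { toFun := fun x => PiTensorProduct.lift m x
    map_add' := fun x y => map_add (PiTensorProduct.lift m) x y
    map_smul' := fun r x => map_smul (PiTensorProduct.lift m) r x }

theorem mapSemi_tprod (θ : ∀ c, V c →ₛₗ[ρ] W c) (v : ∀ c, V c) :
    mapSemi ρ θ (PiTensorProduct.tprod K v) = PiTensorProduct.tprod K fun c => θ c (v c) :=
  PiTensorProduct.lift.tprod (R := K) (E := Twist ρ (Carrier W)) v

/-- The exponent of the Koszul sign of the permutation `e` of the factors. -/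
def permExp (e : Equiv.Perm I) (p : I → ZMod 2) : ZMod 2 :=
  ∑ c, ∑ c', if c < c' ∧ e c' < e c then p c * p c' else 0

/-- The `ρ`-semilinear permutation of factors: it sends `⨂ v_c` to the tensor whose factor at `c`
is `θ_c(v_{e⁻¹ c})`, multiplied by the Koszul sign, the product of `(-1)^(|v_c| |v_{c'}|)` over the
pairs `c < c'` whose order is reversed by `e`. -/
def perm (e : Equiv.Perm I) (θ : ∀ c, V (e.symm c) →ₛₗ[ρ] W c) : Carrier V →ₛₗ[ρ] Carrier W :=
  ((mapSemi (V := fun c => V (e.symm c)) ρ θ).comp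
    (PiTensorProduct.reindex K (fun c => (V c : Type u)) e).toLinearMap).comp
      (signOp V (permExp e))

theorem perm_tprod (e : Equiv.Perm I) (θ : ∀ c, V (e.symm c) →ₛₗ[ρ] W c) {i : I → ℤ}
    {v : ∀ c, V c} (h : IsHom i v) :
    perm ρ e θ (PiTensorProduct.tprod K v) = sgn K (permExp e (par i)) •
      PiTensorProduct.tprod K fun c => θ c (v (e.symm c)) := by
  simp only [perm, LinearMap.comp_apply, signOp_tprod V _ h]
  rw [LinearMap.map_smul, LinearMap.map_smulₛₗ, map_sgn, LinearEquiv.coe_coe,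
    PiTensorProduct.reindex_tprod]
  congr 1
  exact mapSemi_tprod (V := fun c => V (e.symm c)) ρ θ _

section

variable {e : Equiv.Perm I} (θ : ∀ c, V (e.symm c) →ₛₗ[ρ] W c)

theorem IsHom.perm (hθ : ∀ c i x, x ∈ (V (e.symm c)).deg i → θ c x ∈ (W c).deg i)
    {i : I → ℤ} {v : ∀ c, V c} (h : IsHom i v) :
    IsHom (i ∘ e.symm) fun c => θ c (v (e.symm c)) :=
  fun c => hθ c _ _ (h (e.symm c))

theorem perm_mem (hθ : ∀ c i x, x ∈ (V (e.symm c)).deg i → θ c x ∈ (W c).deg i)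
    {n : ℤ} {x : Carrier V} (hx : x ∈ deg V n) : perm ρ e θ x ∈ deg W n := by
  induction hx using Submodule.span_induction with
  | mem x hx =>
    obtain ⟨i, v, h, hn, rfl⟩ := hx
    rw [perm_tprod ρ e θ h]
    refine Submodule.smul_mem _ _ (tprod_mem_deg W (h.perm ρ θ hθ) ?_)
    rw [← hn]
    exact Equiv.sum_comp e.symm i
  | zero => simp
  | add x y _ _ hx hy => rw [map_add]; exact add_mem hx hy
  | smul r x _ hx => rw [LinearMap.map_smulₛₗ]; exact Submodule.smul_mem _ _ hx

/-- Compatibility of the Koszul signs. -/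
theorem permExp_add (e : Equiv.Perm I) (p q : I → ZMod 2) :
    permExp e (p + q) + pExp p q =
      permExp e p + permExp e q + pExp (p ∘ e.symm) (q ∘ e.symm) := by
  have h1 : pExp (p ∘ e.symm) (q ∘ e.symm) =
      ∑ c, ∑ c', if e c' < e c then p c * q c' else 0 := by
    rw [pExp, ← Equiv.sum_comp e]
    refine Finset.sum_congr rfl fun c _ => ?_
    rw [← Equiv.sum_comp e]
    simp
  have h2 : permExp e (p + q) = permExp e p + permExp e q +
      ((∑ c, ∑ c', if c < c' ∧ e c' < e c then p c * q c' else 0) +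
        ∑ c, ∑ c', if c < c' ∧ e c' < e c then q c * p c' else 0) := by
    simp only [permExp, ← Finset.sum_add_distrib]
    refine Finset.sum_congr rfl fun c _ => Finset.sum_congr rfl fun c' _ => ?_
    split_ifs
    · simp only [Pi.add_apply]; ring
    · simp
  have h3 : (∑ c, ∑ c', if c < c' ∧ e c' < e c then q c * p c' else 0) =
      ∑ c, ∑ c', if c' < c ∧ e c < e c' then p c * q c' else 0 := by
    rw [Finset.sum_comm]
    simp only [mul_comm]
  rw [h1, h2, h3, add_assoc]
  congr 1
  simp only [pExp, ← Finset.sum_add_distrib]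
  refine Finset.sum_congr rfl fun c _ => Finset.sum_congr rfl fun c' _ => ?_
  have h0 := CharTwo.add_self_eq_zero (p c * q c')
  rcases lt_trichotomy c c' with h | h | h
  · rcases lt_or_gt_of_ne (e.injective.ne h.ne) with h' | h' <;>
      simp [h, h', h.not_gt, h'.not_gt]
  · subst h; simp
  · rcases lt_or_gt_of_ne (e.injective.ne h.ne) with h' | h' <;>
      simp [h, h', h.not_gt, h'.not_gt, h0]

theorem permExp_single (e : Equiv.Perm I) (c : I) : permExp e (Pi.single c 1) = 0 := by
  refine Finset.sum_eq_zero fun a _ => Finset.sum_eq_zero fun b _ => ?_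
  split_ifs with h
  · rcases eq_or_ne a c with rfl | ha
    · simp [h.1.ne']
    · simp [ha]
  · rfl

theorem permExp_add_single (e : Equiv.Perm I) (c : I) (p : I → ZMod 2) :
    dExp c p + permExp e (p + Pi.single c 1) =
      permExp e p + dExp (e c) (p ∘ e.symm) := by
  have h := permExp_add e (Pi.single c 1) p
  have h1 : (Pi.single c (1 : ZMod 2) : I → ZMod 2) ∘ e.symm = Pi.single (e c) 1 := by
    funext b
    by_cases hb : b = e c
    · subst hb; simp
    · have : e.symm b ≠ c := fun h => hb (by rw [← h]; simp)
      simp [hb, this]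
  rw [permExp_single, h1, pExp_single_left, pExp_single_left, add_comm (Pi.single c 1) p] at h
  rw [add_comm, h]; ring

theorem perm_d (hθ : ∀ c i x, x ∈ (V (e.symm c)).deg i → θ c x ∈ (W c).deg i)
    (hd : ∀ c x, θ c ((V (e.symm c)).d x) = (W c).d (θ c x)) (x : Carrier V) :
    perm ρ e θ (d V x) = d W (perm ρ e θ x) := by
  induction x using induction V with
  | tprod i v h =>
    rw [d_tprod V h, perm_tprod ρ e θ h, LinearMap.map_smul, d_tprod W (h.perm ρ θ hθ), map_sum,
      Finset.smul_sum]
    rw [← Equiv.sum_comp e (fun c => sgn K (permExp e (par i)) • sgn K (dExp c (par (i ∘ e.symm))) •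
      PiTensorProduct.tprod K (Function.update (fun c => θ c (v (e.symm c))) c
        ((W c).d (θ c (v (e.symm c))))))]
    refine Finset.sum_congr rfl fun c _ => ?_
    rw [LinearMap.map_smulₛₗ, map_sgn, perm_tprod ρ e θ (h.update c ((V c).d_mem (h c))), smul_smul,
      smul_smul, ← sgn_add, ← sgn_add, par_update, permExp_add_single]
    congr 2
    funext c'
    by_cases hc : c' = e c
    · subst hc
      rw [Function.update_self, ← hd]
      congr 1
      have : ∀ b, b = c → Function.update v c ((V c).d (v c)) b = (V b).d (v b) := by
        rintro b rfl; simp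
      exact this _ (e.symm_apply_apply c)
    · have : e.symm c' ≠ c := fun h => hc (by rw [← h]; simp)
      rw [Function.update_of_ne hc, Function.update_of_ne this]
  | zero => simp
  | add x y hx hy => simp only [map_add, hx, hy]
  | smul r x hx => simp only [LinearMap.map_smulₛₗ, hx, RingHom.id_apply]

end

theorem perm_pair {e : Equiv.Perm I} {U V W U' V' W' : I → DGVect K}
    (μ : ∀ c, Pairing (U c) (V c) (W c)) (μ' : ∀ c, Pairing (U' c) (V' c) (W' c))
    (θ : ∀ c, U (e.symm c) →ₛₗ[ρ] U' c) (η : ∀ c, V (e.symm c) →ₛₗ[ρ] V' c)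
    (ζ : ∀ c, W (e.symm c) →ₛₗ[ρ] W' c)
    (hθ : ∀ c i x, x ∈ (U (e.symm c)).deg i → θ c x ∈ (U' c).deg i)
    (hη : ∀ c i x, x ∈ (V (e.symm c)).deg i → η c x ∈ (V' c).deg i)
    (h : ∀ c x y, ζ c ((μ (e.symm c)).toFun x y) = (μ' c).toFun (θ c x) (η c y))
    (x : Carrier U) (y : Carrier V) :
    perm ρ e ζ (pair μ x y) = pair μ' (perm ρ e θ x) (perm ρ e η y) := by
  induction x using induction U with
  | tprod i x hx =>
    induction y using induction V with
    | tprod j y hy =>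
      rw [pair_tprod μ hx hy, LinearMap.map_smulₛₗ, map_sgn, perm_tprod ρ e ζ (hx.pair μ hy),
        perm_tprod ρ e θ hx, perm_tprod ρ e η hy, LinearMap.map_smul, LinearMap.map_smul,
        LinearMap.smul_apply, pair_tprod μ' (hx.perm ρ θ hθ) (hy.perm ρ η hη), smul_smul,
        smul_smul, smul_smul, ← sgn_add, ← sgn_add, ← sgn_add]
      simp only [h]
      congr 2
      have := permExp_add e (par i) (par j)
      rw [par_add]
      change _ = permExp e (par j) + permExp e (par i) +
        pExp (par i ∘ e.symm) (par j ∘ e.symm)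
      rw [add_comm, this, add_comm (permExp e (par i))]
    | zero => simp
    | add x y hx hy => simp only [map_add, hx, hy]
    | smul r x hx => simp only [LinearMap.map_smulₛₗ, RingHom.id_apply, hx]
  | zero => simp
  | add x y hx hy => simp only [map_add, LinearMap.add_apply, hx, hy]
  | smul r x hx =>
    simp only [LinearMap.map_smulₛₗ, RingHom.id_apply, LinearMap.smul_apply, hx]

theorem perm_map {e : Equiv.Perm I} {V W V' W' : I → DGVect K}
    (θ : ∀ c, V (e.symm c) →ₛₗ[ρ] V' c) (η : ∀ c, W (e.symm c) →ₛₗ[ρ] W' c)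
    (f : ∀ c, V c →ₗ[K] W c) (f' : ∀ c, V' c →ₗ[K] W' c)
    (hf : ∀ c i x, x ∈ (V c).deg i → f c x ∈ (W c).deg i)
    (h : ∀ c x, η c (f (e.symm c) x) = f' c (θ c x)) (x : Carrier V) :
    perm ρ e η (map f x) = map f' (perm ρ e θ x) := by
  induction x using induction V with
  | tprod i x hx =>
    rw [map_tprod, perm_tprod ρ e η (hx.map f hf), perm_tprod ρ e θ hx, map_smul, map_tprod]
    simp only [h]
  | zero => simp
  | add x y hx hy => simp only [map_add, hx, hy]
  | smul r x hx => simp only [LinearMap.map_smulₛₗ, RingHom.id_apply, hx]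

theorem perm_one {e : Equiv.Perm I} (θ : ∀ c, V (e.symm c) →ₛₗ[ρ] W c)
    (a : ∀ c, V c) (b : ∀ c, W c) (ha : ∀ c, a c ∈ (V c).deg 0)
    (h : ∀ c, θ c (a (e.symm c)) = b c) :
    perm ρ e θ (PiTensorProduct.tprod K a) = PiTensorProduct.tprod K b := by
  rw [perm_tprod ρ e θ (i := fun _ => 0) ha, par_eq_zero fun _ => rfl]
  simp [permExp, sgn, h]

end Tens

namespace Tens

variable {K : Type u} [Field K] {I : Type u} [Fintype I] [LinearOrder I]

theorem sum_symm (G : I → I → ZMod 2) (h : ∀ c, G c c = 0) :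
    ∑ c, ∑ c', G c c' = ∑ c, ∑ c', if c < c' then G c c' + G c' c else 0 := by
  have h1 : ∀ c c', G c c' = (if c < c' then G c c' else 0) + (if c' < c then G c c' else 0) := by
    intro c c'
    rcases lt_trichotomy c c' with hc | hc | hc
    · simp [hc, hc.not_gt]
    · subst hc; simp [h]
    · simp [hc, hc.not_gt]
  have h2 : ∑ c, ∑ c', (if c' < c then G c c' else 0) =
      ∑ c, ∑ c', if c < c' then G c' c else 0 := Finset.sum_comm
  calc ∑ c, ∑ c', G c c' = (∑ c, ∑ c', if c < c' then G c c' else 0) +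
        ∑ c, ∑ c', (if c' < c then G c c' else 0) := by
        simp only [← Finset.sum_add_distrib, ← h1]
    _ = _ := by
        rw [h2]
        simp only [← Finset.sum_add_distrib]
        refine Finset.sum_congr rfl fun c _ => Finset.sum_congr rfl fun c' _ => ?_
        split_ifs <;> simp

theorem permExp_comp (e e' e'' : Equiv.Perm I) (he : ∀ c, e'' c = e' (e c)) (p : I → ZMod 2) :
    permExp e'' p = permExp e p + permExp e' (p ∘ e.symm) := by
  have h1 : permExp e' (p ∘ e.symm) =
      ∑ c, ∑ c', if e c < e c' ∧ e'' c' < e'' c then p c * p c' else 0 := by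
    rw [permExp, ← Equiv.sum_comp e]
    refine Finset.sum_congr rfl fun c _ => ?_
    rw [← Equiv.sum_comp e]
    simp [he]
  rw [h1, sum_symm _ (by simp), permExp, permExp]
  simp only [← Finset.sum_add_distrib]
  refine Finset.sum_congr rfl fun c _ => Finset.sum_congr rfl fun c' _ => ?_
  by_cases hc : c < c'
  · have h0 := CharTwo.add_self_eq_zero (p c * p c')
    rcases lt_or_gt_of_ne (e.injective.ne hc.ne) with h | h <;>
    rcases lt_or_gt_of_ne (e''.injective.ne hc.ne) with h' | h' <;>
      simp [hc, h, h', h.not_gt, h'.not_gt, mul_comm (p c') (p c), h0]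
  · simp [hc]

theorem permExp_refl (e : Equiv.Perm I) (he : ∀ c, e c = c) (p : I → ZMod 2) :
    permExp e p = 0 := by
  refine Finset.sum_eq_zero fun a _ => Finset.sum_eq_zero fun b _ => ?_
  rw [if_neg]
  rintro ⟨h, h'⟩
  rw [he, he] at h'
  exact h.not_gt h'

theorem perm_refl (ρ : K →+* K) {V : I → DGVect K} (hρ : ∀ r, ρ r = r) {e : Equiv.Perm I}
    (he : ∀ c, e c = c) (θ : ∀ c, V (e.symm c) →ₛₗ[ρ] V c)
    (hθ : ∀ (v : ∀ c, V c) c, θ c (v (e.symm c)) = v c) (x : Carrier V) :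
    perm ρ e θ x = x := by
  induction x using induction V with
  | tprod i v hv =>
    rw [perm_tprod ρ e θ hv, permExp_refl e he]
    simp [sgn, hθ]
  | zero => simp
  | add x y hx hy => simp only [map_add, hx, hy]
  | smul r x hx => simp only [LinearMap.map_smulₛₗ, hx, hρ]

theorem perm_perm {ρ ρ' ρ'' : K →+* K} {U V W : I → DGVect K} (hρ : ∀ r, ρ'' r = ρ' (ρ r))
    {e e' e'' : Equiv.Perm I} (he : ∀ c, e'' c = e' (e c))
    (θ : ∀ c, U (e.symm c) →ₛₗ[ρ] V c) (θ' : ∀ c, V (e'.symm c) →ₛₗ[ρ'] W c)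
    (θ'' : ∀ c, U (e''.symm c) →ₛₗ[ρ''] W c)
    (hmem : ∀ c i x, x ∈ (U (e.symm c)).deg i → θ c x ∈ (V c).deg i)
    (hθ : ∀ (v : ∀ c, U c) c,
      θ'' c (v (e''.symm c)) = θ' c (θ (e'.symm c) (v (e.symm (e'.symm c)))))
    (x : Carrier U) : perm ρ'' e'' θ'' x = perm ρ' e' θ' (perm ρ e θ x) := by
  induction x using induction U with
  | tprod i v hv =>
    rw [perm_tprod ρ'' e'' θ'' hv, perm_tprod ρ e θ hv, LinearMap.map_smulₛₗ, map_sgn,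
      perm_tprod ρ' e' θ' (hv.perm ρ θ hmem), smul_smul, ← sgn_add, permExp_comp e e' e'' he]
    simp only [hθ]
    rfl
  | zero => simp
  | add x y hx hy => simp only [map_add, hx, hy]
  | smul r x hx => simp only [LinearMap.map_smulₛₗ, hx, hρ]

end Tens

/-! ## Differential graded algebras and modules -/

/-- A dg `K`-algebra: a complex with an associative unital multiplication which is a morphism of
complexes. -/
structure DGAlg (K : Type u) [Field K] extends DGVect K where
  mul : Pairing toDGVect toDGVect toDGVect
  one : toDGVect
  one_mem : one ∈ toDGVect.deg 0
  one_mul : ∀ x, mul.toFun one x = x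
  mul_one : ∀ x, mul.toFun x one = x
  mul_assoc : ∀ x y z, mul.toFun (mul.toFun x y) z = mul.toFun x (mul.toFun y z)

/-- A right dg module over a dg algebra. -/
structure DGMod {K : Type u} [Field K] (A : DGAlg K) extends DGVect K where
  act : Pairing toDGVect A.toDGVect toDGVect
  act_one : ∀ x, act.toFun x A.one = x
  act_mul : ∀ x a b, act.toFun (act.toFun x a) b = act.toFun x (A.mul.toFun a b)

namespace DGMod

variable {K : Type u} [Field K] {A : DGAlg K}

/-- Morphisms of right dg modules: `A`-linear maps of degree `0` commuting with differentials. -/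
@[ext]
structure Hom (M N : DGMod A) where
  toFun : M.toDGVect →ₗ[K] N.toDGVect
  map_mem : ∀ i x, x ∈ M.deg i → toFun x ∈ N.deg i
  map_d : ∀ x, toFun (M.d x) = N.d (toFun x)
  map_act : ∀ x a, toFun (M.act.toFun x a) = N.act.toFun (toFun x) a

/-- The category `C(A)` of right dg `A`-modules. -/
instance : Category (DGMod A) where
  Hom := Hom
  id M := ⟨LinearMap.id, fun _ _ h => h, fun _ => rfl, fun _ _ => rfl⟩
  comp f g := ⟨g.toFun ∘ₗ f.toFun, fun i x h => g.map_mem i _ (f.map_mem i x h),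
    fun x => by simp [f.map_d, g.map_d], fun x a => by simp [f.map_act, g.map_act]⟩

end DGMod

/-! ## Galois complexes -/

/-- An `L/k`-Galois complex: a complex of `L`-vector spaces with a skew-linear left action of
`Gal(L/k)`. -/
structure GaloisComplex (k L : Type u) [Field k] [Field L] [Algebra k L] extends DGVect L where
  act : (L ≃ₐ[k] L) → toDGVect →+ toDGVect
  act_one : ∀ x, act 1 x = x
  act_mul : ∀ ρ ρ' x, act (ρ * ρ') x = act ρ (act ρ' x)
  act_smul : ∀ ρ (a : L) x, act ρ (a • x) = ρ a • act ρ x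
  act_mem : ∀ ρ i x, x ∈ deg i → act ρ x ∈ deg i
  act_d : ∀ ρ x, act ρ (d x) = d (act ρ x)

namespace GaloisComplex

variable {k L : Type u} [Field k] [Field L] [Algebra k L]

/-- The subgroup of invariants. -/
def inv (W : GaloisComplex k L) : AddSubgroup W.toDGVect where
  carrier := {x | ∀ ρ, W.act ρ x = x}
  add_mem' hx hy ρ := by rw [map_add, hx ρ, hy ρ]
  zero_mem' ρ := map_zero _
  neg_mem' hx ρ := by rw [map_neg, hx ρ]

instance (W : GaloisComplex k L) : Module k W.inv where
  smul a x := ⟨algebraMap k L a • (x : W.toDGVect), fun ρ => by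
    rw [W.act_smul, x.2 ρ, AlgEquiv.commutes]⟩
  one_smul x := Subtype.ext (by change algebraMap k L 1 • (x : W.toDGVect) = x; simp)
  mul_smul a b x := Subtype.ext (by
    change algebraMap k L (a * b) • (x : W.toDGVect) =
      algebraMap k L a • algebraMap k L b • (x : W.toDGVect)
    rw [map_mul, mul_smul])
  smul_zero a := Subtype.ext (smul_zero (algebraMap k L a))
  smul_add a x y := Subtype.ext (smul_add (algebraMap k L a) (x : W.toDGVect) y)
  add_smul a b x := Subtype.ext (by
    change algebraMap k L (a + b) • (x : W.toDGVect) =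
      algebraMap k L a • (x : W.toDGVect) + algebraMap k L b • (x : W.toDGVect)
    rw [map_add, add_smul])
  zero_smul x := Subtype.ext (by change algebraMap k L 0 • (x : W.toDGVect) = 0; simp)

theorem inv_smul_coe (W : GaloisComplex k L) (a : k) (x : W.inv) :
    ((a • x : W.inv) : W.toDGVect) = algebraMap k L a • (x : W.toDGVect) := rfl

theorem proj_mem_inv (W : GaloisComplex k L) (i : ℤ) {x : W.toDGVect} (hx : x ∈ W.inv) :
    W.proj i x ∈ W.inv := fun ρ => by
  rw [DGVect.proj_map W.toDGVect W.toDGVect (W.act ρ) (W.act_mem ρ), hx ρ]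

/-- The complex `W^G` of `k`-vector spaces of invariants of a Galois complex. -/
def invariants (W : GaloisComplex k L) : DGVect k where
  carrier := W.inv
  deg i :=
    { carrier := {x | (x : W.toDGVect) ∈ W.deg i}
      add_mem' := fun {x y} hx hy => add_mem (S := Submodule L W.toDGVect) hx hy
      zero_mem' := zero_mem (W.deg i)
      smul_mem' := fun a _ hx => Submodule.smul_mem (W.deg i) (algebraMap k L a) hx }
  isInternal := by
    refine DGVect.isInternal_of _ ?_ id
      (fun i => (W.proj i).toAddMonoidHom.comp W.inv.subtype) ?_ ?_
    · rw [eq_top_iff]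
      intro x _
      obtain ⟨s, hs⟩ := W.exists_sum_proj (x : W.toDGVect)
      have : x = ∑ i ∈ s, (⟨W.proj i x, W.proj_mem_inv i x.2⟩ : W.inv) := by
        apply Subtype.ext
        rw [AddSubgroup.val_finsetSum]
        exact (hs s subset_rfl).symm
      rw [this]
      exact sum_mem fun i _ => Submodule.mem_iSup_of_mem i (W.proj_mem i _)
    · intro i j hj x hx
      exact W.proj_ne hj hx
    · intro x hx
      exact Subtype.ext (W.eq_zero_of_proj hx)
  d :=
    { toFun := fun x => ⟨W.d x, fun ρ => by rw [W.act_d, x.2 ρ]⟩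
      map_add' := fun x y => Subtype.ext (map_add W.d (x : W.toDGVect) y)
      map_smul' := fun a x => Subtype.ext (map_smul W.d (algebraMap k L a) (x : W.toDGVect)) }
  d_mem hx := W.d_mem hx
  d_d x := Subtype.ext (W.d_d x)

/-- The bilinear map on invariants induced by an equivariant bilinear map. -/
def invPair {U V W : GaloisComplex k L}
    (μ : U.toDGVect →ₗ[L] V.toDGVect →ₗ[L] W.toDGVect)
    (h : ∀ ρ x y, W.act ρ (μ x y) = μ (U.act ρ x) (V.act ρ y)) :
    U.inv →ₗ[k] V.inv →ₗ[k] W.inv :=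
  LinearMap.mk₂ k
    (fun x y => ⟨μ (x : U.toDGVect) (y : V.toDGVect), fun ρ => by rw [h, x.2 ρ, y.2 ρ]⟩)
    (fun x x' y => Subtype.ext (by
      change μ ((x : U.toDGVect) + x') (y : V.toDGVect) = _
      rw [map_add]; rfl))
    (fun a x y => Subtype.ext (by
      change μ (algebraMap k L a • (x : U.toDGVect)) (y : V.toDGVect) = _
      rw [map_smul]; rfl))
    (fun x y y' => Subtype.ext (map_add (μ (x : U.toDGVect)) (y : V.toDGVect) y'))
    (fun a x y => Subtype.ext
      (map_smul (μ (x : U.toDGVect)) (algebraMap k L a) (y : V.toDGVect)))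

/-- The pairing of invariants induced by an equivariant pairing. -/
def invariantsPairing {U V W : GaloisComplex k L}
    (μ : Pairing U.toDGVect V.toDGVect W.toDGVect)
    (h : ∀ ρ x y, W.act ρ (μ.toFun x y) = μ.toFun (U.act ρ x) (V.act ρ y)) :
    Pairing U.invariants V.invariants W.invariants where
  toFun := invPair μ.toFun h
  mem hx hy := μ.mem hx hy
  leibniz := by
    intro i x y hx
    apply Subtype.ext
    refine (μ.leibniz (y : V.inv).1 hx).trans ?_
    have : ((i.negOnePow : ℤ) : L) = algebraMap k L ((i.negOnePow : ℤ) : k) := by simp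
    rw [this]
    rfl

end GaloisComplex

/-! ## The noncommutative Weil restriction -/

section Weil

variable (k l L : Type u) [Field k] [Field l] [Field L] [Algebra k l] [Algebra k L] [Algebra l L]
  [IsScalarTower k l L]

/-- The subgroup `H` of `G = Gal(L/k)` of the automorphisms fixing `l`. -/
def fixing : Subgroup (L ≃ₐ[k] L) :=
  (IsScalarTower.toAlgHom k l L).fieldRange.fixingSubgroup

/-- The set `G/H` of left cosets. -/
abbrev Cosets : Type u := (L ≃ₐ[k] L) ⧸ fixing k l L

variable {k l L}

theorem mem_fixing {σ : L ≃ₐ[k] L} (hσ : σ ∈ fixing k l L) (x : l) :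
    σ (algebraMap l L x) = algebraMap l L x := by
  rw [fixing, IntermediateField.mem_fixingSubgroup_iff] at hσ
  exact hσ _ ⟨x, rfl⟩

/-- The embedding `l → L`, `x ↦ σ(x)`, which depends only on the coset `σH`. -/
def emb (c : Cosets k l L) : l →+* L :=
  Quotient.liftOn' c (fun σ => (σ : L →+* L).comp (algebraMap l L)) (by
    intro σ τ h
    rw [QuotientGroup.leftRel_apply] at h
    ext x
    have := mem_fixing h x
    change σ (algebraMap l L x) = τ (algebraMap l L x)
    rw [AlgEquiv.mul_apply, AlgEquiv.aut_inv, AlgEquiv.symm_apply_eq] at this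
    exact this.symm)

theorem emb_smul (ρ : L ≃ₐ[k] L) (c : Cosets k l L) :
    emb (ρ • c) = (ρ : L →+* L).comp (emb c) := by
  induction c using Quotient.inductionOn'
  rfl

theorem emb_eq (ρ : L ≃ₐ[k] L) (c : Cosets k l L) :
    emb c = (ρ : L →+* L).comp (emb ((MulAction.toPerm ρ).symm c)) := by
  rw [← emb_smul]
  congr 1
  exact ((MulAction.toPerm ρ).apply_symm_apply c).symm

variable [FiniteDimensional k L]

instance : Fintype (Cosets k l L) := Fintype.ofFinite _

/-- An auxiliary linear order on `G/H`, with respect to which Koszul signs are written. -/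
instance : LinearOrder (Cosets k l L) :=
  LinearOrder.lift' (Fintype.equivFin (Cosets k l L)) (Equiv.injective _)

variable (k L)

/-- The family of complexes `^σV_L`, `σ ∈ G/H`. The conjugate `^σV_L` of `V_L = L ⊗_l V` is
realized as `L ⊗_{l,σ} V`, the identification being `λ ⊗ v ↦ σ(λ) ⊗ v`. -/
def conjFam (V : DGVect l) (c : Cosets k l L) : DGVect L := baseChange (emb c) V

/-- The action of `ρ ∈ G` on `⨂_{σ ∈ G/H} ^σV_L`: it permutes the factors (with Koszul signs),
the factor `^σV_L = L ⊗_{l,σ} V` being sent to `^{ρσ}V_L = L ⊗_{l,ρσ} V` by `λ ⊗ v ↦ ρ(λ) ⊗ v`. -/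
def galAct (V : DGVect l) (ρ : L ≃ₐ[k] L) :
    Tens.Carrier (conjFam k L V) →ₛₗ[(ρ : L →+* L)] Tens.Carrier (conjFam k L V) :=
  Tens.perm (ρ : L →+* L) (MulAction.toPerm ρ)
    fun c => conjMap (ρ : L →+* L) (emb_eq ρ c) V

theorem conjMap_comp {φ φ' ψ χ : l →+* L} (ρ ρ' ρ'' : L →+* L) (V : DGVect l)
    (h : ψ = ρ.comp φ) (h' : χ = ρ'.comp ψ) (h'' : χ = ρ''.comp φ')
    (hρ : ∀ r, ρ'' r = ρ' (ρ r)) (hφ : φ' = φ) (x : baseChange φ V) (x' : baseChange φ' V)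
    (hx : HEq x' x) : conjMap ρ'' h'' V x' = conjMap ρ' h' V (conjMap ρ h V x) := by
  subst hφ
  obtain rfl := eq_of_heq hx
  clear hx
  change Tw φ' ⊗[l] V at x'
  change extSemi (twHom ρ'' h'') V x' = extSemi (twHom ρ' h') V (extSemi (twHom ρ h) V x')
  induction x' with
  | zero => simp
  | add x y hx hy => simp only [map_add, hx, hy]
  | tmul a v =>
    simp only [extSemi_tmul]
    congr 1
    exact hρ a

theorem conjMap_id {φ φ' : l →+* L} (ρ : L →+* L) (V : DGVect l)
    (h : φ' = ρ.comp φ) (hρ : ∀ r, ρ r = r) (x : baseChange φ V) (x' : baseChange φ' V)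
    (hx : HEq x' x) : conjMap ρ h V x = x' := by
  have hφ : φ' = φ := by rw [h]; ext x; exact hρ _
  subst hφ
  obtain rfl := eq_of_heq hx
  clear hx
  change Tw φ' ⊗[l] V at x'
  change extSemi (twHom ρ h) V x' = x'
  induction x' with
  | zero => simp
  | add x y hx hy => simp only [map_add, hx, hy]
  | tmul a v =>
    simp only [extSemi_tmul]
    congr 1
    exact hρ a

theorem conjMap_mem (V : DGVect l) (ρ : L ≃ₐ[k] L) (c : Cosets k l L) (i : ℤ)
    (x : conjFam k L V ((MulAction.toPerm ρ).symm c))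
    (hx : x ∈ (conjFam k L V ((MulAction.toPerm ρ).symm c)).deg i) :
    (conjMap (ρ : L →+* L) (emb_eq ρ c) V x : conjFam k L V c) ∈ (conjFam k L V c).deg i :=
  extSemi_mem (twHom (ρ : L →+* L) (emb_eq ρ c)) V hx

theorem conjMap_d (V : DGVect l) (ρ : L ≃ₐ[k] L) (c : Cosets k l L)
    (x : conjFam k L V ((MulAction.toPerm ρ).symm c)) :
    (conjMap (ρ : L →+* L) (emb_eq ρ c) V
      ((conjFam k L V ((MulAction.toPerm ρ).symm c)).d x) : conjFam k L V c) =
      (conjFam k L V c).d (conjMap (ρ : L →+* L) (emb_eq ρ c) V x : conjFam k L V c) :=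
  extSemi_baseChange (twHom (ρ : L →+* L) (emb_eq ρ c)) V.d x

theorem galAct_one (V : DGVect l) (x : Tens.Carrier (conjFam k L V)) :
    galAct k L V 1 x = x := by
  refine Tens.perm_refl (V := conjFam k L V) _ (fun _ => rfl) (fun c => one_smul (L ≃ₐ[k] L) c) _ ?_ x
  intro v c
  refine conjMap_id L _ V _ (fun _ => rfl) _ _ ?_
  have : ∀ b, b = c → HEq (v c) (v b) := by rintro b rfl; rfl
  exact this _ (by rw [Equiv.symm_apply_eq]; exact (one_smul (L ≃ₐ[k] L) c).symm)

theorem galAct_mul (V : DGVect l) (ρ ρ' : L ≃ₐ[k] L) (x : Tens.Carrier (conjFam k L V)) :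
    galAct k L V (ρ * ρ') x = galAct k L V ρ (galAct k L V ρ' x) := by
  refine Tens.perm_perm (U := conjFam k L V) (V := conjFam k L V) (W := conjFam k L V)
    (fun _ => rfl) (fun c => mul_smul ρ ρ' c) _ _ _ (conjMap_mem k L V ρ') ?_ x
  intro v c
  have : ∀ b b', b = b' → emb b = emb b' ∧ HEq (v b) (v b') := by
    rintro b _ rfl; exact ⟨rfl, .rfl⟩
  obtain ⟨h1, h2⟩ := this ((MulAction.toPerm (ρ * ρ')).symm c)
    ((MulAction.toPerm ρ').symm ((MulAction.toPerm ρ).symm c)) (by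
      rw [Equiv.symm_apply_eq]
      change c = (ρ * ρ') • _
      rw [mul_smul]
      change c = MulAction.toPerm ρ (MulAction.toPerm ρ' _)
      simp)
  exact conjMap_comp L _ _ _ V _ _ _ (fun _ => rfl) h1 _ _ h2

/-- The `L/k`-Galois complex `⨂_{σ ∈ G/H} ^σV_L`. -/
def weilTensor (V : DGVect l) : GaloisComplex k L where
  toDGVect := tensor (conjFam k L V)
  act ρ := (galAct k L V ρ).toAddMonoidHom
  act_one := galAct_one k L V
  act_mul := galAct_mul k L V
  act_smul ρ a x := (galAct k L V ρ).map_smulₛₗ a x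
  act_mem ρ _ _ hx := Tens.perm_mem (V := conjFam k L V) _ _ (conjMap_mem k L V ρ) hx
  act_d ρ x := Tens.perm_d (V := conjFam k L V) _ _ (conjMap_mem k L V ρ) (conjMap_d k L V ρ) x

/-- The complex `(⨂_{σ ∈ G/H} ^σV_L)^G` of `k`-vector spaces. -/
def weilVect (V : DGVect l) : DGVect k := (weilTensor k L V).invariants

/-- The conjugates of a base-changed pairing. -/
def conjPairing {U V W : DGVect l} (μ : Pairing U V W) (c : Cosets k l L) :
    Pairing (conjFam k L U c) (conjFam k L V c) (conjFam k L W c) :=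
  extendPairing (Tw (emb c)) μ

/-- The pairing induced on the tensor products `⨂_{σ ∈ G/H} ^σ(-)_L`. -/
def weilTensorPairing {U V W : DGVect l} (μ : Pairing U V W) :
    Pairing (weilTensor k L U).toDGVect (weilTensor k L V).toDGVect (weilTensor k L W).toDGVect :=
  tensorPairing (conjPairing k L μ)

theorem galAct_pair {U V W : DGVect l} (μ : Pairing U V W) (ρ : L ≃ₐ[k] L)
    (x : Tens.Carrier (conjFam k L U)) (y : Tens.Carrier (conjFam k L V)) :
    galAct k L W ρ (Tens.pair (conjPairing k L μ) x y) =
      Tens.pair (conjPairing k L μ) (galAct k L U ρ x) (galAct k L V ρ y) :=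
  Tens.perm_pair _ (conjPairing k L μ) (conjPairing k L μ) _ _ _ (conjMap_mem k L U ρ)
    (conjMap_mem k L V ρ)
    (fun c x y => extSemi_pair (twHom (ρ : L →+* L) (emb_eq ρ c)) μ.toFun x y) x y

/-- The pairing induced on `(⨂_{σ ∈ G/H} ^σ(-)_L)^G`. -/
def weilPairing {U V W : DGVect l} (μ : Pairing U V W) :
    Pairing (weilVect k L U) (weilVect k L V) (weilVect k L W) :=
  GaloisComplex.invariantsPairing (weilTensorPairing k L μ) (galAct_pair k L μ)

theorem weilPairing_assoc {U V W X Y Z : DGVect l} (μ : Pairing U V X) (ν : Pairing X W Z)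
    (μ' : Pairing V W Y) (ν' : Pairing U Y Z)
    (h : ∀ x y z, ν.toFun (μ.toFun x y) z = ν'.toFun x (μ'.toFun y z))
    (x : weilVect k L U) (y : weilVect k L V) (z : weilVect k L W) :
    (weilPairing k L ν).toFun ((weilPairing k L μ).toFun x y) z =
      (weilPairing k L ν').toFun x ((weilPairing k L μ').toFun y z) :=
  Subtype.ext (Tens.pair_assoc (conjPairing k L μ) (conjPairing k L ν) (conjPairing k L μ')
    (conjPairing k L ν') (fun c x y z => extPair_assoc (Tw (emb c)) μ ν μ' ν' h x y z) _ _ _)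

/-- The elements `1 ⊗ 1` of the algebras `^σA_L`. -/
def conjOne (A : DGAlg l) (c : Cosets k l L) : conjFam k L A.toDGVect c :=
  ((1 : Tw (emb c)) ⊗ₜ[l] A.one : Tw (emb c) ⊗[l] A.toDGVect)

theorem conjOne_mem (A : DGAlg l) (c : Cosets k l L) :
    conjOne k L A c ∈ (conjFam k L A.toDGVect c).deg 0 :=
  Submodule.tmul_mem_baseChange_of_mem (1 : Tw (emb c)) A.one_mem

theorem conjMap_one (A : DGAlg l) (ρ : L ≃ₐ[k] L) (c : Cosets k l L) :
    (conjMap (ρ : L →+* L) (emb_eq ρ c) A.toDGVect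
      (conjOne k L A ((MulAction.toPerm ρ).symm c)) : conjFam k L A.toDGVect c) =
      conjOne k L A c := by
  refine (extSemi_tmul (twHom (ρ : L →+* L) (emb_eq ρ c)) A.toDGVect 1 A.one).trans ?_
  rw [map_one]
  rfl

/-- The element `⨂ 1` of `⨂_{σ ∈ G/H} ^σA_L`. -/
def tensorOne (A : DGAlg l) : Tens.Carrier (conjFam k L A.toDGVect) :=
  PiTensorProduct.tprod L (conjOne k L A)

theorem galAct_tensorOne (A : DGAlg l) (ρ : L ≃ₐ[k] L) :
    galAct k L A.toDGVect ρ (tensorOne k L A) = tensorOne k L A :=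
  Tens.perm_one (V := conjFam k L A.toDGVect) (W := conjFam k L A.toDGVect) (ρ : L →+* L)
    (fun c => conjMap (ρ : L →+* L) (emb_eq ρ c) A.toDGVect) (conjOne k L A) (conjOne k L A)
    (conjOne_mem k L A) (conjMap_one k L A ρ)

/-- The unit `⨂ 1` of `(⨂_{σ ∈ G/H} ^σA_L)^G`. -/
def weilOne (A : DGAlg l) : (weilTensor k L A.toDGVect).inv :=
  ⟨tensorOne k L A, galAct_tensorOne k L A⟩

theorem extPair_one_left (B : Type u) [Field B] [Algebra l B] {U V : DGVect l}
    (μ : Pairing U V V) (e : U) (h : ∀ x, μ.toFun e x = x) (x : B ⊗[l] V) :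
    extPair B μ.toFun ((1 : B) ⊗ₜ e) x = x := by
  induction x with
  | zero => simp
  | add x y hx hy => simp only [map_add, hx, hy]
  | tmul a v => simp [extPair_tmul, h]

theorem extPair_one_right (B : Type u) [Field B] [Algebra l B] {U V : DGVect l}
    (μ : Pairing V U V) (e : U) (h : ∀ x, μ.toFun x e = x) (x : B ⊗[l] V) :
    extPair B μ.toFun x ((1 : B) ⊗ₜ e) = x := by
  induction x with
  | zero => simp
  | add x y hx hy => simp only [map_add, LinearMap.add_apply, hx, hy]
  | tmul a v => simp [extPair_tmul, h]

theorem weilPairing_one_left (A : DGAlg l) {V : DGVect l} (μ : Pairing A.toDGVect V V)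
    (h : ∀ x, μ.toFun A.one x = x) (x : weilVect k L V) :
    (weilPairing k L μ).toFun (weilOne k L A : weilVect k L A.toDGVect) x = x :=
  Subtype.ext (Tens.pair_one_left (conjPairing k L μ) (conjOne k L A) (conjOne_mem k L A)
    (fun c x => extPair_one_left (Tw (emb c)) μ A.one h x) _)

theorem weilPairing_one_right (A : DGAlg l) {V : DGVect l} (μ : Pairing V A.toDGVect V)
    (h : ∀ x, μ.toFun x A.one = x) (x : weilVect k L V) :
    (weilPairing k L μ).toFun x (weilOne k L A : weilVect k L A.toDGVect) = x :=
  Subtype.ext (Tens.pair_one_right (conjPairing k L μ) (conjOne k L A) (conjOne_mem k L A)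
    (fun c x => extPair_one_right (Tw (emb c)) μ A.one h x) _)

/-- The noncommutative Weil restriction `R(A) = (⨂_{σ ∈ G/H} ^σA_L)^G` of a dg `l`-algebra. -/
def weilAlg (A : DGAlg l) : DGAlg k where
  toDGVect := weilVect k L A.toDGVect
  mul := weilPairing k L A.mul
  one := weilOne k L A
  one_mem := Tens.tprod_mem_deg (conjFam k L A.toDGVect) (i := fun _ => 0)
    (conjOne_mem k L A) (by simp)
  one_mul := weilPairing_one_left k L A A.mul A.one_mul
  mul_one := weilPairing_one_right k L A A.mul A.mul_one
  mul_assoc := weilPairing_assoc k L _ _ _ _ A.mul_assoc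

/-- The right dg `R(A)`-module `(⨂_{σ ∈ G/H} ^σM_L)^G`. -/
def weilMod {A : DGAlg l} (M : DGMod A) : DGMod (weilAlg k L A) where
  toDGVect := weilVect k L M.toDGVect
  act := weilPairing k L M.act
  act_one := weilPairing_one_right k L A M.act M.act_one
  act_mul := weilPairing_assoc k L _ _ _ _ M.act_mul

end Weil

/-! ### Functoriality of the Weil restriction -/

section WeilMap

variable (k : Type u) {l : Type u} (L : Type u) [Field k] [Field l] [Field L] [Algebra k l]
  [Algebra k L] [Algebra l L] [IsScalarTower k l L] [FiniteDimensional k L]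

theorem baseChange_mem (B : Type u) [Field B] [Algebra l B] {V W : DGVect l} (g : V →ₗ[l] W)
    (hg : ∀ i x, x ∈ V.deg i → g x ∈ W.deg i) (i : ℤ) (x : B ⊗[l] V)
    (hx : x ∈ (V.deg i).baseChange B) : g.baseChange B x ∈ (W.deg i).baseChange B := by
  refine extend_induction B (motive := fun x => g.baseChange B x ∈ (W.deg i).baseChange B)
    hx ?_ ?_ ?_
  · intro b v hv
    exact Submodule.tmul_mem_baseChange_of_mem _ (hg i v hv)
  · simp
  · intro x y hx hy; rw [map_add]; exact add_mem hx hy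

theorem baseChange_d (B : Type u) [Field B] [Algebra l B] {V W : DGVect l} (g : V →ₗ[l] W)
    (hg : ∀ x, g (V.d x) = W.d (g x)) (x : B ⊗[l] V) :
    g.baseChange B (V.d.baseChange B x) = W.d.baseChange B (g.baseChange B x) := by
  induction x with
  | zero => simp
  | add x y hx hy => simp only [map_add, hx, hy]
  | tmul b v => simp [hg]

theorem baseChange_pair (B : Type u) [Field B] [Algebra l B] {U V W : DGVect l}
    (μ : Pairing U V U) (ν : Pairing W V W) (g : U →ₗ[l] W)
    (hg : ∀ x y, g (μ.toFun x y) = ν.toFun (g x) y) (x : B ⊗[l] U) (y : B ⊗[l] V) :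
    g.baseChange B (extPair B μ.toFun x y) = extPair B ν.toFun (g.baseChange B x) y := by
  induction x with
  | zero => simp
  | add x x' hx hy => simp only [map_add, LinearMap.add_apply, hx, hy]
  | tmul a x =>
    induction y with
    | zero => simp
    | add x x' hx hy => simp only [map_add, hx, hy]
    | tmul b y => simp [extPair_tmul, hg]

/-- The conjugates `id ⊗ g : L ⊗_{l,σ} V → L ⊗_{l,σ} W` of a linear map. -/
def conjFamMap {V W : DGVect l} (g : V →ₗ[l] W) (c : Cosets k l L) :
    conjFam k L V c →ₗ[L] conjFam k L W c :=
  (g.baseChange (Tw (emb c)) : Tw (emb c) ⊗[l] V →ₗ[Tw (emb c)] Tw (emb c) ⊗[l] W)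

/-- The map `⨂_σ ^σg_L`. -/
def tensorMap {V W : DGVect l} (g : V →ₗ[l] W) :
    Tens.Carrier (conjFam k L V) →ₗ[L] Tens.Carrier (conjFam k L W) :=
  Tens.map (V := conjFam k L V) (W := conjFam k L W) (conjFamMap k L g)

theorem conjFamMap_mem {V W : DGVect l} (g : V →ₗ[l] W)
    (hg : ∀ i x, x ∈ V.deg i → g x ∈ W.deg i) (c : Cosets k l L) (i : ℤ) (x : conjFam k L V c)
    (hx : x ∈ (conjFam k L V c).deg i) : conjFamMap k L g c x ∈ (conjFam k L W c).deg i :=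
  baseChange_mem (Tw (emb c)) g hg i x hx

theorem galAct_tensorMap {V W : DGVect l} (g : V →ₗ[l] W)
    (hg : ∀ i x, x ∈ V.deg i → g x ∈ W.deg i) (ρ : L ≃ₐ[k] L)
    (x : Tens.Carrier (conjFam k L V)) :
    galAct k L W ρ (tensorMap k L g x) = tensorMap k L g (galAct k L V ρ x) :=
  Tens.perm_map (V := conjFam k L V) (W := conjFam k L W) (V' := conjFam k L V)
    (W' := conjFam k L W) (ρ : L →+* L) _ _ (conjFamMap k L g) (conjFamMap k L g)
    (conjFamMap_mem k L g hg)
    (fun c x => extSemi_baseChange (twHom (ρ : L →+* L) (emb_eq ρ c)) g x) x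

theorem tensorMap_id (V : DGVect l) (x : Tens.Carrier (conjFam k L V)) :
    tensorMap k L (LinearMap.id : V →ₗ[l] V) x = x := by
  have h : conjFamMap k L (LinearMap.id : V →ₗ[l] V) = fun _ => LinearMap.id := by
    funext c
    exact LinearMap.baseChange_id
  rw [tensorMap, h]
  exact congrArg (fun f => f x) (PiTensorProduct.map_id (R := L))

theorem tensorMap_comp {U V W : DGVect l} (f : U →ₗ[l] V) (g : V →ₗ[l] W)
    (x : Tens.Carrier (conjFam k L U)) :
    tensorMap k L (g ∘ₗ f) x = tensorMap k L g (tensorMap k L f x) := by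
  have h : conjFamMap k L (g ∘ₗ f) = fun c => conjFamMap k L g c ∘ₗ conjFamMap k L f c := by
    funext c
    exact LinearMap.baseChange_comp ..
  rw [tensorMap, h]
  exact congrArg (fun f => f x) (PiTensorProduct.map_comp (R := L) (conjFamMap k L g)
    (conjFamMap k L f))

/-- The map `(⨂_σ ^σg_L)^G`. -/
def weilVectMap {V W : DGVect l} (g : V →ₗ[l] W) (hg : ∀ i x, x ∈ V.deg i → g x ∈ W.deg i) :
    weilVect k L V →ₗ[k] weilVect k L W where
  toFun x := (⟨tensorMap k L g (x : (weilTensor k L V).inv).1, fun ρ =>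
    (galAct_tensorMap k L g hg ρ _).trans
      (congrArg (tensorMap k L g) ((x : (weilTensor k L V).inv).2 ρ))⟩ : (weilTensor k L W).inv)
  map_add' x y := Subtype.ext (map_add (tensorMap k L g) (x : (weilTensor k L V).inv).1
    (y : (weilTensor k L V).inv).1)
  map_smul' a x := Subtype.ext (map_smul (tensorMap k L g) (algebraMap k L a)
    (x : (weilTensor k L V).inv).1)

theorem weilVectMap_act {A : DGAlg l} {M N : DGMod A} (g : M ⟶ N) (x : weilVect k L M.toDGVect)
    (a : weilVect k L A.toDGVect) :
    weilVectMap k L g.toFun g.map_mem ((weilPairing k L M.act).toFun x a) =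
      (weilPairing k L N.act).toFun (weilVectMap k L g.toFun g.map_mem x) a := by
  refine Subtype.ext ((Tens.map_pair (conjPairing k L M.act) (conjPairing k L N.act)
    (conjFamMap k L g.toFun) (fun _ => LinearMap.id) (conjFamMap k L g.toFun)
    (conjFamMap_mem k L g.toFun g.map_mem) (fun _ _ _ h => h)
    (fun c x y => baseChange_pair (Tw (emb c)) M.act N.act g.toFun g.map_act x y)
    (x : (weilTensor k L M.toDGVect).inv).1 (a : (weilTensor k L A.toDGVect).inv).1).trans ?_)
  refine congrArg (Tens.pair (conjPairing k L N.act) _) ?_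
  exact congrArg (fun f => f (a : (weilTensor k L A.toDGVect).inv).1)
    (PiTensorProduct.map_id (R := L))

/-- The functor `C(A) → C(R(A))`, `M ↦ (⨂_{σ ∈ G/H} ^σM_L)^G`. -/
def weilFunctor (A : DGAlg l) : DGMod A ⥤ DGMod (weilAlg k L A) where
  obj M := weilMod k L M
  map {M N} g :=
    { toFun := weilVectMap k L g.toFun g.map_mem
      map_mem := fun _ _ hx => Tens.map_mem (V := conjFam k L M.toDGVect)
        (W := conjFam k L N.toDGVect) _ (conjFamMap_mem k L g.toFun g.map_mem) hx
      map_d := fun x => Subtype.ext (Tens.map_d (V := conjFam k L M.toDGVect)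
        (W := conjFam k L N.toDGVect) _ (conjFamMap_mem k L g.toFun g.map_mem)
        (fun c x => baseChange_d (Tw (emb c)) g.toFun g.map_d x)
        (x : (weilTensor k L M.toDGVect).inv).1)
      map_act := weilVectMap_act k L g }
  map_id M := DGMod.Hom.ext (LinearMap.ext fun x =>
    Subtype.ext (tensorMap_id k L M.toDGVect (x : (weilTensor k L M.toDGVect).inv).1))
  map_comp {M _ _} f g := DGMod.Hom.ext (LinearMap.ext fun x =>
    Subtype.ext (tensorMap_comp k L f.toFun g.toFun (x : (weilTensor k L M.toDGVect).inv).1))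

end WeilMap

/-! ## Derived categories -/

section Derived

variable {K : Type u} [Field K]

namespace DGVect

/-- The cocycles of degree `n`. -/
def cocycles (V : DGVect K) (n : ℤ) : Submodule K V := V.deg n ⊓ LinearMap.ker V.d

/-- The coboundaries of degree `n`, as a subspace of the cocycles. -/
def coboundaries (V : DGVect K) (n : ℤ) : Submodule K (V.cocycles n) :=
  ((V.deg (n - 1)).map V.d).comap (V.cocycles n).subtype

/-- The cohomology space of degree `n`. -/
abbrev cohomology (V : DGVect K) (n : ℤ) : Type u := V.cocycles n ⧸ V.coboundaries n

end DGVect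

namespace DGMod

variable {A : DGAlg K}

/-- The map induced by a morphism on cocycles. -/
def cocyclesMap {M N : DGMod A} (f : M ⟶ N) (n : ℤ) :
    M.cocycles n →ₗ[K] N.cocycles n :=
  f.toFun.restrict fun x hx => ⟨f.map_mem n x hx.1, by
    have h : M.d x = 0 := hx.2
    change N.d (f.toFun x) = 0
    rw [← f.map_d, h, map_zero]⟩

/-- The map induced by a morphism on cohomology. -/
def cohomologyMap {M N : DGMod A} (f : M ⟶ N) (n : ℤ) :
    M.cohomology n →ₗ[K] N.cohomology n :=
  Submodule.mapQ _ _ (cocyclesMap f n) (by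
    rintro x ⟨y, hy, hyx⟩
    refine ⟨f.toFun y, f.map_mem _ y hy, ?_⟩
    rw [← f.map_d, hyx]
    rfl)

/-- The class of quasi-isomorphisms. -/
def quasiIso (A : DGAlg K) : MorphismProperty (DGMod A) :=
  fun _ _ f => ∀ n, Function.Bijective (cohomologyMap f n)

/-- The underlying bilinear map of the action on a cone. -/
def coneAct (M N : DGMod A) : N.carrier × M.carrier →ₗ[K] A.carrier →ₗ[K] N.carrier × M.carrier :=
  LinearMap.mk₂ K (fun x a => (N.act.toFun x.1 a, M.act.toFun x.2 a))
    (fun x y a => by simp) (fun r x a => by simp) (fun x a b => by simp) (fun r x a => by simp)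

theorem coneAct_apply (M N : DGMod A) (x : N.carrier × M.carrier) (a : A.carrier) :
    coneAct M N x a = (N.act.toFun x.1 a, M.act.toFun x.2 a) := rfl

/-- The mapping cone of a morphism `f : M ⟶ N`: the graded module `N ⊕ M[1]` with the differential
`(n, m) ↦ (d n + f m, - d m)`. -/
def cone {M N : DGMod A} (f : M ⟶ N) : DGMod A where
  carrier := N.carrier × M.carrier
  deg i := (N.deg i).prod (M.deg (i + 1))
  isInternal := by
    refine DGVect.isInternal_of _ ?_ id (fun i =>
      ((N.proj i).prodMap (M.proj (i + 1))).toAddMonoidHom) ?_ ?_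
    · rw [eq_top_iff]
      rintro ⟨n, m⟩ -
      have h1 : ∀ n : N.carrier, (n, (0 : M.carrier)) ∈
          ⨆ i, (N.deg i).prod (M.deg (i + 1)) := by
        intro n
        induction n using N.hom_induction with
        | mem i n hn => exact Submodule.mem_iSup_of_mem i ⟨hn, zero_mem _⟩
        | zero => exact zero_mem _
        | add x y hx hy => simpa using add_mem hx hy
      have h2 : ∀ m : M.carrier, ((0 : N.carrier), m) ∈
          ⨆ i, (N.deg i).prod (M.deg (i + 1)) := by
        intro m
        induction m using M.hom_induction with
        | mem i m hm =>
          refine Submodule.mem_iSup_of_mem (i - 1) ⟨zero_mem _, ?_⟩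
          change m ∈ M.deg (i - 1 + 1)
          rwa [sub_add_cancel]
        | zero => exact zero_mem _
        | add x y hx hy => simpa using add_mem hx hy
      simpa using add_mem (h1 n) (h2 m)
    · rintro i j hj ⟨n, m⟩ ⟨hn, hm⟩
      refine Prod.ext (N.proj_ne hj hn) (M.proj_ne (fun h => hj ?_) hm)
      simpa using h
    · rintro ⟨n, m⟩ h
      refine Prod.ext (N.eq_zero_of_proj fun i => congrArg Prod.fst (h i))
        (M.eq_zero_of_proj fun i => ?_)
      have := congrArg Prod.snd (h (i - 1))
      change M.proj (i - 1 + 1) m = 0 at this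
      rwa [sub_add_cancel] at this
  d := (N.d ∘ₗ LinearMap.fst K _ _ + f.toFun ∘ₗ LinearMap.snd K _ _).prod
    (-(M.d ∘ₗ LinearMap.snd K _ _))
  d_mem := by
    rintro i ⟨n, m⟩ ⟨hn, hm⟩
    exact ⟨add_mem (N.d_mem hn) (f.map_mem _ _ hm), neg_mem (M.d_mem hm)⟩
  d_d := by
    rintro ⟨n, m⟩
    simp [N.d_d, M.d_d, f.map_d]
  act :=
    { toFun := coneAct M N
      mem := by
        rintro i j ⟨n, m⟩ a ⟨hn, hm⟩ ha
        refine ⟨N.act.mem hn ha, ?_⟩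
        have := M.act.mem hm ha
        rwa [add_right_comm] at this
      leibniz := by
        rintro i ⟨n, m⟩ a ⟨hn, hm⟩
        have h1 := N.act.leibniz a hn
        have h2 := M.act.leibniz a hm
        rw [Int.negOnePow_succ] at h2
        refine Prod.ext ?_ ?_
        · change N.d (N.act.toFun n a) + f.toFun (M.act.toFun m a) =
            N.act.toFun (N.d n + f.toFun m) a + ((i.negOnePow : ℤ) : K) • N.act.toFun n (A.d a)
          rw [h1, f.map_act, map_add, LinearMap.add_apply]
          abel
        · change -M.d (M.act.toFun m a) =
            M.act.toFun (-M.d m) a + ((i.negOnePow : ℤ) : K) • M.act.toFun m (A.d a)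
          rw [h2, map_neg, LinearMap.neg_apply]
          simp only [Units.val_neg, Int.cast_neg, neg_smul]
          abel }
  act_one x := Prod.ext (N.act_one x.1) (M.act_one x.2)
  act_mul x a b := Prod.ext (N.act_mul x.1 a b) (M.act_mul x.2 a b)

end DGMod

/-- The derived category `D(A)`: the localization of `C(A)` at the quasi-isomorphisms. -/
abbrev DCat (A : DGAlg K) : Type (u + 1) := (DGMod.quasiIso A).Localization

/-- The localization functor `C(A) → D(A)`. -/
abbrev toDCat (A : DGAlg K) : DGMod A ⥤ DCat A := (DGMod.quasiIso A).Q

/-- Compact objects: every morphism to a coproduct factors through a finite subcoproduct. (In an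
additive category with coproducts, this means that `Hom(X, -)` commutes with coproducts.) -/
def IsCompactObject {C : Type (u + 1)} [Category.{u + 1} C] (X : C) : Prop :=
  ∀ (ι : Type u) (Y : ι → C) (c : Cofan Y), IsColimit c → ∀ f : X ⟶ c.pt,
    ∃ (s : Finset ι) (b : Cofan fun i : s => Y i) (hb : IsColimit b) (g : X ⟶ b.pt),
      g ≫ hb.desc (Cofan.mk c.pt fun i : s => c.inj (i : ι)) = f

/-- The compact objects of `D(A)`, that is, the objects of `D_c(A)`. -/
abbrev CompactDCat (A : DGAlg K) : Type (u + 1) := {X : DCat A // IsCompactObject X}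

/-- There is a distinguished triangle `X → Y → Z → X[1]`. -/
def IsDistinguished {A : DGAlg K} (X Y Z : DCat A) : Prop :=
  ∃ (M N : DGMod A) (f : M ⟶ N), Nonempty (X ≅ (toDCat A).obj M) ∧
    Nonempty (Y ≅ (toDCat A).obj N) ∧ Nonempty (Z ≅ (toDCat A).obj (DGMod.cone f))

/-- The relations `[Y] - [X] - [Z]` given by the distinguished triangles of `D_c(A)`. -/
def relations (A : DGAlg K) : AddSubgroup (FreeAbelianGroup (CompactDCat A)) :=
  AddSubgroup.closure {r | ∃ X Y Z : CompactDCat A, IsDistinguished X.1 Y.1 Z.1 ∧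
    r = FreeAbelianGroup.of Y - FreeAbelianGroup.of X - FreeAbelianGroup.of Z}

/-- The Grothendieck group `K_0(A)` of the triangulated category `D_c(A)`. -/
abbrev K0 (A : DGAlg K) : Type (u + 1) := FreeAbelianGroup (CompactDCat A) ⧸ relations A

/-- The class in `K_0(A)` of an object of `D_c(A)`. -/
def K0.cls {A : DGAlg K} (X : CompactDCat A) : K0 A :=
  QuotientAddGroup.mk (FreeAbelianGroup.of X)

variable (K)

/-- The field `K` as a dg `K`-algebra concentrated in degree `0`. -/
def unitAlg : DGAlg K where
  carrier := K
  deg i := if i = 0 then ⊤ else ⊥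
  isInternal := by
    refine DGVect.isInternal_of _ ?_ (fun _ : Unit => 0) (fun _ => AddMonoidHom.id K) ?_ ?_
    · rw [eq_top_iff]
      exact le_iSup_of_le 0 (by simp)
    · rintro - j hj x hx
      simpa [hj] using hx
    · intro x hx
      exact hx ()
  d := 0
  d_mem _ := zero_mem _
  d_d _ := rfl
  mul :=
    { toFun := LinearMap.mul K K
      mem := by
        intro i j x y hx hy
        by_cases hi : i = 0
        · by_cases hj : j = 0
          · simp [hi, hj]
          · have : y = 0 := by simpa [hj] using hy
            rw [this, map_zero]; exact zero_mem _
        · have : x = 0 := by simpa [hi] using hx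
          rw [this, map_zero]; exact zero_mem _
      leibniz := by intros; simp }
  one := (1 : K)
  one_mem := by simp
  one_mul x := one_mul x
  mul_one x := mul_one x
  mul_assoc x y z := mul_assoc x y z

end Derived

/-! ## Polynomial maps -/

/-- The iterated cross-effects: `Δ⁰f = f` and
`Δⁿ⁺¹f(m₀, …, mₙ₊₁) = Δⁿf(m₀, …, mₙ + mₙ₊₁) - Δⁿf(m₀, …, mₙ) - Δⁿf(m₀, …, mₙ₋₁, mₙ₊₁)`. -/
def crossEffect {M S : Type*} [AddCommMonoid M] [AddCommGroup S] (f : M → S) :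
    (n : ℕ) → (Fin (n + 1) → M) → S
  | 0, m => f (m 0)
  | n + 1, m =>
    crossEffect f n (Fin.snoc (fun i : Fin n => m i.castSucc.castSucc)
      (m (Fin.last n).castSucc + m (Fin.last (n + 1)))) -
    crossEffect f n (Fin.snoc (fun i : Fin n => m i.castSucc.castSucc)
      (m (Fin.last n).castSucc)) -
    crossEffect f n (Fin.snoc (fun i : Fin n => m i.castSucc.castSucc)
      (m (Fin.last (n + 1))))

/-- `f` is a polynomial map of degree `N`: `f(0) = 0`, and `N` is the smallest integer such that
`Δᴺf = 0`. -/
structure IsPolynomialOfDegree {M S : Type*} [AddCommMonoid M] [AddCommGroup S] (f : M → S)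
    (N : ℕ) : Prop where
  map_zero : f 0 = 0
  isLeast : IsLeast {n : ℕ | ∀ m, crossEffect f n m = 0} N

/-! ## The induced map on Grothendieck groups -/

section Induced

variable (k : Type u) {l : Type u} (L : Type u) [Field k] [Field l] [Field L] [Algebra k l]
  [Algebra k L] [Algebra l L] [IsScalarTower k l L] [FiniteDimensional k L]

/-- The functor `M ↦ (⨂_{σ ∈ G/H} ^σM_L)^G` preserves quasi-isomorphisms. -/
def PreservesQuasiIso (A : DGAlg l) : Prop :=
  (DGMod.quasiIso A).IsInvertedBy (weilFunctor k L A ⋙ toDCat (weilAlg k L A))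

/-- The functor `D(A) → D(R(A))` induced by `M ↦ (⨂_{σ ∈ G/H} ^σM_L)^G`. -/
def derivedWeil {A : DGAlg l} (h : PreservesQuasiIso k L A) : DCat A ⥤ DCat (weilAlg k L A) :=
  Localization.Construction.lift (weilFunctor k L A ⋙ toDCat (weilAlg k L A)) h

/-- The functor `M ↦ (⨂_{σ ∈ G/H} ^σM_L)^G` restricts to a functor `D_c(A) → D_c(R(A))`, and `f` is
the map induced by it: `f [M] = [(⨂_{σ ∈ G/H} ^σM_L)^G]` for all `M` in `D_c(A)`. -/
def IsInducedMap {A : DGAlg l} (f : K0 A → K0 (weilAlg k L A)) : Prop :=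
  ∃ (h : PreservesQuasiIso k L A)
    (hc : ∀ X : DCat A, IsCompactObject X → IsCompactObject ((derivedWeil k L h).obj X)),
    ∀ X : CompactDCat A, f (K0.cls X) = K0.cls ⟨(derivedWeil k L h).obj X.1, hc X.1 X.2⟩

end Induced

end NCWeil

end

noncomputable section

namespace NCWeil

open CategoryTheory CategoryTheory.Limits
open scoped TensorProduct

/-! ### Elementwise homological algebra of dg modules: homotopies, sums, quotients, cones -/

section Graded

variable {K : Type u} [Field K]

/-! Write `R(M)` for the invariants of the tensor product of the conjugates of `M`. It has to be
shown that `R` descends to derived categories, that it preserves compactness, that `[R(M)]` depends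
only on `[M]`, and that this dependence is polynomial of degree at most `d`.

Quasi-isomorphisms. Over a field, a quasi-isomorphism of dg modules has a homotopy inverse as a map
of complexes (not of `A`-modules); it is a block of a linear contraction of the cone
(`QI.exists_inverse`). Tensor products preserve such homotopies (`Tens.map_htpyId`). The homotopies
need not be equivariant, but an invariant element which is a coboundary is the coboundary of an
invariant element: multiply a primitive by an element of trace `1` and sum its conjugates
(`GaloisComplex.exists_inv_boundary`). Hence `weilFunctor_QI`.

Compactness. Semifree resolutions identify morphisms of the derived category with homotopy classes,
and compact objects turn out to be retracts of semifree modules with a finite basis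
(`Cpt.exists_retract`). Galois descent shows that `R` of a finite sum of shifts of `N` is a finite
sum of shifts of `R(N)` (`exists_weilMod_dsum`), so `R` of a finite free module is finite free. A
finite semifree module is a free module whose differential has been deformed by terms which strictly
lower the level. On tensors the total weight, the sum of the levels of the factors, is invariant
under permutation, and the deformed differential is again triangular for it (`Tri.weil`). A
triangular deformation has the same graded pieces as the original module, hence the same compactness
and the same class in `K₀` (`Tri.cpt_kc`).

The map on `K₀`. For the same reason, `W ⊕ cone(f)` being a triangular deformation of `W ⊕ cone(0)`,
the class of `R(W ⊕ cone(f))` does not depend on `f`. A function of modules which is invariant under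
quasi-isomorphisms and has this property factors through `K₀`, although it need not be additive
(`IsConeInvariant.exists_K0_lift`): the compact modules, up to equality of values after adding any
compact module, form a group which receives a homomorphism from `K₀`.

Polynomiality. If `M` is the direct sum of modules `N_e`, then `R(M)` splits according to the set
`O` of those indices `e` which occur in a tensor (`kc_weilMod_fix`). So `f` of a sum over `T` is the
sum of contributions of the subsets `O` of `T`, and an iterated cross-effect is the sum of the
contributions of the sets `O` which meet all its arguments (`crossEffect_eq_sum`). A contributing
`O` is the image of a map from `G/H`, so it has at most `d` elements, and the cross-effect of `d +
1` arguments vanishes.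

Exact degree. The sum of `n` copies of `M` goes to `n ^ d` copies of `R(M)`, so `f(n x) = n ^ d
f(x)`, and `Δ^(d-1) f(x, …, x) = d! f(x)` as for the polynomial `t ^ d`
(`crossEffect_of_homogeneous`). For `A = l` the algebra `R(l)` is a nonzero finite-dimensional
algebra in degree `0`; the Euler characteristic of cohomology is a homomorphism from its `K₀` to the
integers which does not vanish on its class, so no positive multiple of this class is zero. -/

/-- The sign `(-1)^i` as an element of `K`. -/
def sg (K : Type u) [Field K] (i : ℤ) : K := ((i.negOnePow : ℤ) : K)

theorem sg_add (i j : ℤ) : sg K (i + j) = sg K i * sg K j := by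
  simp [sg, Int.negOnePow_add]

theorem sg_zero : sg K 0 = 1 := by simp [sg]

theorem sg_one : sg K 1 = -1 := by simp [sg]

theorem sg_mul_self (i : ℤ) : sg K i * sg K i = 1 := by
  rw [← sg_add, sg, Int.negOnePow_even _ ⟨i, rfl⟩]; simp

theorem sg_neg (i : ℤ) : sg K (-i) = sg K i := by simp [sg, Int.negOnePow_neg]

theorem sg_succ (i : ℤ) : sg K (i + 1) = -sg K i := by rw [sg_add, sg_one]; ring

theorem sg_neg_one : sg K (-1) = -1 := by rw [sg_neg, sg_one]

theorem sg_pred (i : ℤ) : sg K (i - 1) = -sg K i := by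
  rw [sub_eq_add_neg, sg_add, sg_neg_one]; ring

theorem sg_smul_smul {V : Type*} [AddCommGroup V] [Module K V] (i : ℤ) (x : V) :
    sg K i • sg K i • x = x := by rw [smul_smul, sg_mul_self, one_smul]

namespace DGVect

theorem proj_d (V : DGVect K) (i : ℤ) (x : V) : V.proj (i + 1) (V.d x) = V.d (V.proj i x) := by
  induction x using V.hom_induction with
  | mem j x hx =>
    by_cases h : j = i
    · subst h; rw [V.proj_same hx, V.proj_same (V.d_mem hx)]
    · rw [V.proj_ne h hx, V.proj_ne (by omega) (V.d_mem hx), map_zero]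
  | zero => simp
  | add x y hx hy => simp only [map_add, hx, hy]

theorem proj_d' (V : DGVect K) (i : ℤ) (x : V) : V.proj i (V.d x) = V.d (V.proj (i - 1) x) := by
  rw [← proj_d, sub_add_cancel]

theorem proj_degree_map (V W : DGVect K) (r : ℤ) (f : V →ₗ[K] W)
    (hf : ∀ {i x}, x ∈ V.deg i → f x ∈ W.deg (i + r)) (i : ℤ) (x : V) :
    W.proj (i + r) (f x) = f (V.proj i x) := by
  induction x using V.hom_induction with
  | mem j x hx =>
    by_cases h : j = i
    · subst h; rw [V.proj_same hx, W.proj_same (hf hx)]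
    · rw [V.proj_ne h hx, W.proj_ne (by omega) (hf hx), map_zero]
  | zero => simp
  | add x y hx hy => simp only [map_add, hx, hy]

end DGVect

/-- Elementwise form of the condition that a morphism of complexes is a quasi-isomorphism. -/
def QI {V W : DGVect K} (f : V →ₗ[K] W) : Prop :=
  (∀ x, V.d x = 0 → ∀ y, f x = W.d y → ∃ x', x = V.d x') ∧
    ∀ y, W.d y = 0 → ∃ x y', V.d x = 0 ∧ y = f x + W.d y'

/-- A complex all of whose cocycles are coboundaries. -/
def Acyc (V : DGVect K) : Prop := ∀ x, V.d x = 0 → ∃ y, x = V.d y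

theorem Acyc.exists_deg {V : DGVect K} (h : Acyc V) {i : ℤ} {x : V} (hx : x ∈ V.deg i)
    (hd : V.d x = 0) : ∃ y ∈ V.deg (i - 1), x = V.d y := by
  obtain ⟨y, hy⟩ := h x hd
  refine ⟨V.proj (i - 1) y, V.proj_mem _ _, ?_⟩
  rw [← V.proj_d', ← hy, V.proj_same hx]

namespace DGMod

variable {A : DGAlg K}

theorem comp_apply {M N P : DGMod A} (f : M ⟶ N) (g : N ⟶ P) (x : M.carrier) :
    (f ≫ g).toFun x = g.toFun (f.toFun x) := rfl

theorem id_apply (M : DGMod A) (x : M.carrier) : (𝟙 M : M ⟶ M).toFun x = x := rfl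

theorem hom_ext {M N : DGMod A} {f g : M ⟶ N} (h : ∀ x, f.toFun x = g.toFun x) : f = g :=
  Hom.ext (LinearMap.ext h)

theorem d_act (M : DGMod A) {i : ℤ} {x : M.carrier} (hx : x ∈ M.deg i) (a : A.carrier) :
    M.d (M.act.toFun x a) = M.act.toFun (M.d x) a + sg K i • M.act.toFun x (A.d a) :=
  M.act.leibniz a hx

theorem cohomologyMap_injective_iff {M N : DGMod A} (f : M ⟶ N) (n : ℤ) :
    Function.Injective (cohomologyMap f n) ↔ ∀ x ∈ M.cocycles n,
      (∃ y ∈ N.deg (n - 1), N.d y = f.toFun x) → ∃ y ∈ M.deg (n - 1), M.d y = x := by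
  rw [← LinearMap.ker_eq_bot, eq_bot_iff]
  constructor
  · intro h x hx hy
    have : (Submodule.Quotient.mk ⟨x, hx⟩ : M.cohomology n) ∈ LinearMap.ker (cohomologyMap f n) :=
      (Submodule.Quotient.mk_eq_zero _).2 hy
    exact (Submodule.Quotient.mk_eq_zero _).1 ((Submodule.mem_bot _).1 (h this))
  · intro h x hx
    induction x using Submodule.Quotient.induction_on with
    | _ x =>
      have h1 : (Submodule.Quotient.mk (cocyclesMap f n x) : N.cohomology n) = 0 := hx
      exact (Submodule.mem_bot _).2 ((Submodule.Quotient.mk_eq_zero _).2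
        (h x.1 x.2 ((Submodule.Quotient.mk_eq_zero _).1 h1)))

theorem cohomologyMap_surjective_iff {M N : DGMod A} (f : M ⟶ N) (n : ℤ) :
    Function.Surjective (cohomologyMap f n) ↔ ∀ y ∈ N.cocycles n,
      ∃ x ∈ M.cocycles n, ∃ y' ∈ N.deg (n - 1), N.d y' = f.toFun x - y := by
  constructor
  · intro h y hy
    obtain ⟨x, hx⟩ := h (Submodule.Quotient.mk ⟨y, hy⟩)
    induction x using Submodule.Quotient.induction_on with
    | _ x => exact ⟨x.1, x.2, (Submodule.Quotient.eq _).1 hx⟩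
  · intro h y
    induction y using Submodule.Quotient.induction_on with
    | _ y =>
      obtain ⟨x, hx, h'⟩ := h y.1 y.2
      exact ⟨Submodule.Quotient.mk ⟨x, hx⟩, (Submodule.Quotient.eq _).2 h'⟩

/-- An element has finitely many homogeneous components, and those of a cocycle are cocycles because
`d` has degree `1`. So solutions found degree by degree can be added up, and conversely a solution
can be projected to one degree. All later diagram chases use the ungraded form. -/
theorem quasiIso_iff {M N : DGMod A} (f : M ⟶ N) : quasiIso A f ↔ QI f.toFun := by
  have hp : ∀ i x, f.toFun (M.proj i x) = N.proj i (f.toFun x) :=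
    fun i x => DGVect.proj_map M.toDGVect N.toDGVect f.toFun.toAddMonoidHom f.map_mem i x
  constructor
  · intro h
    constructor
    · intro x hx y hy
      have h1 : ∀ i, ∃ z, M.d z = M.proj i x := by
        intro i
        obtain ⟨z, -, hz⟩ := (cohomologyMap_injective_iff f i).1 (h i).1 (M.proj i x)
          ⟨M.proj_mem i x, by
            change M.d _ = 0
            rw [← M.proj_d, hx, map_zero]⟩
          ⟨N.proj (i - 1) y, N.proj_mem _ _, by rw [← N.proj_d', ← hy, hp]⟩
        exact ⟨z, hz⟩
      choose z hz using h1
      obtain ⟨s, hs⟩ := M.exists_sum_proj x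
      refine ⟨∑ i ∈ s, z i, ?_⟩
      rw [map_sum]
      simp only [hz]
      exact (hs s subset_rfl).symm
    · intro y hy
      have h1 : ∀ i, ∃ x y', M.d x = 0 ∧ N.proj i y = f.toFun x + N.d y' := by
        intro i
        obtain ⟨x, hx, y', -, h'⟩ := (cohomologyMap_surjective_iff f i).1 (h i).2 (N.proj i y)
          ⟨N.proj_mem i y, by
            change N.d _ = 0
            rw [← N.proj_d, hy, map_zero]⟩
        exact ⟨x, -y', hx.2, by rw [map_neg, h']; abel⟩
      choose x y' hx h' using h1
      obtain ⟨s, hs⟩ := N.exists_sum_proj y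
      refine ⟨∑ i ∈ s, x i, ∑ i ∈ s, y' i, ?_, ?_⟩
      · rw [map_sum]; exact Finset.sum_eq_zero fun i _ => hx i
      · rw [map_sum, map_sum, ← Finset.sum_add_distrib]
        simp only [← h']
        exact (hs s subset_rfl).symm
  · intro h n
    refine ⟨(cohomologyMap_injective_iff f n).2 ?_, (cohomologyMap_surjective_iff f n).2 ?_⟩
    · rintro x hx ⟨y, hy, hyx⟩
      obtain ⟨x', hx'⟩ := h.1 x hx.2 y hyx.symm
      refine ⟨M.proj (n - 1) x', M.proj_mem _ _, ?_⟩
      rw [← M.proj_d', ← hx', M.proj_same hx.1]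
    · intro y hy
      obtain ⟨x, y', hx, h'⟩ := h.2 y hy.2
      refine ⟨M.proj n x, ⟨M.proj_mem _ _, ?_⟩, -N.proj (n - 1) y', neg_mem (N.proj_mem _ _), ?_⟩
      · change M.d _ = 0
        rw [← M.proj_d, hx, map_zero]
      · rw [map_neg, ← N.proj_d', hp]
        have := congrArg (N.proj n) h'
        rw [N.proj_same hy.1, map_add] at this
        rw [this]; abel

/-! ### The additive structure on morphisms -/

instance (M N : DGMod A) : Zero (M ⟶ N) :=
  ⟨⟨0, fun i _ _ => zero_mem (N.deg i), fun _ => by simp, fun _ _ => by simp⟩⟩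

instance (M N : DGMod A) : Add (M ⟶ N) :=
  ⟨fun f g => ⟨f.toFun + g.toFun, fun i x h => add_mem (f.map_mem i x h) (g.map_mem i x h),
    fun x => by simp [f.map_d, g.map_d], fun x a => by simp [f.map_act, g.map_act]⟩⟩

instance (M N : DGMod A) : Neg (M ⟶ N) :=
  ⟨fun f => ⟨-f.toFun, fun i x h => neg_mem (f.map_mem i x h),
    fun x => by simp [f.map_d], fun x a => by simp [f.map_act]⟩⟩

theorem zero_apply {M N : DGMod A} (x : M.carrier) : (0 : M ⟶ N).toFun x = 0 := rfl

theorem add_apply {M N : DGMod A} (f g : M ⟶ N) (x : M.carrier) :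
    (f + g).toFun x = f.toFun x + g.toFun x := rfl

theorem neg_apply {M N : DGMod A} (f : M ⟶ N) (x : M.carrier) :
    (-f).toFun x = -f.toFun x := rfl

instance (M N : DGMod A) : AddCommGroup (M ⟶ N) where
  add_assoc f g h := hom_ext fun x => add_assoc _ _ _
  zero_add f := hom_ext fun x => zero_add _
  add_zero f := hom_ext fun x => add_zero _
  neg_add_cancel f := hom_ext fun x => neg_add_cancel _
  add_comm f g := hom_ext fun x => add_comm _ _
  nsmul := nsmulRec
  zsmul := zsmulRec

theorem sub_apply {M N : DGMod A} (f g : M ⟶ N) (x : M.carrier) :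
    (f - g).toFun x = f.toFun x - g.toFun x := by
  rw [sub_eq_add_neg, add_apply, neg_apply, sub_eq_add_neg]

instance : Preadditive (DGMod A) where
  add_comp _ _ _ f g h := hom_ext fun x => map_add h.toFun (f.toFun x) (g.toFun x)
  comp_add _ _ _ f g h := rfl

theorem sum_apply {M N : DGMod A} {ι : Type*} (s : Finset ι) (f : ι → (M ⟶ N)) (x : M.carrier) :
    (∑ i ∈ s, f i).toFun x = ∑ i ∈ s, (f i).toFun x := by
  classical
  induction s using Finset.induction_on with
  | empty => rfl
  | insert a s ha ih => rw [Finset.sum_insert ha, Finset.sum_insert ha, add_apply, ih]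

/-- Isomorphisms from bijective morphisms. -/
def isoOfBijective {M N : DGMod A} (f : M ⟶ N) (h : Function.Bijective f.toFun) : M ≅ N :=
  let e := LinearEquiv.ofBijective f.toFun h
  have he : ∀ x, f.toFun (e.symm x) = x := fun x => e.apply_symm_apply x
  { hom := f
    inv := ⟨e.symm.toLinearMap, fun i y hy => by
      change e.symm y ∈ M.deg i
      have h1 : e.symm y = M.proj i (e.symm y) := h.1 (by
        have := DGVect.proj_map M.toDGVect N.toDGVect f.toFun.toAddMonoidHom f.map_mem i (e.symm y)
        refine Eq.trans ?_ this.symm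
        change f.toFun _ = N.proj i (f.toFun _)
        rw [he, N.proj_same hy])
      rw [h1]; exact M.proj_mem _ _,
      fun x => h.1 (by change f.toFun (e.symm _) = f.toFun (M.d (e.symm _)); rw [f.map_d, he, he]),
      fun x a => h.1 (by
        change f.toFun (e.symm _) = f.toFun (M.act.toFun (e.symm _) a); rw [f.map_act, he, he])⟩
    hom_inv_id := hom_ext fun x => e.symm_apply_apply x
    inv_hom_id := hom_ext fun x => e.apply_symm_apply x }

/-! ### Graded maps and homotopies -/

/-- `f` is a homogeneous `A`-linear map of degree `r`. -/
structure IsGr {M N : DGMod A} (r : ℤ) (f : M.carrier →ₗ[K] N.carrier) : Prop where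
  mem : ∀ {i x}, x ∈ M.deg i → f x ∈ N.deg (i + r)
  act : ∀ x a, f (M.act.toFun x a) = N.act.toFun (f x) a

theorem Hom.isGr {M N : DGMod A} (f : M ⟶ N) : IsGr 0 f.toFun :=
  ⟨fun h => by rw [add_zero]; exact f.map_mem _ _ h, f.map_act⟩

theorem IsGr.comp {M N P : DGMod A} {r s t : ℤ} {f : M.carrier →ₗ[K] N.carrier}
    {g : N.carrier →ₗ[K] P.carrier} (hf : IsGr r f) (hg : IsGr s g) (h : r + s = t) :
    IsGr t (g ∘ₗ f) :=
  ⟨fun hx => by rw [← h, ← add_assoc]; exact hg.mem (hf.mem hx),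
    fun x a => by simp [hf.act, hg.act]⟩

theorem IsGr.add {M N : DGMod A} {r : ℤ} {f g : M.carrier →ₗ[K] N.carrier}
    (hf : IsGr r f) (hg : IsGr r g) : IsGr r (f + g) :=
  ⟨fun hx => add_mem (hf.mem hx) (hg.mem hx), fun x a => by simp [hf.act, hg.act]⟩

theorem IsGr.neg {M N : DGMod A} {r : ℤ} {f : M.carrier →ₗ[K] N.carrier}
    (hf : IsGr r f) : IsGr r (-f) :=
  ⟨fun hx => neg_mem (hf.mem hx), fun x a => by simp [hf.act]⟩

theorem IsGr.zero {M N : DGMod A} (r : ℤ) : IsGr r (0 : M.carrier →ₗ[K] N.carrier) :=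
  ⟨fun _ => zero_mem _, fun x a => by simp⟩

/-- A degree `0` graded map commuting with the differentials, as a morphism. -/
def homOfGr {M N : DGMod A} (f : M.carrier →ₗ[K] N.carrier) (hf : IsGr 0 f)
    (hd : ∀ x, f (M.d x) = N.d (f x)) : M ⟶ N :=
  ⟨f, fun i x hx => by have := hf.mem hx; rwa [add_zero] at this, hd, hf.act⟩

/-- Homotopy of morphisms. -/
def Htpy {M N : DGMod A} (f g : M ⟶ N) : Prop :=
  ∃ h : M.carrier →ₗ[K] N.carrier, IsGr (-1) h ∧
    ∀ x, f.toFun x = g.toFun x + (N.d (h x) + h (M.d x))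

theorem Htpy.refl {M N : DGMod A} (f : M ⟶ N) : Htpy f f := ⟨0, IsGr.zero _, fun x => by simp⟩

theorem Htpy.symm {M N : DGMod A} {f g : M ⟶ N} : Htpy f g → Htpy g f := by
  rintro ⟨h, hh, e⟩
  exact ⟨-h, hh.neg, fun x => by rw [e]; simp; abel⟩

theorem Htpy.trans {M N : DGMod A} {f g k : M ⟶ N} : Htpy f g → Htpy g k → Htpy f k := by
  rintro ⟨h, hh, e⟩ ⟨h', hh', e'⟩
  exact ⟨h + h', hh.add hh', fun x => by rw [e, e']; simp; abel⟩

theorem Htpy.comp_right {M N P : DGMod A} {f g : M ⟶ N} (k : N ⟶ P) :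
    Htpy f g → Htpy (f ≫ k) (g ≫ k) := by
  rintro ⟨h, hh, e⟩
  exact ⟨k.toFun ∘ₗ h, hh.comp k.isGr (by simp), fun x => by
    simp only [comp_apply, e, map_add, LinearMap.comp_apply, k.map_d]⟩

/-! ### Constructions of modules -/

variable (A) in
/-- `A` as a right module over itself. -/
@[reducible] def self : DGMod A where
  toDGVect := A.toDGVect
  act := A.mul
  act_one := A.mul_one
  act_mul := A.mul_assoc

/-- The shift `M[n]`. -/
@[reducible] def shift (M : DGMod A) (n : ℤ) : DGMod A where
  carrier := M.carrier
  deg i := M.deg (i + n)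
  isInternal := by
    refine DGVect.isInternal_of _ ?_ id (fun i => (M.proj (i + n)).toAddMonoidHom) ?_ ?_
    · rw [eq_top_iff]
      intro x _
      induction x using M.hom_induction with
      | mem i x hx =>
        refine Submodule.mem_iSup_of_mem (i - n) ?_
        rwa [sub_add_cancel]
      | zero => exact zero_mem _
      | add x y hx hy => exact add_mem (hx trivial) (hy trivial)
    · intro i j hj x hx
      exact M.proj_ne (fun h => hj (add_right_cancel h)) hx
    · intro x h
      refine M.eq_zero_of_proj fun i => ?_
      have := h (i - n)
      change M.proj (i - n + n) x = 0 at this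
      rwa [sub_add_cancel] at this
  d := sg K n • M.d
  d_mem := by
    intro i x hx
    have := Submodule.smul_mem _ (sg K n) (M.d_mem hx)
    rwa [add_right_comm] at this
  d_d x := by simp [M.d_d]
  act :=
    { toFun := M.act.toFun
      mem := by
        intro i j x a hx ha
        have := M.act.mem hx ha
        rwa [add_right_comm] at this
      leibniz := by
        intro i x a hx
        change sg K n • M.d (M.act.toFun x a) = M.act.toFun (sg K n • M.d x) a +
          sg K i • M.act.toFun x (A.d a)
        -- An element of degree `i` of `M[n]` has degree `i + n` in `M`. The sign `(-1)^n` of the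
        -- shifted differential cancels the extra `(-1)^n` of the Leibniz rule, so a right action
        -- needs no sign of its own.
        rw [M.d_act hx, smul_add, map_smul, LinearMap.smul_apply, smul_smul, sg_add, mul_comm,
          mul_assoc, sg_mul_self, mul_one] }
  act_one := M.act_one
  act_mul := M.act_mul

/-- The direct sum of two modules. -/
@[reducible] def prod (M N : DGMod A) : DGMod A where
  carrier := M.carrier × N.carrier
  deg i := (M.deg i).prod (N.deg i)
  isInternal := by
    refine DGVect.isInternal_of _ ?_ id (fun i =>
      ((M.proj i).prodMap (N.proj i)).toAddMonoidHom) ?_ ?_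
    · rw [eq_top_iff]
      rintro ⟨m, n⟩ -
      have h1 : ∀ m : M.carrier, (m, (0 : N.carrier)) ∈ ⨆ i, (M.deg i).prod (N.deg i) := by
        intro m
        induction m using M.hom_induction with
        | mem i n hn => exact Submodule.mem_iSup_of_mem i ⟨hn, zero_mem _⟩
        | zero => exact zero_mem _
        | add x y hx hy => simpa using add_mem hx hy
      have h2 : ∀ n : N.carrier, ((0 : M.carrier), n) ∈ ⨆ i, (M.deg i).prod (N.deg i) := by
        intro n
        induction n using N.hom_induction with
        | mem i n hn => exact Submodule.mem_iSup_of_mem i ⟨zero_mem _, hn⟩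
        | zero => exact zero_mem _
        | add x y hx hy => simpa using add_mem hx hy
      simpa using add_mem (h1 m) (h2 n)
    · rintro i j hj ⟨m, n⟩ ⟨hm, hn⟩
      exact Prod.ext (M.proj_ne hj hm) (N.proj_ne hj hn)
    · rintro ⟨m, n⟩ h
      exact Prod.ext (M.eq_zero_of_proj fun i => congrArg Prod.fst (h i))
        (N.eq_zero_of_proj fun i => congrArg Prod.snd (h i))
  d := M.d.prodMap N.d
  d_mem := by
    rintro i ⟨m, n⟩ ⟨hm, hn⟩
    exact ⟨M.d_mem hm, N.d_mem hn⟩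
  d_d x := Prod.ext (M.d_d _) (N.d_d _)
  act :=
    { toFun := coneAct N M
      mem := fun {i j x a} hx ha => ⟨M.act.mem hx.1 ha, N.act.mem hx.2 ha⟩
      leibniz := fun {i x} a hx => Prod.ext (M.act.leibniz a hx.1) (N.act.leibniz a hx.2) }
  act_one x := Prod.ext (M.act_one x.1) (N.act_one x.2)
  act_mul x a b := Prod.ext (M.act_mul x.1 a b) (N.act_mul x.2 a b)

/-- The direct sum of a family of modules. -/
@[reducible] def dsum {ι : Type u} (N : ι → DGMod A) : DGMod A where
  carrier := Π₀ i, (N i).carrier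
  deg n :=
    { carrier := {f | ∀ i, f i ∈ (N i).deg n}
      add_mem' := fun hx hy i => add_mem (hx i) (hy i)
      zero_mem' := fun i => zero_mem _
      smul_mem' := fun c x hx i => Submodule.smul_mem _ c (hx i) }
  isInternal := by
    classical
    refine DGVect.isInternal_of _ ?_ (fun p : ι × ℤ => p.2) (fun p =>
      ((DFinsupp.lsingle (R := K) (M := fun i => (N i).carrier) p.1) ∘ₗ
        (N p.1).proj p.2 ∘ₗ (DFinsupp.lapply (R := K) (M := fun i => (N i).carrier)
          p.1)).toAddMonoidHom) ?_ ?_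
    · rw [eq_top_iff]
      intro f hf
      clear hf
      induction f using DFinsupp.induction with
      | h0 => exact zero_mem _
      | ha i b f h0 h1 ih =>
        refine add_mem ?_ ih
        clear h0 h1 ih
        induction b using (N i).hom_induction with
        | mem j b hb =>
          refine Submodule.mem_iSup_of_mem j fun i' => ?_
          by_cases h : i' = i
          · subst h; simpa using hb
          · rw [DFinsupp.single_eq_of_ne h]; exact zero_mem _
        | zero => simp
        | add x y hx hy => rw [DFinsupp.single_add]; exact add_mem hx hy
    · rintro ⟨i, n⟩ j hj f hf
      change DFinsupp.single (β := fun i => (N i).carrier) i ((N i).proj n (f i)) = 0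
      rw [(N i).proj_ne hj (hf i), DFinsupp.single_zero]
    · intro f h
      refine DFinsupp.ext fun i => (N i).eq_zero_of_proj fun n => ?_
      have := congrArg (fun g : Π₀ i, (N i).carrier => g i) (h (i, n))
      change DFinsupp.single (β := fun i => (N i).carrier) i ((N i).proj n (f i)) i = 0 at this
      rwa [DFinsupp.single_eq_same] at this
  d := DFinsupp.mapRange.linearMap fun i => (N i).d
  d_mem hx i := (N i).d_mem (hx i)
  d_d f := DFinsupp.ext fun i => (N i).d_d (f i)
  act :=
    { toFun := LinearMap.mk₂ K
        (fun f a => DFinsupp.mapRange (fun i x => (N i).act.toFun x a) (fun i => by simp) f)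
        (fun f g a => DFinsupp.ext fun i => by simp)
        (fun c f a => DFinsupp.ext fun i => by simp)
        (fun f a b => DFinsupp.ext fun i => by simp)
        (fun c f a => DFinsupp.ext fun i => by simp)
      mem := fun hx ha i => (N i).act.mem (hx i) ha
      leibniz := fun a hx => DFinsupp.ext fun i => (N i).act.leibniz a (hx i) }
  act_one f := DFinsupp.ext fun i => (N i).act_one (f i)
  act_mul f a b := DFinsupp.ext fun i => (N i).act_mul (f i) a b

theorem dsum_d_apply {ι : Type u} (N : ι → DGMod A) (f : (dsum N).carrier) (i : ι) :
    ((dsum N).d f : Π₀ i, (N i).carrier) i = (N i).d ((f : Π₀ i, (N i).carrier) i) := rfl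

theorem dsum_act_apply {ι : Type u} (N : ι → DGMod A) (f : (dsum N).carrier) (a : A.carrier)
    (i : ι) : ((dsum N).act.toFun f a : Π₀ i, (N i).carrier) i =
      (N i).act.toFun ((f : Π₀ i, (N i).carrier) i) a := rfl

/-- A graded subspace stable under the differential and the action. -/
structure Sub (M : DGMod A) extends Submodule K M.carrier where
  proj_mem : ∀ i {x}, x ∈ toSubmodule → M.proj i x ∈ toSubmodule
  d_mem : ∀ {x}, x ∈ toSubmodule → M.d x ∈ toSubmodule
  act_mem : ∀ {x} a, x ∈ toSubmodule → M.act.toFun x a ∈ toSubmodule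

/-- A dg submodule. -/
@[reducible] def sub {M : DGMod A} (S : Sub M) : DGMod A where
  carrier := S.toSubmodule
  deg i := (M.deg i).comap S.toSubmodule.subtype
  isInternal := by
    refine DGVect.isInternal_of _ ?_ id
      (fun i => (M.proj i ∘ₗ S.toSubmodule.subtype).toAddMonoidHom) ?_ ?_
    · rw [eq_top_iff]
      intro x _
      obtain ⟨s, hs⟩ := M.exists_sum_proj x.1
      have : x = ∑ i ∈ s, (⟨M.proj i x.1, S.proj_mem i x.2⟩ : S.toSubmodule) := by
        apply Subtype.ext
        rw [AddSubmonoidClass.coe_finset_sum]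
        exact (hs s subset_rfl).symm
      rw [this]
      exact sum_mem fun i _ => Submodule.mem_iSup_of_mem i (M.proj_mem i _)
    · intro i j hj x hx
      exact M.proj_ne hj hx
    · intro x hx
      exact Subtype.ext (M.eq_zero_of_proj hx)
  d := M.d.restrict fun _ hx => S.d_mem hx
  d_mem hx := M.d_mem hx
  d_d x := Subtype.ext (M.d_d x.1)
  act :=
    { toFun := LinearMap.mk₂ K (fun x a => ⟨M.act.toFun x.1 a, S.act_mem a x.2⟩)
        (fun x y a => Subtype.ext (by simp)) (fun c x a => Subtype.ext (by simp))
        (fun x a b => Subtype.ext (by simp)) (fun c x a => Subtype.ext (by simp))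
      mem := fun hx ha => M.act.mem hx ha
      leibniz := fun a hx => Subtype.ext (M.act.leibniz a hx) }
  act_one x := Subtype.ext (M.act_one x.1)
  act_mul x a b := Subtype.ext (M.act_mul x.1 a b)

/-- The inclusion of a dg submodule. -/
def subι {M : DGMod A} (S : Sub M) : sub S ⟶ M :=
  ⟨S.toSubmodule.subtype, fun _ _ h => h, fun _ => rfl, fun _ _ => rfl⟩

theorem subι_apply {M : DGMod A} (S : Sub M) (x : (sub S).carrier) : (subι S).toFun x = x.1 := rfl

/-- The lift of a morphism to a dg submodule. -/
def subLift {M N : DGMod A} (S : Sub N) (f : M ⟶ N) (h : ∀ x, f.toFun x ∈ S.toSubmodule) :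
    M ⟶ sub S :=
  ⟨f.toFun.codRestrict _ h, fun i x hx => f.map_mem i x hx, fun x => Subtype.ext (f.map_d x),
    fun x a => Subtype.ext (f.map_act x a)⟩

theorem subLift_ι {M N : DGMod A} (S : Sub N) (f : M ⟶ N) (h : ∀ x, f.toFun x ∈ S.toSubmodule) :
    subLift S f h ≫ subι S = f := rfl

/-- The kernel of a morphism. -/
@[reducible] def kerSub {M N : DGMod A} (f : M ⟶ N) : Sub M where
  toSubmodule := LinearMap.ker f.toFun
  proj_mem i x hx := by
    have := DGVect.proj_map M.toDGVect N.toDGVect f.toFun.toAddMonoidHom f.map_mem i x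
    change f.toFun _ = 0
    have hx' : f.toFun x = 0 := hx
    change f.toFun _ = N.proj i (f.toFun x) at this
    rw [this, hx', map_zero]
  d_mem {x} hx := by
    have hx' : f.toFun x = 0 := hx
    change f.toFun _ = 0
    rw [f.map_d, hx', map_zero]
  act_mem {x} a hx := by
    have hx' : f.toFun x = 0 := hx
    change f.toFun _ = 0
    rw [f.map_act, hx', map_zero, LinearMap.zero_apply]

/-- The quotient by a dg submodule. -/
@[reducible] def quot {M : DGMod A} (S : Sub M) : DGMod A where
  carrier := M.carrier ⧸ S.toSubmodule
  deg i := (M.deg i).map S.toSubmodule.mkQ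
  isInternal := by
    refine DGVect.isInternal_of _ ?_ id
      (fun i => (Submodule.mapQ S.toSubmodule S.toSubmodule (M.proj i)
        fun x hx => S.proj_mem i hx).toAddMonoidHom) ?_ ?_
    · rw [← Submodule.map_iSup, M.iSup_deg, Submodule.map_top, Submodule.range_mkQ]
    · rintro i j hj _ ⟨x, hx, rfl⟩
      change S.toSubmodule.mkQ (M.proj i x) = 0
      rw [M.proj_ne (show j ≠ i from hj) hx, map_zero]
    · intro x h
      induction x using Submodule.Quotient.induction_on with
      | _ x =>
        rw [Submodule.Quotient.mk_eq_zero]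
        obtain ⟨s, hs⟩ := M.exists_sum_proj x
        rw [← hs s subset_rfl]
        exact sum_mem fun i _ => (Submodule.Quotient.mk_eq_zero _).1 (h i)
  d := Submodule.mapQ _ _ M.d fun x hx => S.d_mem hx
  d_mem := by
    rintro i _ ⟨x, hx, rfl⟩
    exact ⟨M.d x, M.d_mem hx, rfl⟩
  d_d x := by
    induction x using Submodule.Quotient.induction_on with
    | _ x =>
      rw [Submodule.mapQ_apply, Submodule.mapQ_apply, M.d_d, Submodule.Quotient.mk_zero]
  act :=
    { toFun := S.toSubmodule.liftQ
        (LinearMap.compr₂ M.act.toFun S.toSubmodule.mkQ) fun x hx => LinearMap.ext fun a =>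
          (Submodule.Quotient.mk_eq_zero _).2 (S.act_mem a hx)
      mem := by
        rintro i j _ a ⟨x, hx, rfl⟩ ha
        exact ⟨M.act.toFun x a, M.act.mem hx ha, rfl⟩
      leibniz := by
        rintro i _ a ⟨x, hx, rfl⟩
        exact congrArg S.toSubmodule.mkQ (M.act.leibniz a hx) }
  act_one x := by
    induction x using Submodule.Quotient.induction_on with
    | _ x => exact congrArg S.toSubmodule.mkQ (M.act_one x)
  act_mul x a b := by
    induction x using Submodule.Quotient.induction_on with
    | _ x => exact congrArg S.toSubmodule.mkQ (M.act_mul x a b)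

/-- The quotient morphism. -/
def quotπ {M : DGMod A} (S : Sub M) : M ⟶ quot S :=
  ⟨S.toSubmodule.mkQ, fun _ x h => ⟨x, h, rfl⟩, fun _ => rfl, fun _ _ => rfl⟩

/-! ### Maps between direct sums -/

section DSum

variable {ι : Type u} (N : ι → DGMod A)

open scoped Classical in
/-- The inclusion of a summand. -/
def dinj (i : ι) : N i ⟶ dsum N where
  toFun := DFinsupp.lsingle (R := K) (M := fun i => (N i).carrier) i
  map_mem n x hx j := by
    by_cases h : j = i
    · subst h; simpa using hx
    · simp only [DFinsupp.lsingle_apply]; rw [DFinsupp.single_eq_of_ne h]; exact zero_mem _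
  map_d x := by
    refine DFinsupp.ext fun j => ?_
    rw [dsum_d_apply]
    by_cases h : j = i
    · subst h; simp
    · simp only [DFinsupp.lsingle_apply]
      rw [DFinsupp.single_eq_of_ne h, DFinsupp.single_eq_of_ne h, map_zero]
  map_act x a := by
    refine DFinsupp.ext fun j => ?_
    rw [dsum_act_apply]
    by_cases h : j = i
    · subst h; simp
    · simp only [DFinsupp.lsingle_apply]
      rw [DFinsupp.single_eq_of_ne h, DFinsupp.single_eq_of_ne h, map_zero, LinearMap.zero_apply]

/-- The projection to a summand. -/
def dpr (i : ι) : dsum N ⟶ N i :=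
  ⟨DFinsupp.lapply i, fun _ _ hx => hx i, fun _ => rfl, fun _ _ => rfl⟩

theorem dpr_apply (i : ι) (f : (dsum N).carrier) :
    (dpr N i).toFun f = (f : Π₀ i, (N i).carrier) i := rfl

theorem dinj_same (i : ι) (x : (N i).carrier) :
    ((dinj N i).toFun x : Π₀ i, (N i).carrier) i = x := by
  classical exact DFinsupp.single_eq_same (β := fun i => (N i).carrier)

theorem dinj_ne {i j : ι} (h : j ≠ i) (x : (N i).carrier) :
    ((dinj N i).toFun x : Π₀ i, (N i).carrier) j = 0 := by
  classical exact DFinsupp.single_eq_of_ne (β := fun i => (N i).carrier) h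

variable {N} in
theorem dsum_induction {motive : (dsum N).carrier → Prop} (f : (dsum N).carrier)
    (zero : motive 0) (single : ∀ i x, motive ((dinj N i).toFun x))
    (add : ∀ f g, motive f → motive g → motive (f + g)) : motive f := by
  classical
  induction f using DFinsupp.induction with
  | h0 => exact zero
  | ha i b f _ _ ih => 
    refine add _ _ ?_ ih
    have h1 : DFinsupp.single (β := fun i => (N i).carrier) i b = (dinj N i).toFun b := by
      refine DFinsupp.ext fun j => ?_
      by_cases h : j = i
      · subst h; rw [dinj_same, DFinsupp.single_eq_same]
      · rw [dinj_ne N h, DFinsupp.single_eq_of_ne h]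
    rw [h1]
    exact single i b

variable {N} in
theorem dsum_lhom_ext {M : Type*} [AddCommGroup M] [Module K M] {f g : (dsum N).carrier →ₗ[K] M}
    (h : ∀ i x, f ((dinj N i).toFun x) = g ((dinj N i).toFun x)) (x : (dsum N).carrier) :
    f x = g x := by
  induction x using dsum_induction with
  | zero => simp
  | single i x => exact h i x
  | add x y hx hy => rw [map_add, map_add, hx, hy]

variable {N} in
/-- The linear map out of a direct sum given by linear maps on the summands. -/
def dlift {M : DGMod A} (f : ∀ i, (N i).carrier →ₗ[K] M.carrier) :
    (dsum N).carrier →ₗ[K] M.carrier := by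
  classical exact DFinsupp.lsum (M := fun i => (N i).carrier) ℕ f

variable {N}

theorem dlift_inj {M : DGMod A} (f : ∀ i, (N i).carrier →ₗ[K] M.carrier) (i : ι)
    (x : (N i).carrier) : dlift f ((dinj N i).toFun x) = f i x := by
  classical exact DFinsupp.lsum_single (M := fun i => (N i).carrier) ..

/-- Stated for every finite set containing the support, so that the sum may be taken over all
indices or over a set common to several elements. -/
theorem dsum_eq_sum (x : (dsum N).carrier) :
    ∃ s : Finset ι, (∀ i ∉ s, (x : Π₀ i, (N i).carrier) i = 0) ∧ ∀ t, s ⊆ t →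
      x = ∑ i ∈ t, (dinj N i).toFun ((x : Π₀ i, (N i).carrier) i) := by
  classical
  refine ⟨DFinsupp.support x, fun i hi => by simpa using hi, fun t ht => ?_⟩
  refine DFinsupp.ext fun j => ?_
  have h1 : (∑ i ∈ t, (dinj N i).toFun ((x : Π₀ i, (N i).carrier) i) : Π₀ i, (N i).carrier) j =
      ∑ i ∈ t, ((dinj N i).toFun ((x : Π₀ i, (N i).carrier) i) : Π₀ i, (N i).carrier) j :=
    map_sum (DFinsupp.lapply (R := K) j) _ _
  rw [h1]
  by_cases hj : j ∈ t
  · rw [Finset.sum_eq_single_of_mem j hj fun i _ hi => dinj_ne N (Ne.symm hi) _, dinj_same]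
  · have : (x : Π₀ i, (N i).carrier) j = 0 := by
      by_contra h
      exact hj (ht (by simpa using h))
    rw [this]
    refine (Finset.sum_eq_zero fun i hi => dinj_ne N (by rintro rfl; exact hj hi) _).symm

theorem dlift_isGr {M : DGMod A} {r : ℤ} {f : ∀ i, (N i).carrier →ₗ[K] M.carrier}
    (hf : ∀ i, IsGr r (f i)) : IsGr r (dlift f) := by
  constructor
  · intro n x hx
    obtain ⟨s, -, hs⟩ := dsum_eq_sum x
    rw [hs s subset_rfl, map_sum]
    refine sum_mem fun i _ => ?_
    rw [dlift_inj]
    exact (hf i).mem (hx i)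
  · intro x a
    induction x using dsum_induction with
    | zero => simp
    | single i x => rw [← (dinj N i).map_act, dlift_inj, dlift_inj, (hf i).act]
    | add x y hx hy => simp only [map_add, LinearMap.add_apply, hx, hy]

/-- The morphism out of a direct sum given by morphisms on the summands. -/
def ddesc {M : DGMod A} (f : ∀ i, N i ⟶ M) : dsum N ⟶ M :=
  homOfGr (dlift fun i => (f i).toFun) (dlift_isGr fun i => (f i).isGr) fun x => by
    induction x using dsum_induction with
    | zero => simp
    | single i x => rw [← (dinj N i).map_d, dlift_inj, dlift_inj, (f i).map_d]
    | add x y hx hy => simp only [map_add, hx, hy]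

theorem dinj_ddesc {M : DGMod A} (f : ∀ i, N i ⟶ M) (i : ι) : dinj N i ≫ ddesc f = f i :=
  hom_ext fun x => dlift_inj (fun i => (f i).toFun) i x

theorem dsum_hom_ext {M : DGMod A} {f g : dsum N ⟶ M} (h : ∀ i, dinj N i ≫ f = dinj N i ≫ g) :
    f = g :=
  hom_ext fun x => dsum_lhom_ext (fun i x => congrArg (fun k => Hom.toFun k x) (h i)) x

/-- The map of direct sums induced by linear maps of the summands. -/
def dmapL {N' : ι → DGMod A} (f : ∀ i, (N i).carrier →ₗ[K] (N' i).carrier) :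
    (dsum N).carrier →ₗ[K] (dsum N').carrier := DFinsupp.mapRange.linearMap f

/-- The morphism of direct sums induced by morphisms of the summands. -/
def dmap {N' : ι → DGMod A} (f : ∀ i, N i ⟶ N' i) : dsum N ⟶ dsum N' where
  toFun := dmapL fun i => (f i).toFun
  map_mem n x hx i := (f i).map_mem n _ (hx i)
  map_d x := DFinsupp.ext fun i => (f i).map_d _
  map_act x a := DFinsupp.ext fun i => (f i).map_act _ a

theorem dmap_apply {N' : ι → DGMod A} (f : ∀ i, N i ⟶ N' i)
    (x : (dsum N).carrier) (i : ι) :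
    ((dmap f).toFun x : Π₀ i, (N' i).carrier) i = (f i).toFun ((x : Π₀ i, (N i).carrier) i) := rfl

theorem dinj_dmap {N' : ι → DGMod A} (f : ∀ i, N i ⟶ N' i) (i : ι) :
    dinj N i ≫ dmap f = f i ≫ dinj N' i := by
  refine hom_ext fun x => DFinsupp.ext fun j => ?_
  rw [comp_apply, comp_apply, dmap_apply]
  by_cases h : j = i
  · subst h; rw [dinj_same, dinj_same]
  · rw [dinj_ne N h, dinj_ne N' h, map_zero]

/-- Primitives are chosen in each summand separately. They are required to vanish wherever the given
component vanishes, since otherwise the chosen family would not have finite support. -/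
theorem dmap_QI {N' : ι → DGMod A} (f : ∀ i, N i ⟶ N' i) (h : ∀ i, QI (f i).toFun) :
    QI (dmap f).toFun := by
  classical
  constructor
  · intro x hx y hy
    have h1 : ∀ i, ∃ z, (x : Π₀ i, (N i).carrier) i = (N i).d z ∧
        ((x : Π₀ i, (N i).carrier) i = 0 → z = 0) := by
      intro i
      by_cases h0 : (x : Π₀ i, (N i).carrier) i = 0
      · exact ⟨0, by simp [h0], fun _ => rfl⟩
      · obtain ⟨z, hz⟩ := (h i).1 ((x : Π₀ i, (N i).carrier) i)
          (congrArg (fun g : Π₀ i, (N i).carrier => g i) hx) ((y : Π₀ i, (N' i).carrier) i)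
          (congrArg (fun g : Π₀ i, (N' i).carrier => g i) hy)
        exact ⟨z, hz, fun h => absurd h h0⟩
    choose z hz hz0 using h1
    refine ⟨(DFinsupp.mk (DFinsupp.support x) fun i => z i : Π₀ i, (N i).carrier), ?_⟩
    refine DFinsupp.ext fun i => ?_
    rw [dsum_d_apply, hz i]
    congr 1
    rw [DFinsupp.mk_apply]
    split_ifs with hi
    · rfl
    · exact hz0 i (by simpa using hi)
  · intro y hy
    have h1 : ∀ i, ∃ z w, (N i).d z = 0 ∧ (y : Π₀ i, (N' i).carrier) i = (f i).toFun z + (N' i).d w ∧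
        ((y : Π₀ i, (N' i).carrier) i = 0 → z = 0 ∧ w = 0) := by
      intro i
      by_cases h0 : (y : Π₀ i, (N' i).carrier) i = 0
      · exact ⟨0, 0, by simp, by simp [h0], fun _ => ⟨rfl, rfl⟩⟩
      · obtain ⟨z, w, hz, hw⟩ := (h i).2 ((y : Π₀ i, (N' i).carrier) i)
          (congrArg (fun g : Π₀ i, (N' i).carrier => g i) hy)
        exact ⟨z, w, hz, hw, fun h => absurd h h0⟩
    choose z w hz hw h0 using h1
    refine ⟨(DFinsupp.mk (DFinsupp.support y) fun i => z i : Π₀ i, (N i).carrier),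
      (DFinsupp.mk (DFinsupp.support y) fun i => w i : Π₀ i, (N' i).carrier), ?_, ?_⟩
    · refine DFinsupp.ext fun i => ?_
      rw [dsum_d_apply, DFinsupp.mk_apply]
      split_ifs
      · exact hz i
      · simp
    · refine DFinsupp.ext fun i => ?_
      rw [DFinsupp.add_apply, dmap_apply, dsum_d_apply, DFinsupp.mk_apply, DFinsupp.mk_apply]
      split_ifs with hi
      · exact hw i
      · have : (y : Π₀ i, (N' i).carrier) i = 0 := by simpa using hi
        simp [this]

variable (N)

open scoped Classical in
/-- The endomorphism of a direct sum which is the identity on the summands in `s` and zero on the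
others. -/
def dmask (s : Set ι) : dsum N ⟶ dsum N where
  toFun := DFinsupp.filterLinearMap K _ (· ∈ s)
  map_mem n x hx i := by
    rw [DFinsupp.filterLinearMap_apply, DFinsupp.filter_apply]
    split_ifs
    · exact hx i
    · exact zero_mem _
  map_d x := DFinsupp.ext fun i => by
    rw [dsum_d_apply, DFinsupp.filterLinearMap_apply, DFinsupp.filterLinearMap_apply,
      DFinsupp.filter_apply, DFinsupp.filter_apply]
    split_ifs
    · rfl
    · simp
  map_act x a := DFinsupp.ext fun i => by
    rw [dsum_act_apply, DFinsupp.filterLinearMap_apply, DFinsupp.filterLinearMap_apply,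
      DFinsupp.filter_apply, DFinsupp.filter_apply]
    split_ifs
    · rfl
    · simp

theorem dmask_mem {s : Set ι} {i : ι} (h : i ∈ s) (x : (dsum N).carrier) :
    ((dmask N s).toFun x : Π₀ i, (N i).carrier) i = (x : Π₀ i, (N i).carrier) i := by
  classical exact DFinsupp.filter_apply_pos (p := (· ∈ s)) x h

theorem dmask_notMem {s : Set ι} {i : ι} (h : i ∉ s) (x : (dsum N).carrier) :
    ((dmask N s).toFun x : Π₀ i, (N i).carrier) i = 0 := by
  classical exact DFinsupp.filter_apply_neg (p := (· ∈ s)) x h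

end DSum

/-! ### Cones -/

/-- The inclusion of the target into the cone. -/
def coneι {M N : DGMod A} (f : M ⟶ N) : N ⟶ cone f where
  toFun := LinearMap.inl K _ _
  map_mem i x hx := ⟨hx, zero_mem _⟩
  map_d x := Prod.ext (by change N.d x = N.d x + f.toFun 0; simp)
    (by change (0 : M.carrier) = -M.d 0; simp)
  map_act x a := Prod.ext rfl (by change (0 : M.carrier) = M.act.toFun 0 a; simp)

theorem cone_d {M N : DGMod A} (f : M ⟶ N) (n : N.carrier) (m : M.carrier) :
    (cone f).d (n, m) = (N.d n + f.toFun m, -M.d m) := rfl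

/-- For a cocycle `(n, m)`, injectivity on cohomology makes `m` a coboundary `d m1`; then `n + f m1`
is a cocycle of `N`, and surjectivity on cohomology writes it as `f m2 + d n2`. The primitive is
`(n2, m2 - m1)`. -/
theorem QI.acyc_cone {M N : DGMod A} {f : M ⟶ N} (h : QI f.toFun) : Acyc (cone f).toDGVect := by
  rintro ⟨n, m⟩ hx
  have h1 : N.d n + f.toFun m = 0 := congrArg Prod.fst hx
  have h2 : M.d m = 0 := neg_eq_zero.1 (congrArg Prod.snd hx)
  obtain ⟨m1, rfl⟩ := h.1 m h2 (-n) (by rw [map_neg]; exact eq_neg_of_add_eq_zero_right h1)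
  obtain ⟨m2, n2, hm2, hn⟩ := h.2 (n + f.toFun m1) (by rw [map_add, ← f.map_d, h1])
  refine ⟨(n2, m2 - m1), ?_⟩
  rw [cone_d, map_sub, map_sub, hm2]
  refine Prod.ext ?_ ?_
  · change n = _
    rw [eq_sub_of_add_eq hn]; abel
  · change M.d m1 = _
    abel

/-- The morphism of cones given by a square commuting up to homotopy. -/
def coneMap {M N M' N' : DGMod A} (f' : M' ⟶ N') (f : M ⟶ N) (p : M' ⟶ M) (q : N' ⟶ N)
    (h : M'.carrier →ₗ[K] N.carrier) (hh : IsGr (-1) h)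
    (e : ∀ x, q.toFun (f'.toFun x) = f.toFun (p.toFun x) + (N.d (h x) + h (M'.d x))) :
    cone f' ⟶ cone f where
  toFun := (q.toFun ∘ₗ LinearMap.fst K _ _ + h ∘ₗ LinearMap.snd K _ _).prod
    (p.toFun ∘ₗ LinearMap.snd K _ _)
  map_mem := by
    rintro i ⟨r, x⟩ ⟨hr, hx⟩
    refine ⟨add_mem (q.map_mem i _ hr) ?_, p.map_mem _ _ hx⟩
    have := hh.mem hx
    rwa [add_neg_cancel_right] at this
  map_d := by
    rintro ⟨r, x⟩
    refine Prod.ext ?_ ?_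
    · change q.toFun (N'.d r + f'.toFun x) + h (-M'.d x) = N.d (q.toFun r + h x) +
        f.toFun (p.toFun x)
      rw [map_add, map_add, e, q.map_d, map_neg]; abel
    · change p.toFun (-M'.d x) = -M.d (p.toFun x)
      rw [map_neg, p.map_d]
  map_act := by
    rintro ⟨r, x⟩ a
    refine Prod.ext ?_ ?_
    · change q.toFun (N'.act.toFun r a) + h (M'.act.toFun x a) = N.act.toFun (q.toFun r + h x) a
      rw [q.map_act, hh.act, map_add, LinearMap.add_apply]
    · exact p.map_act x a

theorem coneι_coneMap {M N M' N' : DGMod A} (f' : M' ⟶ N') (f : M ⟶ N) (p : M' ⟶ M) (q : N' ⟶ N)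
    (h : M'.carrier →ₗ[K] N.carrier) (hh : IsGr (-1) h)
    (e : ∀ x, q.toFun (f'.toFun x) = f.toFun (p.toFun x) + (N.d (h x) + h (M'.d x))) :
    coneι f' ≫ coneMap f' f p q h hh e = q ≫ coneι f := by
  refine hom_ext fun x => Prod.ext ?_ ?_
  · change q.toFun x + h 0 = q.toFun x; simp
  · change p.toFun 0 = 0; simp

/-- This is the five lemma for the long exact sequences of the two cones, carried out on elements.
-/
theorem coneMap_QI {M N M' N' : DGMod A} (f' : M' ⟶ N') (f : M ⟶ N) (p : M' ⟶ M) (q : N' ⟶ N)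
    (h : M'.carrier →ₗ[K] N.carrier) (hh : IsGr (-1) h)
    (e : ∀ x, q.toFun (f'.toFun x) = f.toFun (p.toFun x) + (N.d (h x) + h (M'.d x)))
    (hp : QI p.toFun) (hq : QI q.toFun) : QI (coneMap f' f p q h hh e).toFun := by
  constructor
  · rintro ⟨r, x⟩ hd ⟨n, m⟩ hy
    have hd1 : N'.d r + f'.toFun x = 0 := congrArg Prod.fst hd
    have hd2 : M'.d x = 0 := neg_eq_zero.1 (congrArg Prod.snd hd)
    have hy1 : q.toFun r + h x = N.d n + f.toFun m := congrArg Prod.fst hy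
    have hy2 : p.toFun x = -M.d m := congrArg Prod.snd hy
    obtain ⟨x0, rfl⟩ := hp.1 x hd2 (-m) (by rw [map_neg, hy2])
    obtain ⟨x2, m', hx2, hm'⟩ := hp.2 (p.toFun x0 + m) (by
      rw [map_add, ← p.map_d, hy2]; abel)
    have e1 : p.toFun (x0 - x2) + m = M.d m' := by
      rw [map_sub, sub_add_eq_add_sub, hm']; abel
    have e2 : M'.d (x0 - x2) = M'.d x0 := by rw [map_sub, hx2, sub_zero]
    -- The primitive `x0` of `x` is only determined up to a cocycle. Replacing it by `x0 - x2` makes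
    -- `p x1 + m` a coboundary, which is what the `N`-component needs.
    rw [← e2] at hd1 hy1 ⊢
    generalize x0 - x2 = x1 at e1 e2 hd1 hy1 ⊢
    obtain ⟨r'', hr''⟩ := hq.1 (r + f'.toFun x1) (by rw [map_add, ← f'.map_d, hd1])
      (n + f.toFun m' + h x1) (by
        rw [map_add, e, map_add, map_add, ← f.map_d, ← e1, map_add]
        rw [eq_sub_of_add_eq hy1]; abel)
    refine ⟨(r'', -x1), ?_⟩
    rw [cone_d, map_neg, map_neg, ← hr'']
    refine Prod.ext ?_ ?_
    · change r = _; abel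
    · change M'.d x1 = _; abel
  · rintro ⟨n, m⟩ hd
    have hd1 : N.d n + f.toFun m = 0 := congrArg Prod.fst hd
    have hd2 : M.d m = 0 := neg_eq_zero.1 (congrArg Prod.snd hd)
    obtain ⟨x, m', hx, rfl⟩ := hp.2 m hd2
    have e1 : N.d (n + f.toFun m') + f.toFun (p.toFun x) = 0 := by
      rw [← hd1, map_add, map_add, ← f.map_d]; abel
    -- Now `(-r1, x)` is a cocycle of the source cone with the right second component; the remaining
    -- discrepancy is a cocycle of `N`, which is removed by surjectivity of `q` on cohomology.
    obtain ⟨r1, hr1⟩ := hq.1 (f'.toFun x) (by rw [← f'.map_d, hx, map_zero])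
      (-(n + f.toFun m') + h x) (by
        rw [e, hx, map_zero, map_add, map_neg, eq_neg_of_add_eq_zero_left e1]; abel)
    obtain ⟨r2, n2, hr2, hn2⟩ := hq.2 (q.toFun r1 + (n + f.toFun m') - h x) (by
      rw [map_sub, map_add, ← q.map_d, ← hr1, e, hx, map_zero, eq_neg_of_add_eq_zero_left e1]; abel)
    refine ⟨(r2 - r1, x), (n2, -m'), ?_, ?_⟩
    · rw [cone_d, map_sub, hr2, ← hr1, hx]
      refine Prod.ext ?_ ?_
      · change 0 - f'.toFun x + f'.toFun x = 0; abel
      · change -(0 : M'.carrier) = 0; simp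
    · refine Prod.ext ?_ ?_
      · change n = q.toFun (r2 - r1) + h x + (N.d n2 + f.toFun (-m'))
        rw [map_sub, map_neg]
        have : n = q.toFun r2 + N.d n2 - q.toFun r1 - f.toFun m' + h x := by rw [← hn2]; abel
        nth_rewrite 1 [this]
        abel
      · change p.toFun x + M.d m' = p.toFun x + -M.d (-m')
        rw [map_neg, neg_neg]

/-- For a short exact sequence, the cone of the inclusion is quasi-isomorphic to the quotient. -/
theorem exists_coneDesc_QI {W V Z : DGMod A} (i : W ⟶ V) (p : V ⟶ Z)
    (hi : Function.Injective i.toFun) (hp : Function.Surjective p.toFun)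
    (hip : ∀ x, p.toFun x = 0 ↔ ∃ w, i.toFun w = x) :
    ∃ g : cone i ⟶ Z, QI g.toFun := by
  have h0 : ∀ w, p.toFun (i.toFun w) = 0 := fun w => (hip _).2 ⟨w, rfl⟩
  -- The map is `(v, w) ↦ p v`, which commutes with the differentials because `p ∘ i = 0`. The two
  -- chases replace the remark that its kernel is the cone of an isomorphism.
  refine ⟨⟨p.toFun ∘ₗ LinearMap.fst K _ _, fun n x hx => p.map_mem n _ hx.1, ?_,
    fun x a => p.map_act _ _⟩, ?_, ?_⟩
  · rintro ⟨v, w⟩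
    change p.toFun (V.d v + i.toFun w) = Z.d (p.toFun v)
    rw [map_add, h0, add_zero, p.map_d]
  · rintro ⟨v, w⟩ hd z hz
    have hd1 : V.d v + i.toFun w = 0 := congrArg Prod.fst hd
    change p.toFun v = Z.d z at hz
    obtain ⟨v', rfl⟩ := hp z
    obtain ⟨w', hw'⟩ := (hip (v - V.d v')).1 (by rw [map_sub, hz, p.map_d, sub_self])
    have e : V.d v' + i.toFun w' = v := by rw [hw']; abel
    refine ⟨(v', w'), ?_⟩
    rw [cone_d, e]
    refine Prod.ext rfl (hi ?_)
    change i.toFun w = i.toFun (-W.d w')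
    rw [map_neg, i.map_d, eq_neg_of_add_eq_zero_right hd1, ← e, map_add, V.d_d, zero_add]
  · intro z hz
    obtain ⟨v, rfl⟩ := hp z
    obtain ⟨w, hw⟩ := (hip (V.d v)).1 (by rw [p.map_d, hz])
    refine ⟨(v, -w), 0, ?_, by rw [map_zero, add_zero]; rfl⟩
    rw [cone_d]
    refine Prod.ext ?_ (hi ?_)
    · change V.d v + i.toFun (-w) = 0
      rw [map_neg, hw]; abel
    · change i.toFun (-W.d (-w)) = i.toFun 0
      simp [i.map_d, hw, V.d_d]

end DGMod

end Graded

/-! ### Morphisms of the derived category: homotopies, K-projective and semifree modules -/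

section Derived2

variable {K : Type u} [Field K] {A : DGAlg K}

namespace DGMod

theorem isIso_Q {M N : DGMod A} (f : M ⟶ N) (h : QI f.toFun) : IsIso ((toDCat A).map f) :=
  MorphismProperty.Q_inverts _ f ((quasiIso_iff f).2 h)

theorem QI_id (M : DGMod A) : QI (𝟙 M : M ⟶ M).toFun :=
  ⟨fun _ _ y hy => ⟨y, hy⟩, fun y hy => ⟨y, 0, hy, by simp [id_apply]⟩⟩

/-- The inclusion of the first summand. -/
def prodInl (M N : DGMod A) : M ⟶ prod M N where
  toFun := LinearMap.inl K _ _
  map_mem i x hx := ⟨hx, zero_mem _⟩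
  map_d x := Prod.ext rfl (map_zero N.d).symm
  map_act x a := Prod.ext rfl (by
    change (0 : N.carrier) = N.act.toFun 0 a
    rw [map_zero, LinearMap.zero_apply])

/-- The inclusion of the second summand. -/
def prodInr (M N : DGMod A) : N ⟶ prod M N where
  toFun := LinearMap.inr K _ _
  map_mem i x hx := ⟨zero_mem _, hx⟩
  map_d x := Prod.ext (map_zero M.d).symm rfl
  map_act x a := Prod.ext (by
    change (0 : M.carrier) = M.act.toFun 0 a
    rw [map_zero, LinearMap.zero_apply]) rfl

/-- The projection to the first summand. -/
def prodFst (M N : DGMod A) : prod M N ⟶ M :=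
  ⟨LinearMap.fst K _ _, fun _ _ h => h.1, fun _ => rfl, fun _ _ => rfl⟩

/-- The projection to the second summand. -/
def prodSnd (M N : DGMod A) : prod M N ⟶ N :=
  ⟨LinearMap.snd K _ _, fun _ _ h => h.2, fun _ => rfl, fun _ _ => rfl⟩

theorem QI_prodInl (M N : DGMod A) (h : Acyc N.toDGVect) : QI (prodInl M N).toFun := by
  constructor
  · rintro x - ⟨m, n⟩ hy
    exact ⟨m, congrArg Prod.fst hy⟩
  · rintro ⟨m, n⟩ hy
    have h1 : M.d m = 0 := congrArg Prod.fst hy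
    obtain ⟨n', rfl⟩ := h n (congrArg Prod.snd hy)
    refine ⟨m, (0, n'), h1, Prod.ext ?_ ?_⟩
    · change m = m + M.d 0
      rw [map_zero, add_zero]
    · change N.d n' = 0 + N.d n'
      rw [zero_add]

/-- The morphism out of a cone given by a morphism `k` and a null-homotopy of `f ≫ k`. -/
def coneDesc {M N Y : DGMod A} (f : M ⟶ N) (k : N ⟶ Y) (h : M.carrier →ₗ[K] Y.carrier)
    (hh : IsGr (-1) h) (e : ∀ x, k.toFun (f.toFun x) = Y.d (h x) + h (M.d x)) : cone f ⟶ Y where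
  toFun := k.toFun ∘ₗ LinearMap.fst K _ _ + h ∘ₗ LinearMap.snd K _ _
  map_mem := by
    rintro i ⟨r, x⟩ ⟨hr, hx⟩
    refine add_mem (k.map_mem i _ hr) ?_
    have := hh.mem hx
    rwa [add_neg_cancel_right] at this
  map_d := by
    rintro ⟨r, x⟩
    change k.toFun (N.d r + f.toFun x) + h (-M.d x) = Y.d (k.toFun r + h x)
    rw [map_add, map_add, e x, k.map_d, map_neg]; abel
  map_act := by
    rintro ⟨r, x⟩ a
    change k.toFun (N.act.toFun r a) + h (M.act.toFun x a) = Y.act.toFun (k.toFun r + h x) a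
    rw [k.map_act, hh.act, map_add, LinearMap.add_apply]

theorem coneι_coneDesc {M N Y : DGMod A} (f : M ⟶ N) (k : N ⟶ Y)
    (h : M.carrier →ₗ[K] Y.carrier) (hh : IsGr (-1) h)
    (e : ∀ x, k.toFun (f.toFun x) = Y.d (h x) + h (M.d x)) :
    coneι f ≫ coneDesc f k h hh e = k := hom_ext fun x => by
  change k.toFun x + h 0 = k.toFun x
  rw [map_zero, add_zero]

/-- The homotopy extends `f - g` to a map `ψ` on the acyclic module `cone (𝟙 M)`. The projection `p`
from `N ⊕ cone (𝟙 M)` to `N` and its modification `p'` by `ψ` agree on the summand `N`, whose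
inclusion is a quasi-isomorphism, so they become equal in the derived category. Composition with one
map `j` from `M` turns them into `g` and `f`. -/
theorem Htpy.Q_eq {M N : DGMod A} {f g : M ⟶ N} (H : Htpy f g) :
    (toDCat A).map f = (toDCat A).map g := by
  obtain ⟨h, hh, e⟩ := H
  let ψ : cone (𝟙 M) ⟶ N := coneDesc (𝟙 M) (f - g) h hh fun x => by
    rw [id_apply, sub_apply, e]; abel
  let i := prodInl N (cone (𝟙 M))
  let p := prodFst N (cone (𝟙 M))
  let p' := p + prodSnd N (cone (𝟙 M)) ≫ ψ
  have hi : IsIso ((toDCat A).map i) := isIso_Q _ (QI_prodInl _ _ (QI.acyc_cone (QI_id M)))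
  have h1 : i ≫ p = 𝟙 _ := rfl
  have h2 : i ≫ p' = 𝟙 _ := hom_ext fun x => by
    change x + ψ.toFun 0 = x
    rw [map_zero, add_zero]
  have h3 : (toDCat A).map p = (toDCat A).map p' := by
    rw [← cancel_epi ((toDCat A).map i), ← Functor.map_comp, ← Functor.map_comp, h1, h2]
  -- The component of `j` in the cone is the canonical inclusion of `M`, on which `ψ` is `f - g`.
  let j : M ⟶ prod N (cone (𝟙 M)) := g ≫ i + coneι (𝟙 M) ≫ prodInr _ _
  have h4 : j ≫ p = g := hom_ext fun x => by
    change g.toFun x + 0 = g.toFun x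
    rw [add_zero]
  have h5 : j ≫ p' = f := hom_ext fun x => by
    change (g.toFun x + 0) + ((f - g).toFun (0 + x) + h (0 + 0)) = f.toFun x
    rw [zero_add, zero_add, map_zero, sub_apply]; abel
  rw [← h5, ← h4, Functor.map_comp, Functor.map_comp, h3]

/-! ### K-projective modules -/

/-- Every graded cocycle `P → C`, with `C` acyclic, is a coboundary. -/
def KProj (P : DGMod A) : Prop :=
  ∀ C : DGMod A, Acyc C.toDGVect → ∀ (r : ℤ) (φ : P.carrier →ₗ[K] C.carrier), IsGr r φ →
    (∀ x, C.d (φ x) = sg K r • φ (P.d x)) →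
    ∃ H : P.carrier →ₗ[K] C.carrier, IsGr (r - 1) H ∧
      ∀ x, φ x = C.d (H x) + sg K r • H (P.d x)

/-- The composite of `g` with the inclusion of `N'` into the acyclic `cone q` is a coboundary. In
the cone, `N` is shifted by one, so the `N`-component of a primitive `H` of degree `-1` has degree
`0` and is the lift; the `N'`-component is, up to sign, the homotopy. -/
theorem KProj.exists_lift {P : DGMod A} (hP : KProj P) {N N' : DGMod A} (q : N ⟶ N')
    (hq : QI q.toFun) (g : P ⟶ N') : ∃ g' : P ⟶ N, Htpy (g' ≫ q) g := by
  obtain ⟨H, hH, e⟩ := hP (cone q) (QI.acyc_cone hq) 0 (LinearMap.inl K _ _ ∘ₗ g.toFun)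
    (g.isGr.comp (coneι q).isGr (by simp)) (fun x => by
      rw [sg_zero, one_smul]
      change (cone q).d ((coneι q).toFun (g.toFun x)) = (coneι q).toFun (g.toFun (P.d x))
      rw [← (coneι q).map_d, g.map_d])
  simp only [sg_zero, one_smul] at e
  have e1 : ∀ x, g.toFun x = N'.d (H x).1 + q.toFun (H x).2 + (H (P.d x)).1 :=
    fun x => congrArg Prod.fst (e x)
  have e2 : ∀ x, (0 : N.carrier) = -N.d (H x).2 + (H (P.d x)).2 :=
    fun x => congrArg Prod.snd (e x)
  refine ⟨⟨LinearMap.snd K _ _ ∘ₗ H, ?_, ?_, fun x a => congrArg Prod.snd (hH.act x a)⟩,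
    -(LinearMap.fst K _ _ ∘ₗ H), ⟨?_, fun x a => ?_⟩, ?_⟩
  · intro i x hx
    have := (hH.mem hx).2
    change (H x).2 ∈ N.deg (i + (0 - 1) + 1) at this
    rwa [show i + (0 - 1) + 1 = i by ring] at this
  · intro x
    change (H (P.d x)).2 = N.d (H x).2
    exact (neg_add_eq_zero.1 (e2 x).symm).symm
  · intro i x hx
    have := (hH.mem hx).1
    rw [zero_sub] at this
    exact neg_mem this
  · have : (H (P.act.toFun x a)).1 = N'.act.toFun (H x).1 a := congrArg Prod.fst (hH.act x a)
    change -(H (P.act.toFun x a)).1 = N'.act.toFun (-(H x).1) a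
    rw [this, map_neg, LinearMap.neg_apply]
  · intro x
    change q.toFun (H x).2 = g.toFun x + (N'.d (-(H x).1) + -(H (P.d x)).1)
    rw [e1, map_neg]; abel

/-- The pair `(-h, f - f')` is a cocycle of degree `-1` with values in `cone q`. Up to sign, the
`N`-component of a primitive of it is the required homotopy. -/
theorem KProj.htpy_of_comp {P : DGMod A} (hP : KProj P) {N N' : DGMod A} (q : N ⟶ N')
    (hq : QI q.toFun) {f f' : P ⟶ N} (H : Htpy (f ≫ q) (f' ≫ q)) : Htpy f f' := by
  obtain ⟨h, hh, e⟩ := H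
  have e' : ∀ x, q.toFun (f.toFun x) = q.toFun (f'.toFun x) + (N'.d (h x) + h (P.d x)) := e
  obtain ⟨H, hH, eH⟩ := hP (cone q) (QI.acyc_cone hq) (-1) ((-h).prod (f - f').toFun)
    ⟨fun {i x} hx => ⟨hh.neg.mem hx, by
      have := (f - f').map_mem i x hx
      change _ ∈ N.deg (i + -1 + 1)
      rwa [neg_add_cancel_right]⟩, fun x a => Prod.ext (hh.neg.act x a) ((f - f').map_act x a)⟩
    (fun x => by
      rw [sg_neg_one, neg_one_smul]
      refine Prod.ext ?_ ?_
      · change N'.d (-h x) + q.toFun ((f - f').toFun x) = - -h (P.d x)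
        rw [sub_apply, map_sub, e', map_neg]; abel
      · change -N.d ((f - f').toFun x) = -(f - f').toFun (P.d x)
        rw [(f - f').map_d])
  simp only [sg_neg_one, neg_one_smul] at eH
  have e2 : ∀ x, (f - f').toFun x = -N.d (H x).2 + -(H (P.d x)).2 :=
    fun x => congrArg Prod.snd (eH x)
  refine ⟨-(LinearMap.snd K _ _ ∘ₗ H), ⟨?_, fun x a => ?_⟩, ?_⟩
  · intro i x hx
    have := (hH.mem hx).2
    change (H x).2 ∈ N.deg (i + (-1 - 1) + 1) at this
    rw [show i + (-1 - 1) + 1 = i + -1 by ring] at this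
    exact neg_mem this
  · have : (H (P.act.toFun x a)).2 = N.act.toFun (H x).2 a := congrArg Prod.snd (hH.act x a)
    change -(H (P.act.toFun x a)).2 = N.act.toFun (-(H x).2) a
    rw [this, map_neg, LinearMap.neg_apply]
  · intro x
    have := e2 x
    rw [sub_apply] at this
    change f.toFun x = f'.toFun x + (N.d (-(H x).2) + -(H (P.d x)).2)
    rw [map_neg, ← this]; abel

/-- The module underlying an object of the derived category. -/
def ob (X : DCat A) : DGMod A := (Localization.Construction.objEquiv (quasiIso A)).symm X

theorem Q_ob (X : DCat A) : (toDCat A).obj (ob X) = X := rfl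

/-- The morphisms `X ⟶ Y` of the derived category for which the composite with each map from `P` to
`X` comes from a map to `Y` are closed under composition. They contain the images of morphisms of
modules and, by `KProj.exists_lift`, the formal inverses of quasi-isomorphisms, and these generate
all morphisms. -/
theorem KProj.full {P N : DGMod A} (hP : KProj P) (g : (toDCat A).obj P ⟶ (toDCat A).obj N) :
    ∃ β : P ⟶ N, (toDCat A).map β = g := by
  let W : MorphismProperty (DCat A) := fun X Y g =>
    ∀ α : P ⟶ ob X, ∃ β : P ⟶ ob Y,
      (toDCat A).map α ≫ (show (toDCat A).obj (ob X) ⟶ (toDCat A).obj (ob Y) from g) =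
        (toDCat A).map β
  have hcomp : W.IsStableUnderComposition := by
    refine ⟨fun f g hf hg α => ?_⟩
    obtain ⟨β, hβ⟩ := hf α
    obtain ⟨γ, hγ⟩ := hg β
    refine ⟨γ, ?_⟩
    rw [← hγ, ← hβ]
    exact (Category.assoc _ _ _).symm
  have h : W = ⊤ := by
    refine Localization.Construction.morphismProperty_eq_top W ?_ ?_
    · intro X Y f α
      exact ⟨α ≫ f, ((toDCat A).map_comp α f).symm⟩
    · intro X Y w hw α
      obtain ⟨β, hβ⟩ := hP.exists_lift w ((quasiIso_iff w).1 hw) (show P ⟶ Y from α)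
      refine ⟨β, ?_⟩
      have h1 : (toDCat A).map (show P ⟶ Y from α) = (toDCat A).map β ≫ (toDCat A).map w := by
        rw [← Functor.map_comp, hβ.Q_eq]
      change (toDCat A).map (show P ⟶ Y from α) ≫ (Localization.Construction.wIso w hw).inv = _
      exact (Iso.comp_inv_eq (Localization.Construction.wIso w hw)).2 h1
  have hg : W g := by rw [h]; trivial
  obtain ⟨β, hβ⟩ := hg (𝟙 P)
  refine ⟨β, hβ.symm.trans ?_⟩
  exact (congrArg (· ≫ g) ((toDCat A).map_id P)).trans (Category.id_comp g)

/-- The functor of homotopy classes of morphisms from `P`. -/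
def htpyFunctor (P : DGMod A) : DGMod A ⥤ Type u where
  obj N := Quot (Htpy (M := P) (N := N))
  map f := TypeCat.ofHom (Quot.map (· ≫ f) fun _ _ h => h.comp_right f)
  map_id N := by
    ext x
    induction x using Quot.inductionOn
    rfl
  map_comp f g := by
    ext x
    induction x using Quot.inductionOn
    rfl

theorem htpy_of_quot_eq {P N : DGMod A} {f g : P ⟶ N}
    (h : Quot.mk (Htpy (M := P) (N := N)) f = Quot.mk _ g) : Htpy f g := by
  rw [Quot.eq] at h
  induction h with
  | rel _ _ h => exact h
  | refl _ => exact Htpy.refl _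
  | symm _ _ _ ih => exact ih.symm
  | trans _ _ _ _ _ ih ih' => exact ih.trans ih'

/-- By `KProj.exists_lift` and `KProj.htpy_of_comp`, the functor of homotopy classes of maps from
`P` inverts quasi-isomorphisms, so it factors through the derived category. Applied to the class of
`𝟙 P`, it recovers the homotopy class of a map from its image. -/
theorem KProj.faithful {P N : DGMod A} (hP : KProj P) {f g : P ⟶ N}
    (h : (toDCat A).map f = (toDCat A).map g) : Htpy f g := by
  have hinv : (quasiIso A).IsInvertedBy (htpyFunctor P) := by
    intro M N q hq
    rw [isIso_iff_bijective]
    rw [quasiIso_iff] at hq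
    constructor
    · intro x y hxy
      induction x using Quot.inductionOn with | _ x => ?_
      induction y using Quot.inductionOn with | _ y => ?_
      exact Quot.sound (hP.htpy_of_comp q hq (htpy_of_quot_eq hxy))
    · intro y
      induction y using Quot.inductionOn with | _ y => ?_
      obtain ⟨x, hx⟩ := hP.exists_lift q hq y
      exact ⟨Quot.mk _ x, Quot.sound hx⟩
  have h1 : ∀ k : P ⟶ N, (Localization.Construction.lift (htpyFunctor P) hinv).map
      ((toDCat A).map k) = (htpyFunctor P).map k := fun k => by
    have := Functor.congr_hom (Localization.Construction.fac (htpyFunctor P) hinv) k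
    refine Eq.trans this ?_
    exact (Category.id_comp _).trans (Category.comp_id _)
  have h2 : (htpyFunctor P).map f = (htpyFunctor P).map g := by rw [← h1, ← h1, h]
  have h3 := congrArg (fun k => k (Quot.mk _ (𝟙 P))) h2
  exact htpy_of_quot_eq h3

/-! ### Semifree modules -/

variable (A) in
/-- The free module with generators of degrees `δ x`. -/
abbrev Free (E : Type u) (δ : E → ℤ) : DGMod A := dsum fun x : E => shift (self A) (-δ x)

section Free

variable {E : Type u} {δ : E → ℤ}

variable (A δ) in
/-- The generators of a free module. -/
def gen (x : E) : (Free A E δ).carrier :=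
  (dinj (fun x : E => shift (self A) (-δ x)) x).toFun A.one

theorem gen_mem (x : E) : gen A δ x ∈ (Free A E δ).deg (δ x) := by
  refine (dinj (fun x : E => shift (self A) (-δ x)) x).map_mem _ _ ?_
  change A.one ∈ A.deg (δ x + -δ x)
  rw [add_neg_cancel]
  exact A.one_mem

theorem gen_act (x : E) (a : A.carrier) : (Free A E δ).act.toFun (gen A δ x) a =
    (dinj (fun x : E => shift (self A) (-δ x)) x).toFun a := by
  rw [gen, ← (dinj (fun x : E => shift (self A) (-δ x)) x).map_act]
  congr 1
  exact A.one_mul a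

variable {N : DGMod A}

/-- The `A`-linear map with prescribed values on the generators. -/
def freeLift (v : E → N.carrier) : (Free A E δ).carrier →ₗ[K] N.carrier :=
  dlift fun x => N.act.toFun (v x)

theorem freeLift_inj (v : E → N.carrier) (x : E) (a : A.carrier) :
    freeLift v ((dinj (fun x : E => shift (self A) (-δ x)) x).toFun a) = N.act.toFun (v x) a :=
  dlift_inj (N := fun x : E => shift (self A) (-δ x)) (fun x => N.act.toFun (v x)) x a

theorem freeLift_gen (v : E → N.carrier) (x : E) : freeLift v (gen A δ x) = v x :=
  (freeLift_inj v x _).trans (N.act_one _)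

theorem freeLift_isGr {r : ℤ} {v : E → N.carrier} (hv : ∀ x, v x ∈ N.deg (δ x + r)) :
    IsGr r (freeLift v : (Free A E δ).carrier →ₗ[K] N.carrier) := by
  refine dlift_isGr fun x => ⟨fun {i a} ha => ?_, fun a b => (N.act_mul _ _ _).symm⟩
  have := N.act.mem (hv x) ha
  rwa [show δ x + r + (i + -δ x) = i + r by ring] at this

theorem free_eq_sum (z : (Free A E δ).carrier) :
    ∃ s : Finset E, (∀ x ∉ s, (z : Π₀ _ : E, A.carrier) x = 0) ∧ ∀ t, s ⊆ t →
      z = ∑ x ∈ t, (Free A E δ).act.toFun (gen A δ x) ((z : Π₀ _ : E, A.carrier) x) := by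
  obtain ⟨s, hs0, hs⟩ := dsum_eq_sum z
  refine ⟨s, hs0, fun t ht => ?_⟩
  exact (hs t ht).trans (Finset.sum_congr rfl fun x _ => (gen_act x _).symm)

theorem free_ext {r : ℤ} {f g : (Free A E δ).carrier →ₗ[K] N.carrier} (hf : IsGr r f)
    (hg : IsGr r g) (h : ∀ x, f (gen A δ x) = g (gen A δ x)) (z : (Free A E δ).carrier) :
    f z = g z := by
  refine dsum_lhom_ext (fun x a => ?_) z
  have := gen_act (δ := δ) x a
  rw [← this, hf.act, hg.act, h]

end Free

/-- A semifree structure: a basis of homogeneous elements, with a function `lev` such that the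
differential of a basis element is a linear combination of basis elements of lower level. -/
structure SemiFree (P : DGMod A) where
  E : Type u
  δ : E → ℤ
  lev : E → ℕ
  J : (Free A E δ).carrier ≃ₗ[K] P.carrier
  isGr : IsGr 0 (J : (Free A E δ).carrier →ₗ[K] P.carrier)
  low : ∀ x y, (J.symm (P.d (J (gen A δ x))) : Π₀ _ : E, A.carrier) y ≠ 0 → lev y < lev x

theorem IsGr.symm {M N : DGMod A} {J : M.carrier ≃ₗ[K] N.carrier}
    (h : IsGr 0 (J : M.carrier →ₗ[K] N.carrier)) :
    IsGr 0 (J.symm : N.carrier →ₗ[K] M.carrier) := by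
  constructor
  · intro i x hx
    have h1 := DGVect.proj_degree_map M.toDGVect N.toDGVect 0 _ h.mem i (J.symm x)
    rw [add_zero] at h1 ⊢
    have h2 : M.proj i (J.symm x) = J.symm x := J.injective (by
      refine h1.symm.trans ?_
      change N.proj i (J (J.symm x)) = _
      rw [J.apply_symm_apply, N.proj_same hx])
    change J.symm x ∈ _
    rw [← h2]; exact M.proj_mem _ _
  · intro x a
    refine J.injective ?_
    refine Eq.trans ?_ (h.act _ _).symm
    change J (J.symm _) = N.act.toFun (J (J.symm x)) a
    rw [J.apply_symm_apply, J.apply_symm_apply]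

namespace SemiFree

variable {P : DGMod A} (s : SemiFree P)

/-- The basis elements. -/
def g (x : s.E) : P.carrier := s.J (gen A s.δ x)

theorem g_mem (x : s.E) : s.g x ∈ P.deg (s.δ x) := by
  have := s.isGr.mem (gen_mem (A := A) (δ := s.δ) x)
  rwa [add_zero] at this

theorem J_act (z : (Free A s.E s.δ).carrier) (a : A.carrier) :
    s.J ((Free A s.E s.δ).act.toFun z a) = P.act.toFun (s.J z) a := s.isGr.act z a

/-- The coordinates of an element. -/
def coord (z : P.carrier) : Π₀ _ : s.E, A.carrier := s.J.symm z

theorem J_coord (z : P.carrier) : s.J (s.coord z) = z := s.J.apply_symm_apply z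

theorem coord_J (z : (Free A s.E s.δ).carrier) : s.coord (s.J z) = z := s.J.symm_apply_apply z

theorem exists_sum (z : P.carrier) :
    ∃ t : Finset s.E, (∀ x ∉ t, s.coord z x = 0) ∧ ∀ t', t ⊆ t' →
      z = ∑ x ∈ t', P.act.toFun (s.g x) (s.coord z x) := by
  obtain ⟨t, ht0, ht⟩ := free_eq_sum (s.coord z : (Free A s.E s.δ).carrier)
  refine ⟨t, ht0, fun t' h => ?_⟩
  have := congrArg s.J (ht t' h)
  rw [J_coord, map_sum] at this
  exact this.trans (Finset.sum_congr rfl fun x _ => s.J_act _ _)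

/-- The `A`-linear map with prescribed values on the basis. -/
def lift {N : DGMod A} (v : s.E → N.carrier) : P.carrier →ₗ[K] N.carrier :=
  freeLift v ∘ₗ (s.J.symm : P.carrier →ₗ[K] (Free A s.E s.δ).carrier)

theorem lift_g {N : DGMod A} (v : s.E → N.carrier) (x : s.E) : s.lift v (s.g x) = v x := by
  change freeLift v (s.J.symm (s.J _)) = v x
  rw [s.J.symm_apply_apply, freeLift_gen]

theorem lift_isGr {N : DGMod A} {r : ℤ} {v : s.E → N.carrier}
    (hv : ∀ x, v x ∈ N.deg (s.δ x + r)) : IsGr r (s.lift v) :=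
  s.isGr.symm.comp (freeLift_isGr hv) (zero_add r)

theorem lift_eq_sum {N : DGMod A} {r : ℤ} {v : s.E → N.carrier}
    (hv : ∀ x, v x ∈ N.deg (s.δ x + r)) (z : P.carrier) (t : Finset s.E)
    (ht : z = ∑ x ∈ t, P.act.toFun (s.g x) (s.coord z x)) :
    s.lift v z = ∑ x ∈ t, N.act.toFun (v x) (s.coord z x) := by
  conv_lhs => rw [ht]
  rw [map_sum]
  exact Finset.sum_congr rfl fun x _ => by rw [(s.lift_isGr hv).act, lift_g]

theorem exists_sum_d (x : s.E) :
    ∃ t : Finset s.E, P.d (s.g x) = ∑ y ∈ t, P.act.toFun (s.g y) (s.coord (P.d (s.g x)) y) :=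
  let ⟨t, _, ht⟩ := s.exists_sum (P.d (s.g x))
  ⟨t, ht t subset_rfl⟩

theorem low' (x y : s.E) (h : ¬s.lev y < s.lev x) : s.coord (P.d (s.g x)) y = 0 := by
  by_contra h'
  exact h (s.low x y h')

/-- Propagation of a homotopy identity along the action. -/
theorem htpy_act {C : DGMod A} {r : ℤ} {φ H : P.carrier →ₗ[K] C.carrier} (hφ : IsGr r φ)
    (hH : IsGr (r - 1) H) {i : ℤ} {z : P.carrier} (hz : z ∈ P.deg i)
    (e : φ z = C.d (H z) + sg K r • H (P.d z)) (a : A.carrier) :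
    φ (P.act.toFun z a) = C.d (H (P.act.toFun z a)) + sg K r • H (P.d (P.act.toFun z a)) := by
  rw [hφ.act, e, hH.act, C.d_act (hH.mem hz), P.d_act hz]
  simp only [map_add, map_smul, hH.act, LinearMap.add_apply, LinearMap.smul_apply, smul_add,
    smul_smul]
  have : sg K (i + (r - 1)) = -(sg K r * sg K i) := by
    rw [sg_add, sg_pred]; ring
  rw [this, neg_smul]; abel

/-- The primitive is built on basis elements by recursion on the level. The obstruction at `x` is `φ
(g x) ∓ H (d (g x))`, which involves only values of `H` at lower levels; it is a cocycle, so it has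
a primitive in the acyclic module `C`. -/
theorem kproj (s : SemiFree P) : KProj P := by
  classical
  intro C hC r φ hφ hd
  -- The default value `0` makes the choice of primitives total, so the recursion can be written
  -- down before its arguments are known to be cocycles; the degree is right in both cases.
  let pick : s.E → C.carrier → C.carrier := fun x c =>
    if h : ∃ b ∈ C.deg (s.δ x + (r - 1)), c = C.d b then h.choose else 0
  have pick_mem : ∀ x c, pick x c ∈ C.deg (s.δ x + (r - 1)) := by
    intro x c
    simp only [pick]
    split_ifs with h
    · exact h.choose_spec.1
    · exact zero_mem _
  have pick_d : ∀ x c, c ∈ C.deg (s.δ x + r) → C.d c = 0 → c = C.d (pick x c) := by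
    intro x c hc hc'
    have h : ∃ b ∈ C.deg (s.δ x + (r - 1)), c = C.d b := by
      rw [← add_sub_assoc]; exact hC.exists_deg hc hc'
    simp only [pick]
    rw [dif_pos h]
    exact h.choose_spec.2
  choose T hT using s.exists_sum_d
  -- The recursion cannot refer to `H`, which is defined from all values of `v`. So `H (d (g x))` is
  -- expanded in coordinates, the terms of level not below that of `x` being dropped; they vanish by
  -- `low'`.
  let v : s.E → C.carrier := (measure s.lev).wf.fix fun x rec =>
    pick x (φ (s.g x) - sg K r • ∑ y ∈ T x, if h : s.lev y < s.lev x then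
      C.act.toFun (rec y h) (s.coord (P.d (s.g x)) y) else 0)
  have hv0 : ∀ x, v x = pick x (φ (s.g x) - sg K r • ∑ y ∈ T x, if s.lev y < s.lev x then
      C.act.toFun (v y) (s.coord (P.d (s.g x)) y) else 0) := by
    intro x
    have := (measure s.lev).wf.fix_eq (fun x rec =>
      pick x (φ (s.g x) - sg K r • ∑ y ∈ T x, if h : s.lev y < s.lev x then
        C.act.toFun (rec y h) (s.coord (P.d (s.g x)) y) else 0)) x
    refine this.trans ?_
    congr 4
  have hmem : ∀ x, v x ∈ C.deg (s.δ x + (r - 1)) := fun x => by rw [hv0]; exact pick_mem _ _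
  let H := s.lift v
  have hH : IsGr (r - 1) H := s.lift_isGr hmem
  have hv : ∀ x, v x = pick x (φ (s.g x) - sg K r • H (P.d (s.g x))) := by
    intro x
    rw [hv0, s.lift_eq_sum hmem _ _ (hT x)]
    congr 4
    funext y
    split_ifs with h
    · rfl
    · rw [s.low' x y h, map_zero]
  have key : ∀ n x, s.lev x = n → φ (s.g x) = C.d (H (s.g x)) + sg K r • H (P.d (s.g x)) := by
    intro n
    induction n using Nat.strong_induction_on with
    | _ n ih =>
      intro x hx
      have h1 : φ (P.d (s.g x)) = C.d (H (P.d (s.g x))) := by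
        -- The identity already holds at the lower basis elements occurring in `d (g x)`, hence at
        -- `d (g x)` itself; its last term vanishes because `d ∘ d = 0`.
        have h2 : φ (P.d (s.g x)) = C.d (H (P.d (s.g x))) + sg K r • H (P.d (P.d (s.g x))) := by
          rw [hT x]
          simp only [map_sum, Finset.smul_sum]
          rw [← Finset.sum_add_distrib]
          refine Finset.sum_congr rfl fun y _ => ?_
          by_cases h : s.lev y < s.lev x
          · exact htpy_act hφ hH (s.g_mem y) (ih _ (hx ▸ h) y rfl) _
          · rw [s.low' x y h]; simp
        rw [h2, P.d_d]; simp
      have h3 := pick_d x (φ (s.g x) - sg K r • H (P.d (s.g x))) (by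
        refine sub_mem (hφ.mem (s.g_mem x)) (Submodule.smul_mem _ _ ?_)
        have := hH.mem (P.d_mem (s.g_mem x))
        rwa [show s.δ x + 1 + (r - 1) = s.δ x + r by ring] at this) (by
        rw [map_sub, map_smul, hd, h1, sub_self])
      rw [← hv] at h3
      have h4 : H (s.g x) = v x := s.lift_g v x
      rw [h4, ← h3]; abel
  refine ⟨H, hH, fun z => ?_⟩
  obtain ⟨t, -, ht⟩ := s.exists_sum z
  rw [ht t subset_rfl]
  simp only [map_sum, Finset.smul_sum]
  rw [← Finset.sum_add_distrib]
  exact Finset.sum_congr rfl fun y _ => htpy_act hφ hH (s.g_mem y) (key _ y rfl) _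

end SemiFree

end DGMod

end Derived2

/-! ### Existence of semifree resolutions -/

section Resolution

variable {K : Type u} [Field K] {A : DGAlg K}

namespace DGMod

/-! ### Twisted differentials -/

/-- The module `N` with the differential `d + θ`. -/
@[reducible] def twist (N : DGMod A) (θ : N.carrier →ₗ[K] N.carrier) (hθ : IsGr 1 θ)
    (h : ∀ x, N.d (θ x) + θ (N.d x) + θ (θ x) = 0) : DGMod A where
  carrier := N.carrier
  deg := N.deg
  isInternal := N.isInternal
  d := N.d + θ
  d_mem hx := add_mem (N.d_mem hx) (hθ.mem hx)
  d_d x := by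
    rw [LinearMap.add_apply, LinearMap.add_apply, map_add, map_add, N.d_d, zero_add, ← add_assoc]
    exact h x
  act :=
    { toFun := N.act.toFun
      mem := N.act.mem
      leibniz := by
        intro i x a hx
        change N.d (N.act.toFun x a) + θ (N.act.toFun x a) = N.act.toFun (N.d x + θ x) a +
          sg K i • N.act.toFun x (A.d a)
        rw [N.d_act hx, hθ.act, map_add, LinearMap.add_apply]
        abel }
  act_one := N.act_one
  act_mul := N.act_mul

theorem twist_d {N : DGMod A} {θ : N.carrier →ₗ[K] N.carrier} {hθ : IsGr 1 θ}
    {h : ∀ x, N.d (θ x) + θ (N.d x) + θ (θ x) = 0} (x : N.carrier) :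
    (twist N θ hθ h).d x = N.d x + θ x := rfl

/-- The differential is not `A`-linear, but the two additional Leibniz terms of `d ∘ θ` and `θ ∘ d`
have opposite signs. Thus the condition `(d + θ)² = 0` can be tested on generators. -/
theorem IsGr.anticomm {N : DGMod A} {θ : N.carrier →ₗ[K] N.carrier} (hθ : IsGr 1 θ) :
    IsGr 2 (N.d ∘ₗ θ + θ ∘ₗ N.d) := by
  constructor
  · intro i x hx
    refine add_mem ?_ ?_
    · have := N.d_mem (hθ.mem hx)
      rwa [add_assoc] at this
    · have := hθ.mem (N.d_mem hx)
      rwa [add_assoc] at this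
  · intro x a
    induction x using N.hom_induction with
    | mem i x hx =>
      simp only [LinearMap.add_apply, LinearMap.comp_apply, hθ.act, N.d_act hx,
        N.d_act (hθ.mem hx), map_add, map_smul, sg_succ, neg_smul]
      abel
    | zero => simp
    | add x y hx hy =>
      rw [map_add N.act.toFun, map_add (N.d ∘ₗ θ + θ ∘ₗ N.d) x, map_add N.act.toFun,
        LinearMap.add_apply (N.act.toFun ((N.d ∘ₗ θ + θ ∘ₗ N.d) x)) _ a, ← hx, ← hy,
        LinearMap.add_apply (N.act.toFun x)]
      exact map_add (N.d ∘ₗ θ + θ ∘ₗ N.d) (N.act.toFun x a) (N.act.toFun y a)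

theorem d_one : A.d A.one = 0 := by
  have := A.mul.leibniz A.one A.one_mem
  rw [A.mul_one, A.mul_one, A.one_mul] at this
  simpa using this

theorem free_d_gen {E : Type u} {δ : E → ℤ} (x : E) : (Free A E δ).d (gen A δ x) = 0 := by
  rw [gen, ← (dinj (fun x : E => shift (self A) (-δ x)) x).map_d]
  change (dinj (fun x : E => shift (self A) (-δ x)) x).toFun (sg K (-δ x) • A.d A.one) = 0
  rw [d_one, smul_zero, map_zero]

theorem gen_apply_same {E : Type u} {δ : E → ℤ} (x : E) :
    (gen A δ x : Π₀ _ : E, A.carrier) x = A.one := dinj_same _ x _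

theorem gen_apply_ne {E : Type u} {δ : E → ℤ} {x y : E} (h : y ≠ x) :
    (gen A δ x : Π₀ _ : E, A.carrier) y = 0 := dinj_ne _ h _

/-! ### A map onto `M` from a semifree module, surjective on cocycles -/

section Cover

variable (M : DGMod A)

/-- The set of homogeneous elements. -/
abbrev HomEl : Type u := Σ n : ℤ, M.deg n

open scoped Classical in
/-- The differential of the generator of a homogeneous element. -/
def coverT (x : HomEl M) : (Free A (HomEl M) Sigma.fst).carrier :=
  if M.d x.2.1 = 0 then 0 else gen A Sigma.fst ⟨x.1 + 1, ⟨M.d x.2.1, M.d_mem x.2.2⟩⟩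

theorem coverT_of_d {x : HomEl M} (h : M.d x.2.1 = 0) : coverT M x = 0 := if_pos h

theorem coverT_of_d_ne {x : HomEl M} (h : M.d x.2.1 ≠ 0) :
    coverT M x = gen A Sigma.fst ⟨x.1 + 1, ⟨M.d x.2.1, M.d_mem x.2.2⟩⟩ := if_neg h

theorem coverT_mem (x : HomEl M) :
    coverT M x ∈ (Free A (HomEl M) Sigma.fst).deg (x.1 + 1) := by
  by_cases h : M.d x.2.1 = 0
  · rw [coverT_of_d M h]; exact zero_mem _
  · rw [coverT_of_d_ne M h]
    exact gen_mem (A := A) (δ := (Sigma.fst : HomEl M → ℤ)) ⟨x.1 + 1, ⟨M.d x.2.1, M.d_mem x.2.2⟩⟩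

theorem coverT_isGr : IsGr 1 (freeLift (coverT M) :
    (Free A (HomEl M) Sigma.fst).carrier →ₗ[K] (Free A (HomEl M) Sigma.fst).carrier) :=
  freeLift_isGr (coverT_mem M)

/-- By `IsGr.anticomm` it is enough to look at generators, and there it says that the generator of
the cocycle `d m` has zero twisted differential. -/
theorem coverT_sq (x : (Free A (HomEl M) Sigma.fst).carrier) :
    (Free A (HomEl M) Sigma.fst).d (freeLift (coverT M) x) +
      freeLift (coverT M) ((Free A (HomEl M) Sigma.fst).d x) +
      freeLift (coverT M) (freeLift (coverT M) x) = 0 := by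
  refine free_ext (((coverT_isGr M).anticomm).add ((coverT_isGr M).comp (coverT_isGr M) rfl))
    (IsGr.zero 2) (fun x => ?_) x
  change (Free A (HomEl M) Sigma.fst).d (freeLift (coverT M) (gen A Sigma.fst x)) +
      freeLift (coverT M) ((Free A (HomEl M) Sigma.fst).d (gen A Sigma.fst x)) +
      freeLift (coverT M) (freeLift (coverT M) (gen A Sigma.fst x)) = 0
  rw [free_d_gen, freeLift_gen, map_zero, add_zero]
  by_cases h : M.d x.2.1 = 0
  · rw [coverT_of_d M h, map_zero, map_zero, add_zero]
  · rw [coverT_of_d_ne M h, free_d_gen, freeLift_gen, coverT_of_d M (M.d_d _), add_zero]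

/-- The module with a generator for each homogeneous element `m`, whose differential is the
generator of `d m`. -/
def cover : DGMod A :=
  twist (Free A (HomEl M) Sigma.fst) (freeLift (coverT M)) (coverT_isGr M) (coverT_sq M)

/-- The generators of the cover. -/
def coverGen (x : HomEl M) : (cover M).carrier := gen A Sigma.fst x

theorem coverGen_mem (x : HomEl M) : coverGen M x ∈ (cover M).deg x.1 :=
  gen_mem (A := A) (δ := (Sigma.fst : HomEl M → ℤ)) x

theorem cover_d_gen (x : HomEl M) : (cover M).d (coverGen M x) = coverT M x := by
  change (Free A (HomEl M) Sigma.fst).d (gen A Sigma.fst x) + freeLift (coverT M) (gen A _ x) = _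
  rw [free_d_gen, freeLift_gen, zero_add]

/-- The map from the cover, as a linear map. -/
def coverπL : (Free A (HomEl M) Sigma.fst).carrier →ₗ[K] M.carrier :=
  freeLift fun x : HomEl M => x.2.1

theorem coverπL_gen (x : HomEl M) : coverπL M (gen A Sigma.fst x) = x.2.1 := freeLift_gen _ _

theorem coverπ_isGr : IsGr 0 (coverπL M) :=
  freeLift_isGr fun x => by rw [add_zero]; exact x.2.2

/-- Generic form of: a graded map commuting with the differential on generators is a morphism. -/
theorem commutes_d_act {P N : DGMod A} {f : P.carrier →ₗ[K] N.carrier} (hf : IsGr 0 f) {i : ℤ}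
    {z : P.carrier} (hz : z ∈ P.deg i) (h : f (P.d z) = N.d (f z)) (a : A.carrier) :
    f (P.d (P.act.toFun z a)) = N.d (f (P.act.toFun z a)) := by
  have := hf.mem hz
  rw [add_zero] at this
  rw [P.d_act hz, hf.act, N.d_act this, map_add, map_smul, hf.act, hf.act, h]

/-- The map from the cover. -/
def coverπ : cover M ⟶ M :=
  homOfGr (M := cover M) (coverπL M)
    ⟨(coverπ_isGr M).mem, (coverπ_isGr M).act⟩ fun z => by
    obtain ⟨s, -, hs⟩ := free_eq_sum (A := A) (δ := (Sigma.fst : HomEl M → ℤ)) z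
    rw [hs s subset_rfl]
    refine (congrArg (coverπL M) (map_sum (cover M).d _ _)).trans ?_
    refine (map_sum (coverπL M) _ _).trans ?_
    refine Eq.trans ?_ (congrArg M.d (map_sum (coverπL M) _ _)).symm
    rw [map_sum M.d]
    refine Finset.sum_congr rfl fun x _ => ?_
    refine commutes_d_act (P := cover M) ⟨(coverπ_isGr M).mem, (coverπ_isGr M).act⟩
      (coverGen_mem M x) ?_ _
    rw [cover_d_gen]
    change coverπL M (coverT M x) = M.d (coverπL M (gen A Sigma.fst x))
    rw [coverπL_gen]
    by_cases h : M.d x.2.1 = 0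
    · rw [coverT_of_d M h, h, map_zero]
    · rw [coverT_of_d_ne M h, coverπL_gen]

theorem coverπ_gen (x : HomEl M) : (coverπ M).toFun (coverGen M x) = x.2.1 := coverπL_gen M x

theorem coverπ_surjective (y : M.carrier) : ∃ x, (coverπ M).toFun x = y := by
  obtain ⟨s, hs⟩ := M.exists_sum_proj y
  refine ⟨∑ i ∈ s, coverGen M ⟨i, ⟨M.proj i y, M.proj_mem i y⟩⟩, ?_⟩
  rw [map_sum, ← hs s subset_rfl]
  exact Finset.sum_congr rfl fun i _ => by rw [coverπ_gen, hs s subset_rfl]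

/-- This is what the case distinction in `coverT` is for: the generator attached to a cocycle is
itself a cocycle, rather than having the generator of `0` as its differential. -/
theorem coverπ_surjective_cocycle {y : M.carrier} (hy : M.d y = 0) :
    ∃ x, (cover M).d x = 0 ∧ (coverπ M).toFun x = y := by
  obtain ⟨s, hs⟩ := M.exists_sum_proj y
  refine ⟨∑ i ∈ s, coverGen M ⟨i, ⟨M.proj i y, M.proj_mem i y⟩⟩, ?_, ?_⟩
  · rw [map_sum]
    refine Finset.sum_eq_zero fun i _ => ?_
    rw [cover_d_gen]
    exact coverT_of_d M (x := ⟨i, ⟨M.proj i y, M.proj_mem i y⟩⟩)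
      (by change M.d (M.proj i y) = 0; rw [← M.proj_d, hy, map_zero])
  · rw [map_sum]
    refine Eq.trans (Finset.sum_congr rfl fun i _ => ?_) (hs s subset_rfl)
    rw [coverπ_gen]

end Cover

/-! ### Resolutions -/

/-- A sequence of modules `S n` with maps `π n : C n ⟶ S n`, surjective also on cocycles, and with
`S (n + 1)` the kernel of `π n`. -/
structure Syz (A : DGAlg K) where
  S : ℕ → DGMod A
  C : ℕ → DGMod A
  π : ∀ n, C n ⟶ S n
  surj : ∀ n y, ∃ x, (π n).toFun x = y
  surj_cocycle : ∀ n y, (S n).d y = 0 → ∃ x, (C n).d x = 0 ∧ (π n).toFun x = y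
  ι : ∀ n, S (n + 1) ⟶ C n
  inj : ∀ n, Function.Injective (ι n).toFun
  π_ι : ∀ n x, (π n).toFun ((ι n).toFun x) = 0
  exists_ι : ∀ n x, (π n).toFun x = 0 → ∃ y, (ι n).toFun y = x

section Res

variable (M : Syz A)

/-- The terms of the resolution. -/
abbrev resTerm (i : ULift.{u} ℕ) : DGMod A := shift (M.C i.down) i.down

/-- The maps between the terms of the resolution. -/
def resMap : ∀ n : ℕ, (resTerm M ⟨n⟩).carrier →ₗ[K] (dsum (resTerm M)).carrier
  | 0 => 0
  | n + 1 => (dinj (resTerm M) ⟨n⟩).toFun ∘ₗ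
      ((M.ι n).toFun ∘ₗ (M.π (n + 1)).toFun :
        (M.C (n + 1)).carrier →ₗ[K] (M.C n).carrier)

theorem resMap_succ (n : ℕ) (x : (M.C (n + 1)).carrier) :
    resMap M (n + 1) x = (dinj (resTerm M) ⟨n⟩).toFun
      ((M.ι n).toFun ((M.π (n + 1)).toFun x)) := rfl

theorem resMap_isGr (n : ℕ) : IsGr 1 (resMap M n) := by
  cases n with
  | zero => exact IsGr.zero 1
  | succ n =>
    constructor
    · intro i x hx
      refine (dinj (resTerm M) ⟨n⟩).map_mem (i + 1) _ ?_
      have h := (M.ι n).map_mem _ _ ((M.π (n + 1)).map_mem _ _ hx)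
      have e : i + ((n + 1 : ℕ) : ℤ) = i + 1 + (n : ℤ) := by push_cast; ring
      change _ ∈ (M.C n).deg (i + 1 + (n : ℤ))
      rw [← e]; exact h
    · intro x a
      rw [resMap_succ, resMap_succ, ← (dinj (resTerm M) ⟨n⟩).map_act]
      change (dinj (resTerm M) ⟨n⟩).toFun ((M.ι n).toFun ((M.π (n + 1)).toFun
        ((M.C (n + 1)).act.toFun x a))) = _
      rw [(M.π (n + 1)).map_act, (M.ι n).map_act]

/-- The twisting part of the differential of the resolution. -/
def resθ : (dsum (resTerm M)).carrier →ₗ[K] (dsum (resTerm M)).carrier :=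
  dlift fun i => resMap M i.down

theorem resθ_inj (n : ℕ) (x : (resTerm M ⟨n⟩).carrier) :
    resθ M ((dinj (resTerm M) ⟨n⟩).toFun x) = resMap M n x :=
  dlift_inj (fun i : ULift.{u} ℕ => resMap M i.down) ⟨n⟩ x

theorem resθ_isGr : IsGr 1 (resθ M) := dlift_isGr fun i => resMap_isGr M i.down

/-- The signs of two consecutive shifts are opposite, so the connecting maps, which commute with the
original differentials, anticommute with the shifted ones. -/
theorem resMap_d (n : ℕ) (x : (M.C n).carrier) :
    (dsum (resTerm M)).d (resMap M n x) = -resMap M n ((resTerm M ⟨n⟩).d x) := by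
  cases n with
  | zero =>
    change (dsum (resTerm M)).d 0 = -0
    rw [map_zero, neg_zero]
  | succ n =>
    change _ = -resMap M (n + 1) (sg K ((n + 1 : ℕ) : ℤ) • (M.C (n + 1)).d x)
    rw [map_smul, resMap_succ, resMap_succ, ← (dinj (resTerm M) ⟨n⟩).map_d,
      (M.π (n + 1)).map_d, (M.ι n).map_d]
    change (dinj (resTerm M) ⟨n⟩).toFun (sg K (n : ℤ) • _) = _
    rw [map_smul]
    push_cast
    rw [sg_succ, neg_smul, neg_neg]

/-- The anticommutator vanishes by `resMap_d`, and the square of `θ` vanishes because it contains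
`π` applied to an element of the image of `ι`. -/
theorem resθ_sq (x : (dsum (resTerm M)).carrier) :
    (dsum (resTerm M)).d (resθ M x) + resθ M ((dsum (resTerm M)).d x) + resθ M (resθ M x) = 0 := by
  induction x using dsum_induction with
  | zero => simp
  | single i x =>
    obtain ⟨n⟩ := i
    rw [← (dinj (resTerm M) ⟨n⟩).map_d, resθ_inj, resθ_inj, resMap_d, neg_add_cancel, zero_add]
    cases n with
    | zero =>
      change resθ M 0 = 0
      rw [map_zero]
    | succ n =>
      rw [resMap_succ, resθ_inj]
      cases n with
      | zero => rfl
      | succ n =>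
        rw [resMap_succ, M.π_ι, map_zero, map_zero]
  | add x y hx hy =>
    simp only [map_add]
    rw [← add_zero (0 : (dsum (resTerm M)).carrier)]
    nth_rewrite 1 [← hx]
    rw [← hy]; abel

/-- A semifree resolution of `M`. -/
def res : DGMod A := twist (dsum (resTerm M)) (resθ M) (resθ_isGr M) (resθ_sq M)

/-- The map from the resolution, on the terms. -/
def resAug : ∀ n : ℕ, (M.C n).carrier →ₗ[K] (M.S 0).carrier
  | 0 => (M.π 0).toFun
  | _ + 1 => 0

theorem resAug_isGr (n : ℕ) : IsGr (M := resTerm M ⟨n⟩) (N := M.S 0) 0 (resAug M n) := by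
  cases n with
  | zero => exact ⟨fun {i x} hx => (M.π 0).map_mem _ _ hx, (M.π 0).map_act⟩
  | succ n => exact IsGr.zero 0

/-- The resolution map, as a linear map. -/
def resπL : (dsum (resTerm M)).carrier →ₗ[K] (M.S 0).carrier := dlift fun i => resAug M i.down

theorem resπL_inj (n : ℕ) (x : (M.C n).carrier) :
    resπL M ((dinj (resTerm M) ⟨n⟩).toFun x) = resAug M n x :=
  dlift_inj (fun i : ULift.{u} ℕ => resAug M i.down) ⟨n⟩ x

theorem resπL_isGr : IsGr (M := dsum (resTerm M)) 0 (resπL M) :=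
  dlift_isGr fun i => resAug_isGr M i.down

/-- The resolution map. -/
def resπ : res M ⟶ M.S 0 :=
  homOfGr (M := res M) (resπL M) ⟨(resπL_isGr M).mem, (resπL_isGr M).act⟩ fun x => by
    change resπL M ((dsum (resTerm M)).d x + resθ M x) = (M.S 0).d (resπL M x)
    induction x using dsum_induction with
    | zero => simp
    | single i x =>
      obtain ⟨n⟩ := i
      rw [← (dinj (resTerm M) ⟨n⟩).map_d, resθ_inj, map_add, resπL_inj, resπL_inj]
      cases n with
      | zero =>
        change (M.π 0).toFun (sg K ((0 : ℕ) : ℤ) • (M.C 0).d x) + resπL M 0 =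
          (M.S 0).d ((M.π 0).toFun x)
        rw [Nat.cast_zero, sg_zero, one_smul, map_zero, add_zero]
        exact (M.π 0).map_d x
      | succ n =>
        rw [resMap_succ, resπL_inj]
        change 0 + _ = (M.S 0).d 0
        rw [zero_add, map_zero]
        cases n with
        | zero => exact M.π_ι 0 _
        | succ n => rfl
    | add x y hx hy =>
      rw [map_add (dsum (resTerm M)).d, map_add (resθ M), add_add_add_comm, map_add, hx, hy,
        map_add, map_add]

/-- The components of an element of the resolution. -/
def resC (x : (res M).carrier) (n : ℕ) : (M.C n).carrier :=
  (dpr (resTerm M) ⟨n⟩).toFun x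

/-- The elements of the resolution supported in one component. -/
def resI (n : ℕ) (x : (M.C n).carrier) : (res M).carrier :=
  (dinj (resTerm M) ⟨n⟩).toFun x

theorem resC_I (n : ℕ) (x : (M.C n).carrier) : resC M (resI M n x) n = x :=
  dinj_same (resTerm M) ⟨n⟩ x

theorem resC_I_ne {m n : ℕ} (h : m ≠ n) (x : (M.C n).carrier) :
    resC M (resI M n x) m = 0 :=
  dinj_ne (resTerm M) (fun e => h (congrArg ULift.down e)) x

theorem resC_add (x y : (res M).carrier) (n : ℕ) : resC M (x + y) n = resC M x n + resC M y n :=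
  map_add (dpr (resTerm M) ⟨n⟩).toFun x y

theorem resC_sub (x y : (res M).carrier) (n : ℕ) : resC M (x - y) n = resC M x n - resC M y n :=
  map_sub (dpr (resTerm M) ⟨n⟩).toFun x y

theorem resC_smul (c : K) (x : (res M).carrier) (n : ℕ) : resC M (c • x) n = c • resC M x n :=
  map_smul (dpr (resTerm M) ⟨n⟩).toFun c x

theorem resC_zero (n : ℕ) : resC M 0 n = 0 := map_zero (dpr (resTerm M) ⟨n⟩).toFun

theorem res_ext {x y : (res M).carrier} (h : ∀ n, resC M x n = resC M y n) : x = y :=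
  DFinsupp.ext fun i => h i.down

theorem res_d_I_zero (x : (M.C 0).carrier) :
    (res M).d (resI M 0 x) = resI M 0 ((M.C 0).d x) := by
  change (dsum (resTerm M)).d _ + resθ M _ = _
  rw [resI, ← (dinj (resTerm M) ⟨0⟩).map_d, resθ_inj]
  change _ + 0 = _
  rw [add_zero]
  change (dinj (resTerm M) ⟨0⟩).toFun (sg K ((0 : ℕ) : ℤ) • _) = _
  rw [Nat.cast_zero, sg_zero, one_smul]; rfl

theorem res_d_I_succ (n : ℕ) (x : (M.C (n + 1)).carrier) :
    (res M).d (resI M (n + 1) x) = sg K ((n + 1 : ℕ) : ℤ) • resI M (n + 1) ((M.C (n + 1)).d x) +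
      resI M n ((M.ι n).toFun ((M.π (n + 1)).toFun x)) := by
  change (dsum (resTerm M)).d _ + resθ M _ = _
  rw [resI, ← (dinj (resTerm M) ⟨n + 1⟩).map_d, resθ_inj, resMap_succ]
  change (dinj (resTerm M) ⟨n + 1⟩).toFun (sg K ((n + 1 : ℕ) : ℤ) • _) + _ = _
  rw [map_smul]; rfl

theorem res_induction {motive : (res M).carrier → Prop} (x : (res M).carrier)
    (zero : motive 0) (single : ∀ n x, motive (resI M n x))
    (add : ∀ f g, motive f → motive g → motive (f + g)) : motive x :=
  dsum_induction (N := resTerm M) x zero (fun i => single i.down) add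

theorem resC_d (x : (res M).carrier) (n : ℕ) :
    resC M ((res M).d x) n = sg K (n : ℤ) • (M.C n).d (resC M x n) +
      (M.ι n).toFun ((M.π (n + 1)).toFun (resC M x (n + 1))) := by
  induction x using res_induction with
  | zero =>
    simp only [map_zero, resC_zero, smul_zero, add_zero]
  | single m x =>
    cases m with
    | zero =>
      rw [res_d_I_zero, resC_I_ne M (by omega : n + 1 ≠ 0), map_zero, map_zero, add_zero]
      by_cases h : n = 0
      · subst h; rw [resC_I, resC_I, Nat.cast_zero, sg_zero, one_smul]
      · rw [resC_I_ne M h, resC_I_ne M h, map_zero, smul_zero]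
    | succ m =>
      rw [res_d_I_succ, resC_add, resC_smul]
      by_cases h : n = m
      · subst h
        rw [resC_I_ne M (by omega : n ≠ n + 1), resC_I_ne M (by omega : n ≠ n + 1), resC_I,
          resC_I, map_zero, smul_zero, smul_zero]
      · rw [resC_I_ne M h, resC_I_ne M (by omega : n + 1 ≠ m + 1), map_zero, map_zero]
        by_cases h' : n = m + 1
        · subst h'; rw [resC_I, resC_I]
        · rw [resC_I_ne M h', resC_I_ne M h', map_zero, smul_zero, smul_zero]
  | add x y hx hy =>
    simp only [map_add, resC_add, hx, hy, smul_add]; abel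

theorem resπ_I_zero (x : (M.C 0).carrier) :
    (resπ M).toFun (resI M 0 x) = (M.π 0).toFun x := resπL_inj M 0 x

theorem resπ_I_succ (n : ℕ) (x : (M.C (n + 1)).carrier) :
    (resπ M).toFun (resI M (n + 1) x) = 0 := resπL_inj M (n + 1) x

theorem resπ_eq (x : (res M).carrier) :
    (resπ M).toFun x = (M.π 0).toFun (resC M x 0) := by
  induction x using res_induction with
  | zero =>
    rw [map_zero, resC_zero, map_zero]
  | single m x =>
    cases m with
    | zero => rw [resπ_I_zero, resC_I]
    | succ m => rw [resπ_I_succ, resC_I_ne M (by omega), map_zero]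
  | add x y hx hy => rw [map_add, hx, hy, resC_add, map_add]

/-- Injectivity on cohomology is proved by removing the top component of a cocycle, subtracting a
coboundary, until nothing is left. Surjectivity of the maps `π` on cocycles is what makes this
possible: exactness of the sequence of terms alone would not control the product-like part of the
total complex. Surjectivity on cohomology is this same property at the first step. -/
theorem resπ_QI : QI (resπ M).toFun := by
  constructor
  · have key : ∀ n (x : (res M).carrier), (∀ i, n ≤ i → resC M x i = 0) → (res M).d x = 0 →
        (∃ y, (resπ M).toFun x = (M.S 0).d y) → ∃ x', x = (res M).d x' := by
      intro n
      induction n with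
      | zero =>
        intro x hx _ _
        refine ⟨0, ?_⟩
        rw [map_zero]
        exact res_ext M fun i => by rw [hx i (Nat.zero_le _), resC_zero]
      | succ n ih =>
        intro x hx hd hπ
        have hd' : ∀ m : ℕ, sg K (m : ℤ) • (M.C m).d (resC M x m) +
            (M.ι m).toFun ((M.π (m + 1)).toFun (resC M x (m + 1))) = 0 := by
          intro m; rw [← resC_d, hd, resC_zero]
        have h1 : (M.C n).d (resC M x n) = 0 := by
          have := hd' n
          rw [hx (n + 1) le_rfl, map_zero, map_zero, add_zero] at this
          rw [← sg_smul_smul (K := K) n ((M.C n).d _), this, smul_zero]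
        -- The image in `S n` of the top component is a coboundary. For `n = 0` this is the
        -- hypothesis on the image of `x`.
        have h2 : ∃ y, (M.π n).toFun (resC M x n) = (M.S n).d y := by
          cases n with
          | zero =>
            obtain ⟨y, hy⟩ := hπ
            exact ⟨y, by rw [← hy, resπ_eq]⟩
          | succ m =>
            -- The component `m` of `d x = 0` says that `ι π` of the top component is `d t`, so that
            -- `π t` is a cocycle. Subtracting from `t` a cocycle with the same image gives an
            -- element of the kernel `S (m + 1)`, which is the required primitive.
            let t := -(sg K (m : ℤ) • resC M x m)
            have ht : (M.C m).d t =
                (M.ι m).toFun ((M.π (m + 1)).toFun (resC M x (m + 1))) := by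
              rw [map_neg, map_smul, neg_eq_iff_add_eq_zero, hd' m]
            obtain ⟨t', ht', he⟩ := M.surj_cocycle m ((M.π m).toFun t) (by rw [← Hom.map_d, ht, M.π_ι])
            obtain ⟨y, hy⟩ := M.exists_ι m (t - t') (by rw [map_sub, he, sub_self])
            refine ⟨y, M.inj m ?_⟩
            rw [Hom.map_d, hy, map_sub, ht', sub_zero, ht]
        obtain ⟨y, hy⟩ := h2
        obtain ⟨w, rfl⟩ := M.surj _ y
        obtain ⟨c, hc⟩ := M.exists_ι n (resC M x n - (M.C n).d w) (by
          rw [map_sub, hy, Hom.map_d, sub_self])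
        have hc0 : (M.S (n + 1)).d c = 0 := M.inj n (by
          rw [Hom.map_d, hc, map_sub, h1, DGVect.d_d, sub_zero, map_zero])
        obtain ⟨v, hv, rfl⟩ := M.surj_cocycle (n + 1) _ hc0
        -- The first term produces `d w` in position `n`, its sign undoing that of the shift; the
        -- second produces `ι π v`, which is the rest of the top component, and nothing in position
        -- `n + 1` since `v` is a cocycle.
        let b := sg K (n : ℤ) • resI M n w + resI M (n + 1) v
        obtain ⟨x', hx'⟩ := ih (x - (res M).d b) (by
          intro i hi
          rw [resC_sub, resC_d]
          have hb : ∀ m, resC M b m = sg K (n : ℤ) • resC M (resI M n w) m +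
            resC M (resI M (n + 1) v) m := fun _ => by rw [resC_add, resC_smul]
          rw [hb, hb]
          rcases eq_or_lt_of_le hi with rfl | hi
          · rw [resC_I, resC_I_ne M (by omega : n ≠ n + 1), resC_I, add_zero,
              resC_I_ne M (by omega : n + 1 ≠ n), smul_zero, zero_add, map_smul, sg_smul_smul, hc]
            abel
          · rw [hx i hi, resC_I_ne M (by omega : i ≠ n), resC_I_ne M (by omega : i + 1 ≠ n),
              resC_I_ne M (by omega : i + 1 ≠ n + 1), zero_sub, neg_eq_zero]
            simp only [smul_zero, zero_add, add_zero, map_zero]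
            by_cases h : i = n + 1
            · subst h; rw [resC_I, hv, smul_zero]
            · rw [resC_I_ne M h, map_zero, smul_zero])
          (by rw [map_sub, hd, DGVect.d_d, sub_zero]) (by
            obtain ⟨y, hy⟩ := hπ
            exact ⟨y - (resπ M).toFun b, by rw [map_sub, hy, Hom.map_d, map_sub]⟩)
        exact ⟨x' + b, by rw [map_add, ← hx']; abel⟩
    intro x hx y hy
    obtain ⟨s, hs, -⟩ := dsum_eq_sum (N := resTerm M) x
    refine key (s.sup ULift.down + 1) x (fun i hi => hs ⟨i⟩ fun h => ?_) hx ⟨y, hy⟩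
    have h' : i ≤ s.sup ULift.down := Finset.le_sup (f := ULift.down) h
    omega
  · intro y hy
    obtain ⟨x, hx, rfl⟩ := M.surj_cocycle 0 _ hy
    refine ⟨resI M 0 x, 0, ?_, ?_⟩
    · have := res_d_I_zero M x
      rw [this, hx]
      exact map_zero (dinj (resTerm M) ⟨0⟩).toFun
    · rw [resπ_I_zero, map_zero, add_zero]

end Res

/-- The sequence of iterated kernels. -/
def syzSeq (M : DGMod A) : ℕ → DGMod A
  | 0 => M
  | n + 1 => sub (kerSub (coverπ (syzSeq M n)))

/-- The iterated kernels of a module. -/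
def syz (M : DGMod A) : Syz A where
  S := syzSeq M
  C n := cover (syzSeq M n)
  π n := coverπ (syzSeq M n)
  surj n := coverπ_surjective _
  surj_cocycle n _ := coverπ_surjective_cocycle _
  ι n := subι (kerSub (coverπ (syzSeq M n)))
  inj n := Subtype.val_injective
  π_ι n x := x.2
  exists_ι n x h := ⟨⟨x, h⟩, rfl⟩

/-- The semifree structure of a twisted free module. -/
def SemiFree.twistFree {E : Type u} {δ : E → ℤ}
    (θ : (Free A E δ).carrier →ₗ[K] (Free A E δ).carrier) (hθ : IsGr 1 θ)
    (h : ∀ x, (Free A E δ).d (θ x) + θ ((Free A E δ).d x) + θ (θ x) = 0) (lev : E → ℕ)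
    (low : ∀ x y, (θ (gen A δ x) : Π₀ _ : E, A.carrier) y ≠ 0 → lev y < lev x) :
    SemiFree (twist (Free A E δ) θ hθ h) where
  E := E
  δ := δ
  lev := lev
  J := LinearEquiv.refl K (Free A E δ).carrier
  isGr := ⟨fun {i x} hx => by rw [add_zero]; exact hx, fun _ _ => rfl⟩
  low x y hxy := low x y (by
    have : (twist (Free A E δ) θ hθ h).d (gen A δ x) = θ (gen A δ x) := by
      rw [twist_d, free_d_gen, zero_add]
    rw [← this]; exact hxy)

section DsumTwist

variable {ι : Type u} {C : ι → DGMod A} (t : ∀ i, SemiFree (C i)) (n : ι → ℤ)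

open scoped Classical in
/-- The isomorphism of a free module with a direct sum of shifts of semifree modules. -/
def dsumJ : (Free A (Σ i, (t i).E) fun x => (t x.1).δ x.2 - n x.1).carrier ≃ₗ[K]
    (dsum fun i => shift (C i) (n i)).carrier :=
  (DFinsupp.sigmaCurryLEquiv (M := fun (i : ι) (_ : (t i).E) => A.carrier)).trans
    (DFinsupp.mapRange.linearEquiv fun i => (t i).J)

theorem dsumJ_apply (x : (Free A (Σ i, (t i).E) fun x => (t x.1).δ x.2 - n x.1).carrier) (i : ι) :
    ∃ z : (Free A (t i).E (t i).δ).carrier, (∀ m, (z : Π₀ _ : (t i).E, A.carrier) m =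
        (x : Π₀ _ : (Σ i, (t i).E), A.carrier) ⟨i, m⟩) ∧
      (dsumJ t n x : Π₀ i, (C i).carrier) i = (t i).J z := ⟨_, fun _ => rfl, rfl⟩

theorem dsumJ_symm_apply (x : (dsum fun i => shift (C i) (n i)).carrier) (i : ι) (m : (t i).E) :
    ((dsumJ t n).symm x : Π₀ _ : (Σ i, (t i).E), A.carrier) ⟨i, m⟩ =
      (t i).coord ((x : Π₀ i, (C i).carrier) i) m := rfl

theorem dsumJ_isGr : IsGr 0 (dsumJ t n : (Free A (Σ i, (t i).E) fun x => (t x.1).δ x.2 -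
    n x.1).carrier →ₗ[K] (dsum fun i => shift (C i) (n i)).carrier) := by
  constructor
  · intro r x hx i
    obtain ⟨z, hz, e⟩ := dsumJ_apply t n x i
    refine e ▸ ?_
    have h1 : z ∈ (Free A (t i).E (t i).δ).deg (r + n i) := by
      intro m
      have h1 := hx ⟨i, m⟩
      have h2 : r + -((t i).δ m - n i) = r + n i + -(t i).δ m := by ring
      change (x : Π₀ _ : (Σ i, (t i).E), A.carrier) ⟨i, m⟩ ∈ A.deg (r + -((t i).δ m - n i)) at h1
      rw [h2, ← hz] at h1
      exact h1
    have := (t i).isGr.mem h1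
    rwa [add_right_comm] at this
  · intro x a
    refine DFinsupp.ext fun i => ?_
    obtain ⟨z, hz, e⟩ := dsumJ_apply t n x i
    obtain ⟨z', hz', e'⟩ := dsumJ_apply t n ((Free A (Σ i, (t i).E) fun x => (t x.1).δ x.2 -
      n x.1).act.toFun x a) i
    have h1 : z' = (Free A (t i).E (t i).δ).act.toFun z a := DFinsupp.ext fun m =>
      (hz' m).trans (congrArg (fun y => A.mul.toFun y a) (hz m).symm)
    refine e'.trans ?_
    rw [h1, (t i).J_act]
    exact congrArg (fun y => (C i).act.toFun y a) e.symm

theorem dsumJ_gen (i : ι) (m : (t i).E) : dsumJ t n (gen A _ ⟨i, m⟩) =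
    (dinj (fun i => shift (C i) (n i)) i).toFun ((t i).g m) := by
  rw [← LinearEquiv.eq_symm_apply]
  refine DFinsupp.ext fun ⟨j, m'⟩ => ?_
  rw [dsumJ_symm_apply]
  by_cases h : j = i
  · subst h
    rw [dinj_same, SemiFree.g, SemiFree.coord_J]
    by_cases h' : m' = m
    · subst h'
      rw [gen_apply_same, gen_apply_same]
    · rw [gen_apply_ne h', gen_apply_ne]
      rintro h; cases h; exact h' rfl
  · rw [dinj_ne _ h, gen_apply_ne]
    · exact (DFinsupp.ext_iff.1 (map_zero (t j).J.symm) m').symm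
    · rintro h'; cases h'; exact h rfl

/-- The semifree structure of a twisted direct sum of shifts of semifree modules. -/
def SemiFree.dsumTwist
    (θ : (dsum fun i => shift (C i) (n i)).carrier →ₗ[K] (dsum fun i => shift (C i) (n i)).carrier)
    (hθ : IsGr 1 θ) (h : ∀ x, (dsum fun i => shift (C i) (n i)).d (θ x) +
      θ ((dsum fun i => shift (C i) (n i)).d x) + θ (θ x) = 0) (lev : (Σ i, (t i).E) → ℕ)
    (low : ∀ i x j y, (t j).coord (((twist _ θ hθ h).d ((dinj (fun i => shift (C i) (n i)) i).toFun
      ((t i).g x)) : Π₀ i, (C i).carrier) j) y ≠ 0 → lev ⟨j, y⟩ < lev ⟨i, x⟩) :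
    SemiFree (twist (dsum fun i => shift (C i) (n i)) θ hθ h) where
  E := Σ i, (t i).E
  δ x := (t x.1).δ x.2 - n x.1
  lev := lev
  J := dsumJ t n
  isGr := ⟨(dsumJ_isGr t n).mem, (dsumJ_isGr t n).act⟩
  low x y hxy := low x.1 x.2 y.1 y.2 (by
    rw [← dsumJ_gen, ← dsumJ_symm_apply]; exact hxy)

end DsumTwist

open scoped Classical in
/-- The semifree structure of the cover. -/
def coverSemiFree (M : DGMod A) : SemiFree (cover M) :=
  SemiFree.twistFree (freeLift (coverT M)) (coverT_isGr M) (coverT_sq M)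
    (fun x => if M.d x.2.1 = 0 then 0 else 1) fun x y hxy => by
      rw [freeLift_gen] at hxy
      by_cases h : M.d x.2.1 = 0
      · rw [coverT_of_d M h] at hxy
        exact absurd rfl hxy
      · rw [coverT_of_d_ne M h] at hxy
        rw [if_neg h]
        by_cases hy : y = ⟨x.1 + 1, ⟨M.d x.2.1, M.d_mem x.2.2⟩⟩
        · subst hy
          rw [if_pos (M.d_d _)]
          exact Nat.zero_lt_one
        · exact absurd (gen_apply_ne hy) hxy

theorem coverSemiFree_lev_le (M : DGMod A) (x) : (coverSemiFree M).lev x ≤ 1 := by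
  classical
  unfold coverSemiFree SemiFree.twistFree
  dsimp only
  split_ifs
  · exact Nat.zero_le _
  · exact le_rfl

/-- The semifree structure of the resolution. -/
def resSemiFree (M : Syz A) (t : ∀ n, SemiFree (M.C n)) (ht : ∀ n x, (t n).lev x ≤ 1) :
    SemiFree (res M) :=
  SemiFree.dsumTwist (fun i : ULift.{u} ℕ => t i.down) (fun i => (i.down : ℤ)) (resθ M)
    -- The differential either lowers the internal level or passes from position `n` to position `n
    -- - 1`. Internal levels are at most `1`, so `2 * n + lev` encodes the lexicographic order.
    (resθ_isGr M) (resθ_sq M) (fun x => 2 * x.1.down + (t x.1.down).lev x.2) (by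
      rintro ⟨n⟩ x ⟨m⟩ y h
      change 2 * m + (t m).lev y < 2 * n + (t n).lev x
      have hm := ht m y
      have h1 : (t m).coord (resC M ((res M).d (resI M n ((t n).g x))) m) y ≠ 0 := h
      rw [resC_d] at h1
      have h0 : (t m).coord 0 y = 0 := DFinsupp.ext_iff.1 (map_zero (t m).J.symm) y
      by_cases hmn : m = n
      · subst hmn
        have := (t m).low x y (by
          rw [resC_I, resC_I_ne M (by omega), map_zero, map_zero, add_zero] at h1
          intro h2
          refine h1 ?_
          change ((t m).J.symm (_ • _) : Π₀ _ : (t m).E, A.carrier) y = 0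
          rw [map_smul]
          change sg K m • _ = (0 : A.carrier)
          refine (congrArg (sg K (m : ℤ) • ·) h2).trans (smul_zero _))
        omega
      · by_cases hmn' : n = m + 1
        · omega
        · rw [resC_I_ne M hmn, resC_I_ne M (Ne.symm hmn'), map_zero, map_zero, smul_zero, map_zero,
            add_zero] at h1
          exact absurd h0 h1)

theorem exists_semiFree (M : DGMod A) :
    ∃ (P : DGMod A) (_ : SemiFree P) (p : P ⟶ M), QI p.toFun :=
  ⟨res (syz M), resSemiFree (syz M) (fun n => coverSemiFree (syzSeq M n))
    fun n => coverSemiFree_lev_le (syzSeq M n), resπ (syz M), resπ_QI (syz M)⟩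

end DGMod

end Resolution

/-! ### Coproducts and compact objects of the derived category -/

section Compact

variable {K : Type u} [Field K] {A : DGAlg K}

namespace DGMod

/-! ### Coproducts in the derived category -/

theorem exists_kproj (M : DGMod A) : ∃ (P : DGMod A) (p : P ⟶ M), KProj P ∧ QI p.toFun :=
  let ⟨P, s, p, hp⟩ := exists_semiFree M
  ⟨P, p, s.kproj, hp⟩

/-- No additive structure on the derived category is used: a morphism counts as zero if it is the
image of `0`. Such morphisms absorb composition on the left because every morphism is represented by
a map after resolving its source. -/
theorem comp_Q_zero {M N N' : DGMod A} (f : (toDCat A).obj M ⟶ (toDCat A).obj N) :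
    f ≫ (toDCat A).map (0 : N ⟶ N') = (toDCat A).map 0 := by
  obtain ⟨P, p, hP, hp⟩ := exists_kproj M
  have := isIso_Q p hp
  obtain ⟨β, hβ⟩ := hP.full ((toDCat A).map p ≫ f)
  rw [← cancel_epi ((toDCat A).map p), ← Category.assoc, ← hβ, ← Functor.map_comp,
    ← Functor.map_comp, comp_zero, comp_zero]

theorem kproj_dsum {ι : Type u} {P : ι → DGMod A} (hP : ∀ i, KProj (P i)) : KProj (dsum P) := by
  intro C hC r φ hφ hd
  have h1 : ∀ i, ∃ H : (P i).carrier →ₗ[K] C.carrier, IsGr (r - 1) H ∧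
      ∀ x, φ ((dinj P i).toFun x) = C.d (H x) + sg K r • H ((P i).d x) := fun i =>
    hP i C hC r (φ ∘ₗ (dinj P i).toFun) ((dinj P i).isGr.comp hφ (zero_add r)) fun x => by
      change C.d (φ _) = sg K r • φ _
      rw [hd, (dinj P i).map_d]
  choose H hH e using h1
  refine ⟨dlift H, dlift_isGr hH, fun x => ?_⟩
  refine dsum_lhom_ext (f := φ) (g := C.d ∘ₗ dlift H + sg K r • (dlift H ∘ₗ (dsum P).d))
    (fun i x => ?_) x
  change φ ((dinj P i).toFun x) = C.d (dlift H ((dinj P i).toFun x)) +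
    sg K r • dlift H ((dsum P).d ((dinj P i).toFun x))
  rw [← (dinj P i).map_d, dlift_inj, dlift_inj, e]

/-- Morphisms from the summands are represented by maps from K-projective resolutions, and the
direct sum of these resolutions still resolves the direct sum. -/
theorem exists_dsum_desc {ι : Type u} (N : ι → DGMod A) {V : DGMod A}
    (f : ∀ i, (toDCat A).obj (N i) ⟶ (toDCat A).obj V) :
    ∃ F : (toDCat A).obj (dsum N) ⟶ (toDCat A).obj V,
      ∀ i, (toDCat A).map (dinj N i) ≫ F = f i := by
  choose P p hP hp using fun i => exists_kproj (N i)
  choose β hβ using fun i => (hP i).full ((toDCat A).map (p i) ≫ f i)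
  have := isIso_Q (dmap p) (dmap_QI p hp)
  refine ⟨inv ((toDCat A).map (dmap p)) ≫ (toDCat A).map (ddesc β), fun i => ?_⟩
  have := isIso_Q (p i) (hp i)
  rw [← cancel_epi ((toDCat A).map (p i)), ← hβ, ← Category.assoc, ← Functor.map_comp,
    ← dinj_dmap, Functor.map_comp, Category.assoc, IsIso.hom_inv_id_assoc, ← Functor.map_comp,
    dinj_ddesc]

/-- On K-projective resolutions, equality on each summand is given by homotopies, and these assemble
to one homotopy on the direct sum. -/
theorem dsum_hom_ext_Q {ι : Type u} {N : ι → DGMod A} {V : DGMod A}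
    {F F' : (toDCat A).obj (dsum N) ⟶ (toDCat A).obj V}
    (h : ∀ i, (toDCat A).map (dinj N i) ≫ F = (toDCat A).map (dinj N i) ≫ F') : F = F' := by
  choose P p hP hp using fun i => exists_kproj (N i)
  have := isIso_Q (dmap p) (dmap_QI p hp)
  rw [← cancel_epi ((toDCat A).map (dmap p))]
  obtain ⟨β, hβ⟩ := (kproj_dsum hP).full ((toDCat A).map (dmap p) ≫ F)
  obtain ⟨β', hβ'⟩ := (kproj_dsum hP).full ((toDCat A).map (dmap p) ≫ F')
  rw [← hβ, ← hβ']
  have h1 : ∀ i, Htpy (dinj P i ≫ β) (dinj P i ≫ β') := fun i => (hP i).faithful (by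
    rw [Functor.map_comp, Functor.map_comp, hβ, hβ', ← Category.assoc, ← Category.assoc,
      ← Functor.map_comp, dinj_dmap, Functor.map_comp, Category.assoc, Category.assoc, h])
  choose H hH e using h1
  refine Htpy.Q_eq ⟨dlift H, dlift_isGr hH, fun x => ?_⟩
  refine dsum_lhom_ext (f := β.toFun)
    (g := β'.toFun + (V.d ∘ₗ dlift H + dlift H ∘ₗ (dsum P).d)) (fun i x => ?_) x
  change β.toFun ((dinj P i).toFun x) = β'.toFun ((dinj P i).toFun x) +
    (V.d (dlift H ((dinj P i).toFun x)) + dlift H ((dsum P).d ((dinj P i).toFun x)))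
  rw [← (dinj P i).map_d, dlift_inj, dlift_inj]
  exact e i x

/-- The cofan of the inclusions into a direct sum. -/
def dsumCofan {ι : Type u} (N : ι → DGMod A) : Cofan fun i => (toDCat A).obj (N i) :=
  Cofan.mk ((toDCat A).obj (dsum N)) fun i => (toDCat A).map (dinj N i)

/-- Direct sums are coproducts in the derived category. -/
def isColimitDsumCofan {ι : Type u} (N : ι → DGMod A) : IsColimit (dsumCofan N) :=
  mkCofanColimit _ (fun c => (exists_dsum_desc (V := ob c.pt) N fun i => c.inj i).choose)
    (fun c => (exists_dsum_desc (V := ob c.pt) N fun i => c.inj i).choose_spec)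
    fun c m hm => dsum_hom_ext_Q (V := ob c.pt) fun i => (hm i).trans
      ((exists_dsum_desc (V := ob c.pt) N fun i => c.inj i).choose_spec i).symm

/-! ### Compact modules -/

theorem dmask_comp {ι : Type u} (N : ι → DGMod A) (s t : Set ι) :
    dmask N s ≫ dmask N t = dmask N (s ∩ t) := by
  refine hom_ext fun x => DFinsupp.ext fun i => ?_
  rw [comp_apply]
  by_cases ht : i ∈ t
  · rw [dmask_mem N ht]
    by_cases hs : i ∈ s
    · rw [dmask_mem N hs, dmask_mem N (s := s ∩ t) ⟨hs, ht⟩]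
    · rw [dmask_notMem N hs, dmask_notMem N (s := s ∩ t) fun h => hs h.1]
  · rw [dmask_notMem N ht, dmask_notMem N (s := s ∩ t) fun h => ht h.2]

theorem dmask_add_compl {ι : Type u} (N : ι → DGMod A) (s : Set ι) :
    dmask N s + dmask N sᶜ = 𝟙 _ := by
  refine hom_ext fun x => DFinsupp.ext fun i => ?_
  rw [add_apply, id_apply, DFinsupp.add_apply]
  by_cases hs : i ∈ s
  · rw [dmask_mem N hs, dmask_notMem N (s := sᶜ) fun h => h hs, add_zero]
  · rw [dmask_notMem N hs, dmask_mem N (s := sᶜ) hs, zero_add]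

theorem dinj_dmask_mem {ι : Type u} (N : ι → DGMod A) {s : Set ι} {i : ι} (h : i ∈ s) :
    dinj N i ≫ dmask N s = dinj N i := by
  refine hom_ext fun x => DFinsupp.ext fun j => ?_
  rw [comp_apply]
  by_cases hs : j ∈ s
  · rw [dmask_mem N hs]
  · rw [dmask_notMem N hs, dinj_ne N (by rintro rfl; exact hs h)]

theorem dinj_dmask_notMem {ι : Type u} (N : ι → DGMod A) {s : Set ι} {i : ι} (h : i ∉ s) :
    dinj N i ≫ dmask N s = 0 := by
  refine hom_ext fun x => DFinsupp.ext fun j => ?_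
  rw [comp_apply]
  by_cases hs : j ∈ s
  · rw [dmask_mem N hs, dinj_ne N (by rintro rfl; exact h hs)]; rfl
  · rw [dmask_notMem N hs]; rfl

/-- Every morphism of the derived category to a direct sum factors through a finite subsum. -/
def Cpt (M : DGMod A) : Prop :=
  ∀ (ι : Type u) (N : ι → DGMod A) (f : (toDCat A).obj M ⟶ (toDCat A).obj (dsum N)),
    ∃ T : Finset ι, f ≫ (toDCat A).map (dmask N (T : Set ι)ᶜ) = (toDCat A).map 0

/-- Every morphism to a direct sum factors through a finite subsum up to homotopy. -/
def CptH (M : DGMod A) : Prop :=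
  ∀ (ι : Type u) (N : ι → DGMod A) (f : M ⟶ dsum N),
    ∃ T : Finset ι, Htpy (f ≫ dmask N (T : Set ι)ᶜ) 0

theorem KProj.cpt_iff {P : DGMod A} (hP : KProj P) : Cpt P ↔ CptH P := by
  constructor
  · intro h ι N f
    obtain ⟨T, hT⟩ := h ι N ((toDCat A).map f)
    exact ⟨T, hP.faithful (by rw [Functor.map_comp, hT])⟩
  · intro h ι N f
    obtain ⟨β, rfl⟩ := hP.full f
    obtain ⟨T, hT⟩ := h ι N β
    exact ⟨T, by rw [← Functor.map_comp, hT.Q_eq]⟩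

theorem Cpt.of_retract {M N : DGMod A} (h : Cpt N) (i : (toDCat A).obj M ⟶ (toDCat A).obj N)
    (r : (toDCat A).obj N ⟶ (toDCat A).obj M) (hir : i ≫ r = 𝟙 _) : Cpt M := by
  intro ι Y f
  obtain ⟨T, hT⟩ := h ι Y (r ≫ f)
  refine ⟨T, ?_⟩
  have := congrArg (i ≫ ·) hT
  rw [Category.assoc, ← Category.assoc, hir, Category.id_comp, comp_Q_zero] at this
  exact this

theorem Cpt.of_iso {M N : DGMod A} (h : Cpt N) (e : (toDCat A).obj M ≅ (toDCat A).obj N) :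
    Cpt M := h.of_retract e.hom e.inv e.hom_inv_id

theorem Cpt.of_QI {M N : DGMod A} (h : Cpt N) (f : M ⟶ N) (hf : QI f.toFun) : Cpt M :=
  have := isIso_Q f hf
  h.of_iso (asIso ((toDCat A).map f))

theorem Cpt.of_QI' {M N : DGMod A} (h : Cpt M) (f : M ⟶ N) (hf : QI f.toFun) : Cpt N :=
  have := isIso_Q f hf
  h.of_iso (asIso ((toDCat A).map f)).symm

/-- The two masks add up to the identity. The addition is carried out for maps up to homotopy, after
resolving the source. -/
theorem eq_comp_dmask {ι : Type u} {N : ι → DGMod A} {M : DGMod A} {s : Set ι}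
    (f : (toDCat A).obj M ⟶ (toDCat A).obj (dsum N))
    (h : f ≫ (toDCat A).map (dmask N sᶜ) = (toDCat A).map 0) :
    f ≫ (toDCat A).map (dmask N s) = f := by
  obtain ⟨P, p, hP, hp⟩ := exists_kproj M
  have := isIso_Q p hp
  obtain ⟨β, hβ⟩ := hP.full ((toDCat A).map p ≫ f)
  obtain ⟨H, hH, e⟩ : Htpy (β ≫ dmask N sᶜ) 0 := hP.faithful (by
    rw [Functor.map_comp, hβ, Category.assoc, h, comp_Q_zero])
  rw [← cancel_epi ((toDCat A).map p), ← Category.assoc, ← hβ, ← Functor.map_comp]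
  refine (Htpy.Q_eq (Htpy.symm ⟨H, hH, fun x => ?_⟩))
  have h0 := e x
  rw [zero_apply, zero_add] at h0
  rw [← h0]
  have := congrArg (fun k => Hom.toFun k (β.toFun x)) (dmask_add_compl N s)
  exact this.symm

/-- A morphism killed by the mask of the complement of `T` is unchanged by the mask of `T`, and that
mask factors through the direct sum over `T`, which is a coproduct. -/
theorem Cpt.isCompactObject {M : DGMod A} (h : Cpt M) : IsCompactObject ((toDCat A).obj M) := by
  intro ι Y c hc f
  obtain ⟨N, rfl⟩ : ∃ N : ι → DGMod A, Y = fun i => (toDCat A).obj (N i) :=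
    ⟨fun i => ob (Y i), rfl⟩
  let e : c.pt ≅ (toDCat A).obj (dsum N) :=
    hc.coconePointUniqueUpToIso (isColimitDsumCofan N)
  have he : ∀ i, (toDCat A).map (dinj N i) ≫ e.inv = c.inj i := fun i =>
    hc.comp_coconePointUniqueUpToIso_inv (isColimitDsumCofan N) ⟨i⟩
  obtain ⟨T, hT⟩ := h ι N (f ≫ e.hom)
  let N' : T → DGMod A := fun i => N i
  let q : dsum N ⟶ dsum N' := ∑ i : T, dpr N i ≫ dinj N' i
  let j : dsum N' ⟶ dsum N := ddesc fun i => dinj N i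
  have hqj : q ≫ j = dmask N (T : Set ι) := by
    classical
    refine dsum_hom_ext fun i => ?_
    have h1 : ∀ k : T, dpr N k ≫ dinj N' k ≫ j = dpr N k ≫ dinj N k := fun k => by
      rw [dinj_ddesc]
    rw [Preadditive.sum_comp, Preadditive.comp_sum]
    simp only [Category.assoc, h1]
    by_cases hi : i ∈ T
    · rw [dinj_dmask_mem N (by simpa using hi), Finset.sum_eq_single ⟨i, hi⟩]
      · exact hom_ext fun x => congrArg (dinj N i).toFun (dinj_same N i x)
      · intro k _ hk
        refine hom_ext fun x => ?_
        refine (congrArg (dinj N k).toFun (dinj_ne N ?_ x)).trans (map_zero _)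
        rintro hk'; exact hk (Subtype.ext hk')
      · simp
    · rw [dinj_dmask_notMem N (by simpa using hi)]
      refine Finset.sum_eq_zero fun k _ => hom_ext fun x => ?_
      refine (congrArg (dinj N k).toFun (dinj_ne N ?_ x)).trans (map_zero _)
      rintro rfl; exact hi k.2
  refine ⟨T, dsumCofan N', isColimitDsumCofan N', (f ≫ e.hom) ≫ (toDCat A).map q, ?_⟩
  let k : (toDCat A).obj (dsum N') ⟶ c.pt :=
    (isColimitDsumCofan N').desc (Cofan.mk c.pt fun i : T => c.inj (i : ι))
  have hk : ∀ i : T, (toDCat A).map (dinj N' i) ≫ k = c.inj i := fun i =>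
    (isColimitDsumCofan N').fac (Cofan.mk c.pt fun i : T => c.inj (i : ι)) ⟨i⟩
  have h2 : k = (toDCat A).map j ≫ e.inv := by
    refine dsum_hom_ext_Q (V := ob c.pt) fun i => (hk i).trans ?_
    refine (he i).symm.trans ?_
    change _ = (toDCat A).map (dinj N' i) ≫ (toDCat A).map j ≫ e.inv
    rw [← Category.assoc, ← Functor.map_comp, dinj_ddesc]
  change ((f ≫ e.hom) ≫ (toDCat A).map q) ≫ k = f
  rw [h2, Category.assoc, ← Category.assoc ((toDCat A).map q), ← Functor.map_comp, hqj,
    ← Category.assoc, eq_comp_dmask _ hT, Category.assoc, e.hom_inv_id, Category.comp_id]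

/-- The mask of the complement of `T` kills each summand with index in `T`, hence everything that
factors through their coproduct, whichever coproduct was supplied. -/
theorem cpt_of_isCompactObject {M : DGMod A} (h : IsCompactObject ((toDCat A).obj M)) :
    Cpt M := by
  intro ι N f
  obtain ⟨T, b, hb, g, hg⟩ := h ι _ (dsumCofan N) (isColimitDsumCofan N) f
  let k : b.pt ⟶ (toDCat A).obj (dsum N) :=
    hb.desc (Cofan.mk (dsumCofan N).pt fun i : T => (dsumCofan N).inj (i : ι))
  have hk : ∀ i : T, b.inj i ≫ k = (toDCat A).map (dinj N i) := fun i => hb.fac _ ⟨i⟩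
  have hg' : g ≫ k = f := hg
  refine ⟨T, ?_⟩
  have h1 : k ≫ (toDCat A).map (dmask N (T : Set ι)ᶜ) =
      k ≫ (toDCat A).map (0 : dsum N ⟶ dsum N) := by
    refine Cofan.IsColimit.hom_ext hb _ _ fun i => ?_
    rw [← Category.assoc, ← Category.assoc, hk, ← Functor.map_comp, ← Functor.map_comp,
      dinj_dmask_notMem N (by simp), comp_zero]
  rw [← hg', Category.assoc, h1, ← Category.assoc, hg', comp_Q_zero]

theorem isCompactObject_iff (M : DGMod A) : IsCompactObject ((toDCat A).obj M) ↔ Cpt M :=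
  ⟨cpt_of_isCompactObject, Cpt.isCompactObject⟩

/-! ### Extensions and shifts of compact modules -/

/-- The cone is a weak cokernel. After replacing `f` by a map `f'` between K-projective modules, the
vanishing of the composite is an actual null-homotopy, and this is a map out of `cone f'`; the two
cones are quasi-isomorphic by `coneMap_QI`. -/
theorem exists_factor_cone {M N Y : DGMod A} (f : M ⟶ N)
    (g : (toDCat A).obj N ⟶ (toDCat A).obj Y)
    (h : (toDCat A).map f ≫ g = (toDCat A).map 0) :
    ∃ g' : (toDCat A).obj (cone f) ⟶ (toDCat A).obj Y, (toDCat A).map (coneι f) ≫ g' = g := by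
  obtain ⟨M', p, hM', hp⟩ := exists_kproj M
  obtain ⟨N', q, hN', hq⟩ := exists_kproj N
  obtain ⟨f', H⟩ := hM'.exists_lift q hq (p ≫ f)
  have hpf := H.Q_eq
  obtain ⟨k, hk, e⟩ := H
  let φ := coneMap f' f p q k hk e
  have hφ : IsIso ((toDCat A).map φ) := isIso_Q φ (coneMap_QI f' f p q k hk e hp hq)
  have hq' := isIso_Q q hq
  obtain ⟨β, hβ⟩ := hN'.full ((toDCat A).map q ≫ g)
  obtain ⟨k', hk', e'⟩ : Htpy (f' ≫ β) 0 := hM'.faithful (by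
    rw [Functor.map_comp, hβ, ← Category.assoc, ← Functor.map_comp, hpf, Functor.map_comp,
      Category.assoc, h, comp_Q_zero])
  refine ⟨inv ((toDCat A).map φ) ≫ (toDCat A).map (coneDesc f' β k' hk' fun x => by
    have := e' x
    rwa [zero_apply, zero_add] at this), ?_⟩
  rw [← cancel_epi ((toDCat A).map q), ← hβ, ← Category.assoc, ← Functor.map_comp,
    ← coneι_coneMap f' f p q k hk e, Functor.map_comp, Category.assoc, IsIso.hom_inv_id_assoc,
    ← Functor.map_comp, coneι_coneDesc]

/-- Let `g` be a morphism from `N` to a direct sum. Outside a finite set of indices its restriction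
to `M` vanishes, so it factors through the cone; outside a further finite set the factorisation
vanishes as well. -/
theorem Cpt.extension {M N : DGMod A} (f : M ⟶ N) (hM : Cpt M) (hC : Cpt (cone f)) : Cpt N := by
  classical
  intro ι Y g
  obtain ⟨T, hT⟩ := hM ι Y ((toDCat A).map f ≫ g)
  obtain ⟨g', hg'⟩ := exists_factor_cone f (g ≫ (toDCat A).map (dmask Y (T : Set ι)ᶜ)) (by
    rw [← Category.assoc, hT])
  obtain ⟨T', hT'⟩ := hC ι Y g'
  refine ⟨T ∪ T', ?_⟩
  rw [Finset.coe_union, Set.compl_union, ← dmask_comp, Functor.map_comp, ← Category.assoc, ← hg',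
    Category.assoc, hT', comp_Q_zero]

theorem Cpt.extension_of_exact {W V Z : DGMod A} (i : W ⟶ V) (p : V ⟶ Z)
    (hi : Function.Injective i.toFun) (hp : Function.Surjective p.toFun)
    (hip : ∀ x, p.toFun x = 0 ↔ ∃ w, i.toFun w = x) (hW : Cpt W) (hZ : Cpt Z) : Cpt V :=
  let ⟨g, hg⟩ := exists_coneDesc_QI i p hi hp hip
  Cpt.extension i hW (hZ.of_QI g hg)

theorem Cpt.prod {M N : DGMod A} (hM : Cpt M) (hN : Cpt N) : Cpt (prod M N) := by
  refine Cpt.extension_of_exact (prodInl M N) (prodSnd M N) ?_ ?_ ?_ hM hN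
  · intro x y h
    exact congrArg Prod.fst h
  · exact fun y => ⟨(0, y), rfl⟩
  · rintro ⟨m, n⟩
    constructor
    · intro h
      exact ⟨m, Prod.ext rfl (show (0 : N.carrier) = n from h.symm)⟩
    · rintro ⟨w, h⟩
      exact (congrArg Prod.snd h).symm

/-- The shift of a morphism. -/
def shiftMap {M N : DGMod A} (f : M ⟶ N) (n : ℤ) : shift M n ⟶ shift N n :=
  ⟨f.toFun, fun i x hx => f.map_mem (i + n) x hx, fun x => by
    change f.toFun (sg K n • M.d x) = sg K n • N.d (f.toFun x)
    rw [map_smul, f.map_d], f.map_act⟩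

theorem shift_d_eq_zero {M : DGMod A} {n : ℤ} {x : M.carrier} :
    (shift M n).d x = 0 ↔ M.d x = 0 := by
  change sg K n • M.d x = 0 ↔ _
  constructor
  · intro h; rw [← sg_smul_smul (K := K) n (M.d x), h, smul_zero]
  · intro h; rw [h, smul_zero]

theorem shiftMap_QI {M N : DGMod A} {f : M ⟶ N} (hf : QI f.toFun) (n : ℤ) :
    QI (shiftMap f n).toFun := by
  constructor
  · intro x hx y hy
    obtain ⟨z, hz⟩ := hf.1 x (shift_d_eq_zero.1 hx) (sg K n • y) (by rw [map_smul]; exact hy)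
    refine ⟨sg K n • z, ?_⟩
    change x = sg K n • M.d (sg K n • z)
    rw [map_smul, sg_smul_smul, hz]
  · intro y hy
    obtain ⟨x, z, hx, hz⟩ := hf.2 y (shift_d_eq_zero.1 hy)
    refine ⟨x, sg K n • z, shift_d_eq_zero.2 hx, ?_⟩
    change y = f.toFun x + sg K n • N.d (sg K n • z)
    rw [map_smul, sg_smul_smul, hz]

theorem KProj.shift {P : DGMod A} (hP : KProj P) (n : ℤ) : KProj (shift P n) := by
  intro C hC r φ hφ hd
  obtain ⟨H, hH, e⟩ := hP C hC (r - n) φ ⟨fun {i x} hx => by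
      have := hφ.mem (i := i - n) (x := x) (by
        change x ∈ P.deg (i - n + n)
        rwa [sub_add_cancel])
      rwa [show i - n + r = i + (r - n) by ring] at this, hφ.act⟩ (fun x => by
      have : C.d (φ x) = sg K r • φ (sg K n • P.d x) := hd x
      rw [this, map_smul, smul_smul, sub_eq_add_neg, sg_add, sg_neg])
  refine ⟨H, ⟨fun {i x} hx => ?_, hH.act⟩, fun x => ?_⟩
  · have := hH.mem (i := i + n) (x := x) hx
    rwa [show i + n + (r - n - 1) = i + (r - 1) by ring] at this
  · change φ x = C.d (H x) + sg K r • H (sg K n • P.d x)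
    rw [e, map_smul, smul_smul, sub_eq_add_neg, sg_add, sg_neg]

/-- The same linear map is a morphism from `P` to the direct sum of the `N i` shifted by `-n`. -/
theorem CptH.shift {P : DGMod A} (hP : CptH P) (n : ℤ) : CptH (shift P n) := by
  intro ι N f
  let f' : P ⟶ dsum fun i => DGMod.shift (N i) (-n) :=
    ⟨f.toFun, fun i x hx j => by
      have := f.map_mem (i - n) x (by
        change x ∈ P.deg (i - n + n)
        rwa [sub_add_cancel]) j
      exact this, fun x => DFinsupp.ext fun j => by
        have h1 : sg K n • f.toFun (P.d x) = (dsum N).d (f.toFun x) := by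
          rw [← map_smul]; exact f.map_d x
        have h2 : f.toFun (P.d x) = sg K n • (dsum N).d (f.toFun x) := by
          rw [← h1, sg_smul_smul]
        rw [h2]
        change sg K n • (N j).d _ = sg K (-n) • (N j).d _
        rw [sg_neg], f.map_act⟩
  obtain ⟨T, H, hH, e⟩ := hP ι _ f'
  -- Rescaling the homotopy by `(-1)^n` absorbs both the sign of the differential of `P[n]` and that
  -- of the shifted targets.
  refine ⟨T, sg K n • H, ⟨fun {i x} hx j => ?_, fun x a => ?_⟩, fun x => ?_⟩
  · have := hH.mem (i := i + n) (x := x) hx j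
    refine Submodule.smul_mem ((N j).deg (i + -1)) (sg K n) ?_
    change _ ∈ (N j).deg (i + n + -1 + -n) at this
    rwa [show i + n + -1 + -n = i + -1 by ring] at this
  · have := hH.act x a
    change sg K n • H _ = (dsum N).act.toFun (sg K n • H x) a
    rw [map_smul, LinearMap.smul_apply]
    exact congrArg (sg K n • ·) this
  · refine DFinsupp.ext fun j => ?_
    have h1 := DFinsupp.ext_iff.1 (e x) j
    refine Eq.trans ?_ (h1.trans ?_)
    · rfl
    · change (0 : (N j).carrier) + (sg K (-n) • (N j).d ((H x : Π₀ i, (N i).carrier) j) +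
        (H (P.d x) : Π₀ i, (N i).carrier) j) = 0 + ((N j).d (sg K n •
          (H x : Π₀ i, (N i).carrier) j) +
          sg K n • (H (sg K n • P.d x) : Π₀ i, (N i).carrier) j)
      have h3 : (H (sg K n • P.d x) : Π₀ i, (N i).carrier) j =
        sg K n • (H (P.d x) : Π₀ i, (N i).carrier) j := by rw [map_smul]; rfl
      rw [h3, sg_smul_smul, map_smul, sg_neg]

theorem Cpt.shift {M : DGMod A} (hM : Cpt M) (n : ℤ) : Cpt (shift M n) := by
  obtain ⟨P, p, hP, hp⟩ := exists_kproj M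
  exact ((hP.shift n).cpt_iff.2 ((hP.cpt_iff.1 (hM.of_QI p hp)).shift n)).of_QI' (shiftMap p n)
    (shiftMap_QI hp n)

end DGMod

end Compact

/-! ### Finite semifree modules and their retracts -/

section FiniteSemiFree

variable {K : Type u} [Field K] {A : DGAlg K}

namespace DGMod

/-- The null-homotopic morphism `d h + h d`. -/
def bdry {M N : DGMod A} (h : M.carrier →ₗ[K] N.carrier) (hh : IsGr (-1) h) : M ⟶ N where
  toFun := N.d ∘ₗ h + h ∘ₗ M.d
  map_mem i x hx := by
    refine add_mem ?_ ?_
    · have := N.d_mem (hh.mem hx)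
      rwa [neg_add_cancel_right] at this
    · have := hh.mem (M.d_mem hx)
      rwa [add_neg_cancel_right] at this
  map_d x := by
    change N.d (h (M.d x)) + h (M.d (M.d x)) = N.d (N.d (h x) + h (M.d x))
    rw [M.d_d, map_zero, add_zero, map_add, N.d_d, zero_add]
  map_act x a := by
    change N.d (h (M.act.toFun x a)) + h (M.d (M.act.toFun x a)) =
      N.act.toFun (N.d (h x) + h (M.d x)) a
    induction x using M.hom_induction with
    | mem i x hx =>
      rw [hh.act, N.d_act (hh.mem hx), M.d_act hx, map_add, map_smul, hh.act, hh.act, map_add,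
        LinearMap.add_apply, sg_add, sg_neg_one, mul_neg_one, neg_smul]
      abel
    | zero => simp
    | add x y hx hy =>
      have e1 : N.act.toFun (N.d (h (x + y)) + h (M.d (x + y))) =
          N.act.toFun (N.d (h x) + h (M.d x)) + N.act.toFun (N.d (h y) + h (M.d y)) := by
        rw [← map_add]; simp only [map_add]; abel_nf
      rw [e1, LinearMap.add_apply, ← hx, ← hy]
      simp only [map_add, LinearMap.add_apply]; abel

theorem bdry_apply {M N : DGMod A} (h : M.carrier →ₗ[K] N.carrier) (hh : IsGr (-1) h)
    (x : M.carrier) : (bdry h hh).toFun x = N.d (h x) + h (M.d x) := rfl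

theorem htpy_sub_bdry {M N : DGMod A} (f : M ⟶ N) (h : M.carrier →ₗ[K] N.carrier)
    (hh : IsGr (-1) h) : Htpy f (f - bdry h hh) :=
  ⟨h, hh, fun x => by rw [sub_apply, bdry_apply]; abel⟩

namespace SemiFree

variable {P : DGMod A} (s : SemiFree P)

theorem ext_gr {N : DGMod A} {r : ℤ} {f f' : P.carrier →ₗ[K] N.carrier} (hf : IsGr r f)
    (hf' : IsGr r f') (h : ∀ x, f (s.g x) = f' (s.g x)) (z : P.carrier) : f z = f' z := by
  obtain ⟨t, -, ht⟩ := s.exists_sum z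
  rw [ht t subset_rfl, map_sum, map_sum]
  exact Finset.sum_congr rfl fun x _ => by rw [hf.act, hf'.act, h]

theorem hom_ext {N : DGMod A} {f f' : P ⟶ N} (h : ∀ x, f.toFun (s.g x) = f'.toFun (s.g x)) :
    f = f' := DGMod.hom_ext (s.ext_gr f.isGr f'.isGr h)

/-- A map is determined by the finitely many images of basis elements, each with finite support; so
it lands in a finite subsum on the nose. -/
theorem cptH [Finite s.E] : CptH P := by
  classical
  have := Fintype.ofFinite s.E
  intro ι N f
  choose T hT _ using fun x => dsum_eq_sum (f.toFun (s.g x))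
  refine ⟨Finset.univ.biUnion T, ?_⟩
  have : f ≫ dmask N ((Finset.univ.biUnion T : Finset ι) : Set ι)ᶜ = 0 := by
    refine s.hom_ext fun x => DFinsupp.ext fun i => ?_
    rw [comp_apply]
    by_cases hi : i ∈ Finset.univ.biUnion T
    · rw [dmask_notMem N (by simpa using hi)]; rfl
    · rw [dmask_mem N (by simpa using hi), hT x i]; · rfl
      intro h
      exact hi (Finset.mem_biUnion.2 ⟨x, Finset.mem_univ _, h⟩)
  rw [this]
  exact Htpy.refl _

theorem cpt (s : SemiFree P) [Finite s.E] : Cpt P := s.kproj.cpt_iff.2 s.cptH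

/-- The coordinate functions. -/
def cf (x : s.E) : P.carrier →ₗ[K] A.carrier :=
  (dpr (fun x : s.E => shift (self A) (-s.δ x)) x).toFun ∘ₗ
    (s.J.symm : P.carrier →ₗ[K] (Free A s.E s.δ).carrier)

theorem cf_act (x : s.E) (z : P.carrier) (a : A.carrier) :
    s.cf x (P.act.toFun z a) = A.mul.toFun (s.cf x z) a := by
  have := s.isGr.symm.act z a
  change (s.J.symm (P.act.toFun z a) : Π₀ _ : s.E, A.carrier) x = _
  exact DFinsupp.ext_iff.1 this x

theorem cf_mem (x : s.E) {i : ℤ} {z : P.carrier} (hz : z ∈ P.deg i) :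
    s.cf x z ∈ A.deg (i + -s.δ x) := by
  have := s.isGr.symm.mem hz x
  rw [add_zero] at this
  exact this

theorem cf_J (x : s.E) (w : (Free A s.E s.δ).carrier) :
    s.cf x (s.J w) = (w : Π₀ _ : s.E, A.carrier) x :=
  DFinsupp.ext_iff.1 (s.coord_J w) x

theorem cf_g_same (x : s.E) : s.cf x (s.g x) = A.one := by
  rw [g, cf_J, gen_apply_same]

theorem cf_g_ne {x y : s.E} (h : y ≠ x) : s.cf y (s.g x) = 0 := by
  rw [g, cf_J, gen_apply_ne h]

theorem eq_sum (z : P.carrier) : ∃ t : Finset s.E, (∀ x ∉ t, s.cf x z = 0) ∧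
    z = ∑ x ∈ t, P.act.toFun (s.g x) (s.cf x z) :=
  let ⟨t, ht, h⟩ := s.exists_sum z
  ⟨t, ht, h t subset_rfl⟩

theorem proj_cf (x : s.E) (i : ℤ) (z : P.carrier) :
    s.cf x (P.proj i z) = A.proj (i + -s.δ x) (s.cf x z) :=
  (DGVect.proj_degree_map P.toDGVect A.toDGVect (-s.δ x) (s.cf x) (s.cf_mem x) i z).symm

/-- A set of basis elements spanning a dg submodule. -/
def Closed (C : Set s.E) : Prop := ∀ x ∈ C, ∀ y ∉ C, s.cf y (P.d (s.g x)) = 0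

/-- Expand `z` in basis elements from `C` and apply the Leibniz rule. The terms with a
differentiated basis element have no coordinate at `y`, and of the others only the one with basis
element `y` does. So the coordinate at `y` commutes with differentials as a map to a shift of `A`.
-/
theorem cf_d_eq {C : Set s.E} {z : P.carrier} (hz : ∀ x ∉ C, s.cf x z = 0) (y : s.E)
    (hy : ∀ x ∈ C, s.cf y (P.d (s.g x)) = 0) :
    s.cf y (P.d z) = sg K (s.δ y) • A.d (s.cf y z) := by
  classical
  obtain ⟨t, ht, e⟩ := s.eq_sum z
  have h1 : ∀ x, s.cf y (P.d (P.act.toFun (s.g x) (s.cf x z))) =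
      if x = y then sg K (s.δ y) • A.d (s.cf y z) else 0 := by
    intro x
    rw [P.d_act (s.g_mem x), map_add, map_smul, cf_act, cf_act]
    have h2 : A.mul.toFun (s.cf y (P.d (s.g x))) (s.cf x z) = 0 := by
      by_cases hx : x ∈ C
      · rw [hy x hx, map_zero, LinearMap.zero_apply]
      · rw [hz x hx, map_zero]
    rw [h2, zero_add]
    split_ifs with h
    · subst h
      rw [cf_g_same, A.one_mul]
    · rw [cf_g_ne s (Ne.symm h), map_zero, LinearMap.zero_apply, smul_zero]
  conv_lhs => rw [e]
  rw [map_sum, map_sum]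
  simp only [h1]
  rw [Finset.sum_ite_eq']
  split_ifs with h
  · rfl
  · rw [ht y h, map_zero, smul_zero]

/-- The dg submodule spanned by a closed set of basis elements. -/
@[reducible] def span (C : Set s.E) (hC : s.Closed C) : Sub P where
  carrier := {z | ∀ x ∉ C, s.cf x z = 0}
  add_mem' hz hw x hx := by rw [map_add, hz x hx, hw x hx, add_zero]
  zero_mem' x _ := map_zero _
  smul_mem' c z hz x hx := by rw [map_smul, hz x hx, smul_zero]
  proj_mem i z hz x hx := by rw [proj_cf, hz x hx, map_zero]
  d_mem {z} hz x hx := by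
    rw [s.cf_d_eq hz x fun y hy => hC y hy x hx, hz x hx, map_zero, smul_zero]
  act_mem {z} a hz x hx := by rw [cf_act, hz x hx, map_zero, LinearMap.zero_apply]

theorem g_mem_span {C : Set s.E} (hC : s.Closed C) {x : s.E} (hx : x ∈ C) :
    s.g x ∈ (s.span C hC).toSubmodule := fun y hy =>
  cf_g_ne s (by rintro rfl; exact hy hx)

theorem closed_lev (n : ℕ) : s.Closed {x | s.lev x < n} := fun x hx y hy =>
  s.low' x y fun h => hy (lt_trans h hx)

theorem Closed.union {C D : Set s.E} (hC : s.Closed C) (hD : s.Closed D) : s.Closed (C ∪ D) := by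
  rintro x (hx | hx) y hy
  · exact hC x hx y fun h => hy (Or.inl h)
  · exact hD x hx y fun h => hy (Or.inr h)

/-- By induction on the level: the differential of a basis element involves finitely many basis
elements, all of lower level. -/
theorem exists_finite_closed (S : Set s.E) (hS : S.Finite) :
    ∃ T : Set s.E, S ⊆ T ∧ T.Finite ∧ s.Closed T := by
  have h1 : ∀ n x, s.lev x < n → ∃ T : Set s.E, x ∈ T ∧ T.Finite ∧ s.Closed T := by
    intro n
    induction n with
    | zero => intro x hx; omega
    | succ n ih =>
      intro x hx
      obtain ⟨t, ht, -⟩ := s.exists_sum (P.d (s.g x))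
      have h2 : ∀ y : s.E, ∃ T : Set s.E, T.Finite ∧ s.Closed T ∧
          (s.cf y (P.d (s.g x)) ≠ 0 → y ∈ T) := by
        intro y
        by_cases hy : s.cf y (P.d (s.g x)) = 0
        · exact ⟨∅, Set.finite_empty, fun _ h => h.elim, fun h => absurd hy h⟩
        · have := s.low x y hy
          obtain ⟨T, hT, hT', hT''⟩ := ih y (by omega)
          exact ⟨T, hT', hT'', fun _ => hT⟩
      choose T hTf hTc hT using h2
      refine ⟨{x} ∪ ⋃ y ∈ t, T y, Or.inl rfl,
        (Set.finite_singleton x).union (t.finite_toSet.biUnion fun y _ => hTf y), ?_⟩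
      rintro z (rfl | hz) y hy
      · by_contra h
        refine hy (Or.inr ?_)
        have hyt : y ∈ t := by
          by_contra h'
          exact h (ht y h')
        exact Set.mem_biUnion hyt (hT y h)
      · obtain ⟨w, hw, hz⟩ := Set.mem_iUnion₂.1 hz
        exact hTc w z hz y fun h => hy (Or.inr (Set.mem_biUnion hw h))
  choose T hT using fun x => h1 (s.lev x + 1) x (Nat.lt_succ_self _)
  refine ⟨⋃ x ∈ S, T x, fun x hx => Set.mem_biUnion hx (hT x).1,
    hS.biUnion fun x _ => (hT x).2.1, ?_⟩
  intro z hz y hy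
  obtain ⟨w, hw, hz⟩ := Set.mem_iUnion₂.1 hz
  exact (hT w).2.2 z hz y fun h => hy (Set.mem_biUnion hw h)

section Restrict

variable (C : Set s.E)

/-- The inclusion of the free module on a set of basis elements. -/
def incl : (Free A C fun x => s.δ x).carrier →ₗ[K] P.carrier := freeLift fun x : C => s.g x

theorem incl_isGr : IsGr 0 (s.incl C) := freeLift_isGr fun x => by
  rw [add_zero]; exact s.g_mem x

theorem cf_incl_mem (w : (Free A C fun x => s.δ x).carrier) (x : C) :
    s.cf x (s.incl C w) = (w : Π₀ _ : C, A.carrier) x := by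
  classical
  have h := dsum_lhom_ext (N := fun x : C => shift (self A) (-s.δ x)) (f := s.cf x ∘ₗ s.incl C)
    (g := (dpr (fun x : C => shift (self A) (-s.δ x)) x).toFun) (fun y a => ?_) w
  · exact h
  · change s.cf x (freeLift _ _) = _
    rw [freeLift_inj, cf_act, dpr_apply]
    by_cases hxy : x = y
    · subst hxy; rw [cf_g_same, A.one_mul, dinj_same]
    · rw [cf_g_ne s (fun h => hxy (Subtype.ext h)), dinj_ne _ hxy, map_zero, LinearMap.zero_apply]

theorem cf_incl_notMem (w : (Free A C fun x => s.δ x).carrier) {x : s.E} (hx : x ∉ C) :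
    s.cf x (s.incl C w) = 0 := by
  have h := dsum_lhom_ext (N := fun x : C => shift (self A) (-s.δ x)) (f := s.cf x ∘ₗ s.incl C)
    (g := 0) (fun y a => ?_) w
  · exact h
  · change s.cf x (freeLift _ _) = 0
    rw [freeLift_inj, cf_act, cf_g_ne s (x := y) (y := x) (fun h => hx (by rw [h]; exact y.2)), map_zero, LinearMap.zero_apply]

theorem incl_bijective (hC : s.Closed C) : Function.Bijective
    ((s.incl C).codRestrict (s.span C hC).toSubmodule fun w _ hx => s.cf_incl_notMem C w hx) := by
  constructor
  · intro w w' h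
    have h' : s.incl C w = s.incl C w' := congrArg Subtype.val h
    exact DFinsupp.ext fun x => by rw [← cf_incl_mem, ← cf_incl_mem, h']
  · rintro ⟨z, hz⟩
    obtain ⟨t, ht, e⟩ := s.eq_sum z
    have h1 : ∀ x, ∃ w, s.incl C w = P.act.toFun (s.g x) (s.cf x z) := by
      intro x
      by_cases hx : x ∈ C
      · exact ⟨_, freeLift_inj (A := A) (δ := fun x : C => s.δ x) (fun x : C => s.g x) ⟨x, hx⟩ _⟩
      · exact ⟨0, by rw [map_zero, hz x hx, map_zero]⟩
    choose w hw using h1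
    refine ⟨∑ x ∈ t, w x, Subtype.ext ?_⟩
    change s.incl C _ = z
    rw [map_sum]
    simp only [hw]
    exact e.symm

/-- The semifree structure of the submodule spanned by a closed set of basis elements. -/
def restrict (hC : s.Closed C) : SemiFree (sub (s.span C hC)) where
  E := C
  δ x := s.δ x
  lev x := s.lev x
  J := LinearEquiv.ofBijective _ (s.incl_bijective C hC)
  isGr := ⟨fun hx => (s.incl_isGr C).mem hx, fun x a => Subtype.ext ((s.incl_isGr C).act x a)⟩
  low x y h := by
    refine s.low x y ?_
    intro h'
    refine h ?_
    rw [← cf_incl_mem]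
    refine Eq.trans (congrArg (s.cf y) ?_) h'
    have h1 := (LinearEquiv.ofBijective _ (s.incl_bijective C hC)).apply_symm_apply
      ((sub (s.span C hC)).d (LinearEquiv.ofBijective _ (s.incl_bijective C hC)
        (gen A (fun x : C => s.δ x) x)))
    refine (congrArg Subtype.val h1).trans ?_
    change P.d (s.incl C (gen A (fun x : C => s.δ x) x)) = P.d (s.g x)
    rw [incl, freeLift_gen]

end Restrict

/-! ### Compact modules are retracts of finite semifree modules -/

/-- Lifting of graded maps along surjections. -/
theorem exists_lift_gr (s : SemiFree P) {M N : DGMod A} (p : M ⟶ N)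
    (hp : ∀ i y, y ∈ N.deg i → ∃ x ∈ M.deg i, p.toFun x = y) {r : ℤ}
    {h : P.carrier →ₗ[K] N.carrier} (hh : IsGr r h) :
    ∃ h' : P.carrier →ₗ[K] M.carrier, IsGr r h' ∧ ∀ z, p.toFun (h' z) = h z := by
  choose v hv e using fun x => hp _ _ (hh.mem (s.g_mem x))
  refine ⟨s.lift v, s.lift_isGr hv, fun z => ?_⟩
  exact s.ext_gr (f := p.toFun ∘ₗ s.lift v) ((s.lift_isGr hv).comp p.isGr (add_zero r)) hh
    (fun x => by rw [LinearMap.comp_apply, lift_g, e]) z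

theorem quotπ_eq_zero {M : DGMod A} {S : Sub M} {x : M.carrier} :
    (quotπ S).toFun x = 0 ↔ x ∈ S.toSubmodule := Submodule.Quotient.mk_eq_zero _

/-- The quotient by the basis elements of level less than `n`. -/
abbrev quotLev (n : ULift.{u} ℕ) : DGMod A := quot (s.span _ (s.closed_lev n.down))

/-- The map to the direct sum of the quotients by the basis elements of bounded level. -/
def toQuots : P.carrier →ₗ[K] (dsum s.quotLev).carrier :=
  -- A basis element vanishes in the quotient by the levels below `n` as soon as `n` exceeds its
  -- level. The finite sum up to its level therefore has the class of the element as its component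
  -- in every quotient.
  s.lift fun x => ∑ n ∈ Finset.range (s.lev x + 1),
    (dinj s.quotLev ⟨n⟩).toFun ((quotπ (s.span _ (s.closed_lev n))).toFun (s.g x))

theorem toQuots_isGr : IsGr 0 s.toQuots := s.lift_isGr fun x => by
  rw [add_zero]
  exact sum_mem fun n _ => (dinj s.quotLev ⟨n⟩).map_mem _ _
    ((quotπ (s.span _ (s.closed_lev n))).map_mem _ _ (s.g_mem x))

theorem toQuots_apply (z : P.carrier) (n : ℕ) :
    (dpr s.quotLev ⟨n⟩).toFun (s.toQuots z) = (quotπ (s.span _ (s.closed_lev n))).toFun z := by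
  refine s.ext_gr (f := (dpr s.quotLev ⟨n⟩).toFun ∘ₗ s.toQuots)
    (s.toQuots_isGr.comp (dpr s.quotLev ⟨n⟩).isGr (add_zero 0))
    (quotπ (s.span _ (s.closed_lev n))).isGr (fun x => ?_) z
  rw [LinearMap.comp_apply, toQuots, lift_g, map_sum]
  by_cases hn : n < s.lev x + 1
  · rw [Finset.sum_eq_single_of_mem n (Finset.mem_range.2 hn)]
    · exact dinj_same s.quotLev ⟨n⟩ _
    · intro m _ hm
      exact dinj_ne s.quotLev (fun h => hm (congrArg ULift.down h).symm) _
  · rw [quotπ_eq_zero.2 (s.g_mem_span (s.closed_lev n) (show s.lev x < n by omega))]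
    refine Finset.sum_eq_zero fun m hm => dinj_ne s.quotLev (fun h => ?_) _
    have h1 : n = m := congrArg ULift.down h
    have := Finset.mem_range.1 hm
    omega

/-- The morphism to the direct sum of the quotients. -/
def toQuotsHom : P ⟶ dsum s.quotLev :=
  homOfGr s.toQuots s.toQuots_isGr fun z => DFinsupp.ext fun ⟨n⟩ => by
    refine (s.toQuots_apply (P.d z) n).trans ?_
    rw [(quotπ _).map_d, ← s.toQuots_apply z n]
    rfl

/-- Compactness is applied to the map from `P` to the direct sum of all quotients by bounded levels.
For an index `n` outside the finite exceptional set, the quotient map itself is null-homotopic;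
lifting the homotopy to `P` and subtracting its boundary from the identity leaves a map into the
part of level below `n`. -/
theorem exists_bounded (hP : CptH P) : ∃ (n : ℕ) (g : P ⟶ P), Htpy (𝟙 P) g ∧
    ∀ z x, n ≤ s.lev x → s.cf x (g.toFun z) = 0 := by
  obtain ⟨T, H⟩ := hP _ _ s.toQuotsHom
  obtain ⟨⟨n⟩, hn⟩ := Infinite.exists_notMem_finset T
  have h1 : (s.toQuotsHom ≫ dmask s.quotLev (T : Set (ULift ℕ))ᶜ) ≫ dpr s.quotLev ⟨n⟩ =
      quotπ (s.span _ (s.closed_lev n)) := DGMod.hom_ext fun z =>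
    (dmask_mem s.quotLev (s := (T : Set (ULift ℕ))ᶜ) hn _).trans (s.toQuots_apply z n)
  obtain ⟨h, hh, e⟩ := H.comp_right (dpr s.quotLev ⟨n⟩)
  rw [h1, zero_comp] at e
  obtain ⟨h', hh', e'⟩ := s.exists_lift_gr (quotπ (s.span _ (s.closed_lev n)))
    (fun i y hy => hy) hh
  refine ⟨n, 𝟙 P - bdry h' hh', htpy_sub_bdry _ _ _, fun z x hx => ?_⟩
  refine (quotπ_eq_zero (S := s.span _ (s.closed_lev n))).1 ?_ x (not_lt.2 hx)
  rw [sub_apply, bdry_apply, map_sub, map_add, (quotπ _).map_d, e', e', id_apply, e z, zero_apply,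
    zero_add, sub_self]

open scoped Classical in
/-- The coordinates at a set of basis elements. -/
def restr (C : Set s.E) : P.carrier →ₗ[K] (Free A C fun x => s.δ x).carrier :=
  (DFinsupp.subtypeDomainLinearMap K (fun _ : s.E => A.carrier) (· ∈ C) : (Π₀ _ : s.E, A.carrier) →ₗ[K]
    Π₀ _ : {x // x ∈ C}, A.carrier) ∘ₗ
    (s.J.symm : P.carrier →ₗ[K] (Free A s.E s.δ).carrier)

/-- The differential of an element of `D` has no component along the elements `E'` of top level
outside `S`, so the coordinates of `g` along `E'` form a morphism to a free module. By compactness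
it is null-homotopic outside a finite set `T`. Subtracting the boundary of this homotopy, viewed in
`P`, removes those coordinates, and `T` is absorbed into a finite closed set. -/
theorem exists_lower (hP : CptH P) (n : ℕ) (S : Set s.E) (hSf : S.Finite) (hS : s.Closed S)
    (g : P ⟶ P) (hg : ∀ z, ∀ x ∉ ({x | s.lev x < n + 1} ∪ S : Set s.E), s.cf x (g.toFun z) = 0) :
    ∃ (S' : Set s.E) (g' : P ⟶ P), S'.Finite ∧ s.Closed S' ∧ Htpy g g' ∧
      ∀ z, ∀ x ∉ ({x | s.lev x < n} ∪ S' : Set s.E), s.cf x (g'.toFun z) = 0 := by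
  classical
  let D : Set s.E := {x | s.lev x < n + 1} ∪ S
  let E' : Set s.E := {x | s.lev x = n ∧ x ∉ S}
  have hD : s.Closed D := Closed.union s (s.closed_lev (n + 1)) hS
  have hE' : ∀ y ∈ E', ∀ x ∈ D, s.cf y (P.d (s.g x)) = 0 := by
    rintro y ⟨hy, hyS⟩ x (hx | hx)
    · refine s.low' x y ?_
      have hx' : s.lev x < n + 1 := hx
      omega
    · exact hS x hx y hyS
  have hE'D : E' ⊆ D := fun x hx => Or.inl (by
    have := hx.1
    change s.lev x < n + 1
    omega)
  let ψ : P ⟶ Free A E' fun x => s.δ x :=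
    { toFun := s.restr E' ∘ₗ g.toFun
      map_mem := fun i z hz x => s.cf_mem x (g.map_mem i z hz)
      map_d := fun z => DFinsupp.ext fun x => by
        refine (congrArg (s.cf x) (g.map_d z)).trans ?_
        rw [s.cf_d_eq (hg z) x (hE' x x.2)]
        change _ = sg K (-s.δ x) • A.d _
        rw [sg_neg]; rfl
      map_act := fun z a => DFinsupp.ext fun x => by
        refine (congrArg (s.cf x) (g.map_act z a)).trans ?_
        exact s.cf_act x _ a }
  obtain ⟨T, h, hh, e⟩ := hP _ _ ψ
  let h' : P.carrier →ₗ[K] P.carrier := s.incl E' ∘ₗ h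
  have hh' : IsGr (-1) h' := hh.comp (s.incl_isGr E') (by norm_num)
  obtain ⟨S', hSS', hSf', hS'⟩ := s.exists_finite_closed (S ∪ Subtype.val '' (T : Set E'))
    (hSf.union (T.finite_toSet.image _))
  refine ⟨S', g - bdry h' hh', hSf', hS', htpy_sub_bdry _ _ _, fun z y hy => ?_⟩
  have hyn : ¬s.lev y < n := fun h => hy (Or.inl h)
  have hyS : y ∉ S := fun h => hy (Or.inr (hSS' (Or.inl h)))
  rw [sub_apply, bdry_apply, map_sub, map_add]
  by_cases hyE : y ∈ E'
  · have hyT : (⟨y, hyE⟩ : E') ∉ T := fun h => hy (Or.inr (hSS' (Or.inr ⟨_, h, rfl⟩)))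
    -- At a top coordinate outside `T` the boundary of `h'` is computed in the free module, where it
    -- equals the coordinate of `g`.
    rw [s.cf_d_eq (C := D) (z := h' z) (fun x hx => s.cf_incl_notMem E' _ fun h => hx (hE'D h)) y
      (hE' y hyE)]
    have h1 : ∀ w, s.cf y (h' w) = (h w : Π₀ _ : E', A.carrier) ⟨y, hyE⟩ :=
      fun w => s.cf_incl_mem E' (h w) ⟨y, hyE⟩
    rw [h1, h1, sub_eq_zero]
    have h2 := DFinsupp.ext_iff.1 (e z) ⟨y, hyE⟩
    have h3 : ((ψ ≫ dmask (fun x : E' => shift (self A) (-s.δ x)) (T : Set E')ᶜ).toFun z :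
        Π₀ _ : E', A.carrier) ⟨y, hyE⟩ = s.cf y (g.toFun z) :=
      dmask_mem (fun x : E' => shift (self A) (-s.δ x)) (s := (T : Set E')ᶜ) hyT _
    refine h3.symm.trans (h2.trans ?_)
    change (0 : A.carrier) + (sg K (-s.δ y) • A.d _ + _) = _
    rw [zero_add, sg_neg]
  -- Outside `D` nothing has to be removed: `g` has no coordinate there, and the boundary of `h'`
  -- stays in the span of the closed set `D`.
  · have hyD : y ∉ D := by
      rintro (h | h)
      · have h' : s.lev y < n + 1 := h
        exact hyE ⟨by omega, hyS⟩
      · exact hyS h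
    have h1 : ∀ w, h' w ∈ (s.span D hD).toSubmodule :=
      fun w x hx => s.cf_incl_notMem E' _ fun h => hx (hE'D h)
    rw [hg z y hyD, (s.span D hD).d_mem (h1 z) y hyD, h1 _ y hyD, add_zero, sub_zero]

theorem exists_finite (hP : CptH P) : ∃ (S : Set s.E) (g : P ⟶ P), S.Finite ∧ s.Closed S ∧
    Htpy (𝟙 P) g ∧ ∀ z, ∀ x ∉ S, s.cf x (g.toFun z) = 0 := by
  obtain ⟨n, g, hg, hgz⟩ := s.exists_bounded hP
  have key : ∀ (n : ℕ) (S : Set s.E) (g : P ⟶ P), S.Finite → s.Closed S → Htpy (𝟙 P) g →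
      (∀ z, ∀ x ∉ ({x | s.lev x < n} ∪ S : Set s.E), s.cf x (g.toFun z) = 0) →
      ∃ (S : Set s.E) (g : P ⟶ P), S.Finite ∧ s.Closed S ∧
        Htpy (𝟙 P) g ∧ ∀ z, ∀ x ∉ S, s.cf x (g.toFun z) = 0 := by
    intro n
    induction n with
    | zero =>
      intro S g h1 h2 h3 h4
      refine ⟨S, g, h1, h2, h3, fun z x hx => h4 z x ?_⟩
      rintro (h | h)
      · exact absurd h (Nat.not_lt_zero _)
      · exact hx h
    | succ n ih =>
      intro S g h1 h2 h3 h4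
      obtain ⟨S', g', h1', h2', h3', h4'⟩ := s.exists_lower hP n S h1 h2 g h4
      exact ih S' g' h1' h2' (h3.trans h3') h4'
  refine key n ∅ g Set.finite_empty (fun _ h => h.elim) hg fun z x hx => hgz z x ?_
  by_contra h
  exact hx (Or.inl (not_le.1 h))

end SemiFree

/-- On a semifree resolution of `M`, the identity is homotopic to a map with values in the span of a
finite closed set of basis elements. Corestriction to this span and its inclusion compose to the
identity in the derived category. -/
theorem Cpt.exists_retract {M : DGMod A} (hM : Cpt M) :
    ∃ (P : DGMod A) (s : SemiFree P) (_ : Finite s.E)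
      (i : (toDCat A).obj M ⟶ (toDCat A).obj P) (r : (toDCat A).obj P ⟶ (toDCat A).obj M),
      i ≫ r = 𝟙 _ := by
  obtain ⟨P, s, p, hp⟩ := exists_semiFree M
  obtain ⟨S, g, hSf, hS, H, hg⟩ := s.exists_finite (s.kproj.cpt_iff.1 (hM.of_QI p hp))
  have := isIso_Q p hp
  refine ⟨_, s.restrict S hS, hSf.to_subtype,
    inv ((toDCat A).map p) ≫ (toDCat A).map (subLift (s.span S hS) g hg),
    (toDCat A).map (subι (s.span S hS)) ≫ (toDCat A).map p, ?_⟩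
  rw [Category.assoc, ← Category.assoc ((toDCat A).map (subLift _ _ _)), ← Functor.map_comp,
    subLift_ι, ← H.Q_eq, CategoryTheory.Functor.map_id, Category.id_comp, IsIso.inv_hom_id]

end DGMod

end FiniteSemiFree

/-! ### Contractions and homotopy inverses over a field -/

section Contraction

variable {K : Type u} [Field K]

/-- The degree `r` part of an arbitrary linear map; it serves to make a section chosen without
regard to the grading homogeneous. -/
theorem DGVect.exists_homogeneous (V W : DGVect K) (r : ℤ) (f : V →ₗ[K] W) :
    ∃ g : V →ₗ[K] W, ∀ i x, x ∈ V.deg i → g x = W.proj (i + r) (f x) := by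
  let e := LinearEquiv.ofBijective (DirectSum.coeLinearMap V.deg) V.isInternal
  refine ⟨DirectSum.toModule K ℤ W (fun i => W.proj (i + r) ∘ₗ f ∘ₗ (V.deg i).subtype) ∘ₗ
    e.symm.toLinearMap, fun i x hx => ?_⟩
  have h : e.symm x = DirectSum.lof K ℤ (fun i => V.deg i) i ⟨x, hx⟩ := by
    rw [LinearEquiv.symm_apply_eq]
    exact (DirectSum.coeLinearMap_lof V.deg i ⟨x, hx⟩).symm
  change DirectSum.toModule K ℤ W _ (e.symm x) = _
  rw [h, DirectSum.toModule_lof]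
  rfl

/-- Over a field, `d` has a linear section on its image, and the part of degree `-1` of an extension
of it is a map `S₁` with `d S₁ d = d`. Then `1 - S₁ d` takes values in the cocycles, which are
coboundaries, so `S₁ (1 - S₁ d)` is a contraction. -/
theorem Acyc.exists_contraction {V : DGVect K} (h : Acyc V) :
    ∃ S : V →ₗ[K] V, (∀ i x, x ∈ V.deg i → S x ∈ V.deg (i - 1)) ∧
      ∀ x, V.d (S x) + S (V.d x) = x := by
  obtain ⟨σ, hσ⟩ := V.d.rangeRestrict.exists_rightInverse_of_surjective V.d.range_rangeRestrict
  obtain ⟨S₀, hS₀⟩ := σ.exists_extend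
  obtain ⟨S₁, hS₁⟩ := V.exists_homogeneous V (-1) S₀
  have h0 : ∀ x, V.d (S₀ (V.d x)) = V.d x := by
    intro x
    have h1 := LinearMap.congr_fun hS₀ ⟨V.d x, x, rfl⟩
    have h2 := LinearMap.congr_fun hσ ⟨V.d x, x, rfl⟩
    have h3 := congrArg Subtype.val h2
    change V.d (σ ⟨V.d x, x, rfl⟩) = V.d x at h3
    exact (congrArg V.d h1).trans h3
  have h1 : ∀ x, V.d (S₁ (V.d x)) = V.d x := by
    intro x
    induction x using V.hom_induction with
    | mem i x hx =>
      rw [hS₁ (i + 1) _ (V.d_mem hx), ← V.proj_d, h0, V.proj_same]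
      rw [neg_add_cancel_right]
      exact V.d_mem hx
    | zero => simp
    | add x y hx hy => simp only [map_add, hx, hy]
  have hm : ∀ i x, x ∈ V.deg i → S₁ x ∈ V.deg (i - 1) := by
    intro i x hx
    rw [hS₁ i x hx]
    exact V.proj_mem _ _
  refine ⟨S₁ ∘ₗ (LinearMap.id - S₁ ∘ₗ V.d), fun i x hx => ?_, fun x => ?_⟩
  · refine hm _ _ (sub_mem hx ?_)
    have := hm _ _ (V.d_mem hx)
    rwa [add_sub_cancel_right] at this
  · obtain ⟨y, hy⟩ := h (x - S₁ (V.d x)) (by rw [map_sub, h1, sub_self])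
    change V.d (S₁ (x - S₁ (V.d x))) + S₁ (V.d x - S₁ (V.d (V.d x))) = x
    rw [V.d_d, map_zero, sub_zero, hy, h1, ← hy, sub_add_cancel]

/-- The endomorphism `e` of the graded space `V` is homotopic to the identity. -/
def HtpyId (V : DGVect K) (e : V →ₗ[K] V) : Prop :=
  ∃ H : V →ₗ[K] V, (∀ i x, x ∈ V.deg i → H x ∈ V.deg (i - 1)) ∧
    ∀ x, e x = x + V.d (H x) + H (V.d x)

theorem HtpyId.id (V : DGVect K) : HtpyId V LinearMap.id :=
  ⟨0, fun _ _ _ => zero_mem _, fun x => by simp⟩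

theorem HtpyId.comp {V : DGVect K} {e e' : V →ₗ[K] V} (h : HtpyId V e) (h' : HtpyId V e')
    (hm : ∀ i x, x ∈ V.deg i → e x ∈ V.deg i) (hd : ∀ x, e (V.d x) = V.d (e x)) :
    HtpyId V (e ∘ₗ e') := by
  obtain ⟨H, hH, hH'⟩ := h
  obtain ⟨S, hS, hS'⟩ := h'
  refine ⟨H + e ∘ₗ S, fun i x hx => add_mem (hH _ _ hx) (hm _ _ (hS _ _ hx)), fun x => ?_⟩
  simp only [LinearMap.comp_apply, hS', map_add, LinearMap.add_apply, hd, hH' x]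
  abel

/-- The inverse and the two homotopies are blocks of a contraction of the cone of `f`. They are
linear over the field only and ignore the action of `A`, which suffices since quasi-isomorphisms are
detected on underlying complexes. -/
theorem QI.exists_inverse {A : DGAlg K} {M N : DGMod A} {f : M ⟶ N} (h : QI f.toFun) :
    ∃ g : N.toDGVect →ₗ[K] M.toDGVect, (∀ i x, x ∈ N.deg i → g x ∈ M.deg i) ∧
      (∀ x, g (N.d x) = M.d (g x)) ∧ HtpyId M.toDGVect (g ∘ₗ f.toFun) ∧
      HtpyId N.toDGVect (f.toFun ∘ₗ g) := by
  obtain ⟨S, hS, hS'⟩ := (DGMod.QI.acyc_cone h).exists_contraction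
  let S' : (N.carrier × M.carrier) →ₗ[K] (N.carrier × M.carrier) := S
  have hn : ∀ n : N.carrier, (N.d (S' (n, 0)).1 + f.toFun (S' (n, 0)).2 + (S' (N.d n, 0)).1 = n) ∧
      -M.d (S' (n, 0)).2 + (S' (N.d n, 0)).2 = 0 := by
    intro n
    have h1 := hS' (n, (0 : M.carrier))
    have h2 : (DGMod.cone f).d (n, (0 : M.carrier)) = (N.d n, (0 : M.carrier)) := by
      rw [DGMod.cone_d, map_zero, add_zero, map_zero, neg_zero]
    rw [h2] at h1
    exact ⟨congrArg Prod.fst h1, congrArg Prod.snd h1⟩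
  have hm : ∀ m : M.carrier,
      -M.d (S' (0, m)).2 + ((S' (f.toFun m, 0)).2 - (S' (0, M.d m)).2) = m := by
    intro m
    have h1 := hS' ((0 : N.carrier), m)
    have h2 : (DGMod.cone f).d ((0 : N.carrier), m) =
        ((f.toFun m, 0) - (0, M.d m) : N.carrier × M.carrier) := by
      rw [DGMod.cone_d, map_zero, zero_add, Prod.mk_sub_mk, sub_zero, zero_sub]
    rw [h2] at h1
    have h3 : S' ((f.toFun m, 0) - (0, M.d m)) = S' (f.toFun m, 0) - S' (0, M.d m) :=
      map_sub S' _ _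
    have h4 := congrArg Prod.snd h1
    change -M.d (S' (0, m)).2 + (S' ((f.toFun m, 0) - (0, M.d m))).2 = m at h4
    rw [h3] at h4
    exact h4
  refine ⟨LinearMap.snd K _ _ ∘ₗ S' ∘ₗ LinearMap.inl K _ _, fun i x hx => ?_, fun x => ?_,
    ⟨LinearMap.snd K _ _ ∘ₗ S' ∘ₗ LinearMap.inr K _ _, fun i x hx => ?_, fun x => ?_⟩,
    ⟨-(LinearMap.fst K _ _ ∘ₗ S' ∘ₗ LinearMap.inl K _ _), fun i x hx => ?_, fun x => ?_⟩⟩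
  · have := (hS i (x, 0) ⟨hx, zero_mem _⟩).2
    change (S' (x, 0)).2 ∈ M.deg (i - 1 + 1) at this
    rwa [sub_add_cancel] at this
  · exact (neg_add_eq_zero.1 (hn x).2).symm
  · have := (hS (i - 1) ((0 : N.carrier), x) ⟨zero_mem _, by rwa [sub_add_cancel]⟩).2
    change (S' (0, x)).2 ∈ M.deg (i - 1 - 1 + 1) at this
    rw [sub_add_cancel] at this
    exact this
  · change (S' (f.toFun x, 0)).2 = x + M.d (S' (0, x)).2 + (S' (0, M.d x)).2
    refine sub_eq_zero.1 (Eq.trans ?_ (sub_eq_zero.2 (hm x)))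
    abel
  · have := (hS i (x, (0 : M.carrier)) ⟨hx, zero_mem _⟩).1
    exact neg_mem this
  · change f.toFun (S' (x, 0)).2 = x + N.d (-(S' (x, 0)).1) + -(S' (N.d x, 0)).1
    refine sub_eq_zero.1 (Eq.trans ?_ (sub_eq_zero.2 (hn x).1))
    rw [map_neg]
    abel

end Contraction

/-! ### Homotopies on tensor products of complexes -/

namespace Tens

variable {K : Type u} [Field K] {I : Type u} [Fintype I] [LinearOrder I] (V : I → DGVect K)

/-- The map `f` on the factor `c`, and the identity on the others, without sign. -/
def mapAt (c : I) (f : V c →ₗ[K] V c) : Carrier V →ₗ[K] Carrier V :=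
  PiTensorProduct.map (Function.update (fun _ => LinearMap.id) c f)

theorem mapAt_tprod (c : I) (f : V c →ₗ[K] V c) (v : ∀ c, V c) :
    mapAt V c f (PiTensorProduct.tprod K v) =
      PiTensorProduct.tprod K (Function.update v c (f (v c))) := by
  rw [mapAt, PiTensorProduct.map_tprod]
  congr 1
  funext c'
  by_cases h : c' = c
  · subst h; simp
  · simp [h]

theorem par_update_pred (i : I → ℤ) (c : I) :
    par (Function.update i c (i c - 1)) = par i + Pi.single c 1 := by
  funext c'
  by_cases h : c' = c
  · subst h; simp [par, sub_eq_add_neg]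
  · simp [par, h]

/-- The homotopy is `H` at the factor `c` with the Koszul sign of the preceding factors. Its mixed
terms with the differentials of the other factors cancel, because exchanging two odd operators
changes the sign. -/
theorem mapAt_htpyId (c : I) {e : V c →ₗ[K] V c} (h : HtpyId (V c) e) :
    HtpyId (tensor V) (mapAt V c e) := by
  obtain ⟨H, hH, hH'⟩ := h
  have key : ∀ {i : I → ℤ} {v : ∀ c, V c}, IsHom i v →
      (mapAt V c H ∘ₗ signOp V (dExp c)) (PiTensorProduct.tprod K v) =
        sgn K (dExp c (par i)) • PiTensorProduct.tprod K (Function.update v c (H (v c))) := by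
    intro i v hv
    rw [LinearMap.comp_apply, signOp_tprod V _ hv, map_smul, mapAt_tprod]
  have hdeg : ∀ (n : ℤ) (x : Carrier V), x ∈ deg V n →
      (mapAt V c H ∘ₗ signOp V (dExp c)) x ∈ deg V (n - 1) := by
    intro n x hx
    induction hx using Submodule.span_induction with
    | mem x hx =>
      obtain ⟨i, v, hv, hn, rfl⟩ := hx
      rw [key hv]
      refine Submodule.smul_mem _ _ (tprod_mem_deg V (hv.update c (hH _ _ (hv c))) ?_)
      have : Function.update i c (i c - 1) = i - Pi.single c 1 := by
        funext c'
        by_cases h : c' = c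
        · subst h; simp
        · simp [h]
      rw [this]
      simp [Finset.sum_sub_distrib, hn]
    | zero => rw [map_zero]; exact zero_mem _
    | add x y _ _ hx hy => rw [map_add]; exact add_mem hx hy
    | smul r x _ hx => rw [map_smul]; exact Submodule.smul_mem _ _ hx
  have hsum : ∀ x : Carrier V, mapAt V c e x = x + d V ((mapAt V c H ∘ₗ signOp V (dExp c)) x) +
      (mapAt V c H ∘ₗ signOp V (dExp c)) (d V x) := by
    intro x
    induction x using induction V with
    | tprod i v hv =>
      have h1 := hv.update c (hH _ _ (hv c))
      rw [key hv, map_smul, d_tprod V h1, d_tprod V hv, map_sum, mapAt_tprod, hH',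
        MultilinearMap.map_update_add, MultilinearMap.map_update_add, Function.update_eq_self,
        add_assoc, add_assoc]
      congr 1
      rw [← Finset.add_sum_erase _ _ (Finset.mem_univ c),
        ← Finset.add_sum_erase _ _ (Finset.mem_univ c), map_smul,
        key (hv.update c ((V c).d_mem (hv c))), par_update, par_update_pred, dExp_add, dExp_single,
        if_neg (lt_irrefl c), add_zero, smul_add, smul_smul, smul_smul, ← sgn_add,
        CharTwo.add_self_eq_zero]
      have h0 : sgn K 0 = 1 := by simp [sgn]
      simp only [h0, one_smul, Function.update_self, Function.update_idem]
      rw [add_add_add_comm, left_eq_add, Finset.smul_sum, ← Finset.sum_add_distrib]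
      refine Finset.sum_eq_zero fun c' hc' => ?_
      have hne : c' ≠ c := Finset.ne_of_mem_erase hc'
      rw [map_smul, key (hv.update c' ((V c').d_mem (hv c'))), Function.update_of_ne hne,
        Function.update_of_ne hne.symm, Function.update_comm hne.symm, smul_smul, smul_smul,
        ← sgn_add, ← sgn_add, ← add_smul, par_update, dExp_add, dExp_add, dExp_single, dExp_single]
      have : sgn K (dExp c (par i) + (dExp c' (par i) + if c < c' then 1 else 0)) +
          sgn K (dExp c' (par i) + (dExp c (par i) + if c' < c then 1 else 0)) = 0 := by
        generalize dExp c (par i) = a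
        generalize dExp c' (par i) = b
        have h11 : sgn K 1 = -1 := by simp [sgn]
        rcases lt_or_gt_of_ne hne with h | h
        · rw [if_neg h.not_gt, if_pos h]
          simp only [sgn_add, h11, h0]; ring
        · rw [if_pos h, if_neg h.not_gt]
          simp only [sgn_add, h11, h0]; ring
      rw [this, zero_smul]
    | zero => simp
    | add x y hx hy => simp only [map_add, hx, hy]; abel
    | smul r x hx => simp only [map_smul, hx, smul_add]
  exact ⟨mapAt V c H ∘ₗ signOp V (dExp c), hdeg, hsum⟩

/-- The maps are applied to one factor at a time. The resulting homotopy depends on the order of the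
factors, so it is not compatible with permutations in general. -/
theorem map_htpyId {e : ∀ c, V c →ₗ[K] V c}
    (hm : ∀ c i x, x ∈ (V c).deg i → e c x ∈ (V c).deg i)
    (hd : ∀ c x, e c ((V c).d x) = (V c).d (e c x)) (h : ∀ c, HtpyId (V c) (e c)) :
    HtpyId (tensor V) (map e) := by
  classical
  have key : ∀ s : Finset I, HtpyId (tensor V)
      (map fun c => if c ∈ s then e c else LinearMap.id) := by
    intro s
    induction s using Finset.induction_on with
    | empty =>
      have : (map fun c => if c ∈ (∅ : Finset I) then e c else LinearMap.id) =
          (LinearMap.id : Carrier V →ₗ[K] Carrier V) := by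
        simp only [Finset.notMem_empty, if_false]
        exact PiTensorProduct.map_id
      rw [this]
      exact HtpyId.id _
    | insert a s ha ih =>
      have : (map fun c => if c ∈ insert a s then e c else LinearMap.id) =
          (map fun c => if c ∈ s then e c else LinearMap.id) ∘ₗ mapAt V a (e a) := by
        refine (congrArg PiTensorProduct.map ?_).trans (PiTensorProduct.map_comp _ _)
        funext c
        by_cases h : c = a
        · subst h; simp [ha]
        · simp [h]
      rw [this]
      refine ih.comp (mapAt_htpyId V a (h a)) (fun n x hx => map_mem _ ?_ hx)
        (fun x => map_d _ ?_ ?_ x)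
      · intro c i x hx
        split_ifs
        · exact hm c i x hx
        · exact hx
      · intro c i x hx
        split_ifs
        · exact hm c i x hx
        · exact hx
      · intro c x
        split_ifs
        · exact hd c x
        · rfl
  simpa using key Finset.univ

end Tens

/-! ### Averaging over the Galois group -/

section Average

variable {k L : Type u} [Field k] [Field L] [Algebra k L] [FiniteDimensional k L] [IsGalois k L]

theorem exists_sum_galois_eq_one : ∃ a : L, ∑ ρ : L ≃ₐ[k] L, ρ a = 1 := by
  obtain ⟨a, ha⟩ := Algebra.trace_surjective k L 1
  exact ⟨a, by rw [← trace_eq_sum_automorphisms, ha, map_one]⟩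

namespace GaloisComplex

variable (W : GaloisComplex k L)

/-- The sum of the conjugates of an element. -/
def average (x : W.toDGVect) : W.inv :=
  ⟨∑ ρ, W.act ρ x, fun τ => by
    rw [map_sum]
    simp only [← W.act_mul]
    exact Fintype.sum_equiv (Equiv.mulLeft τ) _ _ fun _ => rfl⟩

/-- The primitive is the sum of the conjugates of `a • y` with `a` of trace `1`. Division by the
order of the group, which may be zero in the field, is avoided. -/
theorem exists_inv_boundary {x y : W.toDGVect} (hx : x ∈ W.inv) (h : x = W.d y) :
    ∃ y' ∈ W.inv, x = W.d y' := by
  obtain ⟨a, ha⟩ := exists_sum_galois_eq_one (k := k) (L := L)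
  refine ⟨_, (W.average (a • y)).2, ?_⟩
  change x = W.d (∑ ρ, W.act ρ (a • y))
  rw [map_sum]
  simp only [← W.act_d, map_smul, ← h, W.act_smul, hx _]
  rw [← Finset.sum_smul, ha, one_smul]

end GaloisComplex

end Average

/-! ### The Weil restriction preserves quasi-isomorphisms -/

section WeilQI

variable (k : Type u) {l : Type u} (L : Type u) [Field k] [Field l] [Field L] [Algebra k l]
  [Algebra k L] [Algebra l L] [IsScalarTower k l L] [FiniteDimensional k L]

theorem extend_htpyId (B : Type u) [Field B] [Algebra l B] {V : DGVect l} {e : V →ₗ[l] V}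
    (h : HtpyId V e) : HtpyId (extend B V) (e.baseChange B) := by
  obtain ⟨H, hH, hH'⟩ := h
  have hsum : ∀ x : B ⊗[l] V, e.baseChange B x = x + V.d.baseChange B (H.baseChange B x) +
      H.baseChange B (V.d.baseChange B x) := by
    intro x
    induction x using TensorProduct.induction_on with
    | zero => simp
    | tmul b v => simp [hH', TensorProduct.tmul_add]
    | add x y hx hy => simp only [map_add, hx, hy]; abel
  refine ⟨H.baseChange B, fun i x hx => ?_, hsum⟩
  · refine extend_induction B (motive := fun x => H.baseChange B x ∈ (V.deg (i - 1)).baseChange B)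
      hx (fun b v hv => ?_) ?_ ?_
    · exact Submodule.tmul_mem_baseChange_of_mem b (hH _ _ hv)
    · simp
    · intro x y hx hy; rw [map_add]; exact add_mem hx hy

theorem tensorMap_htpyId {V : DGVect l} {e : V →ₗ[l] V} (hm : ∀ i x, x ∈ V.deg i → e x ∈ V.deg i)
    (hd : ∀ x, e (V.d x) = V.d (e x)) (h : HtpyId V e) :
    ∃ H : Tens.Carrier (conjFam k L V) →ₗ[L] Tens.Carrier (conjFam k L V),
      ∀ x, Tens.d (conjFam k L V) x = 0 → tensorMap k L e x = x + Tens.d (conjFam k L V) (H x) := by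
  obtain ⟨H, -, hH⟩ :=
  Tens.map_htpyId (conjFam k L V) (conjFamMap_mem k L e hm)
    (fun c x => baseChange_d (Tw (emb c)) e hd x) fun c => extend_htpyId (Tw (emb c)) h
  refine ⟨H, fun x hx => (hH x).trans ?_⟩
  have : H ((tensor (conjFam k L V)).d x) = 0 := (congrArg H hx).trans (map_zero H)
  rw [this, add_zero]
  rfl

theorem tensorMap_mem_inv {V W : DGVect l} {g : V →ₗ[l] W}
    (hg : ∀ i x, x ∈ V.deg i → g x ∈ W.deg i) {x : (weilTensor k L V).toDGVect}
    (hx : x ∈ (weilTensor k L V).inv) :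
    (tensorMap k L g x : (weilTensor k L W).toDGVect) ∈ (weilTensor k L W).inv := fun ρ =>
  (galAct_tensorMap k L g hg ρ x).trans (congrArg (tensorMap k L g) (hx ρ))

theorem tensorMap_d {V W : DGVect l} {g : V →ₗ[l] W} (hg : ∀ i x, x ∈ V.deg i → g x ∈ W.deg i)
    (hd : ∀ x, g (V.d x) = W.d (g x)) (x : Tens.Carrier (conjFam k L V)) :
    tensorMap k L g (Tens.d (conjFam k L V) x) = Tens.d (conjFam k L W) (tensorMap k L g x) :=
  Tens.map_d (V := conjFam k L V) (W := conjFam k L W) _ (conjFamMap_mem k L g hg)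
    (fun c x => baseChange_d (Tw (emb c)) g hd x) x

variable [IsGalois k L]

/-- The tensor power of a homotopy inverse of `f` is equivariant, hence acts on invariants. Cocycles
are compared through the homotopies, which need not be equivariant; the primitives they give are
then replaced by invariant ones. -/
theorem weilFunctor_QI {A : DGAlg l} {M N : DGMod A} {f : M ⟶ N} (h : QI f.toFun) :
    QI ((weilFunctor k L A).map f).toFun := by
  obtain ⟨g, hgm, hgd, hgf, hfg⟩ := h.exists_inverse
  obtain ⟨H, hH⟩ := tensorMap_htpyId k L (fun i x hx => hgm i _ (f.map_mem i x hx))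
    (fun x => by simp [f.map_d, hgd]) hgf
  obtain ⟨S, hS⟩ := tensorMap_htpyId k L (fun i x hx => f.map_mem i _ (hgm i x hx))
    (fun x => by simp [f.map_d, hgd]) hfg
  constructor
  · rintro ⟨x, hx⟩ hdx ⟨y, hy⟩ hxy
    have hdx' : Tens.d (conjFam k L M.toDGVect) x = 0 := congrArg Subtype.val hdx
    have hxy' : tensorMap k L f.toFun x = Tens.d (conjFam k L N.toDGVect) y :=
      congrArg Subtype.val hxy
    have h1 := ((congrArg (tensorMap k L g) hxy').trans (tensorMap_d k L hgm hgd y)).symm.trans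
      ((tensorMap_comp k L f.toFun g x).symm.trans (hH x hdx'))
    obtain ⟨z, hz, hxz⟩ := (weilTensor k L M.toDGVect).exists_inv_boundary
      (y := tensorMap k L g y - H x) hx (by
        change x = Tens.d (conjFam k L M.toDGVect) _
        rw [map_sub]
        exact eq_sub_of_add_eq h1.symm)
    exact ⟨⟨z, hz⟩, Subtype.ext hxz⟩
  · rintro ⟨(y : Tens.Carrier (conjFam k L N.toDGVect)), hy⟩ hdy
    have hdy' : Tens.d (conjFam k L N.toDGVect) y = 0 := congrArg Subtype.val hdy
    have h1 := (tensorMap_comp k L g f.toFun y).symm.trans (hS y hdy')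
    have hx := tensorMap_mem_inv k L hgm hy
    have hfx := tensorMap_mem_inv k L f.map_mem hx
    obtain ⟨z, hz, hxz⟩ := (weilTensor k L N.toDGVect).exists_inv_boundary
      (x := (y - tensorMap k L f.toFun (tensorMap k L g y) : Tens.Carrier _)) (y := -S y) (sub_mem hy hfx) (by
        change _ = Tens.d (conjFam k L N.toDGVect) _
        rw [map_neg, h1, sub_add_cancel_left])
    refine ⟨⟨_, hx⟩, ⟨z, hz⟩, Subtype.ext ?_, Subtype.ext (sub_eq_iff_eq_add'.1 hxz)⟩
    change Tens.d (conjFam k L M.toDGVect) (tensorMap k L g y) = 0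
    rw [← tensorMap_d k L hgm hgd, hdy', map_zero]

theorem preservesQuasiIso (A : DGAlg l) : PreservesQuasiIso k L A := fun _ _ f hf =>
  Localization.inverts (toDCat _) (DGMod.quasiIso _) _
    ((DGMod.quasiIso_iff _).2 (weilFunctor_QI k L ((DGMod.quasiIso_iff f).1 hf)))

end WeilQI

/-! ### Galois descent for vector spaces -/

section Descent

variable {k L : Type u} [Field k] [Field L] [Algebra k L] [FiniteDimensional k L] [IsGalois k L]

namespace GaloisComplex

variable (W : GaloisComplex k L)

/-- If a functional `f` kills all invariants, it kills the averages of the elements `a • x`, which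
means that `∑ f(ρ x) ρ(a) = 0` for all `a`. By independence of the automorphisms all coefficients
vanish, in particular `f x`. -/
theorem span_inv : Submodule.span L (W.inv : Set W.toDGVect) = ⊤ := by
  by_contra hne
  obtain ⟨x, hx⟩ : ∃ x, x ∉ Submodule.span L (W.inv : Set W.toDGVect) := by
    by_contra h
    push Not at h
    exact hne (eq_top_iff.2 fun x _ => h x)
  obtain ⟨f, hfx, hf⟩ := Submodule.exists_le_ker_of_notMem hx
  have h1 : ∀ a : L, ∑ ρ : L ≃ₐ[k] L, f (W.act ρ x) * ρ a = 0 := by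
    intro a
    have h2 : f (W.average (a • x)) = 0 := hf (Submodule.subset_span (W.average (a • x)).2)
    have h3 : f (∑ ρ, W.act ρ (a • x)) = 0 := h2
    rw [map_sum] at h3
    rw [← h3]
    refine Finset.sum_congr rfl fun ρ _ => ?_
    rw [W.act_smul, map_smul, smul_eq_mul, mul_comm]
  have hli := (linearIndependent_monoidHom L L).comp
    (fun ρ : L ≃ₐ[k] L => ((ρ : L →+* L) : L →* L)) (fun ρ ρ' h => by
      ext a
      exact DFunLike.congr_fun h a)
  have h4 := Fintype.linearIndependent_iff.1 hli (fun ρ => f (W.act ρ x)) (by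
    funext a
    simpa using h1 a) 1
  rw [W.act_one] at h4
  exact hfx h4

/-- Multiplying a relation over `L` by `b` and averaging gives a relation over `k` with coefficients
the traces of `g i * b`. These vanish for every `b`, and the trace form is nondegenerate. -/
theorem linearIndependent_inv {ι : Type*} {u : ι → W.inv} (h : LinearIndependent k u) :
    LinearIndependent L fun i => (u i : W.toDGVect) := by
  rw [linearIndependent_iff'] at h ⊢
  intro s g hg i hi
  have h1 : ∀ b : L, Algebra.trace k L (g i * b) = 0 := by
    intro b
    refine h s (fun i => Algebra.trace k L (g i * b)) (Subtype.ext ?_) i hi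
    have h2 : (W.average (b • ∑ j ∈ s, g j • (u j : W.toDGVect)) : W.toDGVect) = 0 := by
      rw [hg, smul_zero]
      change ∑ ρ, W.act ρ 0 = 0
      simp
    rw [← W.inv.coe_zero] at h2
    rw [← h2, AddSubgroup.val_finsetSum]
    change _ = ∑ ρ, W.act ρ (b • ∑ j ∈ s, g j • (u j : W.toDGVect))
    simp only [Finset.smul_sum, map_sum, smul_smul, W.act_smul, (u _).2 _]
    rw [Finset.sum_comm]
    refine Finset.sum_congr rfl fun j _ => ?_
    rw [inv_smul_coe, trace_eq_sum_automorphisms, Finset.sum_smul]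
    simp only [mul_comm]
  exact (traceForm_nondegenerate k L).1 (g i) h1

/-- A basis of the invariants of a Galois complex is a basis of the complex. -/
def descentBasis {ι : Type*} (b : Module.Basis ι k W.inv) : Module.Basis ι L W.toDGVect :=
  Module.Basis.mk (W.linearIndependent_inv b.linearIndependent) (by
    rw [← W.span_inv, Submodule.span_le]
    intro x hx
    have h1 : (⟨x, hx⟩ : W.inv) = (b.repr ⟨x, hx⟩).sum fun i a => a • b i :=
      (b.linearCombination_repr ⟨x, hx⟩).symm
    have h2 : x = ∑ i ∈ (b.repr ⟨x, hx⟩).support,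
        algebraMap k L (b.repr ⟨x, hx⟩ i) • (b i : W.toDGVect) := by
      conv_lhs => rw [show x = (⟨x, hx⟩ : W.inv).1 from rfl, h1]
      rw [Finsupp.sum, AddSubgroup.val_finsetSum]
      rfl
    rw [h2]
    exact sum_mem fun i _ => Submodule.smul_mem _ _ (Submodule.subset_span ⟨i, rfl⟩))

theorem descentBasis_apply {ι : Type*} (b : Module.Basis ι k W.inv) (i : ι) :
    W.descentBasis b i = (b i : W.toDGVect) := by
  rw [descentBasis, Module.Basis.mk_apply]

end GaloisComplex

end Descent

/-! ### Tensor products of pairings by a space with a homogeneous basis -/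

namespace Tens

variable {K : Type u} [Field K] {I : Type u} [Fintype I] [LinearOrder I]

theorem signOp_signOp (V : I → DGVect K) (s : (I → ZMod 2) → ZMod 2) (x : Carrier V) :
    signOp V s (signOp V s x) = x := by
  induction x using induction V with
  | tprod i v hv =>
    rw [signOp_tprod V _ hv, map_smul, signOp_tprod V _ hv, smul_smul, ← sgn_add,
      CharTwo.add_self_eq_zero]
    simp [sgn]
  | zero => simp
  | add x y hx hy => simp only [map_add, hx, hy]
  | smul r x hx => simp only [map_smul, hx]

variable {E : Type*} [Fintype E]

theorem sum_map_eq {V W : I → DGVect K} (f : ∀ c, E → (V c →ₗ[K] W c)) :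
    ∑ φ : I → E, map (V := V) (W := W) (fun c => f c (φ c)) = map fun c => ∑ e, f c e := by
  classical
  exact ((PiTensorProduct.mapMultilinear K (fun c => (V c).carrier)
    fun c => (W c).carrier).map_sum f).symm

theorem map_map {U V W : I → DGVect K} (f : ∀ c, U c →ₗ[K] V c) (g : ∀ c, V c →ₗ[K] W c)
    (x : Carrier U) : map g (map f x) = map (fun c => g c ∘ₗ f c) x :=
  congrArg (fun h => h x) (PiTensorProduct.map_comp (R := K) g f).symm

variable {U V W : I → DGVect K} (μ : ∀ c, Pairing (U c) (V c) (W c))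
  (b : ∀ c, Module.Basis E K (U c)) (δ : E → ℤ) (inj : ∀ c, E → (V c →ₗ[K] W c))
  (pr : ∀ c, E → (W c →ₗ[K] V c))

/-- Pairing with a pure tensor of basis elements is the tensor product of the inclusions of
summands, precomposed with a sign operator which is an involution and so does not affect
bijectivity. -/
theorem pair_basis (hb : ∀ c e, b c e ∈ (U c).deg (δ e))
    (hinj : ∀ c e y, (μ c).toFun (b c e) y = inj c e y) (φ : I → E) (y : Carrier V) :
    pair μ (Basis.piTensorProduct b φ) y =
      map (fun c => inj c (φ c)) (signOp V (pExp (par fun c => δ (φ c))) y) := by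
  rw [Basis.piTensorProduct_apply]
  induction y using induction V with
  | tprod i v hv =>
    rw [pair_tprod μ (fun c => hb c (φ c)) hv, signOp_tprod V _ hv, map_smul, map_tprod]
    simp only [hinj]
  | zero => simp
  | add x y hx hy => simp only [map_add, hx, hy]
  | smul r x hx => simp only [map_smul, hx]

/-- Each `W c` is a direct sum of copies of `V c` indexed by `E`. Distributing the tensor product
over these sums gives a direct sum of copies of `⨂ V` indexed by the functions `φ`, and these
correspond to the basis tensors of `⨂ U`. -/
theorem lift_pair_bijective (hb : ∀ c e, b c e ∈ (U c).deg (δ e))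
    (hinj : ∀ c e y, (μ c).toFun (b c e) y = inj c e y)
    (hpr : ∀ c e y, pr c e (inj c e y) = y)
    (hpr' : ∀ c e e' y, e ≠ e' → pr c e (inj c e' y) = 0)
    (hsum : ∀ c w, ∑ e, inj c e (pr c e w) = w) :
    Function.Bijective (TensorProduct.lift (pair μ)) := by
  classical
  let B := Basis.piTensorProduct b
  let Θ := TensorProduct.equivFinsuppOfBasisLeft (N := Carrier V) B
  have hΘ : ∀ y : (I → E) →₀ Carrier V, TensorProduct.lift (pair μ) (Θ.symm y) =
      ∑ φ, map (fun c => inj c (φ c)) (signOp V (pExp (par fun c => δ (φ c))) (y φ)) := by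
    intro y
    rw [TensorProduct.equivFinsuppOfBasisLeft_symm_apply, Finsupp.sum_fintype _ _ (by simp),
      map_sum]
    refine Finset.sum_congr rfl fun φ _ => ?_
    rw [TensorProduct.lift.tmul, pair_basis μ b δ inj hb hinj]
  -- The tensor products of the projections and inclusions again form a complete system of
  -- orthogonal projections and inclusions.
  have hpp : ∀ (φ ψ : I → E) (y : Carrier V), map (fun c => pr c (φ c)) (map (fun c => inj c (ψ c)) y) =
      if ψ = φ then y else 0 := by
    intro φ ψ y
    rw [map_map]
    split_ifs with h
    · subst h
      have : (fun c => pr c (ψ c) ∘ₗ inj c (ψ c)) = fun c => LinearMap.id := by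
        funext c
        exact LinearMap.ext fun y => hpr c _ y
      rw [this]
      exact congrArg (fun h => h y) (PiTensorProduct.map_id (R := K))
    · obtain ⟨c, hc⟩ : ∃ c, ψ c ≠ φ c := by
        by_contra hcon
        push Not at hcon
        exact h (funext hcon)
      induction y using PiTensorProduct.induction_on with
      | smul_tprod r v =>
        rw [map_smul, map_tprod, MultilinearMap.map_coord_zero _ c (hpr' c _ _ _ hc.symm),
          smul_zero]
      | add x y hx hy => rw [map_add, hx, hy, add_zero]
  suffices h : Function.Bijective (TensorProduct.lift (pair μ) ∘ Θ.symm) from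
    (Function.Bijective.of_comp_iff _ Θ.symm.bijective).1 h
  refine ⟨fun y y' h => Finsupp.ext fun φ => ?_, fun w => ?_⟩
  · have h1 := congrArg (fun w => signOp V (pExp (par fun c => δ (φ c)))
      (map (fun c => pr c (φ c)) w)) h
    simp only [Function.comp_apply, hΘ, map_sum, hpp] at h1
    simpa only [Finset.sum_ite_eq', Finset.mem_univ, if_true, signOp_signOp, apply_ite, map_zero]
      using h1
  · refine ⟨Finsupp.equivFunOnFinite.symm fun φ =>
      signOp V (pExp (par fun c => δ (φ c))) (map (fun c => pr c (φ c)) w), ?_⟩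
    simp only [Function.comp_apply, hΘ, Finsupp.equivFunOnFinite_symm_apply_apply, signOp_signOp,
      map_map]
    have h1 := sum_map_eq (V := W) (W := W) fun c e => inj c e ∘ₗ pr c e
    have h2 : (fun c => ∑ e, inj c e ∘ₗ pr c e) = fun c => LinearMap.id := by
      funext c
      refine LinearMap.ext fun w => ?_
      rw [LinearMap.sum_apply]
      exact hsum c w
    rw [h2] at h1
    have h3 := LinearMap.congr_fun h1 w
    rw [LinearMap.sum_apply] at h3
    exact h3.trans (congrArg (fun h => h w) (PiTensorProduct.map_id (R := K)))

end Tens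

theorem sum_bilinear_bijective {K : Type*} [Field K] {U V W : Type*} [AddCommGroup U]
    [AddCommGroup V] [AddCommGroup W] [Module K U] [Module K V] [Module K W]
    {μ : U →ₗ[K] V →ₗ[K] W} (h : Function.Bijective (TensorProduct.lift μ))
    {J : Type*} [Fintype J] (v : Module.Basis J K U) :
    Function.Bijective fun y : J → V => ∑ j, μ (v j) (y j) := by
  classical
  let Θ := TensorProduct.equivFinsuppOfBasisLeft (N := V) v
  have : (fun y : J → V => ∑ j, μ (v j) (y j)) =
      TensorProduct.lift μ ∘ Θ.symm ∘ Finsupp.equivFunOnFinite.symm := by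
    funext y
    rw [Function.comp_apply, Function.comp_apply,
      TensorProduct.equivFinsuppOfBasisLeft_symm_apply, Finsupp.sum_fintype _ _ (by simp), map_sum]
    rfl
  rw [this]
  exact h.comp (Θ.symm.bijective.comp Finsupp.equivFunOnFinite.symm.bijective)

/-- A `k`-basis of the invariants of `X` is an `L`-basis of `X`, so every element of `Z` has unique
coefficients in `Y`. The group fixes the basis, so uniqueness forces the coefficients of an
invariant element to be invariant. -/
theorem GaloisComplex.sum_invPair_bijective {k L : Type u} [Field k] [Field L] [Algebra k L]
    [FiniteDimensional k L] [IsGalois k L] {X Y Z : GaloisComplex k L}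
    (μ : X.toDGVect →ₗ[L] Y.toDGVect →ₗ[L] Z.toDGVect)
    (hμ : ∀ ρ x y, Z.act ρ (μ x y) = μ (X.act ρ x) (Y.act ρ y))
    (h : Function.Bijective (TensorProduct.lift μ)) {J : Type*} [Fintype J]
    (b : Module.Basis J k X.inv) :
    Function.Bijective fun y : J → Y.inv => ∑ j, invPair μ hμ (b j) (y j) := by
  have hB := sum_bilinear_bijective h (X.descentBasis b)
  simp only [descentBasis_apply] at hB
  have hc : ∀ y : J → Y.inv, ((∑ j, invPair μ hμ (b j) (y j) : Z.inv) : Z.toDGVect) =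
      ∑ j, μ (b j : X.toDGVect) (y j : Y.toDGVect) := fun y => by
    rw [AddSubgroup.val_finsetSum]
    rfl
  refine ⟨fun y y' hy => ?_, fun z => ?_⟩
  · have h1 := congrArg Subtype.val hy
    simp only [hc] at h1
    exact funext fun j => Subtype.ext (congrFun (hB.1 h1) j)
  · obtain ⟨y, hy⟩ := hB.2 (z : Z.toDGVect)
    have hinv : ∀ j, y j ∈ Y.inv := by
      intro j ρ
      refine congrFun (hB.1 (a₁ := fun j => Y.act ρ (y j)) (a₂ := y) ?_) j
      refine Eq.trans ?_ ((z.2 ρ).trans hy.symm)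
      rw [← hy, map_sum]
      refine Finset.sum_congr rfl fun j _ => ?_
      rw [hμ, (b j).2 ρ]
    exact ⟨fun j => ⟨y j, hinv j⟩, Subtype.ext ((hc _).trans hy)⟩

/-! ### Finite sums of shifts as tensor products with a graded vector space -/

section GradedSpace

variable (l : Type u) [Field l] {E : Type u} [Fintype E] (δ : E → ℤ)

/-- The complex with zero differential having a basis indexed by `E`, with degrees `δ`. -/
def gradedSpace : DGVect l where
  carrier := E → l
  deg i :=
    { carrier := {f | ∀ e, δ e ≠ i → f e = 0}
      add_mem' := fun {f g} hf hg e he => by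
        change f e + g e = 0
        rw [hf e he, hg e he, add_zero]
      zero_mem' := fun _ _ => rfl
      smul_mem' := fun c f hf e he => by
        change c * f e = 0
        rw [hf e he, mul_zero] }
  isInternal := by
    classical
    refine DGVect.isInternal_of _ ?_ δ (fun e => (LinearMap.single l (fun _ => l) e ∘ₗ
      (LinearMap.proj e : (E → l) →ₗ[l] l)).toAddMonoidHom) ?_ ?_
    · rw [eq_top_iff]
      intro f _
      rw [← Finset.univ_sum_single (f : E → l)]
      refine sum_mem fun e _ => Submodule.mem_iSup_of_mem (δ e) fun e' he' => ?_
      exact Pi.single_eq_of_ne (fun h => he' (by rw [h])) _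
    · intro e j hj f hf
      change Pi.single (M := fun _ => l) e (f e) = 0
      rw [hf e (Ne.symm hj), Pi.single_zero]
    · intro f hf
      funext e
      have := congrFun (hf e) e
      change Pi.single (M := fun _ => l) e (f e) e = 0 at this
      rwa [Pi.single_eq_same] at this
  d := 0
  d_mem _ := zero_mem _
  d_d _ := rfl

theorem gradedSpace_d : (gradedSpace l δ).d = 0 := rfl

/-- The standard basis of `gradedSpace`. -/
def gradedBasis : Module.Basis E l (gradedSpace l δ) := Pi.basisFun l E

/-- The coordinates in `gradedSpace`. -/
def gradedCoord (e : E) : gradedSpace l δ →ₗ[l] l := (LinearMap.proj e : (E → l) →ₗ[l] l)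

theorem gradedBasis_apply [DecidableEq E] (e : E) :
    (gradedBasis l δ e : E → l) = Pi.single e 1 := by
  rw [← Pi.basisFun_apply]
  rfl

theorem gradedBasis_mem (e : E) : gradedBasis l δ e ∈ (gradedSpace l δ).deg (δ e) := by
  classical
  intro e' he'
  rw [gradedBasis_apply]
  exact Pi.single_eq_of_ne (fun h => he' (by rw [h])) _

variable {l} {A : DGAlg l} (N : DGMod A)

/-- The linear inclusion of `N` as the summand `e` of `⨁ N[-δ e]`. -/
def dsumInj (e : E) :
    N.toDGVect →ₗ[l] (DGMod.dsum fun e => DGMod.shift N (-δ e)).toDGVect :=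
  (DGMod.dinj (fun e => DGMod.shift N (-δ e)) e).toFun

/-- The linear projection of `⨁ N[-δ e]` to the summand `e`. -/
def dsumPr (e : E) :
    (DGMod.dsum fun e => DGMod.shift N (-δ e)).toDGVect →ₗ[l] N.toDGVect :=
  (DGMod.dpr (fun e => DGMod.shift N (-δ e)) e).toFun

theorem dsumPr_inj (e : E) (x : N.carrier) : dsumPr δ N e (dsumInj δ N e x) = x :=
  DGMod.dinj_same (fun e => DGMod.shift N (-δ e)) e x

theorem dsumPr_inj_ne {e e' : E} (h : e ≠ e') (x : N.carrier) :
    dsumPr δ N e (dsumInj δ N e' x) = 0 :=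
  DGMod.dinj_ne (fun e => DGMod.shift N (-δ e)) h x

theorem sum_dsumInj_pr (w : (DGMod.dsum fun e => DGMod.shift N (-δ e)).carrier) :
    ∑ e, dsumInj δ N e (dsumPr δ N e w) = w := by
  obtain ⟨s, -, hs⟩ := DGMod.dsum_eq_sum w
  exact (hs Finset.univ (Finset.subset_univ s)).symm

theorem dsumInj_d (e : E) (x : N.carrier) :
    (DGMod.dsum fun e => DGMod.shift N (-δ e)).d (dsumInj δ N e x) =
      sg l (δ e) • dsumInj δ N e (N.d x) := by
  have h := (DGMod.dinj (fun e => DGMod.shift N (-δ e)) e).map_d x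
  refine h.symm.trans ?_
  refine (map_smul (dsumInj δ N e) (sg l (-δ e)) (N.d x)).trans ?_
  rw [sg_neg]

/-- The bilinear map `(∑ a_e e, x) ↦ ∑ a_e x_e`. -/
def dsumBilin : gradedSpace l δ →ₗ[l] N.carrier →ₗ[l]
    (DGMod.dsum fun e => DGMod.shift N (-δ e)).carrier :=
  ∑ e, (gradedCoord l δ e).smulRight (dsumInj δ N e)

theorem dsumBilin_apply (f : gradedSpace l δ) (x : N.carrier) :
    dsumBilin δ N f x = ∑ e, (f : E → l) e • dsumInj δ N e x := by
  rw [dsumBilin, LinearMap.sum_apply, LinearMap.sum_apply]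
  rfl

/-- The pairing `(∑ a_e e, x) ↦ ∑ a_e x_e`. -/
def dsumPairing : Pairing (gradedSpace l δ) N.toDGVect
    (DGMod.dsum fun e => DGMod.shift N (-δ e)).toDGVect where
  toFun := dsumBilin δ N
  mem := by
    intro i j f x hf hx
    rw [dsumBilin_apply]
    refine sum_mem fun e _ => ?_
    by_cases he : δ e = i
    · refine Submodule.smul_mem _ _ ((DGMod.dinj (fun e => DGMod.shift N (-δ e)) e).map_mem _ _ ?_)
      change x ∈ N.deg (i + j + -δ e)
      rwa [he, add_neg_cancel_comm]
    · rw [hf e he, zero_smul]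
      exact zero_mem _
  leibniz := by
    intro i f x hf
    have h0 : (gradedSpace l δ).d f = 0 := rfl
    rw [h0, map_zero, LinearMap.zero_apply, zero_add, dsumBilin_apply, dsumBilin_apply, map_sum,
      Finset.smul_sum]
    refine Finset.sum_congr rfl fun e _ => ?_
    by_cases he : δ e = i
    · rw [map_smul, dsumInj_d, he, smul_comm]
      rfl
    · rw [hf e he, zero_smul, zero_smul, map_zero, smul_zero]

theorem dsumPairing_apply (f : gradedSpace l δ) (x : N.carrier) :
    (dsumPairing δ N).toFun f x = ∑ e, (f : E → l) e • dsumInj δ N e x := dsumBilin_apply δ N f x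

theorem dsumPairing_basis (e : E) (x : N.carrier) :
    (dsumPairing δ N).toFun (gradedBasis l δ e) x = dsumInj δ N e x := by
  classical
  refine (dsumPairing_apply δ N _ x).trans ?_
  rw [gradedBasis_apply, Finset.sum_eq_single e, Pi.single_eq_same, one_smul]
  · intro e' _ h
    rw [Pi.single_eq_of_ne h, zero_smul]
  · simp

theorem dsumPairing_act (f : gradedSpace l δ) (x : N.carrier) (a : A.carrier) :
    (DGMod.dsum fun e => DGMod.shift N (-δ e)).act.toFun ((dsumPairing δ N).toFun f x) a =
      (dsumPairing δ N).toFun f (N.act.toFun x a) := by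
  refine Eq.trans ?_ (dsumPairing_apply δ N f _).symm
  rw [dsumPairing_apply δ N f x, map_sum, LinearMap.sum_apply]
  refine Finset.sum_congr rfl fun e _ => ?_
  rw [map_smul, LinearMap.smul_apply]
  exact congrArg ((f : E → l) e • ·) ((DGMod.dinj (fun e => DGMod.shift N (-δ e)) e).map_act x a).symm

end GradedSpace

theorem DGMod.ddesc_bijective {K : Type u} [Field K] {A : DGAlg K} {J : Type u} [Fintype J]
    {N : J → DGMod A} {M : DGMod A} (f : ∀ j, N j ⟶ M)
    (h : Function.Bijective fun y : ∀ j, (N j).carrier => ∑ j, (f j).toFun (y j)) :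
    Function.Bijective (ddesc f).toFun := by
  classical
  have h1 : ⇑(ddesc f).toFun = (fun y : ∀ j, (N j).carrier => ∑ j, (f j).toFun (y j)) ∘
      DFinsupp.equivFunOnFintype := by
    funext z
    obtain ⟨s, -, hs⟩ := dsum_eq_sum z
    have h2 := congrArg (ddesc f).toFun (hs Finset.univ (Finset.subset_univ s))
    rw [map_sum] at h2
    rw [h2]
    refine Finset.sum_congr rfl fun j _ => ?_
    rw [← comp_apply, dinj_ddesc]
    rfl
  rw [h1]
  exact h.comp DFinsupp.equivFunOnFintype.bijective

/-- The isomorphism from a direct sum of shifts given by a family of homogeneous maps. -/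
def DGMod.isoOfHomogeneous {K : Type u} [Field K] {A : DGAlg K} {J : Type u} [Fintype J]
    {n : J → ℤ} {M N : DGMod A} (f : J → (N.carrier →ₗ[K] M.carrier))
    (hm : ∀ j i x, x ∈ N.deg i → f j x ∈ M.deg (n j + i))
    (hd : ∀ j x, M.d (f j x) = sg K (n j) • f j (N.d x))
    (ha : ∀ j x a, M.act.toFun (f j x) a = f j (N.act.toFun x a))
    (h : Function.Bijective fun y : J → N.carrier => ∑ j, f j (y j)) :
    dsum (fun j => shift N (-n j)) ≅ M :=
  isoOfBijective (ddesc fun j =>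
    { toFun := f j
      map_mem := fun i x hx => by
        have := hm j (i + -n j) x hx
        rwa [add_comm, neg_add_cancel_right] at this
      map_d := fun x => by
        refine Eq.trans ?_ (hd j x).symm
        refine (map_smul (f j) (sg K (-n j)) (N.d x)).trans ?_
        rw [sg_neg]
      map_act := fun x a => (ha j x a).symm }) (ddesc_bijective _ h)

/-- Bases of the homogeneous components of the invariants are put together. The count of elements is
made over `L`, where the resulting basis can be compared with any other. -/
theorem GaloisComplex.exists_homogeneous_basis {k L : Type u} [Field k] [Field L] [Algebra k L]
    [FiniteDimensional k L] [IsGalois k L] (W : GaloisComplex k L) {ι : Type*} [Fintype ι]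
    (B : Module.Basis ι L W.toDGVect) :
    ∃ (J : Type u) (_ : Fintype J) (n : J → ℤ) (b : Module.Basis J k W.inv),
      Fintype.card J = Fintype.card ι ∧
      ∀ j, (b j : W.invariants.carrier) ∈ W.invariants.deg (n j) := by
  classical
  let b := W.invariants.isInternal.collectedBasis fun i =>
    Module.Basis.ofVectorSpace k (W.invariants.deg i)
  let e := (W.descentBasis b).indexEquiv B
  letI := Fintype.ofEquiv _ e.symm
  exact ⟨_, ‹_›, fun j => j.1, b, Fintype.card_congr e,
    fun j => W.invariants.isInternal.collectedBasis_mem _ j⟩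

/-! ### The Weil restriction of a finite sum of shifts -/

section WeilDsum

variable (k : Type u) {l : Type u} (L : Type u) [Field k] [Field l] [Field L] [Algebra k l]
  [Algebra k L] [Algebra l L] [IsScalarTower k l L] [FiniteDimensional k L]

theorem weilVect_d_eq_zero {U : DGVect l} (h : U.d = 0) (x : weilVect k L U) :
    (weilVect k L U).d x = 0 := by
  have h1 : ∀ c, (conjFam k L U c).d = 0 := fun c =>
    (congrArg (LinearMap.baseChange (Tw (emb c))) h).trans (LinearMap.baseChange_zero ..)
  have h2 : ∀ y : Tens.Carrier (conjFam k L U), Tens.d (conjFam k L U) y = 0 := by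
    intro y
    induction y using Tens.induction with
    | tprod i v hv =>
      rw [Tens.d_tprod _ hv]
      refine Finset.sum_eq_zero fun c _ => ?_
      rw [h1, LinearMap.zero_apply, MultilinearMap.map_update_zero, smul_zero]
    | zero => simp
    | add x y hx hy => rw [map_add, hx, hy, add_zero]
    | smul r x hx => rw [map_smul, hx, smul_zero]
  exact Subtype.ext (h2 (Subtype.val (p := fun y => y ∈ (weilTensor k L U).inv) x))

theorem weilVect_deg_eq_bot {U : DGVect l} (h : ∀ i ≠ 0, U.deg i = ⊥) {n : ℤ} (hn : n ≠ 0) :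
    (weilVect k L U).deg n = ⊥ := by
  have h1 : ∀ c i, i ≠ 0 → (conjFam k L U c).deg i = ⊥ := by
    intro c i hi
    change (U.deg i).baseChange (Tw (emb c)) = ⊥
    rw [h i hi, Submodule.baseChange_bot]
  have h2 : Tens.deg (conjFam k L U) n = ⊥ := by
    rw [Tens.deg, Submodule.span_eq_bot]
    rintro _ ⟨i, v, hv, hin, rfl⟩
    obtain ⟨c, hc⟩ : ∃ c, i c ≠ 0 := by
      by_contra hcon
      push Not at hcon
      exact hn (by rw [← hin, Finset.sum_eq_zero fun c _ => hcon c])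
    refine MultilinearMap.map_coord_zero _ c ?_
    have := hv c
    rw [h1 c _ hc] at this
    exact (Submodule.mem_bot _).1 this
  rw [eq_bot_iff]
  intro x hx
  have h3 : Subtype.val (p := fun y => y ∈ (weilTensor k L U).inv) x ∈
    Tens.deg (conjFam k L U) n := hx
  rw [h2] at h3
  exact Subtype.ext ((Submodule.mem_bot _).1 h3)

variable {A : DGAlg l} {N W : DGMod A} {U : DGVect l}

theorem weilPairing_d (μ : Pairing U N.toDGVect W.toDGVect) {m : ℤ} {v : weilVect k L U}
    (hv : v ∈ (weilVect k L U).deg m) (hd : (weilVect k L U).d v = 0)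
    (x : weilVect k L N.toDGVect) :
    (weilVect k L W.toDGVect).d ((weilPairing k L μ).toFun v x) =
      sg k m • (weilPairing k L μ).toFun v ((weilVect k L N.toDGVect).d x) := by
  rw [(weilPairing k L μ).leibniz x hv, hd, map_zero, LinearMap.zero_apply, zero_add]
  rfl

/-- The basis of `^σU_L` induced by the standard basis of a graded space. -/
def conjBasis {E : Type u} [Fintype E] (δ : E → ℤ) (c : Cosets k l L) :
    Module.Basis E L (conjFam k L (gradedSpace l δ) c) :=
  ((gradedBasis l δ).baseChange (Tw (emb c)) :
    Module.Basis E (Tw (emb c)) (Tw (emb c) ⊗[l] (gradedSpace l δ)))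

theorem conjBasis_apply {E : Type u} [Fintype E] (δ : E → ℤ) (c : Cosets k l L) (e : E) :
    conjBasis k L δ c e = ((1 : Tw (emb c)) ⊗ₜ[l] gradedBasis l δ e :
      Tw (emb c) ⊗[l] (gradedSpace l δ)) :=
  Module.Basis.baseChange_apply (Tw (emb c)) (gradedBasis l δ) e

variable {E : Type u} [Fintype E] (δ : E → ℤ)
  (μ : Pairing (gradedSpace l δ) N.toDGVect W.toDGVect)
  (inj : E → (N.toDGVect →ₗ[l] W.toDGVect)) (pr : E → (W.toDGVect →ₗ[l] N.toDGVect))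

theorem lift_weilPair_bijective
    (hinj : ∀ e x, μ.toFun (gradedBasis l δ e) x = inj e x) (hpr : ∀ e x, pr e (inj e x) = x)
    (hpr' : ∀ e e' x, e ≠ e' → pr e (inj e' x) = 0) (hsum : ∀ w, ∑ e, inj e (pr e w) = w) :
    Function.Bijective (TensorProduct.lift (Tens.pair (conjPairing k L μ))) := by
  classical
  refine Tens.lift_pair_bijective _ (conjBasis k L δ) δ
    (fun c e => conjFamMap k L (inj e) c) (fun c e => conjFamMap k L (pr e) c)
    (fun c e => ?_) (fun c e y => ?_) (fun c e y => ?_) (fun c e e' y hne => ?_) (fun c w => ?_)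
  · rw [conjBasis_apply]
    exact Submodule.tmul_mem_baseChange_of_mem (1 : Tw (emb c)) (gradedBasis_mem l δ e)
  · rw [conjBasis_apply]
    change extPair (Tw (emb c)) μ.toFun (1 ⊗ₜ gradedBasis l δ e)
      (y : Tw (emb c) ⊗[l] N.toDGVect) = (inj e).baseChange (Tw (emb c)) y
    induction y using TensorProduct.induction_on with
    | zero => rw [map_zero, map_zero]
    | tmul a x => rw [extPair_tmul, one_mul, hinj, LinearMap.baseChange_tmul]
    | add x y hx hy => rw [map_add, map_add, hx, hy]
  · change (pr e).baseChange (Tw (emb c)) ((inj e).baseChange (Tw (emb c))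
      (y : Tw (emb c) ⊗[l] N.toDGVect)) = y
    induction y using TensorProduct.induction_on with
    | zero => rw [map_zero, map_zero]
    | tmul a x => rw [LinearMap.baseChange_tmul, LinearMap.baseChange_tmul, hpr]
    | add x y hx hy => rw [map_add, map_add, hx, hy]
  · change (pr e).baseChange (Tw (emb c)) ((inj e').baseChange (Tw (emb c))
      (y : Tw (emb c) ⊗[l] N.toDGVect)) = 0
    induction y using TensorProduct.induction_on with
    | zero => rw [map_zero, map_zero]
    | tmul a x =>
      rw [LinearMap.baseChange_tmul, LinearMap.baseChange_tmul, hpr' _ _ _ hne,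
        TensorProduct.tmul_zero]
    | add x y hx hy => rw [map_add, map_add, hx, hy, add_zero]
  · have key : ∀ w : Tw (emb c) ⊗[l] W.toDGVect,
        ∑ e, (inj e).baseChange (Tw (emb c)) ((pr e).baseChange (Tw (emb c)) w) = w := by
      intro w
      induction w using TensorProduct.induction_on with
      | zero => simp
      | tmul a x =>
        simp only [LinearMap.baseChange_tmul]
        rw [← TensorProduct.tmul_sum, hsum]
      | add x y hx hy =>
        simp only [map_add, Finset.sum_add_distrib]
        rw [hx, hy]
    exact key w

variable [IsGalois k L]

/-- The number of elements is that of the basis of pure tensors over `L`. The last clause, that no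
shift arises when all degrees are zero, is needed to count copies without signs in `K₀`. -/
theorem exists_weilVect_basis :
    ∃ (J : Type u) (_ : Fintype J) (n : J → ℤ)
      (b : Module.Basis J k (weilTensor k L (gradedSpace l δ)).inv),
      Fintype.card J = Fintype.card E ^ Fintype.card (Cosets k l L) ∧
      (∀ j, (b j : weilVect k L (gradedSpace l δ)) ∈ (weilVect k L (gradedSpace l δ)).deg (n j)) ∧
      ((∀ e, δ e = 0) → ∀ j, n j = 0) := by
  classical
  obtain ⟨J, hJ, n, b, hc, hb⟩ := (weilTensor k L (gradedSpace l δ)).exists_homogeneous_basis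
    (Basis.piTensorProduct (conjBasis k L δ))
  refine ⟨J, hJ, n, b, by rw [hc, Fintype.card_fun], hb, fun hδ j => ?_⟩
  by_contra hj
  have h1 : (weilVect k L (gradedSpace l δ)).deg (n j) = ⊥ := by
    refine weilVect_deg_eq_bot k L (fun i hi => ?_) hj
    rw [eq_bot_iff]
    intro f hf
    exact (Submodule.mem_bot _).2 (funext fun e => hf e (by rw [hδ]; exact hi.symm))
  have h2 : ∀ x ∈ (weilVect k L (gradedSpace l δ)).deg (n j), x = 0 := fun x hx =>
    (Submodule.mem_bot k).1 (h1 ▸ hx)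
  exact b.ne_zero j (h2 _ (hb j))

theorem sum_weilPairing_bijective {U V W : DGVect l} (μ : Pairing U V W)
    (h : Function.Bijective (TensorProduct.lift (Tens.pair (conjPairing k L μ))))
    {J : Type*} [Fintype J] (b : Module.Basis J k (weilTensor k L U).inv) :
    Function.Bijective fun y : J → weilVect k L V =>
      ∑ j, (weilPairing k L μ).toFun (b j : weilVect k L U) (y j) :=
  GaloisComplex.sum_invPair_bijective (X := weilTensor k L U) (Y := weilTensor k L V)
    (Z := weilTensor k L W) (weilTensorPairing k L μ).toFun (galAct_pair k L μ) h b

/-- Here `W` is the tensor product of a graded space `U` with `N`. The pairing of the Weil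
restrictions of `U` and `N` identifies that of `W` with their tensor product; since the Weil
restriction of `U` has zero differential, a homogeneous basis of it splits the result into shifts.
-/
theorem exists_weilMod_iso (hμ : ∀ u x a, W.act.toFun (μ.toFun u x) a = μ.toFun u (N.act.toFun x a))
    (hinj : ∀ e x, μ.toFun (gradedBasis l δ e) x = inj e x) (hpr : ∀ e x, pr e (inj e x) = x)
    (hpr' : ∀ e e' x, e ≠ e' → pr e (inj e' x) = 0) (hsum : ∀ w, ∑ e, inj e (pr e w) = w) :
    ∃ (J : Type u) (_ : Fintype J) (n : J → ℤ),
      Fintype.card J = Fintype.card E ^ Fintype.card (Cosets k l L) ∧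
      ((∀ e, δ e = 0) → ∀ j, n j = 0) ∧
      Nonempty ((DGMod.dsum fun j => DGMod.shift (weilMod k L N) (-n j)) ≅ weilMod k L W) := by
  obtain ⟨J, hJ, n, b, hcard, hb, hn⟩ := exists_weilVect_basis (l := l) k L δ
  have hd : ∀ j, (weilVect k L (gradedSpace l δ)).d (b j) = 0 := fun j =>
    weilVect_d_eq_zero k L (gradedSpace_d l δ) _
  exact ⟨J, hJ, n, hcard, hn, ⟨DGMod.isoOfHomogeneous (M := weilMod k L W)
    (N := weilMod k L N) (fun j => (weilPairing k L μ).toFun (b j))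
    (fun j _ x hx => (weilPairing k L μ).mem (hb j) hx)
    (fun j => weilPairing_d k L μ (hb j) (hd j))
    (fun j => weilPairing_assoc k L μ W.act N.act μ hμ (b j))
    (sum_weilPairing_bijective k L μ (lift_weilPair_bijective k L δ μ inj pr hinj hpr hpr' hsum)
      b)⟩⟩

theorem exists_weilMod_dsum (N : DGMod A) :
    ∃ (J : Type u) (_ : Fintype J) (n : J → ℤ),
      Fintype.card J = Fintype.card E ^ Fintype.card (Cosets k l L) ∧
      ((∀ e, δ e = 0) → ∀ j, n j = 0) ∧
      Nonempty ((DGMod.dsum fun j => DGMod.shift (weilMod k L N) (-n j)) ≅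
        weilMod k L (DGMod.dsum fun e => DGMod.shift N (-δ e))) :=
  exists_weilMod_iso k L δ (dsumPairing δ N) (dsumInj δ N) (dsumPr δ N) (dsumPairing_act δ N)
    (dsumPairing_basis δ N) (dsumPr_inj δ N) (fun _ _ x h => dsumPr_inj_ne δ N h x)
    (sum_dsumInj_pr δ N)

end WeilDsum

/-! ### Weight projections on tensor products -/

namespace Tens

variable {K : Type u} [Field K] {I : Type u} [Fintype I] [LinearOrder I]

theorem sum_map_piFinset {E : Type*} [DecidableEq I] {V W : I → DGVect K}
    (f : ∀ c, E → (V c →ₗ[K] W c)) (s : Finset E) :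
    ∑ φ ∈ Fintype.piFinset fun _ : I => s, map (V := V) (W := W) (fun c => f c (φ c)) =
      map fun c => ∑ e ∈ s, f c e :=
  ((PiTensorProduct.mapMultilinear K (fun c => (V c).carrier)
    fun c => (W c).carrier).map_sum_finset f fun _ => s).symm

section Proj

variable {E : Type*} {V : I → DGVect K} (p : ∀ c, E → (V c →ₗ[K] V c))

/-- The sum of the operators `⨂ p_{φ(c)}` over a set of functions `φ`. -/
def projSum (Φ : Finset (I → E)) : Carrier V →ₗ[K] Carrier V :=
  ∑ φ ∈ Φ, map fun c => p c (φ c)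

theorem projSum_apply (Φ : Finset (I → E)) (x : Carrier V) :
    projSum p Φ x = ∑ φ ∈ Φ, map (fun c => p c (φ c)) x := by
  rw [projSum, LinearMap.sum_apply]

theorem map_proj_ne (hp : ∀ c a b x, a ≠ b → p c a (p c b x) = 0) {φ ψ : I → E} (h : φ ≠ ψ)
    (x : Carrier V) : map (fun c => p c (φ c)) (map (fun c => p c (ψ c)) x) = 0 := by
  obtain ⟨c, hc⟩ := Function.ne_iff.1 h
  rw [map_map]
  induction x using PiTensorProduct.induction_on with
  | smul_tprod r v =>
    rw [map_smul, map_tprod, MultilinearMap.map_coord_zero _ c (hp c _ _ _ hc), smul_zero]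
  | add x y hx hy => rw [map_add, hx, hy, add_zero]

theorem map_proj_same (hp : ∀ c a x, p c a (p c a x) = p c a x) (φ : I → E)
    (x : Carrier V) : map (fun c => p c (φ c)) (map (fun c => p c (φ c)) x) =
      map (fun c => p c (φ c)) x := by
  rw [map_map]
  congr 2
  funext c
  exact LinearMap.ext fun x => hp c _ x

/-- Operators belonging to different functions `φ` are orthogonal already at a factor where the
functions differ, so only the common functions remain. -/
theorem projSum_projSum [DecidableEq I] [DecidableEq E] (hp : ∀ c a x, p c a (p c a x) = p c a x)
    (hp' : ∀ c a b x, a ≠ b → p c a (p c b x) = 0) (Φ Ψ : Finset (I → E)) (x : Carrier V) :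
    projSum p Φ (projSum p Ψ x) = projSum p (Φ ∩ Ψ) x := by
  simp only [projSum_apply, map_sum]
  rw [Finset.sum_comm, ← Finset.sum_filter_add_sum_filter_not Φ (· ∈ Ψ), Finset.filter_mem_eq_inter,
    Finset.sum_eq_zero (s := Φ.filter (· ∉ Ψ)), add_zero]
  · refine Finset.sum_congr rfl fun φ hφ => ?_
    rw [Finset.sum_eq_single_of_mem φ (Finset.mem_inter.1 hφ).2 fun ψ _ h =>
      map_proj_ne p hp' h.symm x, map_proj_same p hp]
  · intro φ hφ
    refine Finset.sum_eq_zero fun ψ hψ => map_proj_ne p hp' ?_ x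
    rintro rfl
    exact (Finset.mem_filter.1 hφ).2 hψ

theorem projSum_mem (hp : ∀ c a i x, x ∈ (V c).deg i → p c a x ∈ (V c).deg i)
    (Φ : Finset (I → E)) {n : ℤ} {x : Carrier V} (hx : x ∈ deg V n) :
    projSum p Φ x ∈ deg V n := by
  rw [projSum_apply]
  exact sum_mem fun φ _ => map_mem _ (fun c i x hx => hp c _ i x hx) hx

theorem projSum_d (hp : ∀ c a i x, x ∈ (V c).deg i → p c a x ∈ (V c).deg i)
    (hd : ∀ c a x, p c a ((V c).d x) = (V c).d (p c a x)) (Φ : Finset (I → E)) (x : Carrier V) :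
    projSum p Φ (d V x) = d V (projSum p Φ x) := by
  simp only [projSum_apply, map_sum]
  exact Finset.sum_congr rfl fun φ _ =>
    map_d _ (fun c i x hx => hp c _ i x hx) (fun c x => hd c _ x) x

theorem projSum_pair {U : I → DGVect K} (μ : ∀ c, Pairing (V c) (U c) (V c))
    (hp : ∀ c a i x, x ∈ (V c).deg i → p c a x ∈ (V c).deg i)
    (hμ : ∀ c a x y, p c a ((μ c).toFun x y) = (μ c).toFun (p c a x) y) (Φ : Finset (I → E))
    (x : Carrier V) (y : Carrier U) :
    projSum p Φ (pair μ x y) = pair μ (projSum p Φ x) y := by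
  simp only [projSum_apply, map_sum, LinearMap.sum_apply]
  refine Finset.sum_congr rfl fun φ _ => ?_
  refine (map_pair μ μ (fun c => p c (φ c)) (fun _ => LinearMap.id) (fun c => p c (φ c))
    (fun c i x hx => hp c _ i x hx) (fun _ _ _ h => h) (fun c x y => hμ c _ x y) x y).trans ?_
  exact congrArg (pair μ _) (congrArg (fun f => f y) (PiTensorProduct.map_id (R := K)))

theorem projSum_piFinset [DecidableEq I] (s : Finset E) :
    projSum p (Fintype.piFinset fun _ => s) = map fun c => ∑ e ∈ s, p c e :=
  sum_map_piFinset p s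

end Proj

section Lower

variable {V W : I → DGVect K}

theorem map_symm_d (J : ∀ c, V c ≃ₗ[K] W c)
    (hJ : ∀ c i x, x ∈ (V c).deg i → J c x ∈ (W c).deg i) {i : I → ℤ} {v : ∀ c, V c}
    (hv : IsHom i v) :
    map (fun c => ((J c).symm : W c →ₗ[K] V c)) (d W (map (fun c => (J c : V c →ₗ[K] W c))
      (PiTensorProduct.tprod K v))) = ∑ c, sgn K (dExp c (par i)) • PiTensorProduct.tprod K
        (Function.update v c ((J c).symm ((W c).d (J c (v c))))) := by
  rw [map_tprod, d_tprod W (IsHom.map (fun c => (J c : V c →ₗ[K] W c)) hJ hv), map_sum]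
  refine Finset.sum_congr rfl fun c _ => ?_
  rw [map_smul, map_tprod]
  congr 2
  funext c'
  by_cases h : c' = c
  · subst h; simp
  · simp [h]

/-- The differential acts on one factor `c` at a time. If `φ` and `ψ` agree away from `c`, the
inequality of total weights gives `ψ c ≤ φ c`, and the hypothesis on that factor applies. If they
differ at some other factor, both sides vanish there. -/
theorem proj_lower (J : ∀ c, V c ≃ₗ[K] W c)
    (hJ : ∀ c i x, x ∈ (V c).deg i → J c x ∈ (W c).deg i) (p : ∀ c, ℕ → (V c →ₗ[K] V c))
    (hm : ∀ c a i x, x ∈ (V c).deg i → p c a x ∈ (V c).deg i)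
    (hp' : ∀ c a b x, a ≠ b → p c a (p c b x) = 0)
    (hlow : ∀ c a b x, b ≤ a →
      p c a ((J c).symm ((W c).d (J c (p c b x)))) = p c a ((V c).d (p c b x)))
    {φ ψ : I → ℕ} (h : ∑ c, ψ c ≤ ∑ c, φ c) (x : Carrier V) :
    map (fun c => p c (φ c)) (map (fun c => ((J c).symm : W c →ₗ[K] V c))
      (d W (map (fun c => (J c : V c →ₗ[K] W c)) (map (fun c => p c (ψ c)) x)))) =
    map (fun c => p c (φ c)) (d V (map (fun c => p c (ψ c)) x)) := by
  induction x using induction V with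
  | tprod i v hv =>
    have hv' := hv.map (fun c => p c (ψ c)) (fun c i x hx => hm c _ i x hx)
    rw [map_tprod, map_symm_d J hJ hv', d_tprod V hv', map_sum, map_sum]
    refine Finset.sum_congr rfl fun c _ => ?_
    rw [map_smul, map_smul, map_tprod, map_tprod]
    congr 1
    by_cases hc : ∀ c' ≠ c, φ c' = ψ c'
    · have hle : ψ c ≤ φ c := by
        have hs : ∑ c' ∈ Finset.univ.erase c, φ c' = ∑ c' ∈ Finset.univ.erase c, ψ c' :=
          Finset.sum_congr rfl fun c' hc' => hc c' (Finset.ne_of_mem_erase hc')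
        rw [← Finset.add_sum_erase Finset.univ ψ (Finset.mem_univ c),
          ← Finset.add_sum_erase Finset.univ φ (Finset.mem_univ c)] at h
        omega
      congr 1
      funext c'
      by_cases h' : c' = c
      · subst h'
        simp only [Function.update_self]
        exact hlow _ _ _ _ hle
      · simp [h']
    · push Not at hc
      obtain ⟨c', hne, hc'⟩ := hc
      rw [MultilinearMap.map_coord_zero _ c', MultilinearMap.map_coord_zero _ c']
      · rw [Function.update_of_ne hne]
        exact hp' _ _ _ _ hc'
      · rw [Function.update_of_ne hne]
        exact hp' _ _ _ _ hc'
  | zero => simp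
  | add x y hx hy => simp only [map_add, hx, hy]
  | smul r x hx => simp only [map_smul, hx]

end Lower

end Tens

/-! ### Equivariant weight projections -/

section WeilProj

variable (k : Type u) {l : Type u} (L : Type u) [Field k] [Field l] [Field L] [Algebra k l]
  [Algebra k L] [Algebra l L] [IsScalarTower k l L] [FiniteDimensional k L]
  {A : DGAlg l} {E : Type*}

/-- A set of functions on `G/H` is stable under the action of `G`. -/
def GStable (Φ : Finset (Cosets k l L → E)) : Prop :=
  ∀ (ρ : L ≃ₐ[k] L), ∀ φ ∈ Φ, (φ ∘ (MulAction.toPerm ρ : Equiv.Perm (Cosets k l L))) ∈ Φ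

variable {M N : DGMod A}

/-- The operator `∑_{φ ∈ Φ} ⨂ p_{φ(c)}` on `⨂ ^σM_L`. -/
def tensorProj (p : E → (M ⟶ M)) (Φ : Finset (Cosets k l L → E)) :
    Tens.Carrier (conjFam k L M.toDGVect) →ₗ[L] Tens.Carrier (conjFam k L M.toDGVect) :=
  Tens.projSum (V := conjFam k L M.toDGVect) (fun c e => conjFamMap k L (p e).toFun c) Φ

/-- The action of `ρ` permutes the factors, hence carries the operator of `φ` to that of `φ ∘ ρ⁻¹`;
the sum over a stable set of functions is therefore equivariant. -/
theorem galAct_tensorProj (p : E → (M ⟶ M)) {Φ : Finset (Cosets k l L → E)}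
    (hΦ : GStable k L Φ) (ρ : L ≃ₐ[k] L) (x : Tens.Carrier (conjFam k L M.toDGVect)) :
    galAct k L M.toDGVect ρ (tensorProj k L p Φ x) =
      tensorProj k L p Φ (galAct k L M.toDGVect ρ x) := by
  rw [tensorProj, Tens.projSum_apply, Tens.projSum_apply, map_sum]
  have key : ∀ φ : Cosets k l L → E, galAct k L M.toDGVect ρ
      (Tens.map (fun c => conjFamMap k L (p (φ c)).toFun c) x) =
      Tens.map (fun c => conjFamMap k L (p (φ ((MulAction.toPerm ρ).symm c))).toFun c)
        (galAct k L M.toDGVect ρ x) := fun φ =>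
    Tens.perm_map (V := conjFam k L M.toDGVect) (W := conjFam k L M.toDGVect)
      (V' := conjFam k L M.toDGVect) (W' := conjFam k L M.toDGVect) (ρ : L →+* L) _ _
      (fun c => conjFamMap k L (p (φ c)).toFun c)
      (fun c => conjFamMap k L (p (φ ((MulAction.toPerm ρ).symm c))).toFun c)
      (fun c => conjFamMap_mem k L (p (φ c)).toFun (p (φ c)).map_mem c)
      (fun c x => extSemi_baseChange (twHom (ρ : L →+* L) (emb_eq ρ c))
        (p (φ ((MulAction.toPerm ρ).symm c))).toFun x) x
  refine Finset.sum_bij' (fun φ _ => φ ∘ (MulAction.toPerm ρ).symm)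
    (fun φ _ => φ ∘ MulAction.toPerm ρ) (fun φ hφ => ?_) (fun φ hφ => hΦ ρ φ hφ)
    (fun φ _ => ?_) (fun φ _ => ?_) (fun φ _ => key φ)
  · exact hΦ ρ⁻¹ φ hφ
  · funext c; simp
  · funext c; simp

theorem conjFamMap_comp_apply {U V W : DGVect l} (f : U →ₗ[l] V) (g : V →ₗ[l] W)
    (c : Cosets k l L) (x : conjFam k L U c) :
    conjFamMap k L g c (conjFamMap k L f c x) = conjFamMap k L (g ∘ₗ f) c x :=
  (congrArg (fun h => h x) (LinearMap.baseChange_comp (A := Tw (emb c)) f g)).symm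

theorem conjFamMap_zero_apply {V W : DGVect l} (c : Cosets k l L) (x : conjFam k L V c) :
    conjFamMap k L (0 : V →ₗ[l] W) c x = 0 :=
  LinearMap.congr_fun (LinearMap.baseChange_zero (R := l) (A := Tw (emb c)) (M := V) (N := W)) x

theorem conjFamMap_sum {V W : DGVect l} (s : Finset E) (f : E → (V →ₗ[l] W)) (c : Cosets k l L) :
    conjFamMap k L (∑ e ∈ s, f e) c = ∑ e ∈ s, conjFamMap k L (f e) c :=
  map_sum (LinearMap.baseChangeHom l (Tw (emb c)) V W) f s

/-- The endomorphism `∑_{φ ∈ Φ} ⨂ p_{φ(c)}` of `(⨂ ^σM_L)^G`, for a stable set `Φ`. -/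
def weilProj (p : E → (M ⟶ M)) (Φ : Finset (Cosets k l L → E)) (hΦ : GStable k L Φ) :
    weilMod k L M ⟶ weilMod k L M where
  toFun :=
    { toFun := fun x => (⟨tensorProj k L p Φ (x : (weilTensor k L M.toDGVect).inv).1, fun ρ =>
        (galAct_tensorProj k L p hΦ ρ _).trans (congrArg (tensorProj k L p Φ)
          ((x : (weilTensor k L M.toDGVect).inv).2 ρ))⟩ : (weilTensor k L M.toDGVect).inv)
      map_add' := fun x y => Subtype.ext (map_add (tensorProj k L p Φ)
        (x : (weilTensor k L M.toDGVect).inv).1 (y : (weilTensor k L M.toDGVect).inv).1)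
      map_smul' := fun a x => Subtype.ext (map_smul (tensorProj k L p Φ) (algebraMap k L a)
        (x : (weilTensor k L M.toDGVect).inv).1) }
  map_mem _ _ hx := Tens.projSum_mem (V := conjFam k L M.toDGVect) _
    (fun c e => conjFamMap_mem k L (p e).toFun (p e).map_mem c) Φ hx
  map_d x := Subtype.ext (Tens.projSum_d (V := conjFam k L M.toDGVect) _
    (fun c e => conjFamMap_mem k L (p e).toFun (p e).map_mem c)
    (fun c e x => baseChange_d (Tw (emb c)) (p e).toFun (p e).map_d x) Φ
    (x : (weilTensor k L M.toDGVect).inv).1)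
  map_act x a := Subtype.ext (Tens.projSum_pair (V := conjFam k L M.toDGVect) _
    (conjPairing k L M.act) (fun c e => conjFamMap_mem k L (p e).toFun (p e).map_mem c)
    (fun c e x y => (baseChange_pair (Tw (emb c)) M.act M.act (p e).toFun (p e).map_act x y)) Φ
    (x : (weilTensor k L M.toDGVect).inv).1 (a : (weilTensor k L A.toDGVect).inv).1)

end WeilProj

/-! ### Classes in `K₀`, idempotents and triangular deformations -/

section Classes

variable {K : Type u} [Field K] {A : DGAlg K}

namespace DGMod

/-! ### Free modules of finite rank -/

/-- A free module is semi-free. -/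
def freeSemiFree (E : Type u) (δ : E → ℤ) : SemiFree (Free A E δ) where
  E := E
  δ := δ
  lev _ := 0
  J := LinearEquiv.refl K _
  isGr := (𝟙 (Free A E δ) : Free A E δ ⟶ Free A E δ).isGr
  low x y h := (h (by
    change ((Free A E δ).d (gen A δ x) : Π₀ _ : E, A.carrier) y = 0
    rw [free_d_gen]; rfl)).elim

theorem Cpt.free (E : Type u) [Finite E] (δ : E → ℤ) : Cpt (Free A E δ) :=
  have : Finite (freeSemiFree (A := A) E δ).E := ‹Finite E›
  (freeSemiFree E δ).cpt

variable (A) in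
/-- The zero module. -/
abbrev zeroMod : DGMod A := Free A PEmpty.{u + 1} fun _ => 0

theorem zeroMod_eq (x : (zeroMod A).carrier) : x = 0 :=
  DFinsupp.ext (β := fun _ : PEmpty.{u + 1} => A.carrier) fun i => i.elim

theorem Cpt.zeroMod : Cpt (zeroMod A) := Cpt.free _ _

theorem cpt_iff_of_iso {M N : DGMod A} (e : (toDCat A).obj M ≅ (toDCat A).obj N) :
    Cpt M ↔ Cpt N := ⟨fun h => h.of_iso e.symm, fun h => h.of_iso e⟩

/-- The projection of a cone to the shift of the source. -/
def coneπ {M N : DGMod A} (f : M ⟶ N) : cone f ⟶ shift M 1 where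
  toFun := LinearMap.snd K N.carrier M.carrier
  map_mem _ _ hx := hx.2
  map_d x := by
    change -M.d x.2 = sg K 1 • M.d x.2
    rw [sg_one, neg_one_smul]
  map_act _ _ := rfl

theorem Cpt.cone {M N : DGMod A} (f : M ⟶ N) (hM : Cpt M) (hN : Cpt N) : Cpt (cone f) := by
  refine Cpt.extension_of_exact (coneι f) (coneπ f) (fun x y h => congrArg Prod.fst h)
    (fun x => ⟨((0 : N.carrier), x), rfl⟩) (fun x => ⟨fun h => ⟨x.1, ?_⟩, ?_⟩) hN (hM.shift 1)
  · exact Prod.ext rfl (Eq.symm h)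
  · rintro ⟨w, rfl⟩; rfl

/-! ### Classes in `K₀` -/

open Classical in
/-- The class in `K₀(A)` of a module which is compact in `D(A)`, and `0` for other modules. -/
def kc (M : DGMod A) : K0 A :=
  if h : Cpt M then K0.cls ⟨(toDCat A).obj M, (isCompactObject_iff M).2 h⟩ else 0

theorem kc_eq {M : DGMod A} (h : Cpt M) :
    kc M = K0.cls ⟨(toDCat A).obj M, (isCompactObject_iff M).2 h⟩ := dif_pos h

theorem cls_eq_add {X Y Z : CompactDCat A} (h : IsDistinguished X.1 Y.1 Z.1) :
    K0.cls Y = K0.cls X + K0.cls Z := by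
  have : FreeAbelianGroup.of Y - FreeAbelianGroup.of X - FreeAbelianGroup.of Z ∈ relations A :=
    AddSubgroup.subset_closure ⟨X, Y, Z, h, rfl⟩
  have h2 := (QuotientAddGroup.eq_zero_iff _).2 this
  have h3 : K0.cls Y - K0.cls X - K0.cls Z = 0 := h2
  rwa [sub_sub, sub_eq_zero] at h3

theorem kc_cone' {M N X Y : DGMod A} (f : M ⟶ N) (hM : Cpt M) (hN : Cpt N)
    (eX : (toDCat A).obj X ≅ (toDCat A).obj M) (eY : (toDCat A).obj Y ≅ (toDCat A).obj N) :
    kc Y = kc X + kc (cone f) := by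
  rw [kc_eq (hM.of_iso eX), kc_eq (hN.of_iso eY), kc_eq (hM.cone f hN)]
  exact cls_eq_add ⟨M, N, f, ⟨eX⟩, ⟨eY⟩, ⟨Iso.refl _⟩⟩

theorem kc_cone {M N : DGMod A} (f : M ⟶ N) (hM : Cpt M) (hN : Cpt N) :
    kc N = kc M + kc (cone f) := kc_cone' f hM hN (Iso.refl _) (Iso.refl _)

theorem kc_cone_id {M : DGMod A} (hM : Cpt M) : kc (cone (𝟙 M)) = 0 := by
  simpa using kc_cone (𝟙 M) hM hM

/-- Isomorphic objects are different generators of `K₀`. They are identified by the triangle of an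
identity map, whose vertices are only prescribed up to isomorphism and whose cone has class zero. -/
theorem kc_of_iso {M N : DGMod A} (e : (toDCat A).obj M ≅ (toDCat A).obj N) : kc M = kc N := by
  by_cases hM : Cpt M
  · rw [kc_cone' (𝟙 M) hM hM e.symm (Iso.refl _), kc_cone_id hM, add_zero]
  · have hN : ¬Cpt N := by rwa [← cpt_iff_of_iso e]
    simp [kc, hM, hN]

theorem kc_of_QI {M N : DGMod A} (f : M ⟶ N) (h : QI f.toFun) : kc M = kc N :=
  have := isIso_Q f h
  kc_of_iso (asIso ((toDCat A).map f))

theorem kc_exact {W V Z : DGMod A} (i : W ⟶ V) (p : V ⟶ Z)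
    (hi : Function.Injective i.toFun) (hp : Function.Surjective p.toFun)
    (hip : ∀ x, p.toFun x = 0 ↔ ∃ w, i.toFun w = x) (hW : Cpt W) (hZ : Cpt Z) :
    kc V = kc W + kc Z := by
  obtain ⟨g, hg⟩ := exists_coneDesc_QI i p hi hp hip
  rw [kc_cone i hW (Cpt.extension_of_exact i p hi hp hip hW hZ), kc_of_QI g hg]

theorem kc_shift_one {M : DGMod A} (hM : Cpt M) : kc (shift M 1) = -kc M := by
  have h := kc_exact (coneι (𝟙 M)) (coneπ (𝟙 M)) (fun x y h => congrArg Prod.fst h)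
    (fun x => ⟨((0 : M.carrier), x), rfl⟩) (fun x => ⟨fun h => ⟨x.1, Prod.ext rfl (Eq.symm h)⟩,
      by rintro ⟨w, rfl⟩; rfl⟩) hM (hM.shift 1)
  rw [kc_cone_id hM] at h
  exact (neg_eq_of_add_eq_zero_right h.symm).symm

theorem kc_prod {M N : DGMod A} (hM : Cpt M) (hN : Cpt N) : kc (prod M N) = kc M + kc N :=
  kc_exact (prodInl M N) (prodSnd M N) (fun x y h => congrArg Prod.fst h)
    (fun x => ⟨((0 : M.carrier), x), rfl⟩) (fun x => ⟨fun h => ⟨x.1, Prod.ext rfl (Eq.symm h)⟩,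
      by rintro ⟨w, rfl⟩; rfl⟩) hM hN

theorem kc_of_subsingleton {M : DGMod A} (h : ∀ x : M.carrier, x = 0) : Cpt M ∧ kc M = 0 := by
  have e : zeroMod A ≅ M := isoOfBijective 0 ⟨fun x y _ => (zeroMod_eq x).trans (zeroMod_eq y).symm,
    fun x => ⟨0, ((map_zero _).trans (h x).symm)⟩⟩
  have hM : Cpt M := Cpt.zeroMod.of_iso ((toDCat A).mapIso e.symm)
  have h1 := kc_exact (𝟙 M) (𝟙 M) (fun x y _ => (h x).trans (h y).symm) (fun x => ⟨x, rfl⟩)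
    (fun x => ⟨fun _ => ⟨x, rfl⟩, fun _ => h _⟩) hM hM
  exact ⟨hM, by simpa using h1⟩

/-- Shifts realise negatives and direct sums realise sums. Hence a map on `K₀` is determined by its
values on classes of modules. -/
theorem exists_kc (x : K0 A) : ∃ M : DGMod A, Cpt M ∧ kc M = x := by
  obtain ⟨x, rfl⟩ := QuotientAddGroup.mk_surjective x
  induction x using FreeAbelianGroup.induction_on with
  | zero => exact ⟨zeroMod A, kc_of_subsingleton zeroMod_eq⟩
  | of X =>
    have h : Cpt (ob X.1) := (isCompactObject_iff _).1 (by rw [Q_ob]; exact X.2)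
    refine ⟨ob X.1, h, ?_⟩
    rw [kc_eq h]
    exact congrArg K0.cls (Subtype.ext (Q_ob X.1))
  | neg X hX =>
    obtain ⟨M, hM, hx⟩ := hX
    exact ⟨shift M 1, hM.shift 1, by rw [kc_shift_one hM, hx]; rfl⟩
  | add x y hx hy =>
    obtain ⟨M, hM, hx⟩ := hx
    obtain ⟨N, hN, hy⟩ := hy
    exact ⟨prod M N, hM.prod hN, by rw [kc_prod hM hN, hx, hy]; rfl⟩

theorem kc_ob (X : CompactDCat A) : Cpt (ob X.1) ∧ kc (ob X.1) = K0.cls X := by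
  have h : Cpt (ob X.1) := (isCompactObject_iff _).1 (by rw [Q_ob]; exact X.2)
  refine ⟨h, ?_⟩
  rw [kc_eq h]
  exact congrArg K0.cls (Subtype.ext (Q_ob X.1))

/-! ### Images of idempotents -/

/-- The submodule of elements fixed by an endomorphism. -/
abbrev fix {M : DGMod A} (p : M ⟶ M) : DGMod A := sub (kerSub (𝟙 M - p))

theorem subLift_injective {M N : DGMod A} (S : Sub N) (f : M ⟶ N)
    (h : ∀ x, f.toFun x ∈ S.toSubmodule) (hf : Function.Injective f.toFun) :
    Function.Injective (subLift S f h).toFun :=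
  fun _ _ e => hf (congrArg (subι S).toFun e)

theorem mem_fix {M : DGMod A} {p : M ⟶ M} {x : M.carrier} :
    x ∈ (kerSub (𝟙 M - p)).toSubmodule ↔ p.toFun x = x := by
  change (𝟙 M - p).toFun x = 0 ↔ _
  rw [sub_apply, id_apply, sub_eq_zero, eq_comm]

theorem Cpt.fix {M : DGMod A} (hM : Cpt M) {p : M ⟶ M} (hp : p ≫ p = p) : Cpt (fix p) := by
  refine hM.of_retract ((toDCat A).map (subι _)) ((toDCat A).map (subLift _ p fun x =>
    mem_fix.2 (congrArg (fun f => f.toFun x) hp))) ?_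
  rw [← Functor.map_comp]
  refine Eq.trans (congrArg _ ?_) ((toDCat A).map_id _)
  exact hom_ext fun x => Subtype.ext (mem_fix.1 x.2)

theorem cpt_kc_fix_add {M : DGMod A} {p q r : M ⟶ M} (hcp : Cpt (fix p)) (hcq : Cpt (fix q))
    (hp : p ≫ p = p) (hq : q ≫ q = q) (hpq : p ≫ q = 0) (hqp : q ≫ p = 0) (hr : p + q = r) :
    Cpt (fix r) ∧ kc (fix r) = kc (fix p) + kc (fix q) := by
  subst hr
  have hp' (x) : p.toFun (p.toFun x) = p.toFun x := congrArg (fun f => f.toFun x) hp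
  have hq' (x) : q.toFun (q.toFun x) = q.toFun x := congrArg (fun f => f.toFun x) hq
  have hpq' (x) : q.toFun (p.toFun x) = 0 := congrArg (fun f => f.toFun x) hpq
  have hqp' (x) : p.toFun (q.toFun x) = 0 := congrArg (fun f => f.toFun x) hqp
  refine (fun i p hi hp hip => ⟨Cpt.extension_of_exact i p hi hp hip hcp hcq,
    kc_exact i p hi hp hip hcp hcq⟩ :
    ∀ (i : fix p ⟶ fix (p + q)) (t : fix (p + q) ⟶ fix q), Function.Injective i.toFun →
      Function.Surjective t.toFun → (∀ x, t.toFun x = 0 ↔ ∃ w, i.toFun w = x) → _)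
    (subLift _ (subι (kerSub (𝟙 M - p))) fun x => mem_fix.2 ?_)
    (subLift _ (subι (kerSub (𝟙 M - (p + q))) ≫ q) fun x => mem_fix.2 (hq' _))
    (subLift_injective _ _ _ Subtype.val_injective) (fun x => ?_) (fun x => ?_)
  · have hx : p.toFun x.1 = x.1 := mem_fix.1 x.2
    rw [add_apply, subι_apply, hx, ← hx, hpq', add_zero]
  · have hx : q.toFun x.1 = x.1 := mem_fix.1 x.2
    refine ⟨⟨x.1, mem_fix.2 ?_⟩, Subtype.ext hx⟩
    rw [add_apply, ← hx, hqp', hq', zero_add]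
  · have hx : (p + q).toFun x.1 = x.1 := mem_fix.1 x.2
    rw [add_apply] at hx
    constructor
    · intro h
      have h' : q.toFun x.1 = 0 := congrArg Subtype.val h
      rw [h', add_zero] at hx
      exact ⟨⟨x.1, mem_fix.2 hx⟩, rfl⟩
    · rintro ⟨w, rfl⟩
      have hw : p.toFun w.1 = w.1 := mem_fix.1 w.2
      refine Subtype.ext ?_
      change q.toFun w.1 = 0
      rw [← hw, hpq']

/-- Orthogonal idempotents are added one at a time; each addition is a short exact sequence of fixed
submodules. -/
theorem cpt_kc_fix_sum {M : DGMod A} {ι : Type*} [DecidableEq ι] (p : ι → (M ⟶ M))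
    (hM : ∀ i, Cpt (fix (p i)))
    (hp : ∀ i, p i ≫ p i = p i) (hpq : ∀ i j, i ≠ j → p i ≫ p j = 0) (s : Finset ι) :
    Cpt (fix (∑ i ∈ s, p i)) ∧ kc (fix (∑ i ∈ s, p i)) = ∑ i ∈ s, kc (fix (p i)) := by
  have key : ∀ s t : Finset ι, (∑ i ∈ s, p i) ≫ (∑ i ∈ t, p i) = ∑ i ∈ s ∩ t, p i := by
    intro s t
    rw [Preadditive.sum_comp, ← Finset.filter_mem_eq_inter, Finset.sum_filter]
    refine Finset.sum_congr rfl fun i _ => ?_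
    rw [Preadditive.comp_sum]
    split_ifs with h
    · rw [Finset.sum_eq_single_of_mem i h fun j _ hj => hpq i j hj.symm, hp]
    · exact Finset.sum_eq_zero fun j hj => hpq i j (by rintro rfl; exact h hj)
  induction s using Finset.induction_on with
  | empty =>
    refine kc_of_subsingleton fun x => Subtype.ext ?_
    exact (mem_fix.1 x.2).symm.trans (congrArg (fun f : M ⟶ M => f.toFun x.1) Finset.sum_empty)
  | insert a s ha ih =>
    have h1 : p a ≫ (∑ i ∈ s, p i) = 0 := by
      have := key {a} s
      rwa [Finset.sum_singleton, Finset.singleton_inter_of_notMem ha, Finset.sum_empty] at this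
    have h2 : (∑ i ∈ s, p i) ≫ p a = 0 := by
      have := key s {a}
      rwa [Finset.sum_singleton, Finset.inter_singleton_of_notMem ha, Finset.sum_empty] at this
    rw [Finset.sum_insert ha (f := fun i => kc (fix (p i))), ← ih.2]
    exact cpt_kc_fix_add (hM a) ih.1 (hp a) (by rw [key, Finset.inter_self]) h1 h2
      (Finset.sum_insert ha).symm

/-- A retract is the image of the corresponding idempotent. -/
def isoFix {M N : DGMod A} (i : N ⟶ M) (r : M ⟶ N) (h : i ≫ r = 𝟙 N) : N ≅ fix (r ≫ i) :=
  have h' (x) : r.toFun (i.toFun x) = x := congrArg (fun f => f.toFun x) h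
  isoOfBijective (subLift _ i fun x => mem_fix.2 (congrArg i.toFun (h' x))) ⟨fun x y e => by
    have e' : i.toFun x = i.toFun y := congrArg Subtype.val e
    rw [← h' x, e', h' y], fun x => ⟨r.toFun x.1, Subtype.ext (mem_fix.1 x.2)⟩⟩

/-! ### Compact filtrations -/

/-- A presentation of `V` as a triangular deformation of the differential of `V₀`, with respect to
a weight decomposition of `V₀`. -/
structure Tri (V₀ V : DGMod A) (n : ℕ) where
  J : V₀.carrier ≃ₗ[K] V.carrier
  isGr : IsGr 0 (J : V₀.carrier →ₗ[K] V.carrier)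
  q : ℕ → (V₀ ⟶ V₀)
  idem : ∀ v w x, (q v).toFun ((q w).toFun x) = if v = w then (q v).toFun x else 0
  sum : ∀ x, ∑ w ∈ Finset.range n, (q w).toFun x = x
  low : ∀ v w x, w ≤ v → (q v).toFun (J.symm (V.d (J ((q w).toFun x)))) =
    (q v).toFun (V₀.d ((q w).toFun x))

namespace Tri

variable {V₀ V : DGMod A} {n : ℕ} (t : Tri V₀ V n)

/-- The trivial deformation with the same weights. -/
def refl : Tri V₀ V₀ n where
  J := LinearEquiv.refl K _
  isGr := (𝟙 V₀ : V₀ ⟶ V₀).isGr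
  q := t.q
  idem := t.idem
  sum := t.sum
  low _ _ _ _ := rfl

theorem sum_of_le {m : ℕ} {x : V₀.carrier} (h : ∀ v, m ≤ v → (t.q v).toFun x = 0) :
    ∑ w ∈ Finset.range m, (t.q w).toFun x = x := by
  rcases le_total m n with hmn | hmn
  · conv_rhs => rw [← t.sum x]
    refine Finset.sum_subset (Finset.range_mono hmn) fun v _ hv => h v ?_
    simpa using hv
  · conv_rhs => rw [← t.sum x]
    refine (Finset.sum_subset (Finset.range_mono hmn) fun v _ hv => ?_).symm
    rw [← t.sum x, map_sum]
    refine Finset.sum_eq_zero fun w hw => ?_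
    rw [t.idem, if_neg]
    rintro rfl
    exact hv hw

/-- An element of weights below `m` has components of weight `w ≤ v` only, where the deformed and
the original differential agree. The bound `m ≤ v + 1` includes the top weight `v = m - 1`, which
identifies the differential of the graded piece. -/
theorem low_sum {m : ℕ} {x : V₀.carrier} (h : ∀ v, m ≤ v → (t.q v).toFun x = 0) {v : ℕ}
    (hv : m ≤ v + 1) : (t.q v).toFun (t.J.symm (V.d (t.J x))) = V₀.d ((t.q v).toFun x) := by
  conv_lhs => rw [← t.sum_of_le h]
  conv_rhs => rw [← t.sum_of_le h]
  simp only [map_sum]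
  refine Finset.sum_congr rfl fun w hw => ?_
  rw [t.low v w x (by have := Finset.mem_range.1 hw; omega), Hom.map_d]

/-- The filtration of `V` by weights. -/
def fil (m : ℕ) : Sub V where
  carrier := {x | ∀ v, m ≤ v → (t.q v).toFun (t.J.symm x) = 0}
  add_mem' hx hy v hv := by rw [map_add, map_add, hx v hv, hy v hv, add_zero]
  zero_mem' v _ := by rw [map_zero, map_zero]
  smul_mem' c x hx v hv := by rw [map_smul, map_smul, hx v hv, smul_zero]
  proj_mem i x hx v hv := by
    have h1 : t.J.symm (V.proj i x) = V₀.proj i (t.J.symm x) :=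
      DGVect.proj_map V.toDGVect V₀.toDGVect (t.J.symm : V.carrier →ₗ[K] V₀.carrier).toAddMonoidHom
        (fun i x hx => by simpa using t.isGr.symm.mem hx) i x
    have h2 : (t.q v).toFun (V₀.proj i (t.J.symm x)) = V₀.proj i ((t.q v).toFun (t.J.symm x)) :=
      DGVect.proj_map V₀.toDGVect V₀.toDGVect (t.q v).toFun.toAddMonoidHom (t.q v).map_mem i _
    rw [h1, h2, hx v hv, map_zero]
  d_mem {x} hx v hv := by
    have h1 := t.low_sum hx (v := v) (by omega)
    rw [t.J.apply_symm_apply, hx v hv, map_zero] at h1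
    exact h1
  act_mem {x} a hx v hv := by
    have h1 : t.J.symm (V.act.toFun x a) = V₀.act.toFun (t.J.symm x) a := t.isGr.symm.act x a
    rw [h1, Hom.map_act, hx v hv, map_zero, LinearMap.zero_apply]

/-- The projection of a step of the filtration to the graded piece. -/
def filπ (m : ℕ) : sub (t.fil (m + 1)) ⟶ fix (t.q m) where
  toFun := LinearMap.codRestrict _ ((t.q m).toFun ∘ₗ (t.J.symm : V.carrier →ₗ[K] V₀.carrier) ∘ₗ
    (t.fil (m + 1)).toSubmodule.subtype) fun x => mem_fix.2 (by
      change (t.q m).toFun ((t.q m).toFun (t.J.symm x.1)) = (t.q m).toFun (t.J.symm x.1)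
      rw [t.idem, if_pos rfl])
  map_mem i x hx := (t.q m).map_mem _ _ (by simpa using t.isGr.symm.mem hx)
  map_d x := Subtype.ext (by
    have h := t.low_sum x.2 (v := m) le_rfl
    rw [t.J.apply_symm_apply] at h
    exact h)
  map_act x a := Subtype.ext ((congrArg (t.q m).toFun (t.isGr.symm.act x.1 a)).trans
    ((t.q m).map_act _ a))

/-- The graded pieces of the filtration carry the original differential of `V₀` and are direct
summands of `V₀`. Compactness and the class follow from the short exact sequences of the filtration.
-/
theorem cpt_kc_fil (h : Cpt V₀) (m : ℕ) : Cpt (sub (t.fil m)) ∧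
    kc (sub (t.fil m)) = ∑ v ∈ Finset.range m, kc (fix (t.q v)) := by
  induction m with
  | zero =>
    refine kc_of_subsingleton fun x => Subtype.ext ?_
    have := t.sum_of_le x.2
    rw [Finset.range_zero, Finset.sum_empty] at this
    exact (LinearEquiv.map_eq_zero_iff t.J.symm).1 this.symm
  | succ m ih =>
    have hfix : Cpt (fix (t.q m)) :=
      h.fix (hom_ext fun x => (t.idem m m x).trans (if_pos rfl))
    let i : sub (t.fil m) ⟶ sub (t.fil (m + 1)) :=
      subLift _ (subι (t.fil m)) fun x v hv => x.2 v (by omega)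
    have hi : Function.Injective i.toFun := subLift_injective _ _ _ Subtype.val_injective
    have hp : Function.Surjective (t.filπ m).toFun := by
      intro z
      have hz : (t.q m).toFun z.1 = z.1 := mem_fix.1 z.2
      refine ⟨⟨t.J z.1, fun v hv => ?_⟩, Subtype.ext ?_⟩
      · rw [t.J.symm_apply_apply, ← hz, t.idem, if_neg (by omega)]
      · change (t.q m).toFun (t.J.symm (t.J z.1)) = z.1
        rw [t.J.symm_apply_apply, hz]
    have hip : ∀ x, (t.filπ m).toFun x = 0 ↔ ∃ w, i.toFun w = x := by
      intro x
      constructor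
      · intro e
        have e' : (t.q m).toFun (t.J.symm x.1) = 0 := congrArg Subtype.val e
        refine ⟨⟨x.1, fun v hv => ?_⟩, rfl⟩
        rcases hv.eq_or_lt with rfl | hv
        · exact e'
        · exact x.2 v hv
      · rintro ⟨w, rfl⟩
        exact Subtype.ext (w.2 m le_rfl)
    refine ⟨Cpt.extension_of_exact i _ hi hp hip ih.1 hfix, ?_⟩
    rw [kc_exact i _ hi hp hip ih.1 hfix, ih.2, Finset.sum_range_succ]

/-- The right-hand side depends only on `V₀` and its weight projections, so any two deformations
with the same projections have the same class. -/
theorem cpt_kc_eq_sum (h : Cpt V₀) : Cpt V ∧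
    kc V = ∑ v ∈ Finset.range n, kc (fix (t.q v)) := by
  have e : sub (t.fil n) ≅ V := isoOfBijective (subι _) ⟨Subtype.val_injective, fun x => ⟨⟨x,
    fun v hv => by
      rw [← t.sum (t.J.symm x), map_sum]
      refine Finset.sum_eq_zero fun w hw => ?_
      rw [t.idem, if_neg]
      rintro rfl
      exact absurd (Finset.mem_range.1 hw) (by omega)⟩, rfl⟩⟩
  obtain ⟨h1, h2⟩ := t.cpt_kc_fil h n
  have e' := (toDCat A).mapIso e
  exact ⟨h1.of_iso e'.symm, by rw [← h2, kc_of_iso e']⟩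

/-- Compactness and the class in `K₀` do not change under triangular deformations. -/
theorem cpt_kc (t : Tri V₀ V n) (h : Cpt V₀) : Cpt V ∧ kc V = kc V₀ :=
  ⟨(t.cpt_kc_eq_sum h).1, (t.cpt_kc_eq_sum h).2.trans (t.refl.cpt_kc_eq_sum h).2.symm⟩

end Tri

end DGMod

end Classes

/-! ### The Weil restriction of a triangular deformation -/

section WeilTri

variable (k : Type u) {l : Type u} (L : Type u) [Field k] [Field l] [Field L] [Algebra k l]
  [Algebra k L] [Algebra l L] [IsScalarTower k l L] [FiniteDimensional k L]

/-! ### The Weil restriction of graded isomorphisms -/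

/-- The isomorphism `(⨂ ^σJ_L)^G` induced by a linear isomorphism of degree `0`. -/
def weilVectEquiv {V W : DGVect l} (J : V.carrier ≃ₗ[l] W.carrier)
    (h : ∀ i x, x ∈ V.deg i → J x ∈ W.deg i) (h' : ∀ i x, x ∈ W.deg i → J.symm x ∈ V.deg i) :
    (weilVect k L V).carrier ≃ₗ[k] (weilVect k L W).carrier :=
  LinearEquiv.ofLinear (weilVectMap k L (J : V.carrier →ₗ[l] W.carrier) h)
    (weilVectMap k L (J.symm : W.carrier →ₗ[l] V.carrier) h')
    (LinearMap.ext fun x => Subtype.ext (by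
      refine (tensorMap_comp k L (J.symm : W.carrier →ₗ[l] V.carrier)
        (J : V.carrier →ₗ[l] W.carrier) (x : (weilTensor k L W).inv).1).symm.trans ?_
      rw [LinearEquiv.comp_coe, LinearEquiv.symm_trans_self]
      exact tensorMap_id k L W _))
    (LinearMap.ext fun x => Subtype.ext (by
      refine (tensorMap_comp k L (J : V.carrier →ₗ[l] W.carrier)
        (J.symm : W.carrier →ₗ[l] V.carrier) (x : (weilTensor k L V).inv).1).symm.trans ?_
      rw [LinearEquiv.comp_coe, LinearEquiv.self_trans_symm]
      exact tensorMap_id k L V _))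

variable {A : DGAlg l} {M N : DGMod A}

theorem weilVectMap_isGr {f : M.carrier →ₗ[l] N.carrier} (h : DGMod.IsGr 0 f)
    (hm : ∀ i x, x ∈ M.deg i → f x ∈ N.deg i) :
    DGMod.IsGr (M := weilMod k L M) (N := weilMod k L N) 0 (weilVectMap k L f hm) where
  mem {i x} hx := by
    rw [add_zero]
    exact Tens.map_mem (V := conjFam k L M.toDGVect) (W := conjFam k L N.toDGVect) _
      (conjFamMap_mem k L f hm) hx
  act x a := by
    refine Subtype.ext ((Tens.map_pair (conjPairing k L M.act) (conjPairing k L N.act)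
      (conjFamMap k L f) (fun _ => LinearMap.id) (conjFamMap k L f)
      (conjFamMap_mem k L f hm) (fun _ _ _ h => h)
      (fun c x y => baseChange_pair (Tw (emb c)) M.act N.act f h.act x y)
      (x : (weilTensor k L M.toDGVect).inv).1 (a : (weilTensor k L A.toDGVect).inv).1).trans ?_)
    refine congrArg (Tens.pair (conjPairing k L N.act) _) ?_
    exact congrArg (fun f => f (a : (weilTensor k L A.toDGVect).inv).1)
      (PiTensorProduct.map_id (R := L))

/-! ### Idempotents of the Weil restriction -/

variable {E : Type*} (p : E → (M ⟶ M))

theorem conjFamMap_idem (hp : ∀ a, p a ≫ p a = p a) (c : Cosets k l L) (a : E)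
    (x : conjFam k L M.toDGVect c) : conjFamMap k L (p a).toFun c
      (conjFamMap k L (p a).toFun c x) = conjFamMap k L (p a).toFun c x := by
  have h : (p a).toFun ∘ₗ (p a).toFun = (p a).toFun := congrArg DGMod.Hom.toFun (hp a)
  rw [conjFamMap_comp_apply, h]

theorem conjFamMap_orth (hp : ∀ a b, a ≠ b → p a ≫ p b = 0) (c : Cosets k l L) (a b : E)
    (x : conjFam k L M.toDGVect c) (h : a ≠ b) : conjFamMap k L (p a).toFun c
      (conjFamMap k L (p b).toFun c x) = 0 :=
  (conjFamMap_comp_apply k L _ _ c x).trans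
    ((congrArg (fun f : M ⟶ M => conjFamMap k L f.toFun c x) (hp b a h.symm)).trans
      (conjFamMap_zero_apply k L c x))

theorem tensorProj_apply (Φ : Finset (Cosets k l L → E))
    (y : Tens.Carrier (conjFam k L M.toDGVect)) : tensorProj k L p Φ y =
      ∑ φ ∈ Φ, Tens.map (V := conjFam k L M.toDGVect) (W := conjFam k L M.toDGVect)
        (fun c => conjFamMap k L (p (φ c)).toFun c) y :=
  Tens.projSum_apply (V := conjFam k L M.toDGVect) _ Φ y

theorem tensorProj_comp [DecidableEq E] (hp : ∀ a, p a ≫ p a = p a)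
    (hp' : ∀ a b, a ≠ b → p a ≫ p b = 0) (Φ Ψ : Finset (Cosets k l L → E))
    (y : Tens.Carrier (conjFam k L M.toDGVect)) :
    tensorProj k L p Φ (tensorProj k L p Ψ y) = tensorProj k L p (Φ ∩ Ψ) y :=
  Tens.projSum_projSum (V := conjFam k L M.toDGVect) (fun c e => conjFamMap k L (p e).toFun c)
    (conjFamMap_idem k L p hp) (conjFamMap_orth k L p hp') Φ Ψ y

theorem tensorProj_empty (y : Tens.Carrier (conjFam k L M.toDGVect)) :
    tensorProj k L p ∅ y = 0 := by
  rw [tensorProj_apply, Finset.sum_empty]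

theorem sum_tensorProj {ι : Type*} [DecidableEq ι] {Φ : Finset (Cosets k l L → E)}
    (g : (Cosets k l L → E) → ι) (s : Finset ι) (hs : ∀ φ ∈ Φ, g φ ∈ s)
    (y : Tens.Carrier (conjFam k L M.toDGVect)) :
    ∑ i ∈ s, tensorProj k L p (Φ.filter fun φ => g φ = i) y = tensorProj k L p Φ y := by
  simp only [tensorProj_apply]
  exact Finset.sum_fiberwise_of_maps_to hs _

theorem tensorProj_piFinset (s : Finset E) (y : Tens.Carrier (conjFam k L M.toDGVect)) :
    tensorProj k L p (Fintype.piFinset fun _ => s) y = tensorMap k L (∑ e ∈ s, p e).toFun y := by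
  have h1 : (∑ e ∈ s, p e).toFun = ∑ e ∈ s, (p e).toFun :=
    LinearMap.ext fun x => by rw [DGMod.sum_apply, LinearMap.sum_apply]
  have h2 : (fun c : Cosets k l L => ∑ e ∈ s, conjFamMap k L (p e).toFun c) =
      conjFamMap k L (∑ e ∈ s, p e).toFun := by
    funext c
    rw [h1, conjFamMap_sum]
  rw [tensorProj, Tens.projSum_piFinset, tensorMap, h2]

theorem weilProj_comp [DecidableEq E] (hp : ∀ a, p a ≫ p a = p a)
    (hp' : ∀ a b, a ≠ b → p a ≫ p b = 0) {Φ Ψ Θ : Finset (Cosets k l L → E)}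
    (hΦ : GStable k L Φ) (hΨ : GStable k L Ψ) (hΘ : GStable k L Θ) (h : Ψ ∩ Φ = Θ) :
    weilProj k L p Φ hΦ ≫ weilProj k L p Ψ hΨ = weilProj k L p Θ hΘ := by
  subst h
  exact DGMod.hom_ext fun x => Subtype.ext (tensorProj_comp k L p hp hp' Ψ Φ
    (x : (weilTensor k L M.toDGVect).inv).1)

theorem weilProj_empty {Φ : Finset (Cosets k l L → E)} (h : GStable k L Φ) (h0 : Φ = ∅) :
    weilProj k L p Φ h = 0 := by
  subst h0
  exact DGMod.hom_ext fun x => Subtype.ext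
    (tensorProj_empty k L p (x : (weilTensor k L M.toDGVect).inv).1)

theorem weilProj_orth [DecidableEq E] (hp : ∀ a, p a ≫ p a = p a)
    (hp' : ∀ a b, a ≠ b → p a ≫ p b = 0) {Φ Ψ : Finset (Cosets k l L → E)}
    (hΦ : GStable k L Φ) (hΨ : GStable k L Ψ) (h : Disjoint Ψ Φ) :
    weilProj k L p Φ hΦ ≫ weilProj k L p Ψ hΨ = 0 := by
  have hs : GStable k L (∅ : Finset (Cosets k l L → E)) :=
    fun _ _ h => absurd h (Finset.notMem_empty _)
  rw [weilProj_comp k L p hp hp' hΦ hΨ hs (Finset.disjoint_iff_inter_eq_empty.1 h),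
    weilProj_empty k L p hs rfl]

variable {k L} in
theorem GStable.filter {ι : Type*} [DecidableEq ι] {Φ : Finset (Cosets k l L → E)}
    (hΦ : GStable k L Φ) (g : (Cosets k l L → E) → ι)
    (hg : ∀ (ρ : L ≃ₐ[k] L) φ, g (φ ∘ (MulAction.toPerm ρ : Equiv.Perm (Cosets k l L))) = g φ)
    (i : ι) : GStable k L (Φ.filter fun φ => g φ = i) := by
  intro ρ φ hφ
  rw [Finset.mem_filter] at hφ ⊢
  exact ⟨hΦ ρ φ hφ.1, (hg ρ φ).trans hφ.2⟩

theorem gStable_piFinset (s : Finset E) :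
    GStable k L (Fintype.piFinset fun _ : Cosets k l L => s) := by
  intro ρ φ hφ
  rw [Fintype.mem_piFinset] at hφ ⊢
  exact fun c => hφ _

theorem sum_weilProj {ι : Type*} [DecidableEq ι] {Φ : Finset (Cosets k l L → E)}
    (hΦ : GStable k L Φ) (g : (Cosets k l L → E) → ι)
    (hg : ∀ (ρ : L ≃ₐ[k] L) φ, g (φ ∘ (MulAction.toPerm ρ : Equiv.Perm (Cosets k l L))) = g φ)
    (s : Finset ι) (hs : ∀ φ ∈ Φ, g φ ∈ s) :
    ∑ i ∈ s, weilProj k L p (Φ.filter fun φ => g φ = i) (hΦ.filter g hg i) =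
      weilProj k L p Φ hΦ := by
  refine DGMod.hom_ext fun x => ?_
  rw [DGMod.sum_apply]
  exact Subtype.ext ((AddSubgroup.val_finsetSum (H := (weilTensor k L M.toDGVect).inv)
    (fun i => (weilProj k L p (Φ.filter fun φ => g φ = i) (hΦ.filter g hg i)).toFun x) s).trans
      (sum_tensorProj k L p g s hs (x : (weilTensor k L M.toDGVect).inv).1))

theorem weilProj_piFinset (s : Finset E) :
    weilProj k L p (Fintype.piFinset fun _ => s) (gStable_piFinset k L s) =
      (weilFunctor k L A).map (∑ e ∈ s, p e) :=
  DGMod.hom_ext fun x => Subtype.ext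
    (tensorProj_piFinset k L p s (x : (weilTensor k L M.toDGVect).inv).1)

namespace DGMod

variable {P₀ P : DGMod A} {n : ℕ}

/-- This is `Tens.proj_lower` for each pair of functions, the weights of the factors being those of
`t`. -/
theorem Tri.tensorProj_low (t : Tri P₀ P n) {Φ Ψ : Finset (Cosets k l L → ℕ)}
    (h : ∀ φ ∈ Φ, ∀ ψ ∈ Ψ, ∑ c, ψ c ≤ ∑ c, φ c) (y : Tens.Carrier (conjFam k L P₀.toDGVect)) :
    tensorProj k L t.q Φ (tensorMap k L (t.J.symm : P.carrier →ₗ[l] P₀.carrier)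
      (Tens.d (conjFam k L P.toDGVect) (tensorMap k L (t.J : P₀.carrier →ₗ[l] P.carrier)
        (tensorProj k L t.q Ψ y)))) =
    tensorProj k L t.q Φ (Tens.d (conjFam k L P₀.toDGVect) (tensorProj k L t.q Ψ y)) := by
  simp only [tensorProj_apply, map_sum]
  refine Finset.sum_congr rfl fun ψ hψ => Finset.sum_congr rfl fun φ hφ => ?_
  refine Tens.proj_lower (V := conjFam k L P₀.toDGVect) (W := conjFam k L P.toDGVect)
    (fun c => t.J.baseChange l (Tw (emb c)) _ _)
    (conjFamMap_mem k L (t.J : P₀.carrier →ₗ[l] P.carrier) fun i x hx => by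
      simpa using t.isGr.mem hx)
    (fun c e => conjFamMap k L (t.q e).toFun c)
    (fun c e => conjFamMap_mem k L (t.q e).toFun (t.q e).map_mem c)
    (conjFamMap_orth k L t.q fun a b h => hom_ext fun x => (t.idem b a x).trans (if_neg h.symm))
    (fun c a b x hba => ?_) (h φ hφ ψ hψ) y
  have hJ : ∀ z : conjFam k L P₀.toDGVect c,
      conjFamMap k L (t.q a).toFun c (conjFamMap k L (t.J.symm : P.carrier →ₗ[l] P₀.carrier) c
        (conjFamMap k L P.d c (conjFamMap k L (t.J : P₀.carrier →ₗ[l] P.carrier) c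
          (conjFamMap k L (t.q b).toFun c z)))) =
      conjFamMap k L (t.q a).toFun c (conjFamMap k L P₀.d c
        (conjFamMap k L (t.q b).toFun c z)) := by
    intro z
    simp only [conjFamMap_comp_apply]
    congr 2
    exact LinearMap.ext fun x => t.low a b x hba
  exact hJ x

/-- The Weil restriction of a triangular deformation. -/
def Tri.weil (t : Tri P₀ P n) :
    Tri (weilMod k L P₀) (weilMod k L P) (Fintype.card (Cosets k l L) * n + 1) :=
  have hp (a : ℕ) : t.q a ≫ t.q a = t.q a := hom_ext fun x => (t.idem a a x).trans (if_pos rfl)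
  have hp' (a b : ℕ) (h : a ≠ b) : t.q a ≫ t.q b = 0 :=
    hom_ext fun x => (t.idem b a x).trans (if_neg h.symm)
  -- The total weight does not change when the factors are permuted, so the functions of a given
  -- total weight form a stable set, whereas a single function does not.
  have hg (ρ : L ≃ₐ[k] L) (φ : Cosets k l L → ℕ) :
      ∑ c, (φ ∘ (MulAction.toPerm ρ : Equiv.Perm (Cosets k l L))) c = ∑ c, φ c :=
    Equiv.sum_comp (MulAction.toPerm ρ : Equiv.Perm (Cosets k l L)) φ
  have hΦ := gStable_piFinset (l := l) k L (Finset.range n)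
  have hJ (i x) (hx : x ∈ P₀.deg i) : t.J x ∈ P.deg i := by simpa using t.isGr.mem hx
  have hJ' (i x) (hx : x ∈ P.deg i) : t.J.symm x ∈ P₀.deg i := by simpa using t.isGr.symm.mem hx
  { J := weilVectEquiv k L t.J hJ hJ'
    isGr := weilVectMap_isGr k L t.isGr hJ
    q := fun w => weilProj k L t.q _ (hΦ.filter (fun φ => ∑ c, φ c) hg w)
    idem := by
      intro v w x
      change (weilProj k L t.q _ (hΦ.filter (fun φ => ∑ c, φ c) hg w) ≫
        weilProj k L t.q _ (hΦ.filter (fun φ => ∑ c, φ c) hg v)).toFun x = _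
      split_ifs with h
      · subst h
        rw [weilProj_comp k L t.q hp hp' _ _ (hΦ.filter (fun φ => ∑ c, φ c) hg v)
          (Finset.inter_self _)]
      · rw [weilProj_orth k L t.q hp hp']
        · rfl
        · rw [Finset.disjoint_left]
          intro φ h1 h2
          exact h ((Finset.mem_filter.1 h1).2.symm.trans (Finset.mem_filter.1 h2).2)
    sum := by
      intro x
      rw [← sum_apply, sum_weilProj k L t.q hΦ (fun φ => ∑ c, φ c) hg, weilProj_piFinset]
      · rw [show ∑ w ∈ Finset.range n, t.q w = 𝟙 P₀ from
          hom_ext fun x => (sum_apply _ _ x).trans (t.sum x)]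
        exact congrArg (fun f => Hom.toFun f x) ((weilFunctor k L A).map_id P₀)
      · intro φ hφ
        rw [Fintype.mem_piFinset] at hφ
        rw [Finset.mem_range, Nat.lt_succ_iff]
        -- Each of the factors has weight below `n`, so the total weight is at most the number of
        -- factors times `n`; this is the reason for the `+ 1` in the length.
        refine (Finset.sum_le_card_nsmul _ _ n fun c _ => (Finset.mem_range.1 (hφ c)).le).trans ?_
        simp
    low := fun v w x hwv => Subtype.ext (t.tensorProj_low k L (fun φ hφ ψ hψ => by
      rw [(Finset.mem_filter.1 hφ).2, (Finset.mem_filter.1 hψ).2]; exact hwv)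
      (x : (weilTensor k L P₀.toDGVect).inv).1) }

end DGMod

end WeilTri

/-! ### Cohomology on the derived category, and isomorphisms as spans -/

section Cohomology

variable {K : Type u} [Field K] {A : DGAlg K}

namespace DGMod

/-! ### Cohomology as a functor on the derived category -/

variable (A) in
/-- The functor of cohomology in degree `n`. -/
def cohomFunctor (n : ℤ) : DGMod A ⥤ ModuleCat.{u} K where
  obj M := ModuleCat.of K (M.cohomology n)
  map f := ModuleCat.ofHom (cohomologyMap f n)
  map_id M := ModuleCat.hom_ext (Submodule.linearMap_qext _ (LinearMap.ext fun _ => rfl))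
  map_comp f g := ModuleCat.hom_ext (Submodule.linearMap_qext _ (LinearMap.ext fun _ => rfl))

variable (A) in
/-- The functor of cohomology in degree `n` on the derived category. -/
def dcohom (n : ℤ) : DCat A ⥤ ModuleCat.{u} K :=
  Localization.Construction.lift (cohomFunctor A n)
    fun _ _ f hf => (ConcreteCategory.isIso_iff_bijective ((cohomFunctor A n).map f)).2 (hf n)

/-- Cohomology factors through the derived category, so the localization inverts nothing but
quasi-isomorphisms. -/
theorem QI_of_isIso_Q {M N : DGMod A} (f : M ⟶ N) (h : IsIso ((toDCat A).map f)) : QI f.toFun :=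
  (quasiIso_iff f).1 fun n => (ConcreteCategory.isIso_iff_bijective ((cohomFunctor A n).map f)).1
    (inferInstanceAs (IsIso ((dcohom A n).map ((toDCat A).map f))))

theorem QI_of_bijective {M N : DGMod A} (f : M ⟶ N) (h : Function.Bijective f.toFun) :
    QI f.toFun :=
  QI_of_isIso_Q f (((toDCat A).mapIso (isoOfBijective f h)).isIso_hom)

/-- Composed with a K-projective resolution of its source, the isomorphism is represented by a map,
which is a quasi-isomorphism by `QI_of_isIso_Q`. Invariance under quasi-isomorphisms thus gives
invariance under isomorphism in the derived category. -/
theorem exists_QI_span {M N : DGMod A} (e : (toDCat A).obj M ≅ (toDCat A).obj N) :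
    ∃ (P : DGMod A) (f : P ⟶ M) (g : P ⟶ N), QI f.toFun ∧ QI g.toFun := by
  obtain ⟨P, p, hP, hp⟩ := exists_kproj M
  obtain ⟨g, hg⟩ := hP.full ((toDCat A).map p ≫ e.hom)
  have := isIso_Q p hp
  exact ⟨P, p, g, hp, QI_of_isIso_Q g (hg ▸ inferInstance)⟩

/-! ### Direct sums of two modules -/

/-- The direct sum of two morphisms. -/
def prodMap {M N M' N' : DGMod A} (f : M ⟶ M') (g : N ⟶ N') : prod M N ⟶ prod M' N' where
  toFun := f.toFun.prodMap g.toFun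
  map_mem _ _ hx := ⟨f.map_mem _ _ hx.1, g.map_mem _ _ hx.2⟩
  map_d _ := Prod.ext (f.map_d _) (g.map_d _)
  map_act _ _ := Prod.ext (f.map_act _ _) (g.map_act _ _)

theorem prodMap_QI {M N M' N' : DGMod A} {f : M ⟶ M'} {g : N ⟶ N'} (hf : QI f.toFun)
    (hg : QI g.toFun) : QI (prodMap f g).toFun := by
  constructor
  · intro x hx y hy
    obtain ⟨a, ha⟩ := hf.1 x.1 (congrArg Prod.fst hx) y.1 (congrArg Prod.fst hy)
    obtain ⟨b, hb⟩ := hg.1 x.2 (congrArg Prod.snd hx) y.2 (congrArg Prod.snd hy)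
    exact ⟨(a, b), Prod.ext ha hb⟩
  · intro y hy
    obtain ⟨a, a', ha, ha'⟩ := hf.2 y.1 (congrArg Prod.fst hy)
    obtain ⟨b, b', hb, hb'⟩ := hg.2 y.2 (congrArg Prod.snd hy)
    exact ⟨(a, b), (a', b'), Prod.ext ha hb, Prod.ext ha' hb'⟩

/-- Commutativity of direct sums. -/
def prodSwap (M N : DGMod A) : prod M N ⟶ prod N M where
  toFun := (LinearEquiv.prodComm K M.carrier N.carrier : _ →ₗ[K] _)
  map_mem _ _ hx := ⟨hx.2, hx.1⟩
  map_d _ := rfl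
  map_act _ _ := rfl

/-- Associativity of direct sums. -/
def prodAssoc (M N P : DGMod A) : prod (prod M N) P ⟶ prod M (prod N P) where
  toFun := (LinearEquiv.prodAssoc K M.carrier N.carrier P.carrier : _ →ₗ[K] _)
  map_mem _ _ hx := ⟨hx.1.1, hx.1.2, hx.2⟩
  map_d _ := rfl
  map_act _ _ := rfl

/-- The cone of a zero morphism is a direct sum. -/
def coneZero (M N : DGMod A) : cone (0 : M ⟶ N) ⟶ prod N (shift M 1) where
  toFun := (LinearMap.id : N.carrier × M.carrier →ₗ[K] N.carrier × M.carrier)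
  map_mem _ _ hx := hx
  map_d x := Prod.ext (add_zero (N.d x.1)) ((coneπ (0 : M ⟶ N)).map_d x)
  map_act _ _ := rfl

theorem prodSwap_bijective (M N : DGMod A) : Function.Bijective (prodSwap M N).toFun :=
  (LinearEquiv.prodComm K M.carrier N.carrier).bijective

theorem prodAssoc_bijective (M N P : DGMod A) : Function.Bijective (prodAssoc M N P).toFun :=
  (LinearEquiv.prodAssoc K M.carrier N.carrier P.carrier).bijective

theorem coneZero_bijective (M N : DGMod A) : Function.Bijective (coneZero M N).toFun :=
  Function.bijective_id

theorem prodFst_bijective {M N : DGMod A} (h : ∀ x : N.carrier, x = 0) :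
    Function.Bijective (prodFst M N).toFun :=
  ⟨fun x y e => Prod.ext e ((h x.2).trans (h y.2).symm), fun x => ⟨(x, 0), rfl⟩⟩

end DGMod

end Cohomology

/-! ### Non-additive functions on modules which factor through `K₀` -/

section Lift

variable {K : Type u} [Field K] {A : DGAlg K}

namespace DGMod

/-! ### Maps out of `K₀` -/

/-- A function on modules which is invariant under quasi-isomorphisms and does not see the
morphism `f` in `W ⊕ cone(f)`. -/
structure IsConeInvariant {X : Type*} (h : DGMod A → X) : Prop where
  of_QI : ∀ {M N : DGMod A} (f : M ⟶ N), QI f.toFun → h M = h N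
  of_cone : ∀ {W M N : DGMod A} (f : M ⟶ N), Cpt W → Cpt M → Cpt N →
    h (prod W (cone f)) = h (prod W (cone (0 : M ⟶ N)))

/-- Equality of the values of `h` after addition of an arbitrary compact module. -/
def StableEq {X : Type*} (h : DGMod A → X) (M N : DGMod A) : Prop :=
  ∀ W, Cpt W → h (prod M W) = h (prod N W)

variable {X : Type*} {h : DGMod A → X}

theorem StableEq.symm {M N : DGMod A} (e : StableEq h M N) : StableEq h N M :=
  fun W hW => (e W hW).symm

theorem StableEq.trans {M N P : DGMod A} (e : StableEq h M N) (e' : StableEq h N P) :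
    StableEq h M P := fun W hW => (e W hW).trans (e' W hW)

variable (H : IsConeInvariant h)

namespace IsConeInvariant

theorem of_bijective (H : IsConeInvariant h) {M N : DGMod A} (f : M ⟶ N)
    (hf : Function.Bijective f.toFun) : h M = h N := H.of_QI f (QI_of_bijective f hf)

theorem stable_of_QI (H : IsConeInvariant h) {M N : DGMod A} (f : M ⟶ N) (hf : QI f.toFun) :
    StableEq h M N := fun W _ => H.of_QI (prodMap f (𝟙 W)) (prodMap_QI hf (QI_id W))

theorem stable_of_bijective (H : IsConeInvariant h) {M N : DGMod A} (f : M ⟶ N)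
    (hf : Function.Bijective f.toFun) : StableEq h M N := H.stable_of_QI f (QI_of_bijective f hf)

theorem stable_of_iso (H : IsConeInvariant h) {M N : DGMod A}
    (e : (toDCat A).obj M ≅ (toDCat A).obj N) : StableEq h M N := by
  obtain ⟨P, f, g, hf, hg⟩ := exists_QI_span e
  exact (H.stable_of_QI f hf).symm.trans (H.stable_of_QI g hg)

theorem stable_prod_right (H : IsConeInvariant h) {M M' N : DGMod A} (e : StableEq h M M')
    (hN : Cpt N) : StableEq h (prod M N) (prod M' N) := fun W hW => by
  rw [H.of_bijective _ (prodAssoc_bijective M N W), H.of_bijective _ (prodAssoc_bijective M' N W),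
    e _ (hN.prod hW)]

theorem stable_comm (H : IsConeInvariant h) (M N : DGMod A) :
    StableEq h (prod M N) (prod N M) := H.stable_of_bijective _ (prodSwap_bijective M N)

/-- The invariance hypothesis replaces `f` by `0`, and the cone of `0` is a direct sum. -/
theorem stable_cone (H : IsConeInvariant h) {M N : DGMod A} (f : M ⟶ N) (hM : Cpt M)
    (hN : Cpt N) : StableEq h (cone f) (prod N (shift M 1)) := by
  refine StableEq.trans (fun W hW => ?_) (H.stable_of_bijective _ (coneZero_bijective M N))
  rw [H.of_bijective _ (prodSwap_bijective (cone f) W), H.of_cone f hW hM hN,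
    H.of_bijective _ (prodSwap_bijective _ _)]

/-- Both sides are compared with the acyclic cone of the identity of `M`. This provides negatives in
the group of stable classes. -/
theorem stable_neg (H : IsConeInvariant h) {M : DGMod A} (hM : Cpt M) :
    StableEq h (prod (shift M 1) M) (zeroMod A) := by
  refine (H.stable_comm _ _).trans ((H.stable_cone (𝟙 M) hM hM).symm.trans (StableEq.symm ?_))
  refine H.stable_of_QI 0 ⟨fun x _ _ _ => ⟨0, (zeroMod_eq x).trans (map_zero _).symm⟩,
    fun y hy => ?_⟩
  obtain ⟨z, rfl⟩ := QI.acyc_cone (QI_id M) y hy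
  exact ⟨0, z, map_zero _, by rw [map_zero, zero_add]⟩

/-- Take the zero module as the additional summand. Stable equality, rather than equality of values,
is needed for direct sums to be well defined on classes, since `h` is not additive. -/
theorem eq_of_stable (H : IsConeInvariant h) {M N : DGMod A} (e : StableEq h M N) : h M = h N := by
  rw [← H.of_bijective _ (prodFst_bijective (M := M) (zeroMod_eq (A := A))), e _ Cpt.zeroMod,
    H.of_bijective _ (prodFst_bijective (M := N) (zeroMod_eq (A := A)))]

/-- The group of compact modules up to stable equality. -/
def Quo (_ : IsConeInvariant h) : Type _ :=
  Quot fun M N : {M : DGMod A // Cpt M} => StableEq h M.1 N.1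

/-- The class of a compact module. -/
def toQuo (H : IsConeInvariant h) (M : DGMod A) (hM : Cpt M) : H.Quo := Quot.mk _ ⟨M, hM⟩

theorem toQuo_eq (H : IsConeInvariant h) {M N : DGMod A} {hM : Cpt M} {hN : Cpt N}
    (e : StableEq h M N) : H.toQuo M hM = H.toQuo N hN := Quot.sound e

instance : Add H.Quo := ⟨Quot.map₂ (fun M N => ⟨prod M.1 N.1, M.2.prod N.2⟩)
  (fun M _ _ e => (H.stable_comm _ _).trans ((H.stable_prod_right e M.2).trans
    (H.stable_comm _ _))) (fun _ _ N e => H.stable_prod_right e N.2)⟩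

instance : Zero H.Quo := ⟨H.toQuo (zeroMod A) Cpt.zeroMod⟩

theorem Quo.exists_neg (x : H.Quo) : ∃ y, y + x = 0 := by
  obtain ⟨M⟩ := x
  exact ⟨H.toQuo (shift M.1 1) (M.2.shift 1), H.toQuo_eq (H.stable_neg M.2)⟩

instance : Neg H.Quo := ⟨fun x => (Quo.exists_neg H x).choose⟩

theorem Quo.add_comm (x y : H.Quo) : x + y = y + x := by
  obtain ⟨M⟩ := x
  obtain ⟨N⟩ := y
  exact H.toQuo_eq (H.stable_comm _ _)

instance : AddCommGroup H.Quo :=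
  { AddGroup.ofLeftAxioms (G := H.Quo)
      (by
        rintro ⟨M⟩ ⟨N⟩ ⟨P⟩
        exact H.toQuo_eq (H.stable_of_bijective _ (prodAssoc_bijective _ _ _)))
      (by
        rintro ⟨M⟩
        exact H.toQuo_eq ((H.stable_comm _ _).trans
          (H.stable_of_bijective _ (prodFst_bijective (zeroMod_eq (A := A))))))
      (fun x => (Quo.exists_neg H x).choose_spec) with
    add_comm := Quo.add_comm H }

/-- The universal property of `K₀` for the group of compact modules up to stable equality. -/
def K0toQuo (H : IsConeInvariant h) : K0 A →+ H.Quo :=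
  QuotientAddGroup.lift (relations A)
    (FreeAbelianGroup.lift fun Y : CompactDCat A => H.toQuo (ob Y.1) (kc_ob Y).1) (by
      rw [relations, AddSubgroup.closure_le]
      rintro _ ⟨Y, Z, T, ⟨M, N, f, ⟨eY⟩, ⟨eZ⟩, ⟨eT⟩⟩, rfl⟩
      have hM : Cpt M := (kc_ob Y).1.of_iso (M := M) (N := ob Y.1) eY.symm
      have hN : Cpt N := (kc_ob Z).1.of_iso (M := N) (N := ob Z.1) eZ.symm
      have h1 : H.toQuo (ob Y.1) (kc_ob Y).1 = H.toQuo M hM :=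
        H.toQuo_eq (H.stable_of_iso (M := ob Y.1) eY)
      have h2 : H.toQuo (ob Z.1) (kc_ob Z).1 = H.toQuo N hN :=
        H.toQuo_eq (H.stable_of_iso (M := ob Z.1) eZ)
      have h3 : H.toQuo (ob T.1) (kc_ob T).1 = H.toQuo N hN + H.toQuo _ (hM.shift 1) :=
        H.toQuo_eq ((H.stable_of_iso (M := ob T.1) eT).trans (H.stable_cone f hM hN))
      have h4 : H.toQuo _ (hM.shift 1) + H.toQuo M hM = 0 := H.toQuo_eq (H.stable_neg hM)
      change FreeAbelianGroup.lift _ _ = 0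
      rw [map_sub, map_sub, FreeAbelianGroup.lift_apply_of, FreeAbelianGroup.lift_apply_of,
        FreeAbelianGroup.lift_apply_of, h1, h2, h3, ← neg_eq_of_add_eq_zero_left h4]
      abel)

/-- In the group of stable classes the cone relation holds by `stable_cone` and `stable_neg`, which
gives a homomorphism from `K₀`; `h` descends to that group as a mere function. -/
theorem exists_K0_lift (H : IsConeInvariant h) :
    ∃ f : K0 A → X, ∀ M, Cpt M → f (kc M) = h M := by
  refine ⟨fun x => Quot.lift (fun M : {M : DGMod A // Cpt M} => h M.1)
    (fun _ _ e => H.eq_of_stable e) (H.K0toQuo x), fun M hM => ?_⟩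
  have : H.K0toQuo (kc M) = H.toQuo M hM := by
    rw [kc_eq hM]
    exact FreeAbelianGroup.lift_apply_of _ _
  exact congrArg (Quot.lift (fun M : {M : DGMod A // Cpt M} => h M.1)
    fun _ _ e => H.eq_of_stable e) this

end IsConeInvariant
end DGMod
end Lift

/-! ### The map on `K₀` induced by the Weil restriction -/

section Induced

namespace DGMod

section

variable {K : Type u} [Field K] {A : DGAlg K}

/-- A semi-free module of finite rank is a triangular deformation of a free module. -/
def SemiFree.tri {P : DGMod A} (s : SemiFree P) (n : ℕ) (hn : ∀ x, s.lev x < n) :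
    Tri (Free A s.E s.δ) P n where
  J := s.J
  isGr := s.isGr
  q w := dmask _ {x | s.lev x = w}
  idem v w x := by
    change (dmask _ {x | s.lev x = w} ≫ dmask _ {x | s.lev x = v}).toFun x = _
    rw [dmask_comp]
    refine DFinsupp.ext (β := fun _ : s.E => A.carrier) fun i => ?_
    by_cases hi : s.lev i = w
    · by_cases hv : v = w
      · subst hv
        rw [if_pos rfl, Set.inter_self]
      · rw [if_neg hv]
        exact dmask_notMem _ (by simp only [Set.mem_inter_iff, Set.mem_setOf_eq]; omega) x
    · refine (dmask_notMem _ (by simp only [Set.mem_inter_iff, Set.mem_setOf_eq]; omega) x).trans ?_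
      split_ifs with hv
      · exact (dmask_notMem _ (by simp only [Set.mem_setOf_eq]; omega) x).symm
      · rfl
  sum x := by
    refine DFinsupp.ext (β := fun _ : s.E => A.carrier) fun i => ?_
    have h := map_sum (dpr (fun x : s.E => shift (self A) (-s.δ x)) i).toFun
      (fun w => (dmask (fun x : s.E => shift (self A) (-s.δ x)) {x | s.lev x = w}).toFun x)
      (Finset.range n)
    refine h.trans ((Finset.sum_eq_single_of_mem (s.lev i) (Finset.mem_range.2 (hn i))
      fun w _ hw => ?_).trans ?_)
    · exact dmask_notMem (fun x : s.E => shift (self A) (-s.δ x)) (s := {x | s.lev x = w})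
        (fun h => hw (Eq.symm h)) x
    · exact dmask_mem (fun x : s.E => shift (self A) (-s.δ x)) (s := {x | s.lev x = s.lev i})
        rfl x
  low v w x hwv := by
    refine DFinsupp.ext (β := fun _ : s.E => A.carrier) fun y => ?_
    by_cases hy : s.lev y = v
    · refine (dmask_mem (fun x : s.E => shift (self A) (-s.δ x)) (s := {x | s.lev x = v})
        hy _).trans (Eq.trans ?_ (dmask_mem (fun x : s.E => shift (self A) (-s.δ x))
          (s := {x | s.lev x = v}) hy _).symm)
      have h := s.cf_d_eq (C := {x | s.lev x = w}) (z := s.J ((dmask _ {x | s.lev x = w}).toFun x))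
        (fun x' hx' => (s.cf_J _ _).trans (dmask_notMem _ hx' x)) y
        (fun x' hx' => s.low' _ _ (by
          have : s.lev x' = w := hx'
          omega))
      rw [s.cf_J] at h
      refine h.trans ?_
      rw [← sg_neg]
      rfl
    · exact (dmask_notMem (fun x : s.E => shift (self A) (-s.δ x)) (s := {x | s.lev x = v})
        hy _).trans (dmask_notMem (fun x : s.E => shift (self A) (-s.δ x))
          (s := {x | s.lev x = v}) hy _).symm

/-- The projection of the cone of `0` to the target. -/
def coneZeroFst (M N : DGMod A) : cone (0 : M ⟶ N) ⟶ cone (0 : M ⟶ N) where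
  toFun := (LinearMap.id : N.carrier →ₗ[K] N.carrier).prodMap (0 : M.carrier →ₗ[K] M.carrier)
  map_mem _ _ hx := ⟨hx.1, zero_mem _⟩
  map_d x := Prod.ext (add_zero (N.d x.1) |>.trans (add_zero (N.d x.1)).symm)
    (show (0 : M.carrier) = -M.d 0 by rw [map_zero, neg_zero])
  map_act x a := Prod.ext rfl
    (show (0 : M.carrier) = M.act.toFun 0 a by rw [map_zero, LinearMap.zero_apply])

/-- The projection of the cone of `0` to the source. -/
def coneZeroSnd (M N : DGMod A) : cone (0 : M ⟶ N) ⟶ cone (0 : M ⟶ N) where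
  toFun := (0 : N.carrier →ₗ[K] N.carrier).prodMap (LinearMap.id : M.carrier →ₗ[K] M.carrier)
  map_mem _ _ hx := ⟨zero_mem _, hx.2⟩
  map_d x := Prod.ext (show (0 : N.carrier) = N.d 0 + 0 by rw [map_zero, add_zero]) rfl
  map_act x a := Prod.ext (show (0 : N.carrier) = N.act.toFun 0 a by
    rw [map_zero, LinearMap.zero_apply]) rfl

/-- The weight decomposition of `W ⊕ N ⊕ M[1]`. -/
def coneWeight (W M N : DGMod A) :
    ℕ → (prod W (cone (0 : M ⟶ N)) ⟶ prod W (cone (0 : M ⟶ N)))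
  | 0 => prodMap (𝟙 W) (coneZeroFst M N)
  | 1 => prodMap 0 (coneZeroSnd M N)
  | _ + 2 => 0

/-- The cone of `f` is a triangular deformation of the cone of `0`. -/
def coneTri (W : DGMod A) {M N : DGMod A} (f : M ⟶ N) :
    Tri (prod W (cone (0 : M ⟶ N))) (prod W (cone f)) 2 where
  J := LinearEquiv.refl K (W.carrier × (N.carrier × M.carrier))
  isGr := ⟨fun hx => by rw [add_zero]; exact hx, fun _ _ => rfl⟩
  q := coneWeight W M N
  idem v w x := by
    rcases v with _ | _ | v <;> rcases w with _ | _ | w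
    · rfl
    · rfl
    · exact map_zero _
    · rfl
    · rfl
    · exact (map_zero _).trans (if_neg (by omega)).symm
    · rfl
    · rfl
    · split_ifs <;> rfl
  sum x := by
    rw [Finset.sum_range_succ, Finset.sum_range_one]
    exact Prod.ext (add_zero x.1) (Prod.ext (add_zero x.2.1) (zero_add x.2.2))
  low v w x hwv := by
    -- The only term distinguishing the two differentials is `f`, which goes from weight `1` to
    -- weight `0`; it never appears when `w ≤ v`.
    rcases v with _ | _ | v
    · obtain rfl : w = 0 := by omega
      refine Prod.ext rfl (Prod.ext ?_ rfl)
      change N.d x.2.1 + f.toFun 0 = N.d x.2.1 + 0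
      rw [map_zero]
    · rcases w with _ | _ | w
      · rfl
      · rfl
      · omega
    · rfl

end

variable (k : Type u) {l : Type u} (L : Type u) [Field k] [Field l] [Field L] [Algebra k l]
  [Algebra k L] [Algebra l L] [IsScalarTower k l L] [FiniteDimensional k L]
  {A : DGAlg l}

variable [IsGalois k L]

/-- The Weil restriction of `A` as a module over itself is the algebra `weilAlg k L A` as a module
over itself, so a finite sum of shifts of `A` goes to a finite free module. -/
theorem cpt_weilMod_free (E : Type u) [Fintype E] (δ : E → ℤ) :
    Cpt (weilMod k L (Free A E δ)) := by
  obtain ⟨J, _, n, _, _, ⟨e⟩⟩ := exists_weilMod_dsum k L δ (self A)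
  exact (Cpt.free (A := weilAlg k L A) J n).of_iso ((toDCat _).mapIso e.symm)

/-- A compact module is a retract of a finite semifree one, which is a triangular deformation of a
finite free one. The Weil restriction carries deformations to deformations, and its derived functor
carries retracts to retracts. -/
theorem Cpt.weilMod {M : DGMod A} (hM : Cpt M) : Cpt (weilMod k L M) := by
  obtain ⟨P, s, hs, i, r, hir⟩ := hM.exists_retract
  have := Fintype.ofFinite s.E
  obtain ⟨b, hb⟩ := (Set.finite_range s.lev).bddAbove
  have hP : Cpt (NCWeil.weilMod k L P) := (((s.tri (b + 1) fun x =>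
    Nat.lt_succ_iff.2 (hb ⟨x, rfl⟩)).weil k L).cpt_kc (cpt_weilMod_free k L s.E s.δ)).1
  refine hP.of_retract ((derivedWeil k L (preservesQuasiIso k L A)).map i)
    ((derivedWeil k L (preservesQuasiIso k L A)).map r) ?_
  exact ((derivedWeil k L (preservesQuasiIso k L A)).map_comp i r).symm.trans
    ((congrArg _ hir).trans ((derivedWeil k L (preservesQuasiIso k L A)).map_id _))

/-- Passing from `f` to `0` is a triangular deformation of `W ⊕ cone(f)`, and after the Weil
restriction it is still one, with the same class. The summand `W` must be included because the Weil
restriction is not additive. -/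
theorem isConeInvariant_weil :
    IsConeInvariant fun M : DGMod A => kc (NCWeil.weilMod k L M) where
  of_QI f hf := kc_of_QI _ (weilFunctor_QI k L hf)
  of_cone {W M N} f hW hM hN := (((coneTri W f).weil k L).cpt_kc
    ((hW.prod (hM.cone 0 hN)).weilMod k L)).2

theorem preserves_compact (X : DCat A) (hX : IsCompactObject X) :
    IsCompactObject ((derivedWeil k L (preservesQuasiIso k L A)).obj X) :=
  (isCompactObject_iff _).2 (Cpt.weilMod k L (kc_ob ⟨X, hX⟩).1)

theorem isInducedMap_iff (f : K0 A → K0 (weilAlg k L A)) :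
    IsInducedMap k L f ↔ ∀ M : DGMod A, Cpt M → f (kc M) = kc (NCWeil.weilMod k L M) := by
  constructor
  · rintro ⟨h, hc, hf⟩ M hM
    rw [kc_eq hM, kc_eq (hM.weilMod k L)]
    exact hf ⟨(toDCat A).obj M, (isCompactObject_iff M).2 hM⟩
  · intro hf
    refine ⟨preservesQuasiIso k L A, preserves_compact k L, fun X => ?_⟩
    have h := hf (ob X.1) (kc_ob X).1
    rw [(kc_ob X).2, kc_eq ((kc_ob X).1.weilMod k L)] at h
    exact h

theorem existsUnique_isInducedMap :
    ∃! f : K0 A → K0 (weilAlg k L A), IsInducedMap k L f := by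
  obtain ⟨f, hf⟩ := (isConeInvariant_weil (A := A) k L).exists_K0_lift
  refine ⟨f, (isInducedMap_iff k L f).2 hf, fun g hg => funext fun x => ?_⟩
  obtain ⟨M, hM, rfl⟩ := exists_kc x
  rw [hf M hM, (isInducedMap_iff k L g).1 hg M hM]

end DGMod

end Induced

/-! ## Cross-effects -/

section CrossEffect

variable {M S : Type*} [AddCommMonoid M] [AddCommGroup S]

/-- The sets meeting all `T i` and contained in their union. -/
def Meets {E : Type*} {n : ℕ} (T : Fin n → Finset E) (O : Finset E) : Prop :=
  (∀ j ∈ O, ∃ i, j ∈ T i) ∧ ∀ i, ∃ j ∈ O, j ∈ T i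

theorem meets_snoc {E : Type*} {n : ℕ} (T : Fin n → Finset E) (U O : Finset E) :
    Meets (Fin.snoc T U : Fin (n + 1) → Finset E) O ↔
      (∀ j ∈ O, (∃ i, j ∈ T i) ∨ j ∈ U) ∧ (∀ i, ∃ j ∈ O, j ∈ T i) ∧ ∃ j ∈ O, j ∈ U := by
  simp only [Meets, Fin.exists_fin_succ', Fin.forall_fin_succ', Fin.snoc_castSucc, Fin.snoc_last]

open Classical in
-- This is inclusion and exclusion. Splitting the last block into two disjoint pieces and
-- subtracting the values at each piece leaves the sets `O` which meet both. The empty set meets no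
-- block, hence `g ∅ = 0` is required for the initial case.
theorem crossEffect_eq_sum {E : Type*} [Fintype E] [DecidableEq E] (f : M → S) (x : E → M)
    (g : Finset E → S) (hf : ∀ T : Finset E, f (∑ e ∈ T, x e) = ∑ O ∈ T.powerset, g O)
    (hg : g ∅ = 0) (n : ℕ) (T : Fin (n + 1) → Finset E)
    (hT : ∀ i j, i ≠ j → Disjoint (T i) (T j)) :
    crossEffect f n (fun i => ∑ e ∈ T i, x e) = ∑ O : Finset E, if Meets T O then g O else 0 := by
  induction n with
  | zero =>
    rw [crossEffect, hf, ← Finset.sum_filter]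
    refine (Finset.sum_subset (fun O hO => ?_) fun O hO hO' => ?_).symm
    · have h := (Finset.mem_filter.1 hO).2.1
      rw [Finset.mem_powerset]
      intro j hj
      obtain ⟨i, hi⟩ := h j hj
      rwa [Fin.fin_one_eq_zero i] at hi
    · rcases O.eq_empty_or_nonempty with rfl | ⟨j, hj⟩
      · exact hg
      · rw [Finset.mem_powerset] at hO
        exact absurd (Finset.mem_filter.2 ⟨Finset.mem_univ _, fun j hj => ⟨0, hO hj⟩, fun i =>
          ⟨j, hj, by rw [Fin.fin_one_eq_zero i]; exact hO hj⟩⟩) hO'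
  | succ n ih =>
    have key : ∀ U : Finset E, U ⊆ T (Fin.last n).castSucc ∪ T (Fin.last (n + 1)) →
        crossEffect f n (Fin.snoc (fun i : Fin n => ∑ e ∈ T i.castSucc.castSucc, x e)
          (∑ e ∈ U, x e)) = ∑ O : Finset E,
          if Meets (Fin.snoc (fun i : Fin n => T i.castSucc.castSucc) U : Fin (n + 1) → _) O
            then g O else 0 := by
      intro U hU
      have hd : ∀ i : Fin n, Disjoint (T i.castSucc.castSucc) U := fun i =>
        Disjoint.mono_right hU (Finset.disjoint_union_right.2 ⟨hT _ _ (by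
          intro h
          exact absurd (Fin.castSucc_injective _ h) (Fin.castSucc_lt_last i).ne),
          hT _ _ (Fin.castSucc_lt_last _).ne⟩)
      rw [← ih]
      · congr 1
        funext i
        refine Fin.lastCases ?_ (fun i => ?_) i
        · simp only [Fin.snoc_last]
        · simp only [Fin.snoc_castSucc]
      · intro i j
        refine Fin.lastCases (Fin.lastCases (fun h => absurd rfl h) (fun i _ => ?_) i)
          (fun j => Fin.lastCases (fun _ => ?_) (fun i h => ?_) i) j
        · simpa only [Fin.snoc_last, Fin.snoc_castSucc] using hd i
        · simpa only [Fin.snoc_last, Fin.snoc_castSucc] using (hd j).symm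
        · simp only [Fin.snoc_castSucc]
          exact hT _ _ fun h' => h (by rw [Fin.castSucc_injective _ (Fin.castSucc_injective _ h')])
    have hab : Disjoint (T (Fin.last n).castSucc) (T (Fin.last (n + 1))) :=
      hT _ _ (Fin.castSucc_lt_last _).ne
    rw [crossEffect, ← Finset.sum_union hab, key _ subset_rfl, key _ Finset.subset_union_left,
      key _ Finset.subset_union_right, ← Finset.sum_sub_distrib, ← Finset.sum_sub_distrib]
    refine Finset.sum_congr rfl fun O _ => ?_
    have hR : ∀ j (i : Fin n), j ∈ T i.castSucc.castSucc →
        j ∉ T (Fin.last n).castSucc ∧ j ∉ T (Fin.last (n + 1)) := fun j i hj =>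
      ⟨Finset.disjoint_left.1 (hT _ _ (by
        intro h
        exact absurd (Fin.castSucc_injective _ h) (Fin.castSucc_lt_last i).ne)) hj,
        Finset.disjoint_left.1 (hT _ _ (Fin.castSucc_lt_last _).ne) hj⟩
    have hab' : ∀ j, j ∈ T (Fin.last n).castSucc → j ∉ T (Fin.last (n + 1)) :=
      fun _ h => Finset.disjoint_left.1 hab h
    have hm : Meets T O ↔ (∀ j ∈ O, (∃ i : Fin n, j ∈ T i.castSucc.castSucc) ∨
        j ∈ T (Fin.last n).castSucc ∪ T (Fin.last (n + 1))) ∧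
        (∀ i : Fin n, ∃ j ∈ O, j ∈ T i.castSucc.castSucc) ∧
        (∃ j ∈ O, j ∈ T (Fin.last n).castSucc) ∧ ∃ j ∈ O, j ∈ T (Fin.last (n + 1)) := by
      simp only [Meets, Fin.exists_fin_succ', Fin.forall_fin_succ', Finset.mem_union, or_assoc,
        and_assoc]
    simp only [meets_snoc, hm]
    generalize T (Fin.last n).castSucc = Ta at *
    generalize T (Fin.last (n + 1)) = Tb at *
    -- A set meeting one piece only is counted once in the union and once in that piece, and
    -- cancels; a set meeting both is counted in the union alone; a set meeting neither is not
    -- counted.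
    by_cases ha : ∃ j ∈ O, j ∈ Ta
    · have h3 : ¬∀ j ∈ O, (∃ i : Fin n, j ∈ T i.castSucc.castSucc) ∨ j ∈ Tb := by
        obtain ⟨j, hj, hja⟩ := ha
        intro h
        rcases h j hj with ⟨i, hi⟩ | hb
        · exact (hR j i hi).1 hja
        · exact hab' j hja hb
      have hu : ∃ j ∈ O, j ∈ Ta ∪ Tb :=
        let ⟨j, hj, hja⟩ := ha
        ⟨j, hj, Finset.mem_union_left _ hja⟩
      by_cases hb : ∃ j ∈ O, j ∈ Tb
      · have h2 : ¬∀ j ∈ O, (∃ i : Fin n, j ∈ T i.castSucc.castSucc) ∨ j ∈ Ta := by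
          obtain ⟨j, hj, hjb⟩ := hb
          intro h
          rcases h j hj with ⟨i, hi⟩ | ha
          · exact (hR j i hi).2 hjb
          · exact hab' j ha hjb
        simp only [ha, hb, h2, h3, hu, false_and, if_false, and_true, sub_zero]
      · have e : (∀ j ∈ O, (∃ i : Fin n, j ∈ T i.castSucc.castSucc) ∨ j ∈ Ta ∪ Tb) ↔
            ∀ j ∈ O, (∃ i : Fin n, j ∈ T i.castSucc.castSucc) ∨ j ∈ Ta := by
          refine forall₂_congr fun j hj => ?_
          have : j ∉ Tb := fun h => hb ⟨j, hj, h⟩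
          simp [this]
        simp only [e, ha, hb, h3, hu, false_and, and_false, if_false, and_true, sub_zero, sub_self]
    · by_cases hb : ∃ j ∈ O, j ∈ Tb
      · have hu : ∃ j ∈ O, j ∈ Ta ∪ Tb :=
          let ⟨j, hj, hjb⟩ := hb
          ⟨j, hj, Finset.mem_union_right _ hjb⟩
        have e : (∀ j ∈ O, (∃ i : Fin n, j ∈ T i.castSucc.castSucc) ∨ j ∈ Ta ∪ Tb) ↔
            ∀ j ∈ O, (∃ i : Fin n, j ∈ T i.castSucc.castSucc) ∨ j ∈ Tb := by
          refine forall₂_congr fun j hj => ?_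
          have : j ∉ Ta := fun h => ha ⟨j, hj, h⟩
          simp [this]
        simp only [e, ha, hb, hu, false_and, and_false, if_false, and_true, sub_zero, sub_self]
      · have hu : ¬∃ j ∈ O, j ∈ Ta ∪ Tb := by
          rintro ⟨j, hj, h⟩
          rcases Finset.mem_union.1 h with h | h
          · exact ha ⟨j, hj, h⟩
          · exact hb ⟨j, hj, h⟩
        simp only [ha, hb, hu, false_and, and_false, if_false, sub_zero]

theorem crossEffect_eq_zero_of_le {f : M → S} {n m : ℕ} (h : n ≤ m)
    (hn : ∀ x, crossEffect f n x = 0) (x : Fin (m + 1) → M) : crossEffect f m x = 0 := by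
  induction m, h using Nat.le_induction with
  | base => exact hn x
  | succ m _ ih => simp only [crossEffect, ih, sub_zero]

theorem crossEffect_map {N S' : Type*} [AddCommMonoid N] [AddCommGroup S'] (φ : N →+ M)
    (ψ : S' →+ S) {f : M → S} {f' : N → S'} (h : ∀ x, f (φ x) = ψ (f' x)) (n : ℕ)
    (x : Fin (n + 1) → N) : crossEffect f n (fun i => φ (x i)) = ψ (crossEffect f' n x) := by
  induction n with
  | zero => exact h _
  | succ n ih =>
    have key : ∀ y, (Fin.snoc (fun i : Fin n => φ (x i.castSucc.castSucc)) (φ y) :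
        Fin (n + 1) → M) = fun i => φ ((Fin.snoc (fun i : Fin n => x i.castSucc.castSucc) y :
          Fin (n + 1) → N) i) := by
      intro y
      funext i
      refine Fin.lastCases ?_ (fun i => ?_) i
      · simp only [Fin.snoc_last]
      · simp only [Fin.snoc_castSucc]
    simp only [crossEffect, ← map_add, key, ih, map_sub]

/-- With all variables but the last equal to `1`, each cross-effect is a forward difference
corrected by its value at `0`. The condition on `d` is used for `0 ^ d = 0`. -/
theorem crossEffect_pow {d : ℕ} (hd : d ≠ 0) (n : ℕ) (a : ℕ) :
    crossEffect (fun j : ℕ => (j : ℤ) ^ d) n (Fin.snoc (fun _ : Fin n => 1) a) =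
      (fwdDiff 1)^[n] (fun j : ℕ => (j : ℤ) ^ d) a - (fwdDiff 1)^[n] (fun j : ℕ => (j : ℤ) ^ d) 0 := by
  induction n generalizing a with
  | zero => simp [crossEffect, hd, Fin.snoc]
  | succ n ih =>
    have h1 : ∀ i : Fin n, (Fin.snoc (fun _ : Fin (n + 1) => 1) a : Fin (n + 2) → ℕ)
        i.castSucc.castSucc = 1 := fun i => Fin.snoc_castSucc (α := fun _ => ℕ) _ _ _
    have h2 : (Fin.snoc (fun _ : Fin (n + 1) => 1) a : Fin (n + 2) → ℕ) (Fin.last n).castSucc = 1 :=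
      Fin.snoc_castSucc (α := fun _ => ℕ) _ _ _
    have h3 : (Fin.snoc (fun _ : Fin (n + 1) => 1) a : Fin (n + 2) → ℕ) (Fin.last (n + 1)) = a :=
      Fin.snoc_last (α := fun _ => ℕ) _ _
    simp only [crossEffect, h1, h2, h3, ih, Function.iterate_succ_apply', fwdDiff, add_comm 1 a,
      zero_add]
    ring

/-- Along the multiples of `x` the function is `j ^ d` times `f x`, and cross-effects are natural.
This reduces to the integers, where the coefficient is the `d`-th difference of `j ^ d`, that is
`d!`. -/
theorem crossEffect_of_homogeneous {f : M → S} {d n : ℕ} (hd : d = n + 1) {x : M}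
    (h : ∀ j : ℕ, f (j • x) = (j ^ d) • f x) :
    crossEffect f n (fun _ => x) = d.factorial • f x := by
  have h1 := crossEffect_map (multiplesHom M x) (zmultiplesHom S (f x))
    (f' := fun j : ℕ => (j : ℤ) ^ d) (f := f) (fun j => by
      simp only [multiplesHom_apply, zmultiplesHom_apply, h, ← natCast_zsmul]
      push_cast
      rfl) n
    (Fin.snoc (fun _ : Fin n => 1) 1)
  have h2 : (fun i => multiplesHom M x ((Fin.snoc (fun _ : Fin n => 1) 1 : Fin (n + 1) → ℕ) i)) =
      fun _ => x := by
    funext i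
    refine Fin.lastCases ?_ (fun i => ?_) i
    · simp only [Fin.snoc_last, multiplesHom_apply, one_smul]
    · simp only [Fin.snoc_castSucc, multiplesHom_apply, one_smul]
  have h3 : crossEffect (fun j : ℕ => (j : ℤ) ^ d) n (Fin.snoc (fun _ : Fin n => 1) 1) =
      d.factorial := by
    have h4 : ∀ (m : ℕ) (a : ℕ), (fwdDiff 1)^[m] (fun j : ℕ => (j : ℤ) ^ d) a =
        (fwdDiff 1)^[m] (fun j : ℤ => j ^ d) a := by
      intro m
      induction m with
      | zero => exact fun a => rfl
      | succ m ih =>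
        intro a
        simp only [Function.iterate_succ_apply', fwdDiff, ih]
        push_cast
        rfl
    have h5 := congrFun (fwdDiff_iter_eq_factorial (R := ℤ) (n := d)) 0
    rw [crossEffect_pow (by omega), h4, h4]
    subst hd
    -- The constant `d`-th difference, taken at `0`, is the difference between the values at `1` and
    -- `0` of the `(d - 1)`-st one, which is the expression given by `crossEffect_pow`.
    rw [Function.iterate_succ_apply'] at h5
    simpa [fwdDiff] using h5
  rw [h2, h3] at h1
  rw [h1, zmultiplesHom_apply, natCast_zsmul]

end CrossEffect

/-! ### Polynomiality and homogeneity of the induced map -/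

section Polynomial

namespace DGMod

section

variable {K : Type u} [Field K] {A : DGAlg K} {ι : Type u} (N : ι → DGMod A)

theorem dinj_dpr_same (i : ι) : dinj N i ≫ dpr N i = 𝟙 (N i) :=
  hom_ext fun x => dinj_same N i x

theorem dinj_dpr_ne {i j : ι} (h : j ≠ i) : dinj N i ≫ dpr N j = 0 :=
  hom_ext fun x => dinj_ne N h x

/-- The projection of a direct sum to one of its summands, as an endomorphism. -/
def dsumProj (i : ι) : dsum N ⟶ dsum N := dpr N i ≫ dinj N i

theorem dsumProj_idem (i : ι) : dsumProj N i ≫ dsumProj N i = dsumProj N i := by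
  simp only [dsumProj, Category.assoc]
  rw [← Category.assoc (dinj N i), dinj_dpr_same, Category.id_comp]

theorem dsumProj_orth (i j : ι) (h : i ≠ j) : dsumProj N i ≫ dsumProj N j = 0 := by
  simp only [dsumProj, Category.assoc]
  rw [← Category.assoc (dinj N i), dinj_dpr_ne N h.symm, zero_comp, comp_zero]

theorem sum_dsumProj [Fintype ι] : ∑ i, dsumProj N i = 𝟙 (dsum N) := by
  classical
  refine dsum_hom_ext fun i => ?_
  rw [Preadditive.comp_sum, Finset.sum_eq_single_of_mem i (Finset.mem_univ i)]
  · rw [dsumProj, ← Category.assoc, dinj_dpr_same, Category.id_comp, Category.comp_id]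
  · intro j _ hj
    rw [dsumProj, ← Category.assoc, dinj_dpr_ne N hj, zero_comp]

/-- The image of the projection to a summand. -/
def isoFixDsumProj (i : ι) : N i ≅ fix (dsumProj N i) :=
  isoFix (dinj N i) (dpr N i) (dinj_dpr_same N i)

theorem kc_fix_dsumProj (i : ι) : kc (fix (dsumProj N i)) = kc (N i) :=
  kc_of_iso ((toDCat A).mapIso (isoFixDsumProj N i).symm)

theorem kc_fix_of_eq_zero {M : DGMod A} {p : M ⟶ M} (h : p = 0) : kc (fix p) = 0 := by
  subst h
  exact (kc_of_subsingleton (M := fix (0 : M ⟶ M)) fun x => Subtype.ext (mem_fix.1 x.2).symm).2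

theorem kc_shift_of_eq_zero (M : DGMod A) {n : ℤ} (h : n = 0) : kc (shift M n) = kc M := by
  subst h
  refine (kc_of_QI (⟨LinearMap.id, fun i x hx => ?_, fun x => ?_, fun _ _ => rfl⟩ : M ⟶ shift M 0)
    (QI_of_bijective _ Function.bijective_id)).symm
  · change x ∈ M.deg (i + 0)
    rwa [add_zero]
  · change M.d x = sg K 0 • M.d x
    rw [sg_zero, one_smul]

theorem cpt_kc_dsum [Fintype ι] (hN : ∀ i, Cpt (N i)) :
    Cpt (dsum N) ∧ kc (dsum N) = ∑ i, kc (N i) := by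
  classical
  have h := cpt_kc_fix_sum (dsumProj N)
    (fun i => (hN i).of_iso ((toDCat A).mapIso (isoFixDsumProj N i).symm))
    (dsumProj_idem N) (dsumProj_orth N) Finset.univ
  have e : dsum N ≅ fix (∑ i, dsumProj N i) := by
    rw [sum_dsumProj]
    exact isoFix (𝟙 (dsum N)) (𝟙 _) (Category.id_comp _) ≪≫ eqToIso (by rw [Category.id_comp])
  refine ⟨h.1.of_iso ((toDCat A).mapIso e), ?_⟩
  rw [kc_of_iso ((toDCat A).mapIso e), h.2]
  exact Finset.sum_congr rfl fun i _ => kc_fix_dsumProj N i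

end

variable (k : Type u) {l : Type u} (L : Type u) [Field k] [Field l] [Field L] [Algebra k l]
  [Algebra k L] [Algebra l L] [IsScalarTower k l L] [FiniteDimensional k L] [IsGalois k L]
  {A : DGAlg l}

theorem gStable_image {E : Type*} [Fintype E] [DecidableEq E] (O : Finset E) :
    GStable k L (Finset.univ.filter fun φ : Cosets k l L → E => Finset.univ.image φ = O) :=
  GStable.filter (Φ := Finset.univ) (fun _ _ _ => Finset.mem_univ _)
    (fun φ => Finset.univ.image φ) (fun ρ φ => by
      ext e
      simp only [Finset.mem_image, Finset.mem_univ, true_and, Function.comp_apply]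
      exact ⟨fun ⟨c, hc⟩ => ⟨_, hc⟩, fun ⟨c, hc⟩ => ⟨(MulAction.toPerm ρ).symm c, by simpa using hc⟩⟩) O

/-- The contribution to the Weil restriction of a sum of submodules of the tensors involving
exactly the summands in `O`. -/
def weilPart {M : DGMod A} {E : Type*} [Fintype E] [DecidableEq E] (p : E → (M ⟶ M))
    (O : Finset E) : K0 (weilAlg k L A) :=
  kc (fix (weilProj k L p _ (gStable_image k L O)))

theorem weilPart_eq_zero {M : DGMod A} {E : Type*} [Fintype E] [DecidableEq E] (p : E → (M ⟶ M))
    (O : Finset E) (h : ∀ φ : Cosets k l L → E, Finset.univ.image φ ≠ O) :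
    weilPart k L p O = 0 :=
  kc_fix_of_eq_zero (weilProj_empty k L p _ (Finset.filter_eq_empty_iff.2 fun φ _ => h φ))

/-- The Weil restriction of a sum of idempotents over `T` is the projection belonging to all
functions from `G/H` to `T`. Sorting these functions by their image `O`, which permutations do not
change, splits it into orthogonal idempotents. -/
theorem kc_weilMod_fix {M : DGMod A} (hM : Cpt M) {E : Type*} [Fintype E] [DecidableEq E]
    (p : E → (M ⟶ M)) (hp : ∀ e, p e ≫ p e = p e) (hp' : ∀ a b, a ≠ b → p a ≫ p b = 0)
    (T : Finset E) (hT : (∑ e ∈ T, p e) ≫ (∑ e ∈ T, p e) = ∑ e ∈ T, p e) :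
    kc (weilMod k L (fix (∑ e ∈ T, p e))) = ∑ O ∈ T.powerset, weilPart k L p O := by
  set π := ∑ e ∈ T, p e with hπ
  let i : fix π ⟶ M := subι _
  let r : M ⟶ fix π := subLift _ π fun x => mem_fix.2 (congrArg (fun f => Hom.toFun f x) hT)
  have hir : i ≫ r = 𝟙 _ := hom_ext fun x => Subtype.ext (mem_fix.1 x.2)
  have hri : r ≫ i = π := rfl
  have e := isoFix ((weilFunctor k L A).map i) ((weilFunctor k L A).map r) (by
    rw [← (weilFunctor k L A).map_comp, hir, (weilFunctor k L A).map_id])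
  rw [← (weilFunctor k L A).map_comp, hri, hπ, ← weilProj_piFinset] at e
  refine (kc_of_iso ((toDCat _).mapIso e)).trans ?_
  have hs : ∑ O ∈ T.powerset, weilProj k L p _ (gStable_image k L O) =
      weilProj k L p _ (gStable_piFinset k L T) := by
    rw [← sum_weilProj k L p (gStable_piFinset k L T) (fun φ => Finset.univ.image φ)
      (fun ρ φ => by
        have := (Finset.mem_filter.1 (gStable_image k L (Finset.univ.image φ) ρ φ
          (Finset.mem_filter.2 ⟨Finset.mem_univ _, rfl⟩))).2
        exact this) T.powerset]
    · refine Finset.sum_congr rfl fun O hO => ?_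
      congr 1
      ext φ
      simp only [Finset.mem_filter, Finset.mem_univ, true_and, Fintype.mem_piFinset]
      refine ⟨fun h => ⟨fun c => Finset.mem_powerset.1 hO ?_, h⟩, fun h => h.2⟩
      rw [← h]
      exact Finset.mem_image_of_mem _ (Finset.mem_univ _)
    · intro φ hφ
      rw [Fintype.mem_piFinset] at hφ
      rw [Finset.mem_powerset]
      intro e he
      obtain ⟨c, _, rfl⟩ := Finset.mem_image.1 he
      exact hφ c
  rw [← hs]
  have hidem : ∀ O : Finset E, weilProj k L p _ (gStable_image k L O) ≫
      weilProj k L p _ (gStable_image k L O) = weilProj k L p _ (gStable_image k L O) := fun O =>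
    weilProj_comp k L p hp hp' _ _ _ (Finset.inter_self _)
  refine (cpt_kc_fix_sum (fun O => weilProj k L p _ (gStable_image k L O))
    (fun O => (hM.weilMod k L).fix (hidem O)) hidem (fun O O' h => ?_) _).2
  refine weilProj_orth k L p hp hp' _ _ (Finset.disjoint_left.2 fun φ h1 h2 => h ?_)
  exact (Finset.mem_filter.1 h2).2.symm.trans (Finset.mem_filter.1 h1).2

variable {k L} {f : K0 A → K0 (weilAlg k L A)}

/-- For an empty index set the only candidate for an image is the empty set, and no function on the
nonempty set `G/H` has empty image. -/
theorem map_zero_of_induced (hf : ∀ M : DGMod A, Cpt M → f (kc M) = kc (weilMod k L M)) :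
    f 0 = 0 := by
  have h := kc_weilMod_fix k L (Cpt.zeroMod (A := A)) (fun _ : PEmpty.{1} => 𝟙 _)
    (fun e => e.elim) (fun e => e.elim) ∅ (by rw [Finset.sum_empty, zero_comp])
  rw [Finset.powerset_empty, Finset.sum_singleton, weilPart_eq_zero k L _ _ fun φ hφ => by
    have : Finset.univ.Nonempty := ⟨((1 : L ≃ₐ[k] L) : Cosets k l L), Finset.mem_univ _⟩
    exact (this.image φ).ne_empty hφ] at h
  rw [← h, ← hf _ (Cpt.zeroMod.fix (by rw [Finset.sum_empty, zero_comp])),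
    kc_fix_of_eq_zero Finset.sum_empty]

/-- The cross-effect of `d + 1` modules collects the contributions of sets which contain all of the
`d + 1` indices. A function on the `d` elements of `G/H` cannot have such an image. -/
theorem crossEffect_card (hf : ∀ M : DGMod A, Cpt M → f (kc M) = kc (weilMod k L M))
    (m : Fin (Fintype.card (Cosets k l L) + 1) → K0 A) :
    crossEffect f (Fintype.card (Cosets k l L)) m = 0 := by
  choose N hN hm using fun i => exists_kc (m i)
  let N' : ULift.{u} (Fin (Fintype.card (Cosets k l L) + 1)) → DGMod A := fun i => N i.down
  have hN' := (cpt_kc_dsum N' fun i => hN i.down).1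
  have hx : ∀ i, kc (fix (dsumProj N' i)) = m i.down := fun i =>
    (kc_fix_dsumProj N' i).trans (hm _)
  have key : ∀ T : Finset (ULift.{u} (Fin (Fintype.card (Cosets k l L) + 1))),
      f (∑ e ∈ T, m e.down) = ∑ O ∈ T.powerset, weilPart k L (dsumProj N') O := by
    intro T
    have hT : (∑ e ∈ T, dsumProj N' e) ≫ (∑ e ∈ T, dsumProj N' e) = ∑ e ∈ T, dsumProj N' e := by
      rw [Preadditive.sum_comp]
      refine Finset.sum_congr rfl fun i hi => ?_
      rw [Preadditive.comp_sum, Finset.sum_eq_single_of_mem i hi fun j _ hj =>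
        dsumProj_orth N' i j hj.symm, dsumProj_idem]
    rw [← kc_weilMod_fix k L hN' _ (dsumProj_idem N') (dsumProj_orth N') T hT,
      ← hf _ (hN'.fix hT)]
    congr 1
    rw [(cpt_kc_fix_sum (dsumProj N') (fun i => hN'.fix (dsumProj_idem N' i)) (dsumProj_idem N')
      (dsumProj_orth N') T).2]
    exact Finset.sum_congr rfl fun i _ => (hx i).symm
  have h0 : weilPart k L (dsumProj N') ∅ = 0 := by
    have := key ∅
    simpa [map_zero_of_induced hf] using this.symm
  classical
  have h := crossEffect_eq_sum f (fun e : ULift.{u} (Fin (Fintype.card (Cosets k l L) + 1)) =>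
    m e.down) _ key h0 (Fintype.card (Cosets k l L)) (fun i => {⟨i⟩})
    (fun i j h => by simpa using h)
  simp only [Finset.sum_singleton] at h
  rw [h]
  refine Finset.sum_eq_zero fun O _ => ?_
  split_ifs with hO
  · refine weilPart_eq_zero k L _ O fun φ hφ => ?_
    -- The blocks are singletons, so a set meeting all of them is the whole index set.
    have h1 : O = Finset.univ := by
      rw [Finset.eq_univ_iff_forall]
      intro i
      obtain ⟨j, hj, hj'⟩ := hO.2 i.down
      rw [Finset.mem_singleton] at hj'
      rwa [hj'] at hj
    have h2 := Finset.card_image_le (s := Finset.univ) (f := φ)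
    rw [hφ, h1, Finset.card_univ, Finset.card_univ, Fintype.card_ulift, Fintype.card_fin] at h2
    omega
  · rfl

/-- The sum of `n` unshifted copies of `M` goes to `n ^ d` copies of its Weil restriction, again
unshifted, so no signs occur in `K₀`. -/
theorem map_nsmul_of_induced (hf : ∀ M : DGMod A, Cpt M → f (kc M) = kc (weilMod k L M))
    (n : ℕ) (x : K0 A) : f (n • x) = (n ^ Fintype.card (Cosets k l L)) • f x := by
  obtain ⟨M, hM, rfl⟩ := exists_kc x
  obtain ⟨J, _, d, hJ, hd, ⟨e⟩⟩ := exists_weilMod_dsum k L (fun _ : ULift.{u} (Fin n) => 0) M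
  have hn := cpt_kc_dsum (fun _ : ULift.{u} (Fin n) => shift M (-0)) fun _ => hM.shift _
  have hJ' := cpt_kc_dsum (fun j => shift (weilMod k L M) (-d j)) fun _ => (hM.weilMod k L).shift _
  have h1 : n • kc M = kc (dsum fun _ : ULift.{u} (Fin n) => shift M (-0)) := by
    rw [hn.2, Finset.sum_congr rfl fun _ _ => kc_shift_of_eq_zero M neg_zero, Finset.sum_const,
      Finset.card_univ, Fintype.card_ulift, Fintype.card_fin]
  rw [h1, hf _ hn.1, ← kc_of_iso ((toDCat _).mapIso e), hJ'.2,
    Finset.sum_congr rfl fun j _ => kc_shift_of_eq_zero (weilMod k L M)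
      (neg_eq_zero.2 (hd (fun _ => rfl) j)), Finset.sum_const, Finset.card_univ, hJ,
    Fintype.card_ulift, Fintype.card_fin, hf M hM]

end DGMod

end Polynomial

/-! ### The Euler characteristic on `K₀` -/

section EulerCharacteristic

/-- The dimension count in an exact sequence `U → V → C → W → X`. -/
theorem finrank_add_of_exact {K U V C W X : Type*} [Field K] [AddCommGroup U] [AddCommGroup V]
    [AddCommGroup C] [AddCommGroup W] [AddCommGroup X] [Module K U] [Module K V] [Module K C]
    [Module K W] [Module K X] [Module.Finite K V] [Module.Finite K W]
    (a : U →ₗ[K] V) (b : V →ₗ[K] C) (c : C →ₗ[K] W) (a' : W →ₗ[K] X)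
    (hb : Function.Exact a b) (hc : Function.Exact b c) (ha : Function.Exact c a') :
    Module.Finite K C ∧
      Module.finrank K C + Module.finrank K (LinearMap.range a) +
        Module.finrank K (LinearMap.range a') = Module.finrank K V + Module.finrank K W := by
  have h1 := b.finrank_range_add_finrank_ker
  have h2 := a'.finrank_range_add_finrank_ker
  rw [LinearMap.exact_iff.1 hb] at h1
  rw [LinearMap.exact_iff.1 ha] at h2
  have : Module.Finite K (LinearMap.ker c) := by rw [LinearMap.exact_iff.1 hc]; infer_instance
  have : Module.Finite K (C ⧸ LinearMap.ker c) := Module.Finite.equiv c.quotKerEquivRange.symm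
  have : Module.Finite K C := Module.Finite.of_submodule_quotient (LinearMap.ker c)
  have h3 := c.finrank_range_add_finrank_ker
  rw [LinearMap.exact_iff.1 hc] at h3
  exact ⟨this, by omega⟩

variable {K : Type u} [Field K] {A : DGAlg K}

namespace DGMod

/-! ### The long exact sequence of a cone -/

theorem mk_eq_zero_iff (V : DGVect K) {n : ℤ} (x : V.cocycles n) :
    (Submodule.Quotient.mk x : V.cohomology n) = 0 ↔ ∃ y ∈ V.deg (n - 1), V.d y = x.1 :=
  Submodule.Quotient.mk_eq_zero _

/-- The map `Hⁿ(cone f) → Hⁿ⁺¹(M)`. -/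
def connecting {M N : DGMod A} (f : M ⟶ N) (n : ℤ) :
    (cone f).cohomology n →ₗ[K] M.cohomology (n + 1) :=
  Submodule.mapQ _ _ ((LinearMap.snd K N.carrier M.carrier).restrict
    (p := (cone f).cocycles n) (q := M.cocycles (n + 1))
    fun _ hx => ⟨hx.1.2, neg_eq_zero.1 (congrArg Prod.snd hx.2)⟩) (by
      rintro ⟨x, hx⟩ ⟨y, hy, hyx⟩
      refine ⟨-y.2, ?_, ?_⟩
      · have h := hy.2
        rw [sub_add_cancel] at h
        rw [add_sub_cancel_right]
        exact neg_mem h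
      · exact (map_neg M.d y.2).trans (congrArg Prod.snd hyx))

theorem exact_coneι {M N : DGMod A} (f : M ⟶ N) (n : ℤ) :
    Function.Exact (cohomologyMap f n) (cohomologyMap (coneι f) n) := by
  intro y
  induction y using Submodule.Quotient.induction_on with
  | _ y =>
  constructor
  · intro h
    obtain ⟨z, hz, e⟩ := (mk_eq_zero_iff (cone f).toDGVect (cocyclesMap (coneι f) n y)).1 h
    have e1 : N.d z.1 + f.toFun z.2 = y.1 := congrArg Prod.fst e
    have e2 : M.d z.2 = 0 := neg_eq_zero.1 (congrArg Prod.snd e)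
    have hz2 : z.2 ∈ M.deg n := by have := hz.2; rwa [sub_add_cancel] at this
    refine ⟨Submodule.Quotient.mk ⟨z.2, hz2, e2⟩, ((Submodule.Quotient.eq _).2 ?_)⟩
    refine ⟨-z.1, neg_mem hz.1, ?_⟩
    change N.d (-z.1) = f.toFun z.2 - y.1
    rw [← e1, map_neg]; abel
  · rintro ⟨x, e⟩
    induction x using Submodule.Quotient.induction_on with
    | _ x =>
    rw [← e]
    refine (mk_eq_zero_iff (cone f).toDGVect _).2 ⟨(0, x.1), ⟨zero_mem _, ?_⟩, ?_⟩
    · rw [sub_add_cancel]; exact x.2.1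
    · refine Prod.ext ?_ ?_
      · change N.d 0 + f.toFun x.1 = f.toFun x.1
        rw [map_zero, zero_add]
      · exact neg_eq_zero.2 x.2.2

theorem exact_connecting {M N : DGMod A} (f : M ⟶ N) (n : ℤ) :
    Function.Exact (cohomologyMap (coneι f) n) (connecting f n) := by
  intro y
  induction y using Submodule.Quotient.induction_on with
  | _ y =>
  constructor
  · intro h
    obtain ⟨z, hz, e⟩ := (mk_eq_zero_iff M.toDGVect _).1 h
    rw [add_sub_cancel_right] at hz
    have e2 : M.d z = y.1.2 := e
    have hy : N.d y.1.1 + f.toFun y.1.2 = 0 := congrArg Prod.fst y.2.2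
    refine ⟨Submodule.Quotient.mk ⟨y.1.1 + f.toFun z, add_mem y.2.1.1 (f.map_mem _ _ hz), ?_⟩,
      (Submodule.Quotient.eq _).2 ?_⟩
    · change N.d (y.1.1 + f.toFun z) = 0
      rw [map_add, ← f.map_d, e2, hy]
    · refine ⟨(0, z), ⟨zero_mem _, by rwa [sub_add_cancel]⟩, Prod.ext ?_ ?_⟩
      · change N.d 0 + f.toFun z = y.1.1 + f.toFun z - y.1.1
        rw [map_zero]; abel
      · change -M.d z = 0 - y.1.2
        rw [e2, zero_sub]
  · rintro ⟨x, e⟩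
    induction x using Submodule.Quotient.induction_on with
    | _ x =>
    rw [← e]
    exact (mk_eq_zero_iff M.toDGVect _).2 ⟨0, zero_mem _, map_zero _⟩

theorem exact_cohomologyMap {M N : DGMod A} (f : M ⟶ N) (n : ℤ) :
    Function.Exact (connecting f n) (cohomologyMap f (n + 1)) := by
  intro y
  induction y using Submodule.Quotient.induction_on with
  | _ y =>
  constructor
  · intro h
    obtain ⟨z, hz, e⟩ := (mk_eq_zero_iff N.toDGVect _).1 h
    rw [add_sub_cancel_right] at hz
    have e1 : N.d z = f.toFun y.1 := e
    refine ⟨Submodule.Quotient.mk ⟨(-z, y.1), ⟨neg_mem hz, y.2.1⟩, Prod.ext ?_ ?_⟩, rfl⟩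
    · change N.d (-z) + f.toFun y.1 = 0
      rw [map_neg, e1, neg_add_cancel]
    · exact neg_eq_zero.2 y.2.2
  · rintro ⟨x, e⟩
    induction x using Submodule.Quotient.induction_on with
    | _ x =>
    rw [← e]
    refine (mk_eq_zero_iff N.toDGVect _).2 ⟨-x.1.1, ?_, ?_⟩
    · rw [add_sub_cancel_right]; exact neg_mem x.2.1.1
    · have hx : N.d x.1.1 + f.toFun x.1.2 = 0 := congrArg Prod.fst x.2.2
      exact (map_neg N.d _).trans (neg_eq_of_add_eq_zero_right hx)

/-! ### Euler characteristics -/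

/-- The total cohomology is finite-dimensional. -/
structure FinCohom (M : DGMod A) : Prop where
  finite : ∀ n, Module.Finite K (M.cohomology n)
  support : {n | Module.finrank K (M.cohomology n) ≠ 0}.Finite

/-- The Euler characteristic of the cohomology. -/
def euler (M : DGMod A) : ℤ :=
  ∑ᶠ n : ℤ, (n.negOnePow : ℤ) * (Module.finrank K (M.cohomology n) : ℤ)

theorem finite_deg (V : DGVect K) [Module.Finite K V] : {n | V.deg n ≠ ⊥}.Finite :=
  WellFoundedGT.finite_ne_bot_of_iSupIndep V.isInternal.submodule_iSupIndep

theorem FinCohom.of_finite (M : DGMod A) [Module.Finite K M.carrier] : FinCohom M where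
  finite n := inferInstance
  support := (finite_deg M.toDGVect).subset fun n hn h => hn (by
    have : Subsingleton (M.cocycles n) := ⟨fun x y => Subtype.ext (by
      have h' : ∀ z ∈ M.deg n, z = 0 := fun z hz => (Submodule.mem_bot K).1 (h ▸ hz)
      rw [h' _ x.2.1, h' _ y.2.1])⟩
    exact Module.finrank_zero_of_subsingleton)

/-- Cohomology is a functor on the derived category, so the cohomology of a retract embeds in that
of the larger module. -/
theorem FinCohom.of_retract {M P : DGMod A} (hP : FinCohom P)
    (i : (toDCat A).obj M ⟶ (toDCat A).obj P) (r : (toDCat A).obj P ⟶ (toDCat A).obj M)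
    (hir : i ≫ r = 𝟙 _) : FinCohom M := by
  have key : ∀ n, ∃ g : M.cohomology n →ₗ[K] P.cohomology n, Function.Injective g := by
    intro n
    refine ⟨((dcohom A n).map i).hom, Function.LeftInverse.injective
      (g := ((dcohom A n).map r).hom) fun x => ?_⟩
    have h := ((dcohom A n).map_comp i r).symm.trans ((congrArg _ hir).trans
      ((dcohom A n).map_id _))
    exact congrArg (fun t => t.hom x) h
  refine ⟨fun n => ?_, hP.support.subset fun n hn h => hn ?_⟩
  · obtain ⟨g, hg⟩ := key n
    have := hP.finite n
    exact Module.Finite.of_injective g hg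
  · obtain ⟨g, hg⟩ := key n
    have := hP.finite n
    exact Nat.eq_zero_of_le_zero (h ▸ LinearMap.finrank_le_finrank_of_injective hg)

/-- Over a finite-dimensional algebra, a finite semifree module is itself finite-dimensional, and
compact modules are retracts of such modules. -/
theorem FinCohom.of_cpt [Module.Finite K A.carrier] {M : DGMod A} (hM : Cpt M) : FinCohom M := by
  obtain ⟨P, s, hs, i, r, hir⟩ := hM.exists_retract
  have : Module.Finite K (Π₀ _ : s.E, A.carrier) := by
    have := Fintype.ofFinite s.E
    classical
    exact Module.Finite.equiv (DFinsupp.linearEquivFunOnFintype (R := K)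
      (M := fun _ : s.E => A.carrier)).symm
  have : Module.Finite K P.carrier := Module.Finite.equiv (M := Π₀ _ : s.E, A.carrier) s.J
  exact (FinCohom.of_finite P).of_retract i r hir

theorem euler_of_iso {M N : DGMod A} (e : (toDCat A).obj M ≅ (toDCat A).obj N) :
    euler M = euler N := by
  refine finsum_congr fun n => ?_
  have h : Module.finrank K (M.cohomology n) = Module.finrank K (N.cohomology n) :=
    ((dcohom A n).mapIso e).toLinearEquiv.finrank_eq
  rw [h]

theorem finsum_negOnePow_shift (r : ℤ → ℤ) :
    ∑ᶠ n : ℤ, (n.negOnePow : ℤ) * r (n + 1) = -∑ᶠ n : ℤ, (n.negOnePow : ℤ) * r n := by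
  rw [← finsum_neg_distrib, ← finsum_comp_equiv (Equiv.addRight (1 : ℤ))
    (f := fun n : ℤ => -((n.negOnePow : ℤ) * r n))]
  refine finsum_congr fun n => ?_
  simp [Int.negOnePow_succ]

/-- The long exact sequence expresses the dimensions for the cone by those for `N` and the shifted
ones for `M`, minus the ranks of the maps induced by `f` in two consecutive degrees; with
alternating signs the ranks cancel. -/
theorem euler_cone {M N : DGMod A} (f : M ⟶ N) (hM : FinCohom M) (hN : FinCohom N) :
    euler (cone f) = euler N - euler M := by
  set m : ℤ → ℤ := fun n => Module.finrank K (M.cohomology n) with hm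
  set v : ℤ → ℤ := fun n => Module.finrank K (N.cohomology n) with hv
  set r : ℤ → ℤ := fun n => Module.finrank K (LinearMap.range (cohomologyMap f n)) with hr
  have hms : (Function.support m).Finite := hM.support.subset fun n hn h => hn (by simp [hm, h])
  have hvs : (Function.support v).Finite := hN.support.subset fun n hn h => hn (by simp [hv, h])
  have hrs : (Function.support r).Finite := by
    refine hN.support.subset fun n hn h => hn ?_
    have := hN.finite n
    have := Submodule.finrank_le (LinearMap.range (cohomologyMap f n))
    simp only [hr]
    omega
  have hsh : ∀ g : ℤ → ℤ, (Function.support g).Finite →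
      (Function.support fun n => g (n + 1)).Finite := fun g hg =>
    hg.preimage (f := fun n : ℤ => n + 1) (add_left_injective 1).injOn
  have hmul : ∀ g : ℤ → ℤ, (Function.support g).Finite →
      (Function.support fun n : ℤ => (n.negOnePow : ℤ) * g n).Finite := fun g hg =>
    hg.subset fun n hn h => hn (by simp [h])
  have h0 : ∀ n : ℤ, (n.negOnePow : ℤ) * (Module.finrank K ((cone f).cohomology n) : ℤ) =
      ((n.negOnePow : ℤ) * v n + (n.negOnePow : ℤ) * m (n + 1)) -
        ((n.negOnePow : ℤ) * r n + (n.negOnePow : ℤ) * r (n + 1)) := by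
    intro n
    have := hN.finite n
    have := hM.finite (n + 1)
    have h := (finrank_add_of_exact _ _ _ _ (exact_coneι f n) (exact_connecting f n)
      (exact_cohomologyMap f n)).2
    have h' : (Module.finrank K ((cone f).cohomology n) : ℤ) = v n + m (n + 1) - (r n + r (n + 1)) := by
      simp only [hv, hm, hr]
      omega
    rw [h']; ring
  rw [euler, finsum_congr h0, finsum_sub_distrib, finsum_add_distrib, finsum_add_distrib,
    finsum_negOnePow_shift m, finsum_negOnePow_shift r, add_neg_cancel, sub_zero, ← sub_eq_add_neg]
  · rfl
  · exact hmul r hrs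
  · exact hmul _ (hsh r hrs)
  · exact hmul v hvs
  · exact hmul _ (hsh m hms)
  · exact ((hmul v hvs).union (hmul _ (hsh m hms))).subset (Function.support_add _ _)
  · exact ((hmul r hrs).union (hmul _ (hsh r hrs))).subset (Function.support_add _ _)

/-- The Euler characteristic as a homomorphism on `K₀`. -/
def eulerHom (A : DGAlg K) [Module.Finite K A.carrier] : K0 A →+ ℤ :=
  QuotientAddGroup.lift (relations A)
    (FreeAbelianGroup.lift fun Y : CompactDCat A => euler (ob Y.1)) (by
      rw [relations, AddSubgroup.closure_le]
      rintro _ ⟨Y, Z, T, ⟨M, N, f, ⟨eY⟩, ⟨eZ⟩, ⟨eT⟩⟩, rfl⟩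
      have hM : Cpt M := (kc_ob Y).1.of_iso (M := M) (N := ob Y.1) eY.symm
      have hN : Cpt N := (kc_ob Z).1.of_iso (M := N) (N := ob Z.1) eZ.symm
      change FreeAbelianGroup.lift _ _ = 0
      rw [map_sub, map_sub, FreeAbelianGroup.lift_apply_of, FreeAbelianGroup.lift_apply_of,
        FreeAbelianGroup.lift_apply_of, euler_of_iso (M := ob Y.1) eY,
        euler_of_iso (M := ob Z.1) eZ, euler_of_iso (M := ob T.1) eT,
        euler_cone f (FinCohom.of_cpt hM) (FinCohom.of_cpt hN)]
      abel)

theorem eulerHom_kc [Module.Finite K A.carrier] {M : DGMod A} (hM : Cpt M) :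
    eulerHom A (kc M) = euler M := by
  rw [kc_eq hM]
  exact FreeAbelianGroup.lift_apply_of _ _

end DGMod

end EulerCharacteristic

/-! ### The exact degree -/

section Degree

namespace DGMod

section

variable {K : Type u} [Field K] {A : DGAlg K}

theorem cpt_self : Cpt (self A) := by
  refine Cpt.of_QI (N := shift (DGMod.self A) (-0)) ?_ (⟨LinearMap.id, fun i x hx => ?_, fun x => ?_,
    fun _ _ => rfl⟩ : DGMod.self A ⟶ shift (DGMod.self A) (-0))
    (QI_of_bijective _ Function.bijective_id)
  · refine (Cpt.free (A := A) PUnit fun _ => 0).of_retract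
      ((toDCat A).map (dinj (fun _ : PUnit => shift (DGMod.self A) (-0)) PUnit.unit))
      ((toDCat A).map (dpr (fun _ : PUnit => shift (DGMod.self A) (-0)) PUnit.unit)) ?_
    rw [← Functor.map_comp, dinj_dpr_same, CategoryTheory.Functor.map_id]
  · change x ∈ A.deg (i + -0)
    rwa [neg_zero, add_zero]
  · change A.d x = sg K (-0) • A.d x
    rw [neg_zero, sg_zero, one_smul]

/-- Only degree `0` contributes, and there the cohomology is the whole nonzero algebra. -/
theorem euler_ne_zero [Module.Finite K A.carrier] [Nontrivial A.carrier] (hd : ∀ x, A.d x = 0)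
    (hdeg : ∀ n ≠ 0, A.deg n = ⊥) : euler (self A) ≠ 0 := by
  have h0 : ∀ n ≠ 0, ∀ x ∈ A.deg n, x = 0 := fun n hn x hx =>
    (Submodule.mem_bot K).1 (hdeg n hn ▸ hx)
  obtain ⟨x, hx⟩ := exists_ne (0 : A.carrier)
  obtain ⟨y, hy, hy0⟩ : ∃ y ∈ A.deg 0, y ≠ 0 := by
    by_contra h
    push Not at h
    refine hx (A.eq_zero_of_proj fun i => ?_)
    by_cases hi : i = 0
    · exact h _ (hi ▸ A.proj_mem i x)
    · exact h0 i hi _ (A.proj_mem i x)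
  rw [euler, finsum_eq_single _ 0]
  · have : Nontrivial ((DGMod.self A).cohomology 0) := by
      refine ⟨Submodule.Quotient.mk ⟨y, hy, hd y⟩, 0, fun h => hy0 ?_⟩
      obtain ⟨z, -, hz⟩ := (mk_eq_zero_iff A.toDGVect _).1 h
      exact hz.symm.trans (hd z)
    have h := Module.finrank_pos (R := K) (M := (DGMod.self A).cohomology 0)
    simpa using h.ne'
  · intro n hn
    have : Subsingleton ((DGMod.self A).cocycles n) := ⟨fun x y => Subtype.ext
      ((h0 n hn _ x.2.1).trans (h0 n hn _ y.2.1).symm)⟩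
    rw [Module.finrank_zero_of_subsingleton]
    simp

end

variable (k : Type u) {l : Type u} (L : Type u) [Field k] [Field l] [Field L] [Algebra k l]
  [Algebra k L] [Algebra l L] [IsScalarTower k l L] [FiniteDimensional k L] [IsGalois k L]

/-- As a complex, `l` is the graded space with one generator in degree `0`, whose Weil restriction
has a basis of `1 ^ d` elements. -/
theorem finite_nontrivial_weilAlg_unitAlg :
    Module.Finite k (weilAlg k L (unitAlg l)).carrier ∧
      Nontrivial (weilAlg k L (unitAlg l)).carrier := by
  obtain ⟨J, _, n, b, hJ, -, -⟩ := exists_weilVect_basis k L (l := l) fun _ : PUnit.{u + 1} => 0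
  have e : (weilVect k L (gradedSpace l fun _ : PUnit.{u + 1} => 0)).carrier ≃ₗ[k]
      (weilVect k L (unitAlg l).toDGVect).carrier :=
    weilVectEquiv k L (LinearEquiv.funUnique PUnit l l) (fun i x hx => by
      change _ ∈ (if i = 0 then ⊤ else ⊥ : Submodule l l)
      split_ifs with hi
      · trivial
      · exact (Submodule.mem_bot l).2 (hx PUnit.unit fun h => hi h.symm)) (fun i x hx e he => by
      change x ∈ (if i = 0 then ⊤ else ⊥ : Submodule l l) at hx
      rw [if_neg fun h => he h.symm] at hx
      exact (Submodule.mem_bot l).1 hx)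
  have hf : Module.Finite k (weilVect k L (gradedSpace l fun _ : PUnit.{u + 1} => 0)).carrier :=
    Module.Finite.of_basis b
  have : Nonempty J := by
    rw [← Fintype.card_pos_iff, hJ]
    simp
  have hn : Nontrivial (weilVect k L (gradedSpace l fun _ : PUnit.{u + 1} => 0)).carrier :=
    b.repr.toEquiv.nontrivial
  exact ⟨Module.Finite.equiv e, e.symm.toEquiv.nontrivial⟩

theorem nsmul_kc_weilMod_self_ne_zero {n : ℕ} (hn : n ≠ 0) :
    n • kc (weilMod k L (self (unitAlg l))) ≠ 0 := by
  obtain ⟨h1, h2⟩ := finite_nontrivial_weilAlg_unitAlg k (l := l) L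
  intro h
  -- The Weil restriction of `l` as a module over itself is, by definition, the algebra `R(l)` as a
  -- module over itself.
  have h3 : n • kc (self (weilAlg k L (unitAlg l))) = 0 := h
  have h4 := congrArg (eulerHom (weilAlg k L (unitAlg l))) h3
  rw [map_nsmul, eulerHom_kc cpt_self, map_zero, smul_eq_zero] at h4
  refine h4.elim hn (euler_ne_zero (weilVect_d_eq_zero k L rfl) fun n hn =>
    weilVect_deg_eq_bot k L (fun i hi => if_neg hi) hn)

/-- By Galois theory the index of the subgroup fixing the image of `l` in `L` is the degree of that
image over `k`. -/
theorem card_cosets : Fintype.card (Cosets k l L) = Module.finrank k l := by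
  have h := IntermediateField.finrank_eq_fixingSubgroup_index L
    (IsScalarTower.toAlgHom k l L).fieldRange
  have e : l ≃ₐ[k] (IsScalarTower.toAlgHom k l L).fieldRange :=
    AlgEquiv.ofInjectiveField (IsScalarTower.toAlgHom k l L)
  rw [e.toLinearEquiv.finrank_eq, h, ← Nat.card_eq_fintype_card]
  rfl

variable {k L} {A : DGAlg l} {f : K0 A → K0 (weilAlg k L A)}

theorem exists_isPolynomialOfDegree (hf : IsInducedMap k L f) :
    ∃ N ≤ Module.finrank k l, IsPolynomialOfDegree f N := by
  classical
  rw [isInducedMap_iff] at hf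
  have h : ∃ n, ∀ m, crossEffect f n m = 0 := ⟨_, crossEffect_card hf⟩
  exact ⟨Nat.find h, card_cosets k (l := l) L ▸ Nat.find_min' h (crossEffect_card hf),
    map_zero_of_induced hf, Nat.find_spec h, fun n hn => Nat.find_min' h hn⟩

/-- If the degree were smaller, the cross-effect of index `d - 1` would vanish identically; but by
homogeneity its value at `(x, …, x)` is `d! f(x)`. -/
theorem isPolynomialOfDegree_finrank (hf : IsInducedMap k L f)
    (h : ∃ x, (Module.finrank k l).factorial • f x ≠ 0) :
    IsPolynomialOfDegree f (Module.finrank k l) := by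
  obtain ⟨N, hN, hp⟩ := exists_isPolynomialOfDegree hf
  obtain ⟨x, hx⟩ := h
  rcases hN.lt_or_eq with h | rfl
  · refine (hx ?_).elim
    obtain ⟨n, hn⟩ := Nat.exists_eq_succ_of_ne_zero (Nat.ne_zero_of_lt h)
    rw [← crossEffect_of_homogeneous hn fun j => card_cosets k (l := l) L ▸
      map_nsmul_of_induced ((isInducedMap_iff k L f).1 hf) j x]
    exact crossEffect_eq_zero_of_le (by omega) hp.isLeast.1 _
  · exact hp

theorem isPolynomialOfDegree_unitAlg {f : K0 (unitAlg l) → K0 (weilAlg k L (unitAlg l))}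
    (hf : IsInducedMap k L f) : IsPolynomialOfDegree f (Module.finrank k l) := by
  refine isPolynomialOfDegree_finrank hf ⟨kc (self (unitAlg l)), ?_⟩
  rw [(isInducedMap_iff k L f).1 hf _ cpt_self]
  exact nsmul_kc_weilMod_self_ne_zero k L (Nat.factorial_ne_zero _)

end DGMod

end Degree

end NCWeil

end

theorem mainTheorem9 {k l L : Type u} [Field k] [Field l] [Field L] [Algebra k l] [Algebra k L]
    [Algebra l L] [IsScalarTower k l L] [FiniteDimensional k L] [IsGalois k L] :
    (∀ A : NCWeil.DGAlg l,
      (∃! f : NCWeil.K0 A → NCWeil.K0 (NCWeil.weilAlg k L A), NCWeil.IsInducedMap k L f) ∧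
      ∀ f : NCWeil.K0 A → NCWeil.K0 (NCWeil.weilAlg k L A), NCWeil.IsInducedMap k L f →
        (∃ N ≤ Module.finrank k l, NCWeil.IsPolynomialOfDegree f N) ∧
        ((∃ x, (Module.finrank k l).factorial • f x ≠ 0) →
          NCWeil.IsPolynomialOfDegree f (Module.finrank k l))) ∧
    ∀ f : NCWeil.K0 (NCWeil.unitAlg l) → NCWeil.K0 (NCWeil.weilAlg k L (NCWeil.unitAlg l)),
      NCWeil.IsInducedMap k L f → NCWeil.IsPolynomialOfDegree f (Module.finrank k l) := by
  exact ⟨fun A => ⟨NCWeil.DGMod.existsUnique_isInducedMap k L, fun f hf =>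
    ⟨NCWeil.DGMod.exists_isPolynomialOfDegree hf, NCWeil.DGMod.isPolynomialOfDegree_finrank hf⟩⟩,
    fun f hf => NCWeil.DGMod.isPolynomialOfDegree_unitAlg hf⟩
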